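/- **Model.** The typical user is at the origin of $\mathbb R^2$. The base stations (BSs) $\mathbf b_0,\mathbf b_1,\dots$ and the obstacles form independent homogeneous Poisson point processes of densities $\lambda_{\rm b}>0$ and $\lambda_{\rm o}>0$; the obstacles have mean length $L_{\rm o}>0$; $\mathbf b_0$ is the BS nearest to the user and $t_{\rm bu}=\|\mathbf b_0\|$. A link of length $t$ to the user is line-of-sight (L) with probability $\mathcal P_{\rm L}(t)=e^{-\beta t}$, $\beta=2\lambda_{\rm o}L_{\rm o}/\pi$, and non-line-of-sight (N) with probability $\mathcal P_{\rm N}=1-\mathcal P_{\rm L}$, independently over links. Each obstacle carries a reconfigurable surface (RIS) independently with probability $\mu\in[0,1]$; put $\lambda_{\rm r}=\mu\lambda_{\rm o}$. A RIS with uniformly random orientation offers a cascaded link if its link to the user is LoS and both the user and $\mathbf b_0$ are on its front side (BS–RIS links are LoS). The serving link is of type DL if the link from $\mathbf b_0$ to the user is LoS; otherwise of type CL if some RIS offers a cascaded link, and then $t_{\rm ru}$ is the distance from the user to the nearest such RIS; otherwise of type DN. The angle $\theta_0$ in the cascaded link is modelled as uniform on $(-\pi,\pi)$ and independent of everything else,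 and $t_{\rm br}=\sqrt{t_{\rm bu}^2+t_{\rm ru}^2-2t_{\rm bu}t_{\rm ru}\cos\theta_0}$. Fading coefficients are independent Gamma variables with shape and rate equal to the integer $m_{\rm L}\ge1$ or $m_{\rm N}\ge1$; $m_{\rm DL}=m_{\rm CL}=m_{\rm L}$, $m_{\rm DN}=m_{\rm N}$. Path-loss exponents are $\alpha_{\rm L}>0$ and $\alpha_{\rm N}>2$. With wavelength $\lambda_f>0$, transmit power $p_{\rm b}>0$, $\zeta=(\lambda_f/4\pi)^2$, $G_{\rm b}=N_{\rm b}$ (with $N_{\rm b}\ge2$ antennas) and $G_{\rm r}=N_{\rm r}^2$ (with $N_{\rm r}\ge 1$ RIS elements), let $$P^{\rm a}_{\rm DL}=p_{\rm b}G_{\rm b}\zeta t_{\rm bu}^{-\alpha_{\rm L}},\quad P^{\rm a}_{\rm CL}=p_{\rm b}G_{\rm b}G_{\rm r}\zeta(t_{\rm ru}t_{\rm br})^{-\alpha_{\rm L}},\quad P^{\rm a}_{\rm DN}=p_{\rm b}G_{\rm b}\zeta t_{\rm bu}^{-\alpha_{\rm N}}.$$ Let $G_{\rm ULA}(x)=\frac{\sin^2(\pi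 N_{\rm b}x)}{N_{\rm b}\sin^2(\pi x)}$ (equal to $N_{\rm b}$ at integers) and $\tilde N=\lfloor N_{\rm b}/2\rfloor-1$. For $\delta>0$ put $G_0=\frac\delta2G_{\rm ULA}(0)$, $G_n=\frac\delta2G_{\rm ULA}(\frac{2n+1}{2N_{\rm b}})$ for $1\le n\le\tilde N$, and $G_{\tilde N+1}=0$. The gain $G_{\rm B}(x)$ is $G_0$ for $|x|\le\frac1{N_{\rm b}}$, $G_n$ for $\frac n{N_{\rm b}}<|x|\le\frac{n+1}{N_{\rm b}}$ with $1\le n\le\tilde N$, and $0$ for all other $|x|\le\frac12$; for $\frac12<|x|\le1$ it is $G_{\rm B}(1-|x|)$. The interference is $I_{\rm B}=\sum_{i\ge1}p_{\rm b}G_{\rm B}(\Delta_i)\zeta\|\mathbf b_i\|^{-\alpha_{v_i}}H_i$, where $v_i\in\{{\rm L},{\rm N}\}$ is the state of the link of $\mathbf b_i$, $H_i$ is its fading with parameter $m_{v_i}$, and $\Delta_i=\frac12\cos\phi_i-\frac12\cos\phi_i^*$ with independent $\phi_i,\phi_i^*$ uniform on $[0,2\pi]$. With noise power $\sigma^2>0$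 and serving fading $H_q$ of parameter $m_q$, let $\Upsilon_q=P^{\rm a}_qH_q/(\sigma^2+I_{\rm B})$; the SINR $\Upsilon$ is $\Upsilon_q$ for the type $q$ of the serving link. **Formulas.** Let $f_\Phi(x)=\frac{2}{\pi\sqrt{1-4x^2}}$ on $[-\frac12,\frac12]$ and $0$ elsewhere, $f_\Delta(y)=\int_{-1/2}^{1/2}f_\Phi(x)f_\Phi(y+x)\,dx$ for $|y|\le1$, $$p_n=2\int_{n/N_{\rm b}}^{(n+1)/N_{\rm b}}f_\Delta+2\int_{1-(n+1)/N_{\rm b}}^{1-n/N_{\rm b}}f_\Delta\quad(0\le n\le\tilde N),\qquad p_{\tilde N+1}=1-\sum_{n\le\tilde N}p_n,$$ $$\kappa_v(x)=\sum_{n=0}^{\tilde N+1}p_n\Big(1+\frac{xG_n}{m_v}\Big)^{-m_v},\qquad \mathcal L_t(s)=\prod_{v\in\{{\rm L},{\rm N}\}}\exp\Big(-2\pi\lambda_{\rm b}\int_t^\infty[1-\kappa_v(sp_{\rm b}\zeta d^{-\alpha_v})]\,d\,\mathcal P_v(d)\,{\rm d}d\Big).$$ Let $a(t,r,\theta)=\mathcal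 P_{\rm L}(r)\Big(\frac12-\frac1{2\pi}\arccos\frac{r-t\cos\theta}{\sqrt{t^2+r^2-2tr\cos\theta}}\Big)$, $\bar a(t,r)=\int_{-\pi}^{\pi}a(t,r,\theta)\,d\theta$, $\mathcal P_{\rm CL}(t)=1-\exp(-\lambda_{\rm r}\int_0^\infty\bar a(t,r)r\,dr)$, $$\mathcal A_{\rm DL}=\mathcal P_{\rm L}(t),\quad\mathcal A_{\rm CL}=\mathcal P_{\rm N}(t)\mathcal P_{\rm CL}(t),\quad\mathcal A_{\rm DN}=\mathcal P_{\rm N}(t)(1-\mathcal P_{\rm CL}(t)),$$ $$f_{T_{\rm bu}}(t)=2\pi\lambda_{\rm b}te^{-\pi\lambda_{\rm b}t^2},\qquad f_{T_{\rm ru}|t}(r)=\frac{\lambda_{\rm r}r\,\bar a(t,r)\exp(-\lambda_{\rm r}\int_0^r\bar a(t,x)x\,dx)}{\mathcal P_{\rm CL}(t)}.$$ For $\gamma>0$ put $s_q=m_q\gamma/P^{\rm a}_q$, $\beta_q=(m_q!)^{-1/m_q}$, and, with $t=t_{\rm bu}$, $$\bar F_q=\sum_{k=0}^{m_q-1}\frac{s_q^k}{k!}(-1)^k\frac{{\rm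 d}^k}{{\rm d}s^k}\Big[e^{-s\sigma^2}\mathcal L_t(s)\Big]_{s=s_q},\qquad \tilde F_q=\sum_{k=1}^{m_q}\binom{m_q}k(-1)^{k+1}e^{-k\beta_qs_q\sigma^2}\mathcal L_t(k\beta_qs_q).$$ **Theorem 1 (Downlink Coverage Probability).** For every $\gamma>0$, $$\mathbb P(\Upsilon>\gamma)=\int_0^\infty\Big[\mathcal A_{\rm DL}\bar F_{\rm DL}+\int_0^\infty\!\!\int_{-\pi}^{\pi}\mathcal A_{\rm CL}\bar F_{\rm CL}\frac1{2\pi}f_{T_{\rm ru}|t_{\rm bu}}(t_{\rm ru})\,d\theta_0\,dt_{\rm ru}+\mathcal A_{\rm DN}\bar F_{\rm DN}\Big]f_{T_{\rm bu}}(t_{\rm bu})\,dt_{\rm bu},$$ where the term of type CL is $0$ if $\mu=0$. Here $f_{T_{\rm bu}}$ is the density of $t_{\rm bu}$; given $t_{\rm bu}$, a cascaded link exists with probability $\mathcal P_{\rm CL}(t_{\rm bu})$, in which case $t_{\rm ru}$ has density $f_{T_{\rm ru}|t_{\rm bu}}$, and the serving link is of type $q$ with probability $\mathcal A_q$. Almost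 surely, $\bar F_q=\mathbb P(\Upsilon_q>\gamma\mid t_{\rm bu})$ for $q\in\{{\rm DL},{\rm DN}\}$, and, under the conditional law given that a cascaded link exists, $\bar F_{\rm CL}=\mathbb P(\Upsilon_{\rm CL}>\gamma\mid t_{\rm bu},t_{\rm ru},\theta_0)$. Moreover $I_{\rm B}<\infty$ almost surely, $\mathbb E[e^{-sI_{\rm B}}\mid t_{\rm bu}]=\mathcal L_{t_{\rm bu}}(s)$ almost surely for every $s\ge0$, and $p_n=\mathbb P(G_{\rm B}(\Delta_i)=G_n)$ for $0\le n\le\tilde N+1$. Finally, the approximation $\tilde F_q$ of $\bar F_q$ satisfies $\bar F_q\le\tilde F_q$ almost surely (for $q={\rm CL}$, given that a cascaded link exists), with equality if $m_q=1$, so that $\mathbb P(\Upsilon>\gamma)$ is at most the above integral with each $\bar F_q$ replaced by $\tilde F_q$. -/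

import Mathlib

open MeasureTheory ProbabilityTheory
open scoped NNReal ENNReal

noncomputable section

namespace RISNet

/-! The plane is `ℂ`, with its Euclidean norm, inner product and Lebesgue measure. -/

/-- Type of propagation: line of sight or not. -/
inductive Vis
  | L
  | N

/-- Type of the serving link: direct LoS, cascaded LoS, direct NLoS. -/
inductive Link
  | DL
  | CL
  | DN

/-- The system parameters. -/
structure Params where
  /-- density of the BSs -/
  lamB : ℝ
  /-- density of the obstacles -/
  lamO : ℝ
  /-- fraction of the obstacles that carry a RIS -/
  mu : ℝ
  /-- mean length of an obstacle -/
  Lo : ℝ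
  /-- number of antennas of a BS -/
  Nb : ℕ
  /-- number of elements of a RIS -/
  Nr : ℕ
  /-- transmit power of a BS -/
  pb : ℝ
  /-- wavelength -/
  lamF : ℝ
  /-- path-loss exponent of LoS and NLoS links -/
  alpha : Vis → ℝ
  /-- Nakagami parameter of LoS and NLoS links -/
  m : Vis → ℕ
  /-- compensation factor of the discrete antenna pattern -/
  delta : ℝ
  /-- noise power -/
  sigma2 : ℝ
  lamB_pos : 0 < lamB
  lamO_pos : 0 < lamO
  mu_nonneg : 0 ≤ mu
  mu_le_one : mu ≤ 1
  Lo_pos : 0 < Lo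
  two_le_Nb : 2 ≤ Nb
  Nr_pos : 0 < Nr
  pb_pos : 0 < pb
  lamF_pos : 0 < lamF
  alphaL_pos : 0 < alpha Vis.L
  two_lt_alphaN : 2 < alpha Vis.N
  m_pos : ∀ v, 0 < m v
  delta_pos : 0 < delta
  sigma2_pos : 0 < sigma2

namespace Params

variable (P : Params)

/-! ### Deterministic quantities -/

/-- Blockage parameter. -/
def beta : ℝ := 2 * P.lamO * P.Lo / Real.pi

/-- Reference path loss. -/
def zeta : ℝ := (P.lamF / (4 * Real.pi)) ^ 2

/-- Maximal gain of a BS antenna. -/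
def Gb : ℝ := P.Nb

/-- Maximal gain of a RIS. -/
def Gr : ℝ := (P.Nr : ℝ) ^ 2

/-- Density of the RISs. -/
def lamR : ℝ := P.mu * P.lamO

/-- LoS and NLoS probability of a link of length `t`. -/
def pVis : Vis → ℝ → ℝ
  | Vis.L, t => Real.exp (-P.beta * t)
  | Vis.N, t => 1 - Real.exp (-P.beta * t)

/-- Nakagami parameter of the serving link. -/
def mLink : Link → ℕ
  | Link.DL => P.m Vis.L
  | Link.CL => P.m Vis.L
  | Link.DN => P.m Vis.N

/-- Gain of the uniform linear array, extended continuously to the integers. -/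
def gULA (x : ℝ) : ℝ :=
  if Real.sin (Real.pi * x) = 0 then P.Nb
  else Real.sin (Real.pi * P.Nb * x) ^ 2 / (P.Nb * Real.sin (Real.pi * x) ^ 2)

/-- The gain levels `G_0, …, G_{Ñ}, G_{Ñ+1} = 0`, where `Ñ + 1 = ⌊N_b / 2⌋`. -/
def gain (n : ℕ) : ℝ :=
  if n = 0 then P.delta / 2 * P.gULA 0
  else if n < P.Nb / 2 then P.delta / 2 * P.gULA ((2 * n + 1) / (2 * P.Nb))
  else 0

/-- The discrete pattern for a deviation in `[-1/2, 1/2]`; outside of the half-open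
intervals of levels `1, …, Ñ` and of the main lobe the gain is `0`. -/
def gainMain (x : ℝ) : ℝ :=
  if |x| ≤ 1 / P.Nb then P.gain 0
  else ∑ n ∈ Finset.Ico 1 (P.Nb / 2),
    if (n : ℝ) / P.Nb < |x| ∧ |x| ≤ ((n : ℝ) + 1) / P.Nb then P.gain n else 0

/-- The discrete multi-lobe antenna pattern, on `[-1, 1]`. -/
def gainB (x : ℝ) : ℝ :=
  if x < -(1 / 2) then P.gainMain |x + 1|
  else if 1 / 2 < x then P.gainMain |x - 1|
  else P.gainMain x

/-- Density of a spatial angle of departure `cos φ / 2`, `φ` uniform on `[0, 2π]`. -/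
def fPhi (x : ℝ) : ℝ :=
  if |x| ≤ 1 / 2 then 2 / (Real.pi * Real.sqrt (1 - 4 * x ^ 2)) else 0

/-- Density of the difference of two independent spatial angles of departure. -/
def fDelta (y : ℝ) : ℝ :=
  if |y| ≤ 1 then ∫ x in (-(1 / 2) : ℝ)..(1 / 2), fPhi x * fPhi (y + x) else 0

/-- `p_n` for a level `n ≤ Ñ`. -/
def pLobe (n : ℕ) : ℝ :=
  2 * (∫ y in ((n : ℝ) / P.Nb)..(((n : ℝ) + 1) / P.Nb), fDelta y)
    + 2 * (∫ y in (1 - ((n : ℝ) + 1) / P.Nb)..(1 - (n : ℝ) / P.Nb), fDelta y)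

/-- The gain probabilities `p_0, …, p_{Ñ+1}`. -/
def pGain (n : ℕ) : ℝ :=
  if n < P.Nb / 2 then P.pLobe n else 1 - ∑ k ∈ Finset.range (P.Nb / 2), P.pLobe k

/-- BS–RIS distance from the BS–user distance, the RIS–user distance and the angle. -/
def tbr (t r θ : ℝ) : ℝ := Real.sqrt (t ^ 2 + r ^ 2 - 2 * t * r * Real.cos θ)

/-- Probability of the reflection condition. -/
def pRefl (t r θ : ℝ) : ℝ :=
  1 / 2 - 1 / (2 * Real.pi) * Real.arccos ((r - t * Real.cos θ) / tbr t r θ)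

/-- Probability that a RIS at distance `r` and angle `θ` offers a cascaded LoS link. -/
def aRIS (t r θ : ℝ) : ℝ := P.pVis Vis.L r * pRefl t r θ

/-- The previous probability integrated over the angle. -/
def aBar (t r : ℝ) : ℝ := ∫ θ in (-Real.pi)..Real.pi, P.aRIS t r θ

/-- Probability that some RIS offers a cascaded LoS link. -/
def pCL (t : ℝ) : ℝ := 1 - Real.exp (-P.lamR * ∫ r in Set.Ioi (0 : ℝ), P.aBar t r * r)

/-- Association probabilities, given the BS–user distance. -/
def assoc : Link → ℝ → ℝ
  | Link.DL, t => P.pVis Vis.L t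
  | Link.CL, t => P.pVis Vis.N t * P.pCL t
  | Link.DN, t => P.pVis Vis.N t * (1 - P.pCL t)

/-- Density of the BS–user distance. -/
def fTbu (t : ℝ) : ℝ := 2 * Real.pi * P.lamB * t * Real.exp (-Real.pi * P.lamB * t ^ 2)

/-- Density of the RIS–user distance in the cascaded link, given the BS–user distance. -/
def fTru (t r : ℝ) : ℝ :=
  P.lamR * r * P.aBar t r * Real.exp (-P.lamR * ∫ x in (0 : ℝ)..r, P.aBar t x * x) / P.pCL t

/-- Laplace transform of gain times fading of one interfering link. -/
def kappa (v : Vis) (x : ℝ) : ℝ :=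
  ∑ n ∈ Finset.range (P.Nb / 2 + 1), P.pGain n * ((1 + x * P.gain n / P.m v) ^ (P.m v))⁻¹

/-- The exponential factor of the interfering BSs of one propagation type. -/
def laplaceVis (v : Vis) (t s : ℝ) : ℝ :=
  Real.exp (-2 * Real.pi * P.lamB *
    ∫ d in Set.Ioi t, (1 - P.kappa v (s * P.pb * P.zeta * d ^ (-P.alpha v))) * d * P.pVis v d)

/-- Closed form of the Laplace transform of the interference, given the BS–user distance. -/
def laplace (t s : ℝ) : ℝ := P.laplaceVis Vis.L t s * P.laplaceVis Vis.N t s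

/-- Received serving power without fading. Only the cascaded link uses `r` and `θ`. -/
def meanPower : Link → ℝ → ℝ → ℝ → ℝ
  | Link.DL, t, _, _ => P.pb * P.Gb * P.zeta * t ^ (-P.alpha Vis.L)
  | Link.CL, t, r, θ => P.pb * P.Gb * P.Gr * P.zeta * (r * tbr t r θ) ^ (-P.alpha Vis.L)
  | Link.DN, t, _, _ => P.pb * P.Gb * P.zeta * t ^ (-P.alpha Vis.N)

/-- `s_q`. -/
def sArg (q : Link) (γ t r θ : ℝ) : ℝ := P.mLink q * γ / P.meanPower q t r θ

/-- The derivative formula for the conditional coverage probability, with the Laplace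
transform `exp (-s σ²) 𝓛(s)` of noise plus interference. -/
def condCov (q : Link) (γ t r θ : ℝ) : ℝ :=
  ∑ k ∈ Finset.range (P.mLink q),
    P.sArg q γ t r θ ^ k / (k.factorial : ℝ) * (-1) ^ k *
      iteratedDeriv k (fun s => Real.exp (-s * P.sigma2) * P.laplace t s) (P.sArg q γ t r θ)

/-- `β_q`. -/
def betaLink (q : Link) : ℝ := ((P.mLink q).factorial : ℝ) ^ (-1 / (P.mLink q : ℝ))

/-- The derivative-free approximation of the conditional coverage probability. -/
def condCovApprox (q : Link) (γ t r θ : ℝ) : ℝ :=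
  ∑ k ∈ Finset.Icc 1 (P.mLink q),
    ((P.mLink q).choose k : ℝ) * (-1) ^ (k + 1) *
      Real.exp (-(k : ℝ) * P.betaLink q * P.sArg q γ t r θ * P.sigma2) *
      P.laplace t (k * P.betaLink q * P.sArg q γ t r θ)

/-- Average over the distances and the angle of `∑_q A_q F_q`. -/
def average (F : Link → ℝ → ℝ → ℝ → ℝ) : ℝ :=
  ∫ t in Set.Ioi (0 : ℝ),
    (P.assoc Link.DL t * F Link.DL t 0 0
      + (∫ r in Set.Ioi (0 : ℝ), ∫ θ in (-Real.pi)..Real.pi,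
          P.assoc Link.CL t * F Link.CL t r θ * (1 / (2 * Real.pi) * P.fTru t r))
      + P.assoc Link.DN t * F Link.DN t 0 0) * P.fTbu t

end Params

/-! ### The random network -/

/-- Number of points of a random sequence that lie in `B`. -/
def count {Ω : Type*} (x : ℕ → Ω → ℂ) (B : Set ℂ) (ω : Ω) : ℕ∞ := {i : ℕ | x i ω ∈ B}.encard

/-- The sequence `x` enumerates a homogeneous Poisson point process of density `lam`. -/
structure IsPPP {Ω : Type*} [MeasurableSpace Ω] (μ : Measure Ω) (lam : ℝ) (x : ℕ → Ω → ℂ) :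
    Prop where
  measurable : ∀ i, Measurable (x i)
  poisson : ∀ B : Set ℂ, MeasurableSet B → volume B < ∞ → ∀ k : ℕ,
    μ {ω | count x B ω = k} = poissonMeasure (lam * (volume B).toReal).toNNReal {k}
  indep : ∀ (n : ℕ) (B : Fin n → Set ℂ), (∀ j, MeasurableSet (B j)) →
    Pairwise (Function.onFun Disjoint B) → iIndepFun (fun j => count x (B j)) μ

/-- Labels of the real random variables that are attached to BSs, obstacles and the
serving link. -/
inductive Source
  /-- decides whether the link from BS `i` to the user is LoS -/
  | bsBlock (i : ℕ)
  /-- fading of the interfering link from BS `i` if that link is LoS or NLoS -/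
  | bsFading (v : Vis) (i : ℕ)
  /-- physical angle of departure from BS `i` towards the user -/
  | bsAngle (i : ℕ)
  /-- physical angle of the beam of BS `i` -/
  | bsBeam (i : ℕ)
  /-- decides whether obstacle `i` carries a RIS -/
  | risEquip (i : ℕ)
  /-- decides whether the link from obstacle `i` to the user is LoS -/
  | risBlock (i : ℕ)
  /-- direction of the normal of the front side of obstacle `i` -/
  | risNormal (i : ℕ)
  /-- fading of the serving link, for each of its types -/
  | servFading (q : Link)
  /-- angle between the user–BS link and the user–RIS link -/
  | theta

/-- Uniform distribution on `[a, b]`. -/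
def unif (a b : ℝ) : Measure ℝ := ProbabilityTheory.cond volume (Set.Icc a b)

/-- Nakagami power fading with parameter `m`: the Gamma law with shape and rate `m`. -/
def nakagami (m : ℕ) : Measure ℝ := gammaMeasure m m

/-- Distribution of each source. -/
def Source.law (P : Params) : Source → Measure ℝ
  | .bsBlock _ => unif 0 1
  | .bsFading v _ => nakagami (P.m v)
  | .bsAngle _ => unif 0 (2 * Real.pi)
  | .bsBeam _ => unif 0 (2 * Real.pi)
  | .risEquip _ => unif 0 1
  | .risBlock _ => unif 0 1
  | .risNormal _ => unif 0 (2 * Real.pi)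
  | .servFading q => nakagami (P.mLink q)
  | .theta => unif (-Real.pi) Real.pi

/-- The random network seen from the typical user at the origin. -/
structure Network (P : Params) {Ω : Type*} [MeasurableSpace Ω] (μ : Measure Ω) where
  /-- locations of the BSs -/
  b : ℕ → Ω → ℂ
  /-- locations of the obstacles -/
  o : ℕ → Ω → ℂ
  /-- the attached random variables -/
  X : Source → Ω → ℝ
  b_ppp : IsPPP μ P.lamB b
  o_ppp : IsPPP μ P.lamO o
  /-- the BSs are labelled so that the tagged BS, the nearest one, has label `0` -/
  nearest : ∀ᵐ ω ∂μ, ∀ i, ‖b 0 ω‖ ≤ ‖b i ω‖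
  X_meas : ∀ s, Measurable (X s)
  X_law : ∀ s, μ.map (X s) = s.law P
  X_indep : iIndepFun X μ
  /-- the two point processes and the attached variables are mutually independent -/
  bo_indep : IndepFun (fun ω i => b i ω) (fun ω i => o i ω) μ
  boX_indep : IndepFun (fun ω => (fun i => b i ω, fun i => o i ω)) (fun ω s => X s ω) μ

namespace Network

variable {P : Params} {Ω : Type*} [MeasurableSpace Ω] {μ : Measure Ω} (W : Network P μ)

/-- BS–user distance. -/
def tbu (ω : Ω) : ℝ := ‖W.b 0 ω‖

/-- The link between BS `i` and the user is LoS. -/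
def bsLoS (i : ℕ) (ω : Ω) : Prop := W.X (.bsBlock i) ω < P.pVis Vis.L ‖W.b i ω‖

/-- Unit normal of the front side of obstacle `i`. -/
def normal (i : ℕ) (ω : Ω) : ℂ := Complex.exp (W.X (.risNormal i) ω * Complex.I)

/-- Obstacle `i` carries a RIS that offers a cascaded LoS link: its link to the user is LoS,
and both the user and the tagged BS are on its front side. The BS–RIS link is always LoS. -/
def suitable (i : ℕ) (ω : Ω) : Prop :=
  W.X (.risEquip i) ω < P.mu ∧ W.X (.risBlock i) ω < P.pVis Vis.L ‖W.o i ω‖ ∧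
    0 < inner ℝ (W.normal i ω) (0 - W.o i ω) ∧
    0 < inner ℝ (W.normal i ω) (W.b 0 ω - W.o i ω)

/-- A cascaded LoS link exists. -/
def existsCL : Set Ω := {ω | ∃ i, W.suitable i ω}

/-- RIS–user distance: distance of the nearest RIS that offers a cascaded LoS link
(meaningful when there is one). -/
def tru (ω : Ω) : ℝ := sInf {d | ∃ i, W.suitable i ω ∧ d = ‖W.o i ω‖}

/-- Angle between the user–BS link and the user–RIS link. -/
def theta (ω : Ω) : ℝ := W.X .theta ω

open Classical in
/-- Type of the link between the user and BS `i`. -/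
def vis (i : ℕ) (ω : Ω) : Vis := if W.bsLoS i ω then Vis.L else Vis.N

open Classical in
/-- Type of the serving link. -/
def link (ω : Ω) : Link :=
  if W.bsLoS 0 ω then Link.DL else if ω ∈ W.existsCL then Link.CL else Link.DN

/-- Spatial deviation from the beam of BS `i` in the direction of the user. -/
def dev (i : ℕ) (ω : Ω) : ℝ :=
  1 / 2 * Real.cos (W.X (.bsAngle i) ω) - 1 / 2 * Real.cos (W.X (.bsBeam i) ω)

/-- Received power from the interfering BS `i`. -/
def interf (i : ℕ) (ω : Ω) : ℝ :=
  P.pb * P.gainB (W.dev i ω) * P.zeta * ‖W.b i ω‖ ^ (-P.alpha (W.vis i ω))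
    * W.X (.bsFading (W.vis i ω) i) ω

/-- Aggregate interference of all BSs but the tagged one. -/
def I (ω : Ω) : ℝ := ∑' i, W.interf (i + 1) ω

/-- Received serving power for a serving link of type `q`. -/
def power (q : Link) (ω : Ω) : ℝ :=
  P.meanPower q (W.tbu ω) (W.tru ω) (W.theta ω) * W.X (.servFading q) ω

/-- SINR for a serving link of type `q`. -/
def sinrOf (q : Link) (ω : Ω) : ℝ := W.power q ω / (P.sigma2 + W.I ω)

/-- Downlink SINR. -/
def sinr (ω : Ω) : ℝ := W.sinrOf (W.link ω) ω

/-- Information carried by the BS–user distance. -/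
abbrev sigmaTbu : MeasurableSpace Ω := MeasurableSpace.comap W.tbu inferInstance

/-- Information carried by the BS–user distance, the RIS–user distance and the angle. -/
abbrev sigmaCL : MeasurableSpace Ω :=
  MeasurableSpace.comap (fun ω => (W.tbu ω, W.tru ω, W.theta ω)) inferInstance

end Network

end RISNet

end

/-! Fix the BS–user distance `t`. If the mean serving power and the interference `I` are also fixed,
the SINR exceeds `γ` exactly when a Gamma variable with integer shape and rate `m` exceeds `s (σ² +
I) / m`, where `s` is `sArg`. Its tail is the Erlang sum of `x ^ k / k! * exp (-x)` over `k < m` at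
`x = s (σ² + I)` (`nakagami_Ioi`). Each term is, up to sign, `s ^ k / k!` times the `k`-th
derivative of `s ↦ exp (-s (σ² + I))`, so averaging over `I` gives derivatives of the Laplace
transform of noise plus interference (`sum_iteratedDeriv_eq_integral_erlangTail`). Alzer's
inequality (`erlangTail_le`) bounds the Erlang tail by `1 - (1 - exp (-b x)) ^ m` with `b = (m!) ^
(-1 / m)`; expanding this power needs the Laplace transform itself only at multiples of `b s`, with
no derivatives.

Both point processes are treated through the Laplace functional (`IsPPP.laplace_functional`), stated
for costs in `[0, ∞]`. An infinite cost on a set turns `exp (-∑ f)` into the indicator that the set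
is empty, so void probabilities and Laplace transforms are instances of one formula. In this way the
BSs other than the nearest one, given its distance `t`, have the Laplace functional of a Poisson
process outside the disc of radius `t` (`IsPPP.setLIntegral_expNeg_nearest`). Averaging the
independent blockage, angles and fading of a BS at distance `d` gives `markLaplace`; using minus its
logarithm as the cost and passing to polar coordinates gives the closed form `laplace`
(`tailLaplace_interfExponent`, `setLIntegral_exp_interf`).

The suitable obstacles arise by thinning. With the nearest BS fixed, an obstacle is retained with
probability `μ` times its LoS probability times the chance that a uniform normal puts user and BS on
the front side. Two open half-circles of directions whose centres are at angle `c` overlap in an arc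
of length `π - |c|`, which explains the arccosine (`unif_inner_pos`, `front_eq`). The void
probability of the disc of radius `r` is then the exponential of minus the integrated intensity, and
minus its derivative is the density of the distance of the nearest suitable obstacle
(`setLIntegral_existsCL`).

All variables are measurable with respect to disjoint sets of labelled independent sources, so each
independence claim is a disjointness claim about labels (`indepFun_of_disjoint`). The conditional
law of `I` given `t` is the kernel `interfLaw`; almost surely it has Laplace transform `laplace t`
(`ae_integral_interfLaw`), and neither the obstacles, nor the blockage of the tagged link, nor the
angle changes it. Conditional statements are proved as identities of integrals over the events of
the conditioning variable. The coverage event is split by link type in `measure_sinr_gt`, and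
`average_eq` identifies the resulting expectation with the stated real integral. -/

namespace RISNet

open Filter Topology

/-! ### The function `x ↦ exp (-x)` on `[0, ∞]` -/

/-- `exp (-x)` for `x ∈ [0, ∞]`. -/
noncomputable def expNeg (x : ℝ≥0∞) : ℝ≥0∞ := EReal.exp (-(x : EReal))

lemma expNeg_zero : expNeg 0 = 1 := by simp [expNeg]

lemma expNeg_top : expNeg ∞ = 0 := by simp [expNeg]

lemma expNeg_add (x y : ℝ≥0∞) : expNeg (x + y) = expNeg x * expNeg y := by
  simp only [expNeg, EReal.exp_neg, EReal.coe_ennreal_add, EReal.exp_add]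
  rw [ENNReal.mul_inv] <;> simp

lemma expNeg_ofReal {x : ℝ} (hx : 0 ≤ x) :
    expNeg (ENNReal.ofReal x) = ENNReal.ofReal (Real.exp (-x)) := by
  simp [expNeg, EReal.coe_ennreal_ofReal, max_eq_left hx, ← EReal.coe_neg]

lemma expNeg_antitone : Antitone expNeg := fun x y h => by
  simpa [expNeg] using h

lemma expNeg_le_one (x : ℝ≥0∞) : expNeg x ≤ 1 := by
  rw [← expNeg_zero]; exact expNeg_antitone zero_le

lemma expNeg_continuous : Continuous expNeg :=
  ENNReal.continuous_exp.comp (continuous_neg.comp continuous_coe_ennreal_ereal)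

@[fun_prop]
lemma expNeg_measurable : Measurable expNeg := expNeg_continuous.measurable

lemma expNeg_sum {ι : Type*} (s : Finset ι) (f : ι → ℝ≥0∞) :
    expNeg (∑ i ∈ s, f i) = ∏ i ∈ s, expNeg (f i) := by
  classical
  induction s using Finset.induction_on with
  | empty => simp [expNeg_zero]
  | insert a s ha ih => rw [Finset.sum_insert ha, Finset.prod_insert ha, expNeg_add, ih]

lemma expNeg_eq_zero {x : ℝ≥0∞} : expNeg x = 0 ↔ x = ∞ := by
  simp [expNeg]

/-- `-log g` as an element of `[0, ∞]`. -/
noncomputable def negLog (g : ℝ) : ℝ≥0∞ := ENNReal.ofReal (-Real.log g)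

lemma expNeg_negLog {g : ℝ} (h0 : 0 < g) (h1 : g ≤ 1) : expNeg (negLog g) = ENNReal.ofReal g := by
  rw [negLog, expNeg_ofReal (by simpa using Real.log_nonpos h0.le h1), neg_neg, Real.exp_log h0]

@[fun_prop]
lemma negLog_measurable : Measurable negLog := by unfold negLog; fun_prop

/-- Divergent sums are included, because `expNeg` is continuous at `∞`. -/
lemma tendsto_prod_expNeg (f : ℕ → ℝ≥0∞) :
    Tendsto (fun n => ∏ i ∈ Finset.range n, expNeg (f i)) atTop (𝓝 (expNeg (∑' i, f i))) := by
  simp_rw [← expNeg_sum]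
  exact (expNeg_continuous.tendsto _).comp ENNReal.summable.hasSum.tendsto_sum_nat

/-! ### Laplace functional of a Poisson point process -/

section count

variable {Ω : Type*} [MeasurableSpace Ω] {μ : Measure Ω} {lam : ℝ} {x : ℕ → Ω → ℂ}

-- The bridge between sums over the points, to which the Laplace functional applies, and the counts
-- in terms of which a Poisson process is defined.
omit [MeasurableSpace Ω] in
lemma tsum_indicator_eq_count (B : Set ℂ) (ω : Ω) :
    ∑' i, B.indicator (fun _ => (1 : ℝ≥0∞)) (x i ω) = (count x B ω : ℝ≥0∞) := by
  rw [count, ← ENNReal.tsum_set_one, tsum_subtype {i | x i ω ∈ B} (fun _ => (1 : ℝ≥0∞))]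
  rfl

lemma measurable_count (hx : ∀ i, Measurable (x i)) {B : Set ℂ} (hB : MeasurableSet B) :
    Measurable (count x B) := by
  have h : Measurable (fun ω => (count x B ω : ℝ≥0∞)) := by
    simp_rw [← tsum_indicator_eq_count]
    exact Measurable.tsum fun i => (measurable_one.indicator hB).comp (hx i)
  refine measurable_to_countable' fun k => ?_
  have : count x B ⁻¹' {k} = (fun ω => (count x B ω : ℝ≥0∞)) ⁻¹' {(k : ℝ≥0∞)} := by
    ext ω; simp
  rw [this]
  exact h (measurableSet_singleton _)

namespace IsPPP

/-- The Poisson masses of the finite values already add up to one, so nothing is left for `⊤`. -/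
lemma ae_count_ne_top [IsProbabilityMeasure μ] (h : IsPPP μ lam x) {B : Set ℂ}
    (hB : MeasurableSet B) (hv : volume B < ∞) : ∀ᵐ ω ∂μ, count x B ω ≠ ⊤ := by
  have hm := measurable_count h.measurable hB
  have hset : {ω | count x B ω ≠ ⊤} = ⋃ k : ℕ, {ω | count x B ω = k} := by
    ext ω
    simp only [Set.mem_ofPred_eq, Set.mem_iUnion]
    rw [ENat.ne_top_iff_exists]
    simp [eq_comm]
  have hms : MeasurableSet {ω | count x B ω ≠ ⊤} := hm (measurableSet_singleton ⊤).compl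
  have h1 : μ {ω | count x B ω ≠ ⊤} = 1 := by
    rw [hset, measure_iUnion]
    · simp_rw [h.poisson B hB hv]
      have := measure_iUnion (μ := poissonMeasure (lam * (volume B).toReal).toNNReal)
        (f := fun k : ℕ => {k}) (fun i j hij => Set.disjoint_singleton.2 hij)
        (fun k => measurableSet_singleton k)
      rw [← this, Set.iUnion_of_singleton, measure_univ]
    · intro i j hij
      refine Set.disjoint_left.2 fun ω hi hj => hij ?_
      simp only [Set.mem_ofPred_eq] at hi hj
      exact_mod_cast hi.symm.trans hj
    · exact fun k => hm (measurableSet_singleton _)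
  exact (prob_compl_eq_zero_iff hms).2 h1

lemma lintegral_comp_count [IsProbabilityMeasure μ] (h : IsPPP μ lam x) {B : Set ℂ}
    (hB : MeasurableSet B) (hv : volume B < ∞) (g : ℕ∞ → ℝ≥0∞) :
    ∫⁻ ω, g (count x B ω) ∂μ
      = ∑' k : ℕ, g k * poissonMeasure (lam * (volume B).toReal).toNNReal {k} := by
  have hm := measurable_count h.measurable hB
  have h1 : ∀ᵐ ω ∂μ, g (count x B ω)
      = ∑' k : ℕ, {ω | count x B ω = k}.indicator (fun _ => g k) ω := by
    filter_upwards [h.ae_count_ne_top hB hv] with ω hω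
    obtain ⟨k, hk⟩ := ENat.ne_top_iff_exists.1 hω
    rw [tsum_eq_single k]
    · simp [← hk]
    · intro j hj
      rw [Set.indicator_of_notMem]
      simp only [Set.mem_ofPred_eq, ← hk]
      exact_mod_cast hj.symm
  rw [lintegral_congr_ae h1, lintegral_tsum]
  · refine tsum_congr fun k => ?_
    have hk : MeasurableSet {ω | count x B ω = k} := hm (measurableSet_singleton _)
    rw [lintegral_indicator hk, setLIntegral_const, h.poisson B hB hv]
  · intro k
    have hk : MeasurableSet {ω | count x B ω = k} := hm (measurableSet_singleton _)
    exact (measurable_const.indicator hk).aemeasurable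

/-- The generating function of the Poisson law: the exponential series in `v * exp (-c)` sums to
`exp (-v (1 - exp (-c)))`. -/
lemma lintegral_expNeg_count [IsProbabilityMeasure μ] (h : IsPPP μ lam x) (hlam : 0 ≤ lam)
    {B : Set ℂ} (hB : MeasurableSet B) (hv : volume B < ∞) {c : ℝ≥0∞} (hc : c ≠ ∞) :
    ∫⁻ ω, expNeg (c * count x B ω) ∂μ
      = expNeg (ENNReal.ofReal lam * (volume B * (1 - expNeg c))) := by
  rw [h.lintegral_comp_count hB hv (fun k => expNeg (c * k))]
  obtain ⟨a, rfl⟩ : ∃ a : ℝ≥0, c = a := ⟨c.toNNReal, (ENNReal.coe_toNNReal hc).symm⟩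
  set v := (lam * (volume B).toReal).toNNReal with hvdef
  have hvr : (v : ℝ) = lam * (volume B).toReal := Real.coe_toNNReal _ (by positivity)
  have e1 : ∀ y : ℝ≥0, expNeg y = ENNReal.ofReal (Real.exp (-y)) := fun y => by
    rw [← ENNReal.ofReal_coe_nnreal (p := y), expNeg_ofReal y.coe_nonneg]
  have hterm : ∀ k : ℕ, expNeg (a * ((k : ℕ∞) : ℝ≥0∞)) * poissonMeasure v {k}
      = ENNReal.ofReal (Real.exp (-v) * ((v * Real.exp (-a)) ^ k / k.factorial)) := fun k => by
    rw [poissonMeasure_singleton]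
    have : ((a : ℝ≥0∞) * ((k : ℕ∞) : ℝ≥0∞)) = ((a * k : ℝ≥0) : ℝ≥0∞) := by simp
    rw [this, e1, ← ENNReal.ofReal_mul (Real.exp_pos _).le]
    congr 1
    rw [mul_pow, ← Real.exp_nat_mul]
    have : -((a * k : ℝ≥0) : ℝ) = k * -(a : ℝ) := by push_cast; ring
    rw [this]
    ring
  rw [tsum_congr hterm]
  have hs : HasSum (fun k : ℕ => Real.exp (-v) * ((v * Real.exp (-a)) ^ k / k.factorial))
      (Real.exp (-v) * Real.exp (v * Real.exp (-a))) := by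
    have := NormedSpace.expSeries_div_hasSum_exp ((v : ℝ) * Real.exp (-a))
    rw [← Real.exp_eq_exp_ℝ] at this
    exact this.mul_left _
  rw [← ENNReal.ofReal_tsum_of_nonneg (fun k => by positivity) hs.summable, hs.tsum_eq,
    ← Real.exp_add]
  have e2 : ENNReal.ofReal lam * (volume B * (1 - expNeg a))
      = ENNReal.ofReal (v * (1 - Real.exp (-a))) := by
    rw [hvr, ENNReal.ofReal_mul (by positivity), ENNReal.ofReal_mul hlam,
      ENNReal.ofReal_toReal hv.ne, ENNReal.ofReal_sub _ (Real.exp_pos _).le, e1 a,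
      ENNReal.ofReal_one, mul_assoc]
  rw [e2, expNeg_ofReal]
  · congr 2; ring
  · have : Real.exp (-a) ≤ 1 := Real.exp_le_one_iff.2 (by simp)
    exact mul_nonneg v.2 (by linarith)

/-- A simple cost is a finite combination of indicators of disjoint fibres. The counts of the fibres
are independent, so the expectation factors into Poisson generating functions. -/
lemma laplace_functional_simple [IsProbabilityMeasure μ] (h : IsPPP μ lam x) (hlam : 0 ≤ lam)
    (g : SimpleFunc ℂ ℝ≥0∞) (hg : ∀ z, g z ≠ ∞) (hv : volume {z | g z ≠ 0} < ∞) :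
    ∫⁻ ω, expNeg (∑' i, g (x i ω)) ∂μ
      = expNeg (ENNReal.ofReal lam * ∫⁻ z, (1 - expNeg (g z))) := by
  classical
  -- The value `0` is left out: it costs nothing, and its fibre need not have finite volume.
  set s := g.range.filter (· ≠ 0) with hs
  set e := s.equivFin.symm with he
  set B : Fin s.card → Set ℂ := fun j => g ⁻¹' {(e j : ℝ≥0∞)} with hB
  have hBm : ∀ j, MeasurableSet (B j) := fun j => g.measurableSet_fiber _
  have hne : ∀ j, (e j : ℝ≥0∞) ≠ 0 := fun j => (Finset.mem_filter.1 (e j).2).2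
  have hnt : ∀ j, (e j : ℝ≥0∞) ≠ ∞ := fun j => by
    obtain ⟨z, hz⟩ := SimpleFunc.mem_range.1 (Finset.mem_filter.1 (e j).2).1
    exact hz ▸ hg z
  have hBv : ∀ j, volume (B j) < ∞ := fun j => by
    refine (measure_mono fun z hz => ?_).trans_lt hv
    have : g z = e j := hz
    change g z ≠ 0
    rw [this]; exact hne j
  have hdis : Pairwise (Function.onFun Disjoint B) := fun i j hij => by
    refine Set.disjoint_left.2 fun z hi hj => hij ?_
    have h1 : g z = e i := hi
    have h2 : g z = e j := hj
    exact e.injective (Subtype.ext (h1.symm.trans h2))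
  -- Used twice: with the identity to decompose the sum over the points, and with `1 - expNeg` to
  -- decompose the volume integral.
  have hsum : ∀ (F : ℝ≥0∞ → ℝ≥0∞), F 0 = 0 → ∀ z,
      F (g z) = ∑ j, F (e j) * (B j).indicator (fun _ => 1) z := fun F hF z => by
    by_cases hz : g z = 0
    · rw [hz, hF, Finset.sum_eq_zero]
      intro j _
      rw [Set.indicator_of_notMem, mul_zero]
      intro hj
      exact hne j (hj.symm.trans hz)
    · have hmem : g z ∈ s := Finset.mem_filter.2 ⟨SimpleFunc.mem_range_self g z, hz⟩
      rw [Finset.sum_eq_single (e.symm ⟨g z, hmem⟩)]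
      · rw [Set.indicator_of_mem] <;> simp [B]
      · intro j _ hj
        rw [Set.indicator_of_notMem, mul_zero]
        intro hzj
        apply hj
        rw [Equiv.eq_symm_apply]
        exact Subtype.ext (Eq.symm hzj)
      · simp
  have h1 : ∀ ω, ∑' i, g (x i ω) = ∑ j, (e j : ℝ≥0∞) * count x (B j) ω := fun ω => by
    simp_rw [← tsum_indicator_eq_count, ← ENNReal.tsum_mul_left]
    rw [← Summable.tsum_finsetSum fun _ _ => ENNReal.summable]
    exact tsum_congr fun i => hsum id rfl _
  simp_rw [h1, expNeg_sum]
  rw [lintegral_prod_eq_prod_lintegral_of_indepFun Finset.univ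
    (fun j ω => expNeg ((e j : ℝ≥0∞) * count x (B j) ω))
    ((h.indep _ B hBm hdis).comp (fun j k => expNeg ((e j : ℝ≥0∞) * k))
      fun j => Measurable.of_discrete)
    fun j => (Measurable.of_discrete (f := fun k : ℕ∞ => expNeg ((e j : ℝ≥0∞) * k))).comp
      (measurable_count h.measurable (hBm j))]
  rw [Finset.prod_congr rfl fun j _ => h.lintegral_expNeg_count hlam (hBm j) (hBv j) (hnt j),
    ← expNeg_sum, ← Finset.mul_sum]
  congr 2
  rw [lintegral_congr fun z => hsum (fun y => 1 - expNeg y) (by simp [expNeg_zero]) z,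
    lintegral_finsetSum _ fun j _ => (measurable_const.indicator (hBm j)).const_mul _]
  refine Finset.sum_congr rfl fun j _ => ?_
  rw [lintegral_const_mul _ (measurable_const.indicator (hBm j)), lintegral_indicator (hBm j),
    setLIntegral_one, mul_comm]

/-- The Laplace functional of a Poisson point process. -/
theorem laplace_functional [IsProbabilityMeasure μ] (h : IsPPP μ lam x) (hlam : 0 ≤ lam)
    {f : ℂ → ℝ≥0∞} (hf : Measurable f) :
    ∫⁻ ω, expNeg (∑' i, f (x i ω)) ∂μ
      = expNeg (ENNReal.ofReal lam * ∫⁻ z, (1 - expNeg (f z))) := by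
  -- The standard simple approximations are cut off to growing balls. This gives supports of finite
  -- volume and keeps the convergence to `f` monotone.
  set g : ℕ → SimpleFunc ℂ ℝ≥0∞ := fun n =>
    (SimpleFunc.eapprox f n).restrict (Metric.ball 0 n) with hg
  have hgz : ∀ n z, g n z = (Metric.ball (0 : ℂ) n).indicator (SimpleFunc.eapprox f n) z :=
    fun n z => SimpleFunc.restrict_apply _ Metric.isOpen_ball.measurableSet z
  have hmono : ∀ z, Monotone fun n => g n z := fun z m n hmn => by
    simp only [hgz]
    refine (Set.indicator_le_indicator_of_subset (Metric.ball_subset_ball (Nat.cast_le.2 hmn))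
      (fun _ => zero_le) z).trans ?_
    exact Set.indicator_le_indicator (SimpleFunc.monotone_eapprox f hmn z)
  have hlim : ∀ z, Tendsto (fun n => g n z) atTop (𝓝 (f z)) := fun z => by
    have h1 : Tendsto (fun n => SimpleFunc.eapprox f n z) atTop (𝓝 (f z)) := by
      rw [← SimpleFunc.iSup_eapprox_apply hf z]
      exact tendsto_atTop_iSup fun m n hmn => SimpleFunc.monotone_eapprox f hmn z
    refine h1.congr' ?_
    obtain ⟨N, hN⟩ := exists_nat_gt ‖z‖
    filter_upwards [eventually_ge_atTop N] with n hn
    rw [hgz, Set.indicator_of_mem]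
    rw [mem_ball_zero_iff]
    exact hN.trans_le (by exact_mod_cast hn)
  have hsimp : ∀ n, ∫⁻ ω, expNeg (∑' i, g n (x i ω)) ∂μ
      = expNeg (ENNReal.ofReal lam * ∫⁻ z, (1 - expNeg (g n z))) := fun n => by
    refine h.laplace_functional_simple hlam _ (fun z => ?_) ?_
    · rw [hgz]
      by_cases hz : z ∈ Metric.ball (0 : ℂ) n
      · rw [Set.indicator_of_mem hz]; exact (SimpleFunc.eapprox_lt_top f n z).ne
      · rw [Set.indicator_of_notMem hz]; exact ENNReal.zero_ne_top
    · refine (measure_mono (t := Metric.ball (0 : ℂ) n) fun z hz => ?_).trans_lt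
        measure_ball_lt_top
      by_contra hz'
      exact hz (by rw [hgz, Set.indicator_of_notMem hz'])
  have hL : Tendsto (fun n => ∫⁻ ω, expNeg (∑' i, g n (x i ω)) ∂μ) atTop
      (𝓝 (∫⁻ ω, expNeg (∑' i, f (x i ω)) ∂μ)) := by
    refine tendsto_lintegral_of_dominated_convergence (fun _ => 1) (fun n => ?_) (fun n => ?_)
      (by simp) ?_
    · exact expNeg_measurable.comp
        (Measurable.tsum fun i => (g n).measurable.comp (h.measurable i))
    · exact Eventually.of_forall fun ω => expNeg_le_one _
    · refine Eventually.of_forall fun ω => (expNeg_continuous.tendsto _).comp ?_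
      -- A sum over `ℕ` is an integral for the counting measure, so monotone convergence applies to
      -- it.
      simp_rw [← lintegral_count]
      exact lintegral_tendsto_of_tendsto_of_monotone
        (fun n => Measurable.of_discrete.aemeasurable)
        (Eventually.of_forall fun i => hmono _) (Eventually.of_forall fun i => hlim _)
  have hR : Tendsto (fun n => expNeg (ENNReal.ofReal lam * ∫⁻ z, (1 - expNeg (g n z)))) atTop
      (𝓝 (expNeg (ENNReal.ofReal lam * ∫⁻ z, (1 - expNeg (f z))))) := by
    refine (expNeg_continuous.tendsto _).comp
      (ENNReal.Tendsto.const_mul ?_ (Or.inr ENNReal.ofReal_ne_top))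
    refine lintegral_tendsto_of_tendsto_of_monotone (fun n => ?_)
      (Eventually.of_forall fun z m n hmn => ?_) (Eventually.of_forall fun z => ?_)
    · exact (measurable_const.sub (expNeg_measurable.comp (g n).measurable)).aemeasurable
    · exact tsub_le_tsub_left (expNeg_antitone (hmono z hmn)) _
    · exact ENNReal.Tendsto.sub tendsto_const_nhds ((expNeg_continuous.tendsto _).comp (hlim z))
        (Or.inl ENNReal.one_ne_top)
  simp_rw [hsimp] at hL
  exact tendsto_nhds_unique hL hR

end IsPPP

end count

end RISNet

namespace RISNet

open Filter Topology

/-! ### The nearest point of a Poisson point process -/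

/-- The part of `f` outside of the closed disc of radius `t`. -/
noncomputable def tail (t : ℝ) (f : ℂ → ℝ≥0∞) (z : ℂ) : ℝ≥0∞ :=
  {z : ℂ | t < ‖z‖}.indicator f z

lemma tail_of_lt {t : ℝ} {f : ℂ → ℝ≥0∞} {z : ℂ} (h : t < ‖z‖) : tail t f z = f z :=
  Set.indicator_of_mem (s := {z : ℂ | t < ‖z‖}) h f

lemma tail_of_le {t : ℝ} {f : ℂ → ℝ≥0∞} {z : ℂ} (h : ‖z‖ ≤ t) : tail t f z = 0 :=
  Set.indicator_of_notMem (s := {z : ℂ | t < ‖z‖}) (not_lt.2 h) f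

lemma measurableSet_lt_norm (t : ℝ) : MeasurableSet {z : ℂ | t < ‖z‖} :=
  measurableSet_lt measurable_const measurable_norm

lemma tail_measurable {f : ℂ → ℝ≥0∞} (hf : Measurable f) (t : ℝ) : Measurable (tail t f) :=
  hf.indicator (measurableSet_lt_norm t)

lemma tail_antitone (f : ℂ → ℝ≥0∞) (z : ℂ) : Antitone fun t => tail t f z := fun s t hst => by
  rcases lt_or_ge t ‖z‖ with h | h
  · simp [tail_of_lt h, tail_of_lt (hst.trans_lt h)]
  · simp [tail_of_le h]

lemma tail_measurable_uncurry {f : ℂ → ℝ≥0∞} (hf : Measurable f) :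
    Measurable fun p : ℝ × ℂ => tail p.1 f p.2 := by
  have : (fun p : ℝ × ℂ => tail p.1 f p.2)
      = {p : ℝ × ℂ | p.1 < ‖p.2‖}.indicator (fun p => f p.2) := by
    ext p
    rcases lt_or_ge p.1 ‖p.2‖ with h | h
    · rw [tail_of_lt h, Set.indicator_of_mem]
      exact h
    · rw [tail_of_le h, Set.indicator_of_notMem]
      exact not_lt.2 h
  rw [this]
  exact (hf.comp measurable_snd).indicator
    (measurableSet_lt measurable_fst (measurable_norm.comp measurable_snd))

/-- Laplace functional of the part of a Poisson process outside of a disc. -/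
noncomputable def tailLaplace (lam : ℝ) (f : ℂ → ℝ≥0∞) (t : ℝ) : ℝ≥0∞ :=
  expNeg (ENNReal.ofReal lam * ∫⁻ z, (1 - expNeg (tail t f z)))

/-- A larger removed disc leaves fewer points to pay for. Monotonicity also yields measurability in
`t` without any regularity of `f`, which later serves for the closed form of the Laplace transform.
-/
lemma tailLaplace_monotone (lam : ℝ) (f : ℂ → ℝ≥0∞) : Monotone (tailLaplace lam f) :=
  fun s t hst => expNeg_antitone <| by
    gcongr with z
    exact expNeg_antitone (tail_antitone f z hst)

lemma tailLaplace_le_one (lam : ℝ) (f : ℂ → ℝ≥0∞) (t : ℝ) : tailLaplace lam f t ≤ 1 :=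
  expNeg_le_one _

lemma tailLaplace_measurable (lam : ℝ) (f : ℂ → ℝ≥0∞) : Measurable (tailLaplace lam f) :=
  (tailLaplace_monotone lam f).measurable

/-- The condition `t < ‖z‖` is strict, so the cut-off is continuous from the right in `t`. This is
why random thresholds are approximated from above. -/
lemma tail_tendsto (f : ℂ → ℝ≥0∞) (z : ℂ) {u : ℕ → ℝ} {t : ℝ} (hu : ∀ n, t ≤ u n)
    (hlim : Tendsto u atTop (𝓝 t)) : Tendsto (fun n => tail (u n) f z) atTop (𝓝 (tail t f z)) := by
  refine tendsto_const_nhds.congr' ?_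
  rcases lt_or_ge t ‖z‖ with h | h
  · filter_upwards [hlim.eventually_lt_const h] with n hn
    rw [tail_of_lt h, tail_of_lt hn]
  · exact Eventually.of_forall fun n => by
      simp only [tail_of_le h, tail_of_le (h.trans (hu n))]

lemma tailLaplace_tendsto (lam : ℝ) {f : ℂ → ℝ≥0∞} (hf : Measurable f) {u : ℕ → ℝ} {t : ℝ}
    (hanti : Antitone u) (hu : ∀ n, t ≤ u n) (hlim : Tendsto u atTop (𝓝 t)) :
    Tendsto (fun n => tailLaplace lam f (u n)) atTop (𝓝 (tailLaplace lam f t)) := by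
  refine (expNeg_continuous.tendsto _).comp
    (ENNReal.Tendsto.const_mul ?_ (Or.inr ENNReal.ofReal_ne_top))
  refine lintegral_tendsto_of_tendsto_of_monotone (fun n => ?_)
    (Eventually.of_forall fun z m n hmn => ?_) (Eventually.of_forall fun z => ?_)
  · exact (measurable_const.sub (expNeg_measurable.comp (tail_measurable hf _))).aemeasurable
  · exact tsub_le_tsub_left (expNeg_antitone (tail_antitone f z (hanti hmn))) _
  · exact ENNReal.Tendsto.sub tendsto_const_nhds
      ((expNeg_continuous.tendsto _).comp (tail_tendsto f z hu hlim)) (Or.inl ENNReal.one_ne_top)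

lemma tsum_tail_tendsto (f : ℂ → ℝ≥0∞) (y : ℕ → ℂ) {u : ℕ → ℝ} {t : ℝ}
    (hanti : Antitone u) (hu : ∀ n, t ≤ u n) (hlim : Tendsto u atTop (𝓝 t)) :
    Tendsto (fun n => ∑' i, tail (u n) f (y i)) atTop (𝓝 (∑' i, tail t f (y i))) := by
  simp_rw [← lintegral_count]
  exact lintegral_tendsto_of_tendsto_of_monotone (fun n => Measurable.of_discrete.aemeasurable)
    (Eventually.of_forall fun i m n hmn => tail_antitone f _ (hanti hmn))
    (Eventually.of_forall fun i => tail_tendsto f _ hu hlim)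

/-- Upper dyadic approximation. -/
noncomputable def dyadicCeil (n : ℕ) (t : ℝ) : ℝ := (⌈t * 2 ^ n⌉₊ : ℝ) / 2 ^ n

lemma le_dyadicCeil (n : ℕ) (t : ℝ) : t ≤ dyadicCeil n t := by
  rw [dyadicCeil, le_div_iff₀ (by positivity)]
  exact Nat.le_ceil _

/-- Follows from `⌈2 y⌉ ≤ 2 ⌈y⌉`. -/
lemma dyadicCeil_antitone (t : ℝ) : Antitone fun n => dyadicCeil n t := by
  refine antitone_nat_of_succ_le fun n => ?_
  rw [dyadicCeil, dyadicCeil, div_le_div_iff₀ (by positivity) (by positivity)]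
  have h : ⌈t * 2 ^ (n + 1)⌉₊ ≤ 2 * ⌈t * 2 ^ n⌉₊ := by
    refine Nat.ceil_le.2 ?_
    have := Nat.le_ceil (t * 2 ^ n)
    push_cast
    rw [pow_succ]
    linarith
  have h' : (⌈t * 2 ^ (n + 1)⌉₊ : ℝ) ≤ 2 * ⌈t * 2 ^ n⌉₊ := by exact_mod_cast h
  have : (0 : ℝ) < 2 ^ n := by positivity
  calc (⌈t * 2 ^ (n + 1)⌉₊ : ℝ) * 2 ^ n ≤ 2 * ⌈t * 2 ^ n⌉₊ * 2 ^ n := by gcongr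
    _ = ⌈t * 2 ^ n⌉₊ * 2 ^ (n + 1) := by ring

lemma dyadicCeil_tendsto {t : ℝ} (ht : 0 ≤ t) : Tendsto (fun n => dyadicCeil n t) atTop (𝓝 t) := by
  have h2 : Tendsto (fun n : ℕ => t + (1 / 2 : ℝ) ^ n) atTop (𝓝 t) := by
    simpa using (tendsto_pow_atTop_nhds_zero_of_lt_one (r := (1 / 2 : ℝ)) (by norm_num)
      (by norm_num)).const_add t
  refine tendsto_of_tendsto_of_tendsto_of_le_of_le tendsto_const_nhds h2
    (fun n => le_dyadicCeil n t) fun n => ?_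
  have := (Nat.ceil_lt_add_one (show 0 ≤ t * 2 ^ n by positivity)).le
  rw [dyadicCeil, div_le_iff₀ (by positivity), add_mul, one_div, inv_pow,
    inv_mul_cancel₀ (by positivity)]
  exact this

lemma dyadicCeil_measurable (n : ℕ) : Measurable (dyadicCeil n) := by
  unfold dyadicCeil
  exact ((measurable_from_top (f := fun k : ℕ => (k : ℝ))).comp
    (Nat.measurable_ceil.comp (measurable_id.mul_const _))).div_const _

lemma volume_complex_closedBall {a : ℝ} (ha : 0 ≤ a) :
    volume (Metric.closedBall (0 : ℂ) a) = ENNReal.ofReal (Real.pi * a ^ 2) := by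
  rw [Complex.volume_closedBall, ← ENNReal.ofReal_pow ha, mul_comm,
    ENNReal.ofReal_mul Real.pi_pos.le]
  congr 1
  rw [← NNReal.coe_real_pi, ENNReal.ofReal_coe_nnreal]

section nearest

variable {Ω : Type*} [MeasurableSpace Ω] {μ : Measure Ω} [IsProbabilityMeasure μ] {lam : ℝ}
  {b : ℕ → Ω → ℂ}

namespace IsPPP

/-- An infinite cost on the closed disc of radius `a` encodes the event that the nearest point lies
outside of it, so one application of the Laplace functional covers both the event and the cost
outside radius `t`. -/
lemma setLIntegral_expNeg_tail (h : IsPPP μ lam b) (hlam : 0 ≤ lam)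
    (hnear : ∀ᵐ ω ∂μ, ∀ i, ‖b 0 ω‖ ≤ ‖b i ω‖) {f : ℂ → ℝ≥0∞} (hf : Measurable f) {a t : ℝ}
    (hat : a ≤ t) :
    ∫⁻ ω in {ω | a < ‖b 0 ω‖}, expNeg (∑' i, tail t f (b i ω)) ∂μ
      = expNeg (ENNReal.ofReal lam * volume (Metric.closedBall (0 : ℂ) a))
        * tailLaplace lam f t := by
  set B := Metric.closedBall (0 : ℂ) a with hB
  have hBm : MeasurableSet B := Metric.isClosed_closedBall.measurableSet
  set v : ℂ → ℝ≥0∞ := B.indicator (fun _ => ∞) with hv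
  have hvm : Measurable v := measurable_const.indicator hBm
  have hmT : MeasurableSet {ω | a < ‖b 0 ω‖} :=
    measurableSet_lt measurable_const (measurable_norm.comp (h.measurable 0))
  have h1 : ∀ᵐ ω ∂μ, expNeg (∑' i, (v (b i ω) + tail t f (b i ω)))
      = {ω | a < ‖b 0 ω‖}.indicator (fun ω => expNeg (∑' i, tail t f (b i ω))) ω := by
    filter_upwards [hnear] with ω hω
    by_cases hT : a < ‖b 0 ω‖
    · rw [Set.indicator_of_mem (by exact hT)]
      congr 1
      refine tsum_congr fun i => ?_
      rw [hv, Set.indicator_of_notMem, zero_add]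
      simpa [hB] using hT.trans_le (hω i)
    · rw [Set.indicator_of_notMem (by exact hT), expNeg_eq_zero, ENNReal.tsum_eq_top_of_eq_top]
      refine ⟨0, ?_⟩
      rw [hv, Set.indicator_of_mem, top_add]
      simpa [hB] using not_lt.1 hT
  rw [← lintegral_indicator hmT, ← lintegral_congr_ae h1,
    h.laplace_functional hlam (f := fun z => v z + tail t f z) (hvm.add (tail_measurable hf t)),
    tailLaplace, ← expNeg_add, ← mul_add]
  congr 2
  -- Since `a ≤ t`, the two costs have disjoint supports, so their contributions to the exponent
  -- add.
  have h2 : ∀ z, 1 - expNeg (v z + tail t f z)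
      = B.indicator (fun _ => 1) z + (1 - expNeg (tail t f z)) := fun z => by
    by_cases hz : z ∈ B
    · have : tail t f z = 0 := tail_of_le (by
        have : ‖z‖ ≤ a := by simpa [hB] using hz
        linarith)
      simp [hv, hz, this, expNeg_top, expNeg_zero]
    · simp [hv, hz]
  rw [lintegral_congr h2, lintegral_add_left (measurable_const.indicator hBm),
    lintegral_indicator hBm, setLIntegral_one]

lemma measure_lt_norm (h : IsPPP μ lam b) (hlam : 0 ≤ lam)
    (hnear : ∀ᵐ ω ∂μ, ∀ i, ‖b 0 ω‖ ≤ ‖b i ω‖) (a : ℝ) :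
    μ {ω | a < ‖b 0 ω‖} = expNeg (ENNReal.ofReal lam * volume (Metric.closedBall (0 : ℂ) a)) := by
  have := h.setLIntegral_expNeg_tail hlam hnear (f := 0) measurable_zero (le_refl a)
  simpa [tail, tailLaplace, expNeg_zero] using this

/-- The difference of the formulas for the events `a < ‖b 0‖` and `t < ‖b 0‖`, with the same
deterministic cut-off `t`. Both carry the factor `tailLaplace lam f t`. -/
lemma setLIntegral_expNeg_tail_Ioc (h : IsPPP μ lam b) (hlam : 0 ≤ lam)
    (hnear : ∀ᵐ ω ∂μ, ∀ i, ‖b 0 ω‖ ≤ ‖b i ω‖) {f : ℂ → ℝ≥0∞} (hf : Measurable f) (a t : ℝ) :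
    ∫⁻ ω in {ω | a < ‖b 0 ω‖ ∧ ‖b 0 ω‖ ≤ t}, expNeg (∑' i, tail t f (b i ω)) ∂μ
      = ∫⁻ _ in {ω | a < ‖b 0 ω‖ ∧ ‖b 0 ω‖ ≤ t}, tailLaplace lam f t ∂μ := by
  rcases lt_or_ge t a with hta | hat
  · have : {ω | a < ‖b 0 ω‖ ∧ ‖b 0 ω‖ ≤ t} = ∅ := by
      ext ω
      simp only [Set.mem_ofPred_eq, Set.mem_empty_iff_false, iff_false, not_and, not_le]
      exact fun h => hta.trans h
    simp [this]
  have hm : ∀ c, MeasurableSet {ω | c < ‖b 0 ω‖} := fun c =>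
    measurableSet_lt measurable_const (measurable_norm.comp (h.measurable 0))
  have hset : {ω | a < ‖b 0 ω‖ ∧ ‖b 0 ω‖ ≤ t} = {ω | a < ‖b 0 ω‖} \ {ω | t < ‖b 0 ω‖} := by
    ext ω; simp
  have hsub : {ω | t < ‖b 0 ω‖} ⊆ {ω | a < ‖b 0 ω‖} := fun ω hω => hat.trans_lt hω
  have key : ∀ F : Ω → ℝ≥0∞, (∀ ω, F ω ≤ 1) →
      ∫⁻ ω in {ω | a < ‖b 0 ω‖ ∧ ‖b 0 ω‖ ≤ t}, F ω ∂μ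
        = ∫⁻ ω in {ω | a < ‖b 0 ω‖}, F ω ∂μ - ∫⁻ ω in {ω | t < ‖b 0 ω‖}, F ω ∂μ := by
    intro F hF
    rw [hset, ← lintegral_inter_add_sdiff (μ := μ) F {ω | a < ‖b 0 ω‖} (hm t),
      Set.inter_eq_self_of_subset_right hsub, ENNReal.add_sub_cancel_left]
    refine ne_top_of_le_ne_top ENNReal.one_ne_top ?_
    calc ∫⁻ ω in {ω | t < ‖b 0 ω‖}, F ω ∂μ ≤ ∫⁻ ω in {ω | t < ‖b 0 ω‖}, 1 ∂μ := lintegral_mono hF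
      _ ≤ 1 := by rw [setLIntegral_one]; exact prob_le_one
  rw [key _ fun ω => expNeg_le_one _, key _ fun ω => tailLaplace_le_one _ _ _,
    h.setLIntegral_expNeg_tail hlam hnear hf hat,
    h.setLIntegral_expNeg_tail hlam hnear hf le_rfl, setLIntegral_const, setLIntegral_const,
    h.measure_lt_norm hlam hnear, h.measure_lt_norm hlam hnear]
  simp only [mul_comm]

lemma ae_norm_pos (h : IsPPP μ lam b) (hlam : 0 ≤ lam)
    (hnear : ∀ᵐ ω ∂μ, ∀ i, ‖b 0 ω‖ ≤ ‖b i ω‖) : ∀ᵐ ω ∂μ, 0 < ‖b 0 ω‖ := by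
  have h1 := h.measure_lt_norm hlam hnear 0
  simp only [Metric.closedBall_zero, measure_singleton, mul_zero, expNeg_zero] at h1
  have hm : MeasurableSet {ω | 0 < ‖b 0 ω‖} :=
    measurableSet_lt measurable_const (measurable_norm.comp (h.measurable 0))
  exact (prob_compl_eq_zero_iff hm).2 h1

/-- The random cut-off `‖b 0‖` is replaced by its upper dyadic approximation, which is constant on
each dyadic cell, where the deterministic formula applies. Right-continuity of both sides in the
cut-off allows the limit. -/
lemma setLIntegral_lt_tail_nearest (h : IsPPP μ lam b) (hlam : 0 ≤ lam)
    (hnear : ∀ᵐ ω ∂μ, ∀ i, ‖b 0 ω‖ ≤ ‖b i ω‖) {f : ℂ → ℝ≥0∞} (hf : Measurable f) {a : ℝ}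
    (ha : 0 ≤ a) :
    ∫⁻ ω in {ω | a < ‖b 0 ω‖}, expNeg (∑' i, tail ‖b 0 ω‖ f (b i ω)) ∂μ
      = ∫⁻ ω in {ω | a < ‖b 0 ω‖}, tailLaplace lam f ‖b 0 ω‖ ∂μ := by
  have hTm : Measurable fun ω => ‖b 0 ω‖ := measurable_norm.comp (h.measurable 0)
  have happ : ∀ n, ∫⁻ ω in {ω | a < ‖b 0 ω‖},
        expNeg (∑' i, tail (dyadicCeil n ‖b 0 ω‖) f (b i ω)) ∂μ
      = ∫⁻ ω in {ω | a < ‖b 0 ω‖}, tailLaplace lam f (dyadicCeil n ‖b 0 ω‖) ∂μ := by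
    intro n
    -- Cells open on the left and closed on the right, to match the ceiling: on cell `k` the
    -- approximation equals its right end `(k + 1) / 2 ^ n`.
    set S : ℕ → Set Ω := fun k =>
      {ω | max a (k / 2 ^ n) < ‖b 0 ω‖ ∧ ‖b 0 ω‖ ≤ ((k + 1 : ℕ) : ℝ) / 2 ^ n} with hS
    have hSm : ∀ k, MeasurableSet (S k) := fun k =>
      (measurableSet_lt measurable_const hTm).inter (measurableSet_le hTm measurable_const)
    have hceil : ∀ k, ∀ ω ∈ S k, ⌈‖b 0 ω‖ * 2 ^ n⌉₊ = k + 1 := by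
      intro k ω hω
      have h1 := (max_lt_iff.1 hω.1).2
      have h2 := hω.2
      rw [div_lt_iff₀ (by positivity)] at h1
      rw [le_div_iff₀ (by positivity)] at h2
      exact (Nat.ceil_eq_iff (by simp)).2 ⟨by simpa using h1, h2⟩
    have hU : {ω | a < ‖b 0 ω‖} = ⋃ k, S k := by
      ext ω
      simp only [Set.mem_iUnion]
      constructor
      · intro hω
        have hω' : a < ‖b 0 ω‖ := hω
        have hpos : 0 < ‖b 0 ω‖ * 2 ^ n := mul_pos (ha.trans_lt hω') (by positivity)
        obtain ⟨k, hk⟩ := Nat.exists_eq_succ_of_ne_zero (Nat.ceil_pos.2 hpos).ne'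
        have h3 := (Nat.ceil_eq_iff (by simp)).1 hk
        refine ⟨k, max_lt hω' ?_, ?_⟩
        · rw [div_lt_iff₀ (by positivity)]; simpa using h3.1
        · rw [le_div_iff₀ (by positivity)]; exact h3.2
      · rintro ⟨k, hk⟩
        exact (max_lt_iff.1 hk.1).1
    have hd : Pairwise (Function.onFun Disjoint S) := fun i j hij => by
      refine Set.disjoint_left.2 fun ω hi hj => hij ?_
      have := (hceil i ω hi).symm.trans (hceil j ω hj)
      omega
    rw [hU, lintegral_iUnion hSm hd, lintegral_iUnion hSm hd]
    refine tsum_congr fun k => ?_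
    have hval : ∀ ω ∈ S k, dyadicCeil n ‖b 0 ω‖ = ((k + 1 : ℕ) : ℝ) / 2 ^ n := fun ω hω => by
      rw [dyadicCeil, hceil k ω hω]
    rw [setLIntegral_congr_fun
        (g := fun ω => expNeg (∑' i, tail (((k + 1 : ℕ) : ℝ) / 2 ^ n) f (b i ω))) (hSm k)
        (fun ω hω => by simp only [hval ω hω]),
      setLIntegral_congr_fun (f := fun ω => tailLaplace lam f (dyadicCeil n ‖b 0 ω‖))
        (g := fun _ => tailLaplace lam f (((k + 1 : ℕ) : ℝ) / 2 ^ n)) (hSm k)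
        (fun ω hω => by simp only [hval ω hω])]
    exact h.setLIntegral_expNeg_tail_Ioc hlam hnear hf _ _
  have hL : Tendsto (fun n => ∫⁻ ω in {ω | a < ‖b 0 ω‖},
        expNeg (∑' i, tail (dyadicCeil n ‖b 0 ω‖) f (b i ω)) ∂μ) atTop
      (𝓝 (∫⁻ ω in {ω | a < ‖b 0 ω‖}, expNeg (∑' i, tail ‖b 0 ω‖ f (b i ω)) ∂μ)) := by
    refine tendsto_lintegral_of_dominated_convergence (fun _ => 1) (fun n => ?_) (fun n => ?_)
      (by simp) ?_
    · exact expNeg_measurable.comp (Measurable.tsum fun i =>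
        (tail_measurable_uncurry hf).comp
          (((dyadicCeil_measurable n).comp hTm).prodMk (h.measurable i)))
    · exact Eventually.of_forall fun ω => expNeg_le_one _
    · exact Eventually.of_forall fun ω => (expNeg_continuous.tendsto _).comp
        (tsum_tail_tendsto f _ (dyadicCeil_antitone _) (fun n => le_dyadicCeil n _)
          (dyadicCeil_tendsto (norm_nonneg _)))
  have hR : Tendsto (fun n => ∫⁻ ω in {ω | a < ‖b 0 ω‖},
        tailLaplace lam f (dyadicCeil n ‖b 0 ω‖) ∂μ) atTop
      (𝓝 (∫⁻ ω in {ω | a < ‖b 0 ω‖}, tailLaplace lam f ‖b 0 ω‖ ∂μ)) := by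
    refine tendsto_lintegral_of_dominated_convergence (fun _ => 1) (fun n => ?_) (fun n => ?_)
      (by simp) ?_
    · exact (tailLaplace_measurable lam f).comp ((dyadicCeil_measurable n).comp hTm)
    · exact Eventually.of_forall fun ω => tailLaplace_le_one _ _ _
    · exact Eventually.of_forall fun ω => tailLaplace_tendsto lam hf (dyadicCeil_antitone _)
        (fun n => le_dyadicCeil n _) (dyadicCeil_tendsto (norm_nonneg _))
  simp_rw [happ] at hL
  exact tendsto_nhds_unique hL hR

/-- For a Poisson variable of mean `v` the probability is `1 - (1 + v) exp (-v)`, and `exp (-v) ≥ 1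
- v` bounds this by `v ^ 2`. -/
lemma measure_two_le_count (h : IsPPP μ lam b) (hlam : 0 ≤ lam) {B : Set ℂ}
    (hB : MeasurableSet B) (hv : volume B < ∞) :
    μ {ω | 2 ≤ count b B ω} ≤ ENNReal.ofReal ((lam * (volume B).toReal) ^ 2) := by
  have hm := measurable_count h.measurable hB
  set v := lam * (volume B).toReal with hvdef
  have hv0 : 0 ≤ v := by positivity
  have hk : ∀ k : ℕ, MeasurableSet {ω | count b B ω = k} := fun k => hm (measurableSet_singleton _)
  have hset : {ω | 2 ≤ count b B ω}
      = ({ω | count b B ω = (0 : ℕ)} ∪ {ω | count b B ω = (1 : ℕ)})ᶜ := by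
    ext ω
    simp only [Set.mem_ofPred_eq, Set.mem_compl_iff, Set.mem_union, not_or]
    generalize count b B ω = c
    induction c using ENat.recTopCoe with
    | top => simp
    | coe c => norm_cast; omega
  have hd : Disjoint {ω | count b B ω = (0 : ℕ)} {ω | count b B ω = (1 : ℕ)} := by
    refine Set.disjoint_left.2 fun ω h0 h1 => ?_
    have h0' : count b B ω = (0 : ℕ) := h0
    have h1' : count b B ω = (1 : ℕ) := h1
    rw [h0'] at h1'
    norm_num at h1'
  have hr : ∀ k : ℕ, μ.real {ω | count b B ω = k} = Real.exp (-v) * v ^ k / k.factorial :=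
    fun k => by
      rw [measureReal_def, h.poisson B hB hv, poissonMeasure_singleton, ENNReal.toReal_ofReal
        (by positivity), Real.coe_toNNReal _ hv0]
  rw [hset, ← ofReal_measureReal, probReal_compl_eq_one_sub ((hk 0).union (hk 1)),
    measureReal_union hd (hk 1), hr, hr]
  refine ENNReal.ofReal_le_ofReal ?_
  simp only [pow_zero, Nat.factorial, pow_one]
  norm_num
  have h1 : 1 - v ≤ Real.exp (-v) := by have := Real.add_one_le_exp (-v); linarith
  nlinarith

/-- Two points at the same distance, at most `R`, would share one of `R N` annuli of width `1 / N`.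
Each has area of order `1 / N` and holds two points with probability of order `1 / N ^ 2`, so the
union bound tends to `0`. The strict inequality is needed because `tail ‖b 0 ω‖` keeps only the
points that are strictly farther away. -/
lemma ae_norm_ne (h : IsPPP μ lam b) (hlam : 0 ≤ lam)
    (hnear : ∀ᵐ ω ∂μ, ∀ i, ‖b 0 ω‖ ≤ ‖b i ω‖) : ∀ᵐ ω ∂μ, ∀ i, ‖b 0 ω‖ < ‖b (i + 1) ω‖ := by
  have hTm : ∀ i, Measurable fun ω => ‖b i ω‖ := fun i => measurable_norm.comp (h.measurable i)
  have key : ∀ R : ℕ, ∀ᵐ ω ∂μ, ‖b 0 ω‖ ≤ R → 0 < ‖b 0 ω‖ → ∀ i, ‖b (i + 1) ω‖ ≠ ‖b 0 ω‖ := by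
    intro R
    set E := {ω | ‖b 0 ω‖ ≤ R ∧ 0 < ‖b 0 ω‖ ∧ ∃ i, ‖b (i + 1) ω‖ = ‖b 0 ω‖} with hE
    have hE0 : μ E = 0 := by
      have hbound : ∀ n : ℕ, μ E
          ≤ ENNReal.ofReal ((lam * (2 * Real.pi * R)) ^ 2 * R / ((n + 1 : ℕ) : ℝ)) := by
        intro n
        set N : ℕ := n + 1 with hN
        have hNpos : (0 : ℝ) < N := by simp [hN]; positivity
        set B : ℕ → Set ℂ := fun k =>
          Metric.closedBall (0 : ℂ) (((k + 1 : ℕ) : ℝ) / N) \ Metric.closedBall (0 : ℂ) (k / N)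
          with hB
        have hBm : ∀ k, MeasurableSet (B k) := fun k =>
          Metric.isClosed_closedBall.measurableSet.diff Metric.isClosed_closedBall.measurableSet
        have hBv : ∀ k, (volume (B k)).toReal = Real.pi * (2 * k + 1) / N ^ 2 := fun k => by
          have hsub : Metric.closedBall (0 : ℂ) (k / N)
              ⊆ Metric.closedBall (0 : ℂ) (((k + 1 : ℕ) : ℝ) / N) :=
            Metric.closedBall_subset_closedBall (by gcongr; simp)
          rw [hB, measure_sdiff hsub Metric.isClosed_closedBall.measurableSet.nullMeasurableSet
            measure_closedBall_lt_top.ne, volume_complex_closedBall (by positivity),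
            volume_complex_closedBall (by positivity), ← ENNReal.ofReal_sub _ (by positivity),
            ENNReal.toReal_ofReal]
          · push_cast; field_simp; ring
          · rw [sub_nonneg]; gcongr; simp
        have hBf : ∀ k, volume (B k) < ∞ := fun k =>
          (measure_mono Set.sdiff_subset).trans_lt measure_closedBall_lt_top
        have hcover : E ⊆ ⋃ k ∈ Finset.range (R * N), {ω | 2 ≤ count b (B k) ω} := by
          rintro ω ⟨h1, h2, i, hi⟩
          have hpos : 0 < ‖b 0 ω‖ * N := by positivity
          obtain ⟨k, hk⟩ := Nat.exists_eq_succ_of_ne_zero (Nat.ceil_pos.2 hpos).ne'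
          have h3 := (Nat.ceil_eq_iff (by simp)).1 hk
          have h4 : ⌈‖b 0 ω‖ * N⌉₊ ≤ R * N := Nat.ceil_le.2 (by push_cast; gcongr)
          simp only [Set.mem_iUnion, Finset.mem_range]
          refine ⟨k, by omega, ?_⟩
          have hmem : ∀ z : ℂ, ‖z‖ = ‖b 0 ω‖ → z ∈ B k := fun z hz => by
            simp only [hB, Set.mem_sdiff, mem_closedBall_zero_iff, hz, not_le]
            constructor
            · rw [le_div_iff₀ hNpos]; exact h3.2
            · rw [div_lt_iff₀ hNpos]; simpa using h3.1
          have hpair : ({0, i + 1} : Set ℕ) ⊆ {j : ℕ | b j ω ∈ B k} := by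
            rintro j (rfl | rfl)
            · exact hmem _ rfl
            · exact hmem _ hi
          calc (2 : ℕ∞) = ({0, i + 1} : Set ℕ).encard := (Set.encard_pair (by simp)).symm
            _ ≤ _ := Set.encard_le_encard hpair
        calc μ E ≤ ∑ k ∈ Finset.range (R * N), μ {ω | 2 ≤ count b (B k) ω} :=
              (measure_mono hcover).trans (measure_biUnion_finset_le _ _)
          _ ≤ ∑ k ∈ Finset.range (R * N),
                ENNReal.ofReal ((lam * (2 * Real.pi * R / N)) ^ 2) := by
              refine Finset.sum_le_sum fun k hk => (h.measure_two_le_count hlam (hBm k)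
                (hBf k)).trans (ENNReal.ofReal_le_ofReal ?_)
              rw [hBv]
              have hk' : (k : ℝ) + 1 ≤ R * N := by exact_mod_cast Finset.mem_range.1 hk
              have : Real.pi * (2 * k + 1) / N ^ 2 ≤ 2 * Real.pi * R / N := by
                rw [div_le_div_iff₀ (by positivity) hNpos]
                have : Real.pi * (2 * k + 1) ≤ 2 * Real.pi * (R * N) := by
                  nlinarith [Real.pi_pos]
                calc Real.pi * (2 * k + 1) * N ≤ 2 * Real.pi * (R * N) * N := by gcongr
                  _ = _ := by ring
              gcongr
          _ = _ := by
              rw [Finset.sum_const, Finset.card_range, nsmul_eq_mul, ← ENNReal.ofReal_natCast,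
                ← ENNReal.ofReal_mul (by positivity)]
              congr 1
              push_cast
              field_simp
      have hlim : Tendsto (fun n : ℕ => ENNReal.ofReal
          ((lam * (2 * Real.pi * R)) ^ 2 * R / ((n + 1 : ℕ) : ℝ))) atTop (𝓝 0) := by
        rw [← ENNReal.ofReal_zero]
        refine ENNReal.tendsto_ofReal ?_
        exact (tendsto_const_div_atTop_nhds_zero_nat _).comp (tendsto_add_atTop_nat 1)
      exact le_antisymm (ge_of_tendsto' hlim hbound) zero_le
    have := measure_eq_zero_iff_ae_notMem.1 hE0
    filter_upwards [this] with ω hω h1 h2 i hi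
    exact hω ⟨h1, h2, i, hi⟩
  filter_upwards [ae_all_iff.2 key, h.ae_norm_pos hlam hnear, hnear] with ω h1 h2 h3 i
  obtain ⟨R, hR⟩ := exists_nat_ge ‖b 0 ω‖
  exact lt_of_le_of_ne (h3 _) (h1 R hR h2 i).symm

/-- The points other than the nearest one, given the distance of the nearest one, form a Poisson
process outside of a disc. -/
theorem setLIntegral_expNeg_nearest (h : IsPPP μ lam b) (hlam : 0 ≤ lam)
    (hnear : ∀ᵐ ω ∂μ, ∀ i, ‖b 0 ω‖ ≤ ‖b i ω‖) {f : ℂ → ℝ≥0∞} (hf : Measurable f) {A : Set ℝ}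
    (hA : MeasurableSet A) :
    ∫⁻ ω in {ω | ‖b 0 ω‖ ∈ A}, expNeg (∑' i, f (b (i + 1) ω)) ∂μ
      = ∫⁻ ω in {ω | ‖b 0 ω‖ ∈ A}, tailLaplace lam f ‖b 0 ω‖ ∂μ := by
  have hTm : Measurable fun ω => ‖b 0 ω‖ := measurable_norm.comp (h.measurable 0)
  have h1 : ∀ᵐ ω ∂μ, expNeg (∑' i, tail ‖b 0 ω‖ f (b i ω)) = expNeg (∑' i, f (b (i + 1) ω)) := by
    filter_upwards [h.ae_norm_ne hlam hnear] with ω hω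
    rw [tsum_eq_zero_add' ENNReal.summable, tail_of_le le_rfl, zero_add]
    congr 1
    exact tsum_congr fun i => tail_of_lt (hω i)
  -- As functions of `A` both sides are finite measures on the line, so agreement on half-lines
  -- suffices. Half-lines starting below `0` reduce to `(0, ∞)`, because the nearest distance is
  -- almost surely positive.
  set M₁ : Measure ℝ :=
    (μ.withDensity fun ω => expNeg (∑' i, f (b (i + 1) ω))).map (fun ω => ‖b 0 ω‖) with hM₁
  set M₂ : Measure ℝ :=
    (μ.withDensity fun ω => tailLaplace lam f ‖b 0 ω‖).map (fun ω => ‖b 0 ω‖) with hM₂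
  have hM₁A : ∀ A : Set ℝ, MeasurableSet A →
      M₁ A = ∫⁻ ω in {ω | ‖b 0 ω‖ ∈ A}, expNeg (∑' i, f (b (i + 1) ω)) ∂μ := fun A hA => by
    rw [hM₁, Measure.map_apply hTm hA, withDensity_apply _ (hTm hA)]; rfl
  have hM₂A : ∀ A : Set ℝ, MeasurableSet A →
      M₂ A = ∫⁻ ω in {ω | ‖b 0 ω‖ ∈ A}, tailLaplace lam f ‖b 0 ω‖ ∂μ := fun A hA => by
    rw [hM₂, Measure.map_apply hTm hA, withDensity_apply _ (hTm hA)]; rfl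
  have hfin : ∀ F : Ω → ℝ≥0∞, (∀ ω, F ω ≤ 1) → IsFiniteMeasure (μ.withDensity F) := fun F hF =>
    isFiniteMeasure_withDensity (ne_top_of_le_ne_top ENNReal.one_ne_top
      ((lintegral_mono hF).trans (by simp)))
  have : IsFiniteMeasure (μ.withDensity fun ω => expNeg (∑' i, f (b (i + 1) ω))) :=
    hfin _ fun ω => expNeg_le_one _
  have : IsFiniteMeasure (μ.withDensity fun ω => tailLaplace lam f ‖b 0 ω‖) :=
    hfin _ fun ω => tailLaplace_le_one _ _ _
  have : IsFiniteMeasure M₁ := by rw [hM₁]; infer_instance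
  have : IsFiniteMeasure M₂ := by rw [hM₂]; infer_instance
  have hpos : ∀ a : ℝ, 0 ≤ a → M₁ (Set.Ioi a) = M₂ (Set.Ioi a) := fun a ha => by
    rw [hM₁A _ measurableSet_Ioi, hM₂A _ measurableSet_Ioi]
    refine (setLIntegral_congr_fun_ae (hTm measurableSet_Ioi) ?_).trans
      (h.setLIntegral_lt_tail_nearest hlam hnear hf ha)
    filter_upwards [h1] with ω hω _ using hω.symm
  have hIoi : ∀ a : ℝ, M₁ (Set.Ioi a) = M₂ (Set.Ioi a) := fun a => by
    rcases le_or_gt 0 a with ha | ha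
    · exact hpos a ha
    · have hset : {ω | ‖b 0 ω‖ ∈ Set.Ioi a} =ᵐ[μ] {ω | ‖b 0 ω‖ ∈ Set.Ioi (0 : ℝ)} := by
        filter_upwards [h.ae_norm_pos hlam hnear] with ω hω
        refine propext ⟨fun _ => hω, fun _ => ha.trans hω⟩
      have h0 := hpos 0 le_rfl
      rw [hM₁A _ measurableSet_Ioi, hM₂A _ measurableSet_Ioi] at h0 ⊢
      rw [setLIntegral_congr hset, setLIntegral_congr hset, h0]
  have huniv : M₁ Set.univ = M₂ Set.univ := by
    have h0 := hIoi (-1)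
    have hset : {ω | ‖b 0 ω‖ ∈ Set.Ioi (-1 : ℝ)} = {ω | ‖b 0 ω‖ ∈ Set.univ} := by
      ext ω
      simp only [Set.mem_ofPred_eq, Set.mem_Ioi, Set.mem_univ, iff_true]
      linarith [norm_nonneg (b 0 ω)]
    rw [hM₁A _ measurableSet_Ioi, hM₂A _ measurableSet_Ioi, hset] at h0
    rw [hM₁A _ MeasurableSet.univ, hM₂A _ MeasurableSet.univ, h0]
  have : M₁ = M₂ := by
    refine Measure.ext_of_Iic M₁ M₂ fun a => ?_
    rw [← Set.compl_Ioi, measure_compl measurableSet_Ioi (measure_ne_top _ _),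
      measure_compl measurableSet_Ioi (measure_ne_top _ _), huniv, hIoi]
  rw [← hM₁A A hA, ← hM₂A A hA, this]

end IsPPP

end nearest

/-- The nearest BS is farther than `a` exactly when the closed disc of radius `a` is empty, which
gives the tail `exp (-π λ a ^ 2)`. Minus this tail is an antiderivative of `fTbu`, so the two laws
agree on half-lines. -/
lemma Network.map_tbu {P : Params} {Ω : Type*} [MeasurableSpace Ω] {μ : Measure Ω}
    [IsProbabilityMeasure μ] (W : Network P μ) :
    μ.map W.tbu
      = (volume.restrict (Set.Ioi 0)).withDensity (fun t => ENNReal.ofReal (P.fTbu t)) := by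
  have hTm : Measurable W.tbu := measurable_norm.comp (W.b_ppp.measurable 0)
  have hlam := P.lamB_pos
  have hder : ∀ t : ℝ, HasDerivAt (fun t => -Real.exp (-Real.pi * P.lamB * t ^ 2)) (P.fTbu t) t := by
    intro t
    have h1 : HasDerivAt (fun t : ℝ => -Real.pi * P.lamB * t ^ 2)
        (-Real.pi * P.lamB * (2 * t)) t := by
      simpa using (hasDerivAt_pow 2 t).const_mul (-Real.pi * P.lamB)
    refine h1.exp.neg.congr_deriv ?_
    simp only [Params.fTbu]; ring
  have hlim : Tendsto (fun t : ℝ => -Real.exp (-Real.pi * P.lamB * t ^ 2)) atTop (𝓝 0) := by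
    rw [← neg_zero]
    refine (Real.tendsto_exp_atBot.comp ?_).neg
    have h2 : Tendsto (fun t : ℝ => t ^ 2) atTop atTop := tendsto_pow_atTop two_ne_zero
    exact h2.const_mul_atTop_of_neg (by have := Real.pi_pos; nlinarith [mul_pos this hlam])
  have hnn : ∀ t : ℝ, 0 ≤ t → 0 ≤ P.fTbu t := fun t ht => by
    simp only [Params.fTbu]; have := Real.pi_pos; positivity
  have hIoi : ∀ a : ℝ, 0 ≤ a → ∫⁻ t in Set.Ioi a, ENNReal.ofReal (P.fTbu t)
      = ENNReal.ofReal (Real.exp (-Real.pi * P.lamB * a ^ 2)) := fun a ha => by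
    have hint : IntegrableOn P.fTbu (Set.Ioi a) := integrableOn_Ioi_deriv_of_nonneg'
      (fun x _ => hder x) (fun x hx => hnn x (ha.trans (le_of_lt hx))) hlim
    rw [← ofReal_integral_eq_lintegral_ofReal hint, integral_Ioi_of_hasDerivAt_of_tendsto'
      (fun x _ => hder x) hint hlim]
    · simp
    · filter_upwards [ae_restrict_mem measurableSet_Ioi] with x hx
        using hnn x (ha.trans (le_of_lt hx))
  have hmu : ∀ a : ℝ, 0 ≤ a → μ.map W.tbu (Set.Ioi a)
      = ENNReal.ofReal (Real.exp (-Real.pi * P.lamB * a ^ 2)) := fun a ha => by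
    rw [Measure.map_apply hTm measurableSet_Ioi]
    refine (W.b_ppp.measure_lt_norm hlam.le W.nearest a).trans ?_
    rw [volume_complex_closedBall ha, ← ENNReal.ofReal_mul hlam.le,
      expNeg_ofReal (by have := Real.pi_pos; positivity)]
    congr 2; ring
  have : IsProbabilityMeasure (μ.map W.tbu) := Measure.isProbabilityMeasure_map hTm.aemeasurable
  set M := (volume.restrict (Set.Ioi 0)).withDensity (fun t => ENNReal.ofReal (P.fTbu t)) with hM
  have hMm : ∀ A : Set ℝ, MeasurableSet A →
      M A = ∫⁻ t in A ∩ Set.Ioi 0, ENNReal.ofReal (P.fTbu t) := fun A hA => by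
    rw [hM, withDensity_apply _ hA, Measure.restrict_restrict hA]
  have hMuniv : M Set.univ = 1 := by
    rw [hMm _ MeasurableSet.univ, Set.univ_inter, hIoi 0 le_rfl]; simp
  have : IsProbabilityMeasure M := ⟨hMuniv⟩
  refine Measure.ext_of_Iic _ _ fun a => ?_
  rw [← Set.compl_Ioi, measure_compl measurableSet_Ioi (measure_ne_top _ _),
    measure_compl measurableSet_Ioi (measure_ne_top _ _), measure_univ, measure_univ]
  congr 1
  rcases le_or_gt 0 a with ha | ha
  · rw [hmu a ha, hMm _ measurableSet_Ioi, Set.inter_eq_self_of_subset_left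
      (Set.Ioi_subset_Ioi ha), hIoi a ha]
  · have h1 : (1 : ℝ≥0∞) ≤ μ.map W.tbu (Set.Ioi a) := by
      refine le_trans ?_ (measure_mono (Set.Ioi_subset_Ioi ha.le))
      rw [hmu 0 le_rfl]; simp
    have h2 : M (Set.Ioi a) = 1 := by
      rw [hMm _ measurableSet_Ioi, Set.inter_eq_self_of_subset_right (Set.Ioi_subset_Ioi ha.le),
        hIoi 0 le_rfl]; simp
    rw [h2, le_antisymm prob_le_one h1]

end RISNet

namespace RISNet

open Filter Topology

/-! ### The Nakagami power fading -/

/-- Tail of the Erlang distribution with shape `m` and rate `1`. -/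
noncomputable def erlangTail (m : ℕ) (y : ℝ) : ℝ :=
  ∑ k ∈ Finset.range m, y ^ k / (k.factorial : ℝ) * Real.exp (-y)

/-- The derivatives of consecutive terms telescope, and only the contribution of the top term
survives. -/
lemma hasDerivAt_erlangTail (m : ℕ) (y : ℝ) :
    HasDerivAt (erlangTail (m + 1)) (-(y ^ m / (m.factorial : ℝ) * Real.exp (-y))) y := by
  have hexp : HasDerivAt (fun y : ℝ => Real.exp (-y)) (-Real.exp (-y)) y := by
    simpa using (hasDerivAt_neg y).exp
  induction m with
  | zero =>
    have : erlangTail (0 + 1) = fun y => Real.exp (-y) := by ext y; simp [erlangTail]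
    rw [this]
    simpa using hexp
  | succ m ih =>
    have h1 : erlangTail (m + 1 + 1) = fun y => erlangTail (m + 1) y
        + y ^ (m + 1) / ((m + 1).factorial : ℝ) * Real.exp (-y) := by
      ext y; rw [erlangTail, Finset.sum_range_succ]; rfl
    rw [h1]
    have h2 := ih.add (((hasDerivAt_pow (m + 1) y).div_const ((m + 1).factorial : ℝ)).mul hexp)
    refine h2.congr_deriv ?_
    have h3 : ((m + 1).factorial : ℝ) = (m + 1) * m.factorial := by
      rw [Nat.factorial_succ]; push_cast; ring
    have h4 : (m.factorial : ℝ) ≠ 0 := by positivity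
    have h5 : ((m : ℝ) + 1) ≠ 0 := by positivity
    rw [h3]
    push_cast
    field_simp
    ring

lemma erlangTail_nonneg (m : ℕ) {y : ℝ} (hy : 0 ≤ y) : 0 ≤ erlangTail m y :=
  Finset.sum_nonneg fun k _ => by positivity

lemma erlangTail_zero {m : ℕ} (hm : 0 < m) : erlangTail m 0 = 1 := by
  obtain ⟨m, rfl⟩ := Nat.exists_eq_add_one_of_ne_zero hm.ne'
  rw [erlangTail, Finset.sum_range_succ']
  simp

lemma erlangTail_tendsto (m : ℕ) : Tendsto (erlangTail m) atTop (𝓝 0) := by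
  have : Tendsto (fun y : ℝ => ∑ k ∈ Finset.range m, y ^ k / (k.factorial : ℝ) * Real.exp (-y))
      atTop (𝓝 (∑ k ∈ Finset.range m, (0 : ℝ))) := by
    refine tendsto_finsetSum _ fun k _ => ?_
    have := (Real.tendsto_pow_mul_exp_neg_atTop_nhds_zero k).const_mul ((k.factorial : ℝ)⁻¹)
    rw [mul_zero] at this
    refine this.congr fun y => ?_
    ring
  rw [Finset.sum_const_zero] at this
  exact this

@[fun_prop]
lemma continuous_erlangTail (m : ℕ) : Continuous (erlangTail m) := by
  unfold erlangTail
  fun_prop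

lemma erlangTail_le_one (m : ℕ) {y : ℝ} (hy : 0 ≤ y) : erlangTail m y ≤ 1 := by
  have h := Real.sum_le_exp_of_nonneg hy m
  rw [erlangTail, ← Finset.sum_mul]
  calc _ ≤ Real.exp y * Real.exp (-y) := by gcongr
    _ = 1 := by rw [← Real.exp_add]; simp

lemma lintegral_nakagami (m : ℕ) (F : ℝ → ℝ≥0∞) :
    ∫⁻ h, F h ∂(nakagami m) = ∫⁻ h, gammaPDF m m h * F h := by
  rw [nakagami, gammaMeasure, lintegral_withDensity_eq_lintegral_mul_non_measurable _
    (f := gammaPDF m m) (measurable_gammaPDFReal m m).ennreal_ofReal]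
  · rfl
  · exact Eventually.of_forall fun x => ENNReal.ofReal_lt_top

lemma nakagami_Iio (m : ℕ) : nakagami m (Set.Iio 0) = 0 := by
  rw [nakagami, gammaMeasure, withDensity_apply _ measurableSet_Iio]
  exact lintegral_gammaPDF_of_nonpos le_rfl

/-- Exponential tilting turns the Gamma density of rate `m` into a constant multiple of the Gamma
density of rate `m + x`, and the constant is the transform. -/
lemma nakagami_laplace {m : ℕ} (hm : 0 < m) {x : ℝ} (hx : 0 ≤ x) :
    ∫⁻ h, ENNReal.ofReal (Real.exp (-(x * h))) ∂(nakagami m)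
      = ENNReal.ofReal (((1 + x / m) ^ m)⁻¹) := by
  have hm' : (0 : ℝ) < m := by exact_mod_cast hm
  have hc : (0 : ℝ) ≤ ((1 + x / m) ^ m)⁻¹ := by positivity
  rw [lintegral_nakagami]
  have : ∀ h : ℝ, gammaPDF m m h * ENNReal.ofReal (Real.exp (-(x * h)))
      = ENNReal.ofReal (((1 + x / m) ^ m)⁻¹) * gammaPDF m (m + x) h := by
    intro h
    rw [gammaPDF_eq, gammaPDF_eq]
    split_ifs with hh
    · rw [← ENNReal.ofReal_mul (by have := Real.Gamma_pos_of_pos hm'; positivity),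
        ← ENNReal.ofReal_mul hc]
      congr 1
      have e1 : (1 + x / m) = (m + x) / m := by field_simp
      have e2 : Real.exp (-((m + x) * h)) = Real.exp (-(m * h)) * Real.exp (-(x * h)) := by
        rw [← Real.exp_add]; congr 1; ring
      rw [e1, e2, Real.rpow_natCast, Real.rpow_natCast, div_pow]
      have : (m + x : ℝ) ^ m ≠ 0 := by positivity
      have := (Real.Gamma_pos_of_pos hm').ne'
      field_simp
    · simp
  have hmeas : Measurable (gammaPDF m (m + x)) := (measurable_gammaPDFReal _ _).ennreal_ofReal
  rw [lintegral_congr this, lintegral_const_mul _ hmeas,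
    lintegral_gammaPDF_eq_one hm' (by positivity), mul_one]

/-- For integer shape the Gamma density is minus the derivative of the rescaled Erlang tail, which
vanishes at infinity. -/
lemma nakagami_Ioi {m : ℕ} (hm : 0 < m) {x : ℝ} (hx : 0 ≤ x) :
    nakagami m (Set.Ioi x) = ENNReal.ofReal (erlangTail m (m * x)) := by
  have hm' : (0 : ℝ) < m := by exact_mod_cast hm
  obtain ⟨n, rfl⟩ := Nat.exists_eq_add_one_of_ne_zero hm.ne'
  set M : ℝ := ((n + 1 : ℕ) : ℝ) with hM
  have hder : ∀ h : ℝ, 0 ≤ h → HasDerivAt (fun h => -erlangTail (n + 1) (M * h))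
      (gammaPDFReal M M h) h := fun h hh => by
    have h1 := (hasDerivAt_erlangTail n (M * h)).comp h ((hasDerivAt_id h).const_mul M)
    refine h1.neg.congr_deriv ?_
    rw [gammaPDFReal, if_pos hh]
    have e : M - 1 = n := by simp [hM]
    have e2 : Real.Gamma M = n.factorial := by
      rw [← Real.Gamma_nat_eq_factorial, hM]; push_cast; rfl
    rw [e, e2, Real.rpow_natCast]
    conv_rhs => rw [hM, Real.rpow_natCast]
    rw [mul_pow, pow_succ]
    ring
  have hlim : Tendsto (fun h => -erlangTail (n + 1) (M * h)) atTop (𝓝 0) := by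
    rw [← neg_zero]
    exact ((erlangTail_tendsto _).comp (tendsto_id.const_mul_atTop hm')).neg
  have hnn : ∀ h, 0 ≤ gammaPDFReal M M h := gammaPDFReal_nonneg hm' hm'
  have hint : IntegrableOn (gammaPDFReal M M) (Set.Ioi x) := integrableOn_Ioi_deriv_of_nonneg'
    (fun y hy => hder y (hx.trans hy)) (fun y _ => hnn y) hlim
  rw [nakagami, gammaMeasure, withDensity_apply _ measurableSet_Ioi]
  change ∫⁻ a in Set.Ioi x, ENNReal.ofReal (gammaPDFReal M M a) = _
  rw [← ofReal_integral_eq_lintegral_ofReal hint (Eventually.of_forall hnn),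
    integral_Ioi_of_hasDerivAt_of_tendsto' (fun y hy => hder y (hx.trans hy)) hint hlim]
  simp [hM]

/-! ### Alzer's inequality -/

/-- If the derivative is nonnegative on an initial segment only, so is a function that vanishes
at `0`. -/
lemma nonneg_initial_of_deriv {f f' : ℝ → ℝ} (hf : ∀ x, HasDerivAt f (f' x) x) (h0 : f 0 = 0)
    (h' : ∀ x y, 0 < x → x < y → 0 ≤ f' y → 0 ≤ f' x) :
    ∀ x y, 0 < x → x < y → 0 ≤ f y → 0 ≤ f x := by
  intro x y hx hxy hy
  by_contra! hlt
  have hc : Continuous f := continuous_iff_continuousAt.2 fun x => (hf x).continuousAt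
  -- From `f 0 = 0`, `f x < 0` and `0 ≤ f y`, mean value points `u < x < v` satisfy `f' u < 0 ≤ f'
  -- v`, against the sign pattern of `f'`.
  obtain ⟨u, hu, hu'⟩ := exists_hasDerivAt_eq_slope f f' hx hc.continuousOn fun z _ => hf z
  obtain ⟨v, hv, hv'⟩ := exists_hasDerivAt_eq_slope f f' hxy hc.continuousOn fun z _ => hf z
  have hu0 : f' u < 0 := by
    rw [hu', h0, sub_zero, sub_zero]
    exact div_neg_of_neg_of_pos hlt hx
  have hv0 : 0 ≤ f' v := by
    rw [hv']
    exact div_nonneg (by linarith) (by linarith)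
  exact absurd (h' u v hu.1 (hu.2.trans hv.1) hv0) (not_le.2 hu0)

/-- If the derivative is nonnegative on an initial segment only, a function that vanishes at `0`
and at infinity is nonnegative. -/
lemma nonneg_of_deriv_initial {f f' : ℝ → ℝ} (hf : ∀ x, HasDerivAt f (f' x) x) (h0 : f 0 = 0)
    (hlim : Tendsto f atTop (𝓝 0))
    (h' : ∀ x y, 0 < x → x < y → 0 ≤ f' y → 0 ≤ f' x) {x : ℝ} (hx : 0 ≤ x) : 0 ≤ f x := by
  rcases hx.eq_or_lt with rfl | hx
  · exact h0.ge
  by_contra! hlt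
  have hc : Continuous f := continuous_iff_continuousAt.2 fun x => (hf x).continuousAt
  obtain ⟨u, hu, hu'⟩ := exists_hasDerivAt_eq_slope f f' hx hc.continuousOn fun z _ => hf z
  have hu0 : f' u < 0 := by
    rw [hu', h0, sub_zero, sub_zero]
    exact div_neg_of_neg_of_pos hlt hx
  -- Once negative at `u`, the derivative cannot be nonnegative later. So `f` decreases from `u` on,
  -- and its limit `0` lies below `f x`.
  have hanti : AntitoneOn f (Set.Ici u) := by
    refine antitoneOn_of_deriv_nonpos (convex_Ici u) hc.continuousOn
      (fun z _ => (hf z).differentiableAt.differentiableWithinAt) fun z hz => ?_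
    rw [interior_Ici] at hz
    rw [(hf z).deriv]
    by_contra! hz'
    exact absurd (h' u z hu.1 hz hz'.le) (not_le.2 hu0)
  have : (0 : ℝ) ≤ f x := by
    refine le_of_tendsto hlim ?_
    filter_upwards [eventually_ge_atTop x] with z hz
    exact hanti hu.2.le (hu.2.le.trans hz) hz
  linarith

/-- Multiplication by `exp (c x)` gives `x - exp (c x) + exp ((c - 1) x)`, which vanishes at `0`
together with its first derivative. The second derivative has the sign of `(c - 1) ^ 2 * exp (-x) -
c ^ 2`, which is antitone in `x`. Two applications of `nonneg_initial_of_deriv` carry the sign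
pattern back to the function. -/
lemma nonneg_initial_sub_exp (c : ℝ) : ∀ x y : ℝ, 0 < x → x < y →
    0 ≤ y * Real.exp (-c * y) - (1 - Real.exp (-y)) →
    0 ≤ x * Real.exp (-c * x) - (1 - Real.exp (-x)) := by
  have hE : ∀ a x : ℝ, HasDerivAt (fun x => Real.exp (a * x)) (a * Real.exp (a * x)) x := by
    intro a x
    have := ((hasDerivAt_id x).const_mul a).exp
    refine this.congr_deriv ?_
    simp [mul_comm]
  have h2 : ∀ x y : ℝ, 0 < x → x < y →
      0 ≤ -c * (c * Real.exp (c * y)) + (c - 1) * ((c - 1) * Real.exp ((c - 1) * y)) →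
      0 ≤ -c * (c * Real.exp (c * x)) + (c - 1) * ((c - 1) * Real.exp ((c - 1) * x)) := by
    have hfac : ∀ x : ℝ, -c * (c * Real.exp (c * x)) + (c - 1) * ((c - 1) * Real.exp ((c - 1) * x))
        = Real.exp (c * x) * ((c - 1) ^ 2 * Real.exp (-x) - c ^ 2) := fun x => by
      have : Real.exp ((c - 1) * x) = Real.exp (c * x) * Real.exp (-x) := by
        rw [← Real.exp_add]; congr 1; ring
      rw [this]; ring
    intro x y _ hxy hy
    rw [hfac] at hy ⊢
    have hy' := nonneg_of_mul_nonneg_right hy (Real.exp_pos _)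
    have : Real.exp (-y) ≤ Real.exp (-x) := Real.exp_le_exp.2 (by linarith)
    have := mul_le_mul_of_nonneg_left this (sq_nonneg (c - 1))
    exact mul_nonneg (Real.exp_pos _).le (by linarith)
  have h1 := nonneg_initial_of_deriv (f := fun x => 1 - c * Real.exp (c * x)
      + (c - 1) * Real.exp ((c - 1) * x)) (fun x => by
        refine (((hE c x).const_mul c).const_sub 1 |>.add
          ((hE (c - 1) x).const_mul (c - 1))).congr_deriv ?_
        rw [← neg_mul]) (by simp) h2
  have h0 := nonneg_initial_of_deriv (f := fun x => x - Real.exp (c * x)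
      + Real.exp ((c - 1) * x)) (fun x => ((hasDerivAt_id x).sub (hE c x)).add (hE (c - 1) x))
      (by simp) h1
  have hfac : ∀ x : ℝ, x * Real.exp (-c * x) - (1 - Real.exp (-x))
      = Real.exp (-c * x) * (x - Real.exp (c * x) + Real.exp ((c - 1) * x)) := fun x => by
    have e1 : Real.exp (-c * x) * Real.exp (c * x) = 1 := by rw [← Real.exp_add]; simp
    have e2 : Real.exp (-c * x) * Real.exp ((c - 1) * x) = Real.exp (-x) := by
      rw [← Real.exp_add]; congr 1; ring
    rw [mul_add, mul_sub, e1, e2]; ring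
  intro x y hx hxy hy
  rw [hfac] at hy ⊢
  exact mul_nonneg (Real.exp_pos _).le
    (h0 x y hx hxy (nonneg_of_mul_nonneg_right hy (Real.exp_pos _)))

/-- Alzer's inequality for integer shape. -/
theorem erlangTail_le {m : ℕ} (hm : 0 < m) {x : ℝ} (hx : 0 ≤ x) :
    erlangTail m x
      ≤ 1 - (1 - Real.exp (-((m.factorial : ℝ) ^ (-1 / (m : ℝ)) * x))) ^ m := by
  set b : ℝ := (m.factorial : ℝ) ^ (-1 / (m : ℝ)) with hb
  have hfac : (0 : ℝ) < m.factorial := by positivity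
  have hb0 : 0 < b := Real.rpow_pos_of_pos hfac _
  have hm' : (m : ℝ) ≠ 0 := by exact_mod_cast hm.ne'
  have hbm : b ^ m * m.factorial = 1 := by
    rw [hb, ← Real.rpow_natCast, ← Real.rpow_mul hfac.le, div_mul_cancel₀ _ hm', Real.rpow_neg_one,
      inv_mul_cancel₀ hfac.ne']
  obtain ⟨n, rfl⟩ := Nat.exists_eq_add_one_of_ne_zero hm.ne'
  -- Shape one is an equality with `b = 1`. It is separated because `c` below divides by `n`.
  rcases Nat.eq_zero_or_pos n with rfl | hn
  · have : b = 1 := by simpa using hbm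
    simp [erlangTail, this]
  have hder : ∀ x, HasDerivAt
      (fun x => 1 - erlangTail (n + 1) x - (1 - Real.exp (-(b * x))) ^ (n + 1))
      (x ^ n / n.factorial * Real.exp (-x)
        - (n + 1) * (1 - Real.exp (-(b * x))) ^ n * (b * Real.exp (-(b * x)))) x := by
    intro x
    have h1 : HasDerivAt (fun x => Real.exp (-(b * x))) (-(b * Real.exp (-(b * x)))) x := by
      refine ((hasDerivAt_id x).const_mul b).neg.exp.congr_deriv ?_
      simp [mul_comm]
    refine (((hasDerivAt_erlangTail n x).const_sub 1).sub
      ((h1.const_sub 1).pow (n + 1))).congr_deriv ?_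
    push_cast
    ring
  -- Chosen so that the `n`-th power of `b x exp (-c b x)` is `b ^ n x ^ n exp (-x) exp (b x)`. The
  -- sign of the derivative then becomes a comparison of two `n`-th powers, and their bases are
  -- compared by `nonneg_initial_sub_exp` at the point `b x`.
  set c : ℝ := (1 - b) / (b * n) with hc
  have hn0 : (n : ℝ) ≠ 0 := by exact_mod_cast hn.ne'
  have hsign : ∀ x : ℝ, 0 < x → (0 ≤ x ^ n / n.factorial * Real.exp (-x)
        - (n + 1) * (1 - Real.exp (-(b * x))) ^ n * (b * Real.exp (-(b * x))) ↔
      0 ≤ b * x * Real.exp (-c * (b * x)) - (1 - Real.exp (-(b * x)))) := by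
    intro x hx
    have h1 : (0 : ℝ) ≤ 1 - Real.exp (-(b * x)) := by
      have : Real.exp (-(b * x)) ≤ 1 := Real.exp_le_one_iff.2 (by have := mul_pos hb0 hx; linarith)
      linarith
    have h2 : 0 ≤ b * x * Real.exp (-c * (b * x)) := by positivity
    have e1 : (b * x * Real.exp (-c * (b * x))) ^ n
        = b ^ n * x ^ n * (Real.exp (-x) * Real.exp (b * x)) := by
      rw [mul_pow, mul_pow, ← Real.exp_nat_mul, ← Real.exp_add]
      congr 2
      rw [hc]; field_simp; ring
    -- The only place that needs the exact value of `b`: the two terms of the derivative get the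
    -- same constant factor.
    have e2 : 1 / (n.factorial : ℝ) = (n + 1) * b ^ (n + 1) := by
      rw [Nat.factorial_succ] at hbm
      push_cast at hbm
      field_simp
      linarith
    have e3 : Real.exp (b * x) * Real.exp (-(b * x)) = 1 := by rw [← Real.exp_add]; simp
    have e4 : x ^ n / n.factorial * Real.exp (-x)
        - (n + 1) * (1 - Real.exp (-(b * x))) ^ n * (b * Real.exp (-(b * x)))
        = ((n + 1) * (b * Real.exp (-(b * x)))) *
          ((b * x * Real.exp (-c * (b * x))) ^ n - (1 - Real.exp (-(b * x))) ^ n) := by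
      rw [e1, div_eq_mul_one_div, e2, pow_succ]
      linear_combination (-(x ^ n * (n + 1) * b ^ n * b * Real.exp (-x))) * e3
    have hpos : (0 : ℝ) < (n + 1) * (b * Real.exp (-(b * x))) := by positivity
    rw [e4, mul_nonneg_iff_of_pos_left hpos, sub_nonneg, sub_nonneg,
      pow_le_pow_iff_left₀ h1 h2 hn.ne']
  have hlim : Tendsto (fun x => 1 - erlangTail (n + 1) x - (1 - Real.exp (-(b * x))) ^ (n + 1))
      atTop (𝓝 0) := by
    have h1 : Tendsto (fun x => Real.exp (-(b * x))) atTop (𝓝 0) :=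
      Real.tendsto_exp_neg_atTop_nhds_zero.comp (tendsto_id.const_mul_atTop hb0)
    have h2 := ((erlangTail_tendsto (n + 1)).const_sub 1).sub ((h1.const_sub 1).pow (n + 1))
    simpa using h2
  have := nonneg_of_deriv_initial hder (by simp [erlangTail_zero]) hlim (fun u v hu huv hv => by
    rw [hsign u hu]
    rw [hsign v (hu.trans huv)] at hv
    exact nonneg_initial_sub_exp c (b * u) (b * v) (by positivity) (by gcongr) hv) hx
  linarith

lemma one_sub_one_sub_pow (m : ℕ) (e : ℝ) :
    1 - (1 - e) ^ m
      = ∑ k ∈ Finset.Icc 1 m, (m.choose k : ℝ) * (-1) ^ (k + 1) * e ^ k := by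
  have h1 : (1 - e) ^ m = ∑ k ∈ Finset.range (m + 1), (m.choose k : ℝ) * (-1) ^ k * e ^ k := by
    rw [sub_eq_neg_add, add_pow]
    refine Finset.sum_congr rfl fun k _ => ?_
    rw [neg_pow]; ring
  have h2 : Finset.range (m + 1) = insert 0 (Finset.Icc 1 m) := by
    ext k; simp; omega
  rw [h1, h2, Finset.sum_insert (by simp)]
  simp only [Nat.choose_zero_right, Nat.cast_one, pow_zero, mul_one, sub_add_cancel_left,
    ← Finset.sum_neg_distrib]
  refine Finset.sum_congr rfl fun k _ => ?_
  ring

end RISNet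

namespace RISNet

open Filter Topology

/-! ### The law of the spatial deviation -/

lemma lintegral_unif {a b : ℝ} (hab : a < b) (F : ℝ → ℝ≥0∞) :
    ∫⁻ x, F x ∂(unif a b) = ENNReal.ofReal (b - a)⁻¹ * ∫⁻ x in Set.Icc a b, F x := by
  rw [unif, ProbabilityTheory.cond, lintegral_smul_measure, Real.volume_Icc,
    ENNReal.ofReal_inv_of_pos (by linarith), smul_eq_mul]

lemma unif_prob {a b : ℝ} (hab : a < b) : IsProbabilityMeasure (unif a b) := by
  refine cond_isProbabilityMeasure_of_finite ?_ ?_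
  · rw [Real.volume_Icc]; simpa using hab
  · rw [Real.volume_Icc]; exact ENNReal.ofReal_ne_top

namespace Params

lemma fPhi_eq_zero {x : ℝ} (hx : x ∉ Set.Ioo (-(1 / 2) : ℝ) (1 / 2)) : fPhi x = 0 := by
  rw [fPhi]
  split_ifs with h
  · rw [abs_le] at h
    have : x = -(1 / 2) ∨ x = 1 / 2 := by
      by_contra! hne
      exact hx ⟨lt_of_le_of_ne h.1 hne.1.symm, lt_of_le_of_ne h.2 hne.2⟩
    rcases this with rfl | rfl <;> norm_num
  · rfl

lemma fPhi_nonneg (x : ℝ) : 0 ≤ fPhi x := by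
  rw [fPhi]; split_ifs
  · have := Real.pi_pos; positivity
  · exact le_rfl

lemma fPhi_neg (x : ℝ) : fPhi (-x) = fPhi x := by simp [fPhi]

@[fun_prop]
lemma measurable_fPhi : Measurable fPhi := by
  unfold fPhi
  refine Measurable.ite (measurableSet_le (by fun_prop) measurable_const) (by fun_prop)
    measurable_const

end Params

open Params

/-- Substitution `x = cos φ / 2`, injective on `(0, π)`: the Jacobian `sin φ / 2` times `fPhi` is
the constant `1 / π`. -/
lemma lintegral_Ioo_cos (F : ℝ → ℝ≥0∞) :
    ∫⁻ x, ENNReal.ofReal (fPhi x) * F x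
      = ENNReal.ofReal Real.pi⁻¹ * ∫⁻ φ in Set.Ioo 0 Real.pi, F (1 / 2 * Real.cos φ) := by
  have himg : (fun φ => 1 / 2 * Real.cos φ) '' Set.Ioo 0 Real.pi
      = Set.Ioo (-(1 / 2) : ℝ) (1 / 2) := by
    ext x
    constructor
    · rintro ⟨φ, hφ, rfl⟩
      have h1 : Real.cos φ < Real.cos 0 :=
        Real.cos_lt_cos_of_nonneg_of_le_pi le_rfl hφ.2.le hφ.1
      have h2 : Real.cos Real.pi < Real.cos φ :=
        Real.cos_lt_cos_of_nonneg_of_le_pi hφ.1.le le_rfl hφ.2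
      rw [Real.cos_zero] at h1
      rw [Real.cos_pi] at h2
      exact ⟨by simp only; linarith, by simp only; linarith⟩
    · rintro ⟨h1, h2⟩
      refine ⟨Real.arccos (2 * x), ⟨Real.arccos_pos.2 (by linarith), ?_⟩, ?_⟩
      · exact lt_of_le_of_ne (Real.arccos_le_pi _) fun h => by
          rw [Real.arccos_eq_pi] at h; linarith
      · simp only
        rw [Real.cos_arccos (by linarith) (by linarith)]; ring
  have hinj : Set.InjOn (fun φ => 1 / 2 * Real.cos φ) (Set.Ioo 0 Real.pi) := fun u hu v hv h => by
    refine Real.injOn_cos (Set.Ioo_subset_Icc_self hu) (Set.Ioo_subset_Icc_self hv) ?_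
    simp only at h
    linarith
  have hcv := lintegral_image_eq_lintegral_abs_deriv_mul (s := Set.Ioo 0 Real.pi)
    (f := fun φ => 1 / 2 * Real.cos φ) (f' := fun φ => 1 / 2 * -Real.sin φ) measurableSet_Ioo
    (fun φ _ => ((Real.hasDerivAt_cos φ).const_mul _).hasDerivWithinAt) hinj
    (fun x => ENNReal.ofReal (fPhi x) * F x)
  rw [himg] at hcv
  have h1 : ∫⁻ x, ENNReal.ofReal (fPhi x) * F x
      = ∫⁻ x in Set.Ioo (-(1 / 2) : ℝ) (1 / 2), ENNReal.ofReal (fPhi x) * F x := by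
    refine (setLIntegral_eq_of_support_subset ?_).symm
    intro x hx
    by_contra hx'
    exact hx (by simp [fPhi_eq_zero hx'])
  rw [h1, hcv, ← lintegral_const_mul' _ _ ENNReal.ofReal_ne_top]
  refine setLIntegral_congr_fun measurableSet_Ioo fun φ hφ => ?_
  have hs := Real.sin_pos_of_pos_of_lt_pi hφ.1 hφ.2
  rw [← mul_assoc, ← ENNReal.ofReal_mul (abs_nonneg _)]
  congr 2
  have hc := Real.abs_cos_le_one φ
  rw [fPhi, if_pos]
  · have : 1 - 4 * (1 / 2 * Real.cos φ) ^ 2 = Real.sin φ ^ 2 := by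
      rw [Real.sin_sq]; ring
    rw [this, Real.sqrt_sq hs.le, abs_mul, abs_neg, abs_of_pos hs, abs_of_pos (by norm_num)]
    have := Real.pi_pos
    field_simp
  · rw [abs_mul, abs_of_pos (by norm_num : (0 : ℝ) < 1 / 2)]; linarith

/-- The reflection `φ ↦ 2 π - φ` preserves the cosine and folds the second half of the circle onto
the first. -/
lemma lintegral_unif_cos (F : ℝ → ℝ≥0∞) :
    ∫⁻ φ, F (1 / 2 * Real.cos φ) ∂(unif 0 (2 * Real.pi))
      = ∫⁻ x, ENNReal.ofReal (fPhi x) * F x := by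
  have hpi := Real.pi_pos
  rw [lintegral_Ioo_cos, lintegral_unif (by positivity), sub_zero]
  have hsplit : Set.Icc 0 (2 * Real.pi) =ᵐ[volume]
      (Set.Ioc 0 Real.pi ∪ Set.Ioc Real.pi (2 * Real.pi) : Set ℝ) := by
    rw [Set.Ioc_union_Ioc_eq_Ioc hpi.le (by linarith)]
    exact Ioc_ae_eq_Icc.symm
  rw [setLIntegral_congr hsplit, lintegral_union measurableSet_Ioc
    (Set.disjoint_left.2 fun x h1 h2 => absurd h1.2 (not_le.2 h2.1)),
    setLIntegral_congr (Ioo_ae_eq_Ioc (a := 0) (b := Real.pi)).symm,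
    setLIntegral_congr (Ioo_ae_eq_Ioc (a := Real.pi) (b := 2 * Real.pi)).symm]
  have hrefl : ∫⁻ φ in Set.Ioo Real.pi (2 * Real.pi), F (1 / 2 * Real.cos φ)
      = ∫⁻ φ in Set.Ioo 0 Real.pi, F (1 / 2 * Real.cos φ) := by
    have hmp := (Measure.measurePreserving_sub_left (volume : Measure ℝ) (2 * Real.pi))
    have := hmp.setLIntegral_comp_preimage_emb
      (MeasurableEquiv.subLeft (2 * Real.pi)).measurableEmbedding
      (fun φ => F (1 / 2 * Real.cos φ)) (Set.Ioo 0 Real.pi)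
    rw [← this]
    have hpre : (fun x => 2 * Real.pi - x) ⁻¹' Set.Ioo 0 Real.pi
        = Set.Ioo Real.pi (2 * Real.pi) := by
      rw [Set.preimage_const_sub_Ioo]
      congr 1 <;> ring
    rw [hpre]
    simp only [Real.cos_two_pi_sub]
  rw [hrefl, ← two_mul, ← mul_assoc]
  congr 1
  rw [← ENNReal.ofReal_ofNat, ← ENNReal.ofReal_mul (by positivity)]
  congr 1
  field_simp

/-- Spatial deviation as a function of the two physical angles. -/
noncomputable def deviation (p : ℝ × ℝ) : ℝ := 1 / 2 * Real.cos p.1 - 1 / 2 * Real.cos p.2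

/-- Law of the spatial deviation. -/
noncomputable def deviationLaw : Measure ℝ :=
  ((unif 0 (2 * Real.pi)).prod (unif 0 (2 * Real.pi))).map deviation

@[fun_prop]
lemma measurable_deviation : Measurable deviation := by unfold deviation; fun_prop

instance : IsProbabilityMeasure (unif 0 (2 * Real.pi)) := unif_prob (by have := Real.pi_pos; linarith)

instance : IsProbabilityMeasure deviationLaw :=
  Measure.isProbabilityMeasure_map measurable_deviation.aemeasurable

/-- The density of the deviation, as a lower integral. -/
noncomputable def lDelta (y : ℝ) : ℝ≥0∞ :=
  ∫⁻ x, ENNReal.ofReal (fPhi x) * ENNReal.ofReal (fPhi (y + x))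

lemma measurable_lDelta : Measurable lDelta := by
  unfold lDelta
  exact Measurable.lintegral_prod_right' (f := fun p : ℝ × ℝ =>
    ENNReal.ofReal (fPhi p.2) * ENNReal.ofReal (fPhi (p.1 + p.2))) (by fun_prop)

/-- The law of a difference of two independent variables has the correlation of their densities as
its density: translate the inner integral, then exchange the order of integration. -/
lemma lintegral_deviationLaw {F : ℝ → ℝ≥0∞} (hF : Measurable F) :
    ∫⁻ y, F y ∂deviationLaw = ∫⁻ y, lDelta y * F y := by
  rw [deviationLaw, lintegral_map hF measurable_deviation, lintegral_prod_symm _ (by fun_prop)]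
  simp only [deviation]
  have h1 : ∀ ψ, ∫⁻ φ, F (1 / 2 * Real.cos φ - 1 / 2 * Real.cos ψ) ∂(unif 0 (2 * Real.pi))
      = ∫⁻ x, ENNReal.ofReal (fPhi x) * F (x - 1 / 2 * Real.cos ψ) := fun ψ =>
    lintegral_unif_cos fun x => F (x - 1 / 2 * Real.cos ψ)
  simp_rw [h1]
  rw [lintegral_unif_cos fun z => ∫⁻ x, ENNReal.ofReal (fPhi x) * F (x - z)]
  have h2 : ∀ z, ∫⁻ x, ENNReal.ofReal (fPhi x) * F (x - z)
      = ∫⁻ y, ENNReal.ofReal (fPhi (y + z)) * F y := fun z => by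
    rw [← lintegral_add_right_eq_self (fun x => ENNReal.ofReal (fPhi x) * F (x - z)) z]
    simp
  simp_rw [h2, ← lintegral_const_mul' _ _ ENNReal.ofReal_ne_top]
  rw [lintegral_lintegral_swap (by fun_prop)]
  refine lintegral_congr fun y => ?_
  rw [lDelta, ← lintegral_mul_const _ (by fun_prop)]
  exact lintegral_congr fun z => by rw [mul_assoc]

lemma lintegral_lDelta : ∫⁻ y, lDelta y = 1 := by
  have := lintegral_deviationLaw (F := fun _ => 1) measurable_const
  simpa using this.symm

/-- No integrability is needed. Where the correlation diverges, as it does at `y = 0`, the Bochner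
integral and `toReal` both default to `0`. -/
lemma fDelta_eq_toReal (y : ℝ) : fDelta y = (lDelta y).toReal := by
  rw [fDelta]
  split_ifs with h
  · rw [intervalIntegral.integral_of_le (by norm_num), integral_Ioc_eq_integral_Ioo,
      integral_eq_lintegral_of_nonneg_ae
        (Eventually.of_forall fun x => mul_nonneg (fPhi_nonneg _) (fPhi_nonneg _))
        (by fun_prop), lDelta]
    congr 1
    rw [setLIntegral_eq_of_support_subset]
    · exact lintegral_congr fun x => ENNReal.ofReal_mul (fPhi_nonneg _)
    · intro x hx
      by_contra hx'
      exact hx (by simp [fPhi_eq_zero hx'])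
  · have : lDelta y = 0 := by
      rw [lDelta, ← lintegral_zero (μ := (volume : Measure ℝ))]
      refine lintegral_congr fun x => ?_
      by_cases hx : x ∈ Set.Ioo (-(1 / 2) : ℝ) (1 / 2)
      · rw [fPhi_eq_zero (x := y + x), ENNReal.ofReal_zero, mul_zero]
        intro hxy
        apply h
        rw [abs_le]
        constructor <;> linarith [hx.1, hx.2, hxy.1, hxy.2]
      · simp [fPhi_eq_zero hx]
    simp [this]

/-- The total mass of `lDelta` is one, so it is finite almost everywhere and the default values do
not matter. -/
lemma ae_ofReal_fDelta : ∀ᵐ y : ℝ, ENNReal.ofReal (fDelta y) = lDelta y := by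
  filter_upwards [ae_lt_top measurable_lDelta (by rw [lintegral_lDelta]; simp)] with y hy
  rw [fDelta_eq_toReal, ENNReal.ofReal_toReal hy.ne]

lemma fDelta_nonneg (y : ℝ) : 0 ≤ fDelta y := by
  rw [fDelta_eq_toReal]; exact ENNReal.toReal_nonneg

lemma lDelta_neg (y : ℝ) : lDelta (-y) = lDelta y := by
  rw [lDelta, ← lintegral_neg_eq_self (μ := (volume : Measure ℝ)), lDelta]
  refine lintegral_congr fun x => ?_
  rw [fPhi_neg, ← neg_add, fPhi_neg]

lemma integrable_fDelta : Integrable fDelta := by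
  have : fDelta = fun y => (lDelta y).toReal := funext fDelta_eq_toReal
  rw [this]
  exact integrable_toReal_of_lintegral_ne_top measurable_lDelta.aemeasurable
    (by rw [lintegral_lDelta]; simp)

lemma lintegral_lDelta_Ioo {a b : ℝ} (hab : a ≤ b) :
    ∫⁻ y in Set.Ioo a b, lDelta y = ENNReal.ofReal (∫ y in a..b, fDelta y) := by
  rw [intervalIntegral.integral_of_le hab, integral_Ioc_eq_integral_Ioo,
    ofReal_integral_eq_lintegral_ofReal integrable_fDelta.integrableOn
      (Eventually.of_forall fDelta_nonneg)]
  exact lintegral_congr_ae (ae_restrict_of_ae (ae_ofReal_fDelta.mono fun y hy => hy.symm))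

/-- The density is even, so the two signs of `y` contribute equally. This is the origin of the
factor `2` in `pLobe`. -/
lemma lintegral_lDelta_abs {a b : ℝ} (ha : 0 ≤ a) (hab : a ≤ b) :
    ∫⁻ y, lDelta y * (Set.Ioo a b).indicator (fun _ => 1) |y|
      = ENNReal.ofReal (2 * ∫ y in a..b, fDelta y) := by
  have h1 : ∀ y : ℝ, lDelta y * (Set.Ioo a b).indicator (fun _ => 1) |y|
      = (Set.Ioo a b).indicator lDelta y + (Set.Ioo (-b) (-a)).indicator lDelta y := fun y => by
    rcases le_or_gt 0 y with hy | hy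
    · have : y ∉ Set.Ioo (-b) (-a) := fun h => by linarith [h.2]
      rw [abs_of_nonneg hy, Set.indicator_of_notMem this, add_zero]
      by_cases h : y ∈ Set.Ioo a b <;> simp [h]
    · have : y ∉ Set.Ioo a b := fun h => by linarith [h.1]
      rw [abs_of_neg hy, Set.indicator_of_notMem this, zero_add]
      have hiff : -y ∈ Set.Ioo a b ↔ y ∈ Set.Ioo (-b) (-a) :=
        ⟨fun h => ⟨by linarith [h.2], by linarith [h.1]⟩,
          fun h => ⟨by linarith [h.2], by linarith [h.1]⟩⟩
      by_cases h : y ∈ Set.Ioo (-b) (-a)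
      · rw [Set.indicator_of_mem (hiff.2 h), Set.indicator_of_mem h, mul_one]
      · rw [Set.indicator_of_notMem (mt hiff.1 h), Set.indicator_of_notMem h, mul_zero]
  rw [lintegral_congr h1, lintegral_add_left (measurable_lDelta.indicator measurableSet_Ioo),
    lintegral_indicator measurableSet_Ioo, lintegral_indicator measurableSet_Ioo]
  have h2 : ∫⁻ y in Set.Ioo (-b) (-a), lDelta y = ∫⁻ y in Set.Ioo a b, lDelta y := by
    have := (Measure.measurePreserving_neg (volume : Measure ℝ)).setLIntegral_comp_preimage_emb
      (MeasurableEquiv.neg ℝ).measurableEmbedding lDelta (Set.Ioo a b)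
    rw [← this]
    have hpre : (Neg.neg : ℝ → ℝ) ⁻¹' Set.Ioo a b = Set.Ioo (-b) (-a) := by
      ext y; simp only [Set.mem_preimage, Set.mem_Ioo]
      constructor <;> rintro ⟨h1, h2⟩ <;> constructor <;> linarith
    rw [hpre]
    simp only [lDelta_neg]
  rw [h2, lintegral_lDelta_Ioo hab, ENNReal.ofReal_mul (by norm_num), ENNReal.ofReal_ofNat, two_mul]

/-! ### Gain levels -/

namespace Params

variable (P : Params)

lemma Nb_pos : (0 : ℝ) < P.Nb := by
  have := P.two_le_Nb
  have : 0 < P.Nb := by omega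
  exact_mod_cast this

lemma half_pos : 0 < P.Nb / 2 := Nat.div_pos P.two_le_Nb (by norm_num)

lemma succ_div_le_half {n : ℕ} (hn : n < P.Nb / 2) : ((n : ℝ) + 1) / P.Nb ≤ 1 / 2 := by
  have h : 2 * (n + 1) ≤ P.Nb := by omega
  rw [div_le_div_iff₀ P.Nb_pos (by norm_num)]
  have : (2 * (n + 1) : ℝ) ≤ P.Nb := by exact_mod_cast h
  linarith

/-- The half-open cell of the normalized deviations of gain level `n`. -/
def InCell (n : ℕ) (x : ℝ) : Prop :=
  if n = 0 then |x| ≤ 1 / P.Nb else (n : ℝ) / P.Nb < |x| ∧ |x| ≤ ((n : ℝ) + 1) / P.Nb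

lemma InCell.le {P : Params} {n : ℕ} {x : ℝ} (h : P.InCell n x) :
    |x| ≤ ((n : ℝ) + 1) / P.Nb := by
  rw [InCell] at h
  split_ifs at h with hn
  · simpa [hn] using h
  · exact h.2

lemma InCell.lt {P : Params} {n : ℕ} {x : ℝ} (h : P.InCell n x) (hn : n ≠ 0) :
    (n : ℝ) / P.Nb < |x| := by
  rw [InCell, if_neg hn] at h
  exact h.1

lemma InCell.unique {P : Params} {n k : ℕ} {x : ℝ} (hn : P.InCell n x) (hk : P.InCell k x) :
    n = k := by
  have key : ∀ {n k : ℕ}, P.InCell n x → P.InCell k x → ¬ n < k := fun {n k} hn hk hlt => by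
    have h1 := hk.lt (by omega)
    have h2 := hn.le
    have h3 : ((n : ℝ) + 1) / P.Nb ≤ k / P.Nb := by
      have := P.Nb_pos
      have : (n : ℝ) + 1 ≤ k := by exact_mod_cast hlt
      gcongr
    linarith
  have := key hn hk
  have := key hk hn
  omega

lemma gainMain_of_inCell {n : ℕ} (hn : n < P.Nb / 2) {x : ℝ} (h : P.InCell n x) :
    P.gainMain x = P.gain n := by
  rw [gainMain]
  by_cases h0 : n = 0
  · subst h0
    rw [if_pos (by simpa [InCell] using h)]
  · rw [if_neg, Finset.sum_eq_single n]
    · rw [if_pos (by simpa [InCell, h0] using h)]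
    · intro k hk hkn
      rw [if_neg]
      intro hk'
      have hk0 : k ≠ 0 := by have := (Finset.mem_Ico.1 hk).1; omega
      exact hkn (InCell.unique (P := P) (x := x) (by simpa [InCell, hk0] using hk') h)
    · intro hmem
      exact absurd (Finset.mem_Ico.2 ⟨by omega, hn⟩) hmem
    · intro h'
      exact h0 (h.unique (k := 0) (by simpa [InCell] using h'))

lemma gainMain_of_not_inCell {x : ℝ} (h : ∀ n < P.Nb / 2, ¬ P.InCell n x) :
    P.gainMain x = P.gain (P.Nb / 2) := by
  have h0 := h 0 P.half_pos
  rw [gainMain, if_neg (by simpa [InCell] using h0), Finset.sum_eq_zero, gain,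
    if_neg P.half_pos.ne', if_neg (lt_irrefl _)]
  intro k hk
  obtain ⟨hk1, hk2⟩ := Finset.mem_Ico.1 hk
  have := h k hk2
  rw [InCell, if_neg (by omega)] at this
  rw [if_neg this]

/-- Folding of the deviation. -/
noncomputable def fold (y : ℝ) : ℝ := if y < -(1 / 2) then |y + 1| else if 1 / 2 < y then |y - 1| else y

lemma gainB_eq (y : ℝ) : P.gainB y = P.gainMain (fold y) := by
  rw [gainB, fold]; split_ifs <;> rfl

lemma exists_gainB_eq (y : ℝ) : ∃ n ≤ P.Nb / 2, P.gainB y = P.gain n := by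
  rw [gainB_eq]
  by_cases h : ∃ n < P.Nb / 2, P.InCell n (fold y)
  · obtain ⟨n, hn, hc⟩ := h
    exact ⟨n, hn.le, P.gainMain_of_inCell hn hc⟩
  · push Not at h
    exact ⟨_, le_rfl, P.gainMain_of_not_inCell h⟩

/-- Jordan's inequality `2 x / π ≤ sin x` on `[0, π / 2]`; the condition on `n` keeps the angle in
that range. -/
lemma sin_angle_pos {n : ℕ} (hn : n < P.Nb / 2) :
    (2 * n + 1) / P.Nb ≤ Real.sin (Real.pi * ((2 * n + 1) / (2 * P.Nb))) := by
  have hN := P.Nb_pos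
  have hpi := Real.pi_pos
  have h1 : Real.pi * ((2 * n + 1) / (2 * P.Nb)) ≤ Real.pi / 2 := by
    have h : 2 * n + 1 ≤ P.Nb := by omega
    have : (2 * n + 1 : ℝ) ≤ P.Nb := by exact_mod_cast h
    rw [div_eq_mul_one_div Real.pi 2]
    refine mul_le_mul_of_nonneg_left ?_ hpi.le
    rw [div_le_div_iff₀ (by positivity) (by norm_num)]
    linarith
  have := Real.mul_le_sin (x := Real.pi * ((2 * n + 1) / (2 * P.Nb))) (by positivity) h1
  refine le_trans (le_of_eq ?_) this
  field_simp

lemma gain_eq {n : ℕ} (h0 : n ≠ 0) (hn : n < P.Nb / 2) :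
    P.gain n = P.delta / 2
      * (1 / (P.Nb * Real.sin (Real.pi * ((2 * n + 1) / (2 * P.Nb))) ^ 2)) := by
  have hN := P.Nb_pos
  have hs : 0 < Real.sin (Real.pi * ((2 * n + 1) / (2 * P.Nb))) :=
    lt_of_lt_of_le (by positivity) (P.sin_angle_pos hn)
  rw [gain, if_neg h0, if_pos hn, gULA, if_neg hs.ne']
  have : Real.pi * P.Nb * ((2 * n + 1) / (2 * P.Nb)) = n * Real.pi + Real.pi / 2 := by
    field_simp
  rw [this, Real.sin_add_pi_div_two, Real.cos_nat_mul_pi, ← pow_mul, mul_comm n 2, pow_mul]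
  norm_num

lemma gain_zero : P.gain 0 = P.delta / 2 * P.Nb := by simp [gain, gULA]

lemma gain_half : P.gain (P.Nb / 2) = 0 := by
  rw [gain, if_neg P.half_pos.ne', if_neg (lt_irrefl _)]

lemma gain_pos {n : ℕ} (hn : n < P.Nb / 2) : 0 < P.gain n := by
  have hd := P.delta_pos
  have hN := P.Nb_pos
  by_cases h0 : n = 0
  · rw [h0, gain_zero]; positivity
  · rw [P.gain_eq h0 hn]
    have hs : 0 < Real.sin (Real.pi * ((2 * n + 1) / (2 * P.Nb))) :=
      lt_of_lt_of_le (by positivity) (P.sin_angle_pos hn)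
    positivity

/-- At the centre of a side lobe the numerator of the array gain is `1`, so the gain decreases as
the sine grows; the main lobe wins because Jordan's inequality gives `N_b sin > 1`. Distinct levels
are essential: they let the event that the gain equals `G_n` identify the cell of the deviation. -/
lemma gain_strictAnti {n k : ℕ} (hnk : n < k) (hk : k ≤ P.Nb / 2) : P.gain k < P.gain n := by
  have hd := P.delta_pos
  have hN := P.Nb_pos
  rcases hk.eq_or_lt with rfl | hk
  · rw [gain_half]; exact P.gain_pos hnk
  have hsk : 0 < Real.sin (Real.pi * ((2 * k + 1) / (2 * P.Nb))) :=
    lt_of_lt_of_le (by positivity) (P.sin_angle_pos hk)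
  rw [P.gain_eq (by omega) hk]
  by_cases h0 : n = 0
  · rw [h0, gain_zero]
    refine mul_lt_mul_of_pos_left ?_ (by positivity)
    rw [div_lt_iff₀ (by positivity), ← mul_assoc, ← sq, ← mul_pow]
    have h1 : 1 < P.Nb * Real.sin (Real.pi * ((2 * k + 1) / (2 * P.Nb))) := by
      have h2 := mul_le_mul_of_nonneg_left (P.sin_angle_pos hk) hN.le
      have h3 : P.Nb * ((2 * k + 1) / P.Nb) = (2 * k + 1 : ℝ) := by field_simp
      have h4 : (1 : ℝ) ≤ k := by
        have : 1 ≤ k := by omega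
        exact_mod_cast this
      linarith
    exact one_lt_pow₀ h1 two_ne_zero
  · have hsn : 0 < Real.sin (Real.pi * ((2 * n + 1) / (2 * P.Nb))) :=
      lt_of_lt_of_le (by positivity) (P.sin_angle_pos (hnk.trans hk))
    rw [P.gain_eq h0 (hnk.trans hk)]
    have hpi := Real.pi_pos
    have hlt : Real.sin (Real.pi * ((2 * n + 1) / (2 * P.Nb)))
        < Real.sin (Real.pi * ((2 * k + 1) / (2 * P.Nb))) := by
      refine Real.sin_lt_sin_of_lt_of_le_pi_div_two ?_ ?_ ?_
      · have : 0 ≤ Real.pi * ((2 * n + 1) / (2 * P.Nb)) := by positivity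
        linarith
      · have h : 2 * k + 1 ≤ P.Nb := by omega
        have : (2 * k + 1 : ℝ) ≤ P.Nb := by exact_mod_cast h
        rw [div_eq_mul_one_div Real.pi 2]
        refine mul_le_mul_of_nonneg_left ?_ hpi.le
        rw [div_le_div_iff₀ (by positivity) (by norm_num)]
        linarith
      · gcongr
    refine mul_lt_mul_of_pos_left ?_ (by positivity)
    gcongr

lemma gain_nonneg (n : ℕ) : 0 ≤ P.gain n := by
  rcases lt_or_ge n (P.Nb / 2) with h | h
  · exact (P.gain_pos h).le
  · rw [gain, if_neg (by have := P.half_pos; omega), if_neg (by omega)]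

lemma gain_inj {n k : ℕ} (hn : n ≤ P.Nb / 2) (hk : k ≤ P.Nb / 2) (h : P.gain n = P.gain k) :
    n = k := by
  rcases lt_trichotomy n k with h1 | h1 | h1
  · exact absurd h (P.gain_strictAnti h1 hk).ne'
  · exact h1
  · exact absurd h (P.gain_strictAnti h1 hn).ne

lemma gainB_nonneg (y : ℝ) : 0 ≤ P.gainB y := by
  obtain ⟨n, -, h⟩ := P.exists_gainB_eq y
  rw [h]; exact P.gain_nonneg n

lemma gainB_eq_iff {n : ℕ} (hn : n < P.Nb / 2) (y : ℝ) :
    P.gainB y = P.gain n ↔ P.InCell n (fold y) := by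
  rw [gainB_eq]
  constructor
  · intro h
    by_cases hex : ∃ k < P.Nb / 2, P.InCell k (fold y)
    · obtain ⟨k, hk, hc⟩ := hex
      rw [P.gainMain_of_inCell hk hc] at h
      rwa [← P.gain_inj hk.le hn.le h]
    · push Not at hex
      rw [P.gainMain_of_not_inCell hex] at h
      exact absurd (P.gain_inj le_rfl hn.le h) (by omega)
  · exact P.gainMain_of_inCell hn

lemma measurable_gainB : Measurable P.gainB := by
  have habs : Measurable fun x : ℝ => |x| := measurable_norm
  have h1 : Measurable P.gainMain := by
    unfold gainMain
    refine Measurable.ite (measurableSet_le habs measurable_const) measurable_const ?_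
    refine Finset.measurable_sum _ fun n _ => Measurable.ite ?_ measurable_const measurable_const
    exact (measurableSet_lt measurable_const habs).inter (measurableSet_le habs measurable_const)
  unfold gainB
  refine Measurable.ite (measurableSet_lt measurable_id measurable_const)
    (h1.comp (habs.comp (measurable_id.add_const _))) (Measurable.ite
    (measurableSet_lt measurable_const measurable_id)
    (h1.comp (habs.comp (measurable_id.sub_const _))) h1)

lemma ae_abs_ne (c : ℝ) : ∀ᵐ y : ℝ, |y| ≠ c := by
  have : Set.Finite {y : ℝ | |y| = c} := by
    refine Set.Finite.subset (Set.toFinite {c, -c}) fun y hy => ?_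
    rcases abs_choice y with h | h
    · left; rw [← h]; exact hy
    · right
      have : |y| = c := hy
      rw [h] at this
      simp [← this]
  exact measure_eq_zero_iff_ae_notMem.1 (this.measure_zero volume)

/-- Folding sends `|y|` to itself below `1 / 2` and to `1 - |y|` above. Hence level `n` is attained,
up to null sets, when `|y|` lies in `(l, u)` or in the mirrored interval `(1 - u, 1 - l)`. These are
disjoint since `u ≤ 1 / 2`, and they give the two integrals of `pLobe`. -/
lemma deviationLaw_gain_lobe {n : ℕ} (hn : n < P.Nb / 2) :
    deviationLaw {y | P.gainB y = P.gain n} = ENNReal.ofReal (P.pLobe n) := by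
  have hN := P.Nb_pos
  have hm : MeasurableSet {y | P.gainB y = P.gain n} :=
    P.measurable_gainB (measurableSet_singleton _)
  have hlt : (n : ℝ) / P.Nb ≤ ((n : ℝ) + 1) / P.Nb := by gcongr; linarith
  have hh := P.succ_div_le_half hn
  set l : ℝ := (n : ℝ) / P.Nb with hl
  set u : ℝ := ((n : ℝ) + 1) / P.Nb with hu
  have hl0 : 0 ≤ l := by positivity
  rw [← lintegral_indicator_one hm, lintegral_deviationLaw (measurable_one.indicator hm), pLobe,
    ENNReal.ofReal_add, ← lintegral_lDelta_abs hl0 hlt, ← lintegral_lDelta_abs (by linarith)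
      (by linarith), ← lintegral_add_left]
  · refine lintegral_congr_ae ?_
    -- Discarding the endpoints makes the closed main lobe and the half-open side lobes all behave
    -- like open intervals.
    filter_upwards [ae_abs_ne l, ae_abs_ne u, ae_abs_ne (1 - l), ae_abs_ne (1 - u),
      ae_abs_ne (1 / 2), ae_abs_ne 0] with y h1 h2 h3 h4 h5 h6
    by_cases hy : |y| ≤ 1
    · rw [← mul_add]
      congr 1
      have hfold : |fold y| = if |y| < 1 / 2 then |y| else 1 - |y| := by
        rw [fold]
        have hy' := abs_le.1 hy
        rcases lt_or_gt_of_ne h5 with h | h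
        · have h' := abs_lt.1 h
          rw [if_pos h, if_neg (by linarith), if_neg (by linarith)]
        · rw [if_neg (c := |y| < 1 / 2) (by linarith)]
          rcases lt_abs.1 h with h' | h'
          · rw [if_neg (by linarith), if_pos h', abs_abs, abs_of_nonpos (by linarith),
              abs_of_pos (a := y) (by linarith)]
            ring
          · rw [if_pos (by linarith), abs_abs, abs_of_nonneg (by linarith),
              abs_of_neg (a := y) (by linarith)]
            ring
      have hcell : P.gainB y = P.gain n ↔ l < |fold y| ∧ |fold y| < u := by
        rw [P.gainB_eq_iff hn]
        have hne : |fold y| ≠ u := by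
          rw [hfold]; split_ifs
          · exact h2
          · intro h; exact h4 (by linarith)
        constructor
        · intro hc
          refine ⟨?_, lt_of_le_of_ne hc.le hne⟩
          by_cases h0 : n = 0
          · have : l = 0 := by simp [hl, h0]
            rw [this]
            refine lt_of_le_of_ne (abs_nonneg _) (Ne.symm ?_)
            rw [hfold]; split_ifs
            · exact h6
            · intro h; exact h3 (by linarith)
          · exact hc.lt h0
        · rintro ⟨ha, hb⟩
          rw [InCell]
          split_ifs with h0
          · have : u = 1 / P.Nb := by simp [hu, h0]
            rw [← this]; exact hb.le
          · exact ⟨ha, hb.le⟩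
      rw [hfold] at hcell
      rcases lt_or_gt_of_ne h5 with h | h
      · rw [if_pos h] at hcell
        have hno : |y| ∉ Set.Ioo (1 - u) (1 - l) := fun hmem => by linarith [hmem.1]
        rw [Set.indicator_of_notMem hno, add_zero]
        by_cases hg : P.gainB y = P.gain n
        · rw [Set.indicator_of_mem (by exact hg), Set.indicator_of_mem (by exact hcell.1 hg)]; rfl
        · rw [Set.indicator_of_notMem (by exact hg),
            Set.indicator_of_notMem (by exact mt hcell.2 hg)]
      · rw [if_neg (by linarith)] at hcell
        have hno : |y| ∉ Set.Ioo l u := fun hmem => by linarith [hmem.2]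
        have hcell' : P.gainB y = P.gain n ↔ |y| ∈ Set.Ioo (1 - u) (1 - l) := hcell.trans
          ⟨fun h => ⟨by linarith [h.2], by linarith [h.1]⟩,
            fun h => ⟨by linarith [h.2], by linarith [h.1]⟩⟩
        rw [Set.indicator_of_notMem hno, zero_add]
        by_cases hg : P.gainB y = P.gain n
        · rw [Set.indicator_of_mem (by exact hg), Set.indicator_of_mem (hcell'.1 hg)]; rfl
        · rw [Set.indicator_of_notMem (by exact hg), Set.indicator_of_notMem (mt hcell'.2 hg)]
    · have hno1 : |y| ∉ Set.Ioo l u := fun hmem => by linarith [hmem.2]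
      have hno2 : |y| ∉ Set.Ioo (1 - u) (1 - l) := fun hmem => by linarith [hmem.2]
      -- For `|y| > 1` the two supports of length one in the correlation do not overlap, so the
      -- values of the pattern there are irrelevant.
      have h0 : lDelta y = 0 := by
        rw [lDelta, ← lintegral_zero (μ := (volume : Measure ℝ))]
        refine lintegral_congr fun x => ?_
        by_cases hx : x ∈ Set.Ioo (-(1 / 2) : ℝ) (1 / 2)
        · rw [fPhi_eq_zero (x := y + x), ENNReal.ofReal_zero, mul_zero]
          intro hxy
          apply hy
          rw [abs_le]
          constructor <;> linarith [hx.1, hx.2, hxy.1, hxy.2]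
        · simp [fPhi_eq_zero hx]
      simp [h0]
  · exact measurable_lDelta.mul ((measurable_const.indicator measurableSet_Ioo).comp measurable_norm)
  · exact mul_nonneg (by norm_num) (intervalIntegral.integral_nonneg hlt fun y _ => fDelta_nonneg y)
  · exact mul_nonneg (by norm_num)
      (intervalIntegral.integral_nonneg (by linarith) fun y _ => fDelta_nonneg y)

/-- The lobes are disjoint by distinctness of the levels; the last level `0` takes the complementary
mass. -/
lemma deviationLaw_real_gain {n : ℕ} (hn : n ≤ P.Nb / 2) :
    deviationLaw.real {y | P.gainB y = P.gain n} = P.pGain n := by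
  have hN := P.Nb_pos
  have hlobe : ∀ k < P.Nb / 2, deviationLaw.real {y | P.gainB y = P.gain k} = P.pLobe k :=
    fun k hk => by
      rw [measureReal_def, P.deviationLaw_gain_lobe hk, ENNReal.toReal_ofReal]
      have h1 : (k : ℝ) / P.Nb ≤ ((k : ℝ) + 1) / P.Nb := by gcongr; linarith
      exact add_nonneg (mul_nonneg (by norm_num)
        (intervalIntegral.integral_nonneg h1 fun y _ => fDelta_nonneg y))
        (mul_nonneg (by norm_num)
          (intervalIntegral.integral_nonneg (by linarith) fun y _ => fDelta_nonneg y))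
  rcases hn.lt_or_eq with hn | rfl
  · rw [pGain, if_pos hn, hlobe n hn]
  · have hm : ∀ k, MeasurableSet {y | P.gainB y = P.gain k} := fun k =>
      P.measurable_gainB (measurableSet_singleton _)
    have hset : {y | P.gainB y = P.gain (P.Nb / 2)}
        = (⋃ k ∈ Finset.range (P.Nb / 2), {y | P.gainB y = P.gain k})ᶜ := by
      ext y
      simp only [Set.mem_ofPred_eq, Set.mem_compl_iff, Set.mem_iUnion, Finset.mem_range,
        not_exists]
      constructor
      · intro h k hk h'
        exact absurd (P.gain_inj le_rfl hk.le (h.symm.trans h')) (by omega)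
      · intro h
        obtain ⟨k, hk, h'⟩ := P.exists_gainB_eq y
        rcases hk.lt_or_eq with hk | rfl
        · exact absurd h' (h k hk)
        · exact h'
    rw [pGain, if_neg (lt_irrefl _), hset, probReal_compl_eq_one_sub
      (Finset.measurableSet_biUnion _ fun k _ => hm k), measureReal_biUnion_finset]
    · rw [Finset.sum_congr rfl fun k hk => hlobe k (Finset.mem_range.1 hk)]
    · intro i hi j hj hij
      refine Set.disjoint_left.2 fun y h1 h2 => hij ?_
      have h1' : P.gainB y = P.gain i := h1
      have h2' : P.gainB y = P.gain j := h2
      exact P.gain_inj (Finset.mem_range.1 hi).le (Finset.mem_range.1 hj).le (h1'.symm.trans h2')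
    · exact fun k _ => hm k

lemma pGain_nonneg {n : ℕ} (hn : n ≤ P.Nb / 2) : 0 ≤ P.pGain n := by
  rw [← P.deviationLaw_real_gain hn]; exact measureReal_nonneg

lemma lintegral_comp_gainB (F : ℝ → ℝ≥0∞) :
    ∫⁻ y, F (P.gainB y) ∂deviationLaw
      = ∑ n ∈ Finset.range (P.Nb / 2 + 1), ENNReal.ofReal (P.pGain n) * F (P.gain n) := by
  have hm : ∀ k, MeasurableSet {y | P.gainB y = P.gain k} := fun k =>
    P.measurable_gainB (measurableSet_singleton _)
  have h1 : ∀ y, F (P.gainB y) = ∑ n ∈ Finset.range (P.Nb / 2 + 1),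
      {y | P.gainB y = P.gain n}.indicator (fun _ => F (P.gain n)) y := fun y => by
    obtain ⟨k, hk, h⟩ := P.exists_gainB_eq y
    rw [Finset.sum_eq_single k]
    · rw [Set.indicator_of_mem (by exact h), h]
    · intro j hj hjk
      rw [Set.indicator_of_notMem]
      intro hj'
      have h2 : P.gainB y = P.gain j := hj'
      exact hjk (P.gain_inj (by have := Finset.mem_range.1 hj; omega) hk (h2.symm.trans h))
    · intro hk'
      exact absurd (Finset.mem_range.2 (by omega)) hk'
  rw [lintegral_congr h1, lintegral_finsetSum _ fun k _ => measurable_const.indicator (hm k)]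
  refine Finset.sum_congr rfl fun k hk => ?_
  rw [lintegral_indicator (hm k), setLIntegral_const,
    ← P.deviationLaw_real_gain (by have := Finset.mem_range.1 hk; omega), ofReal_measureReal,
    mul_comm]

lemma sum_pGain : ∑ n ∈ Finset.range (P.Nb / 2 + 1), P.pGain n = 1 := by
  rw [Finset.sum_range_succ, pGain, if_neg (lt_irrefl _)]
  rw [Finset.sum_congr rfl fun k hk => show P.pGain k = P.pLobe k by
    rw [pGain, if_pos (Finset.mem_range.1 hk)]]
  ring

end Params

end RISNet

namespace RISNet

open Filter Topology

/-! ### Independence of the components of the network -/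

section general

variable {Ω : Type*} [mΩ : MeasurableSpace Ω] {μ : Measure Ω}

/-- In a finite intersection the factor with label `none` is split off; the remaining factors form
one event of the supremum of the other σ-algebras. Used twice to attach the obstacles and then the
BSs to the family of marks. -/
lemma iIndep_option {ι : Type*} {m : Option ι → MeasurableSpace Ω}
    (h : iIndep (fun i => m (some i)) μ) (h0 : Indep (m none) (⨆ i, m (some i)) μ) :
    iIndep m μ := by
  classical
  rw [iIndep_iff] at h ⊢
  intro s f hf
  have hmeas : MeasurableSet[⨆ i, m (some i)] (⋂ i ∈ Finset.eraseNone s, f (some i)) := by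
    refine Finset.measurableSet_biInter _ fun i hi => ?_
    exact le_iSup (fun i => m (some i)) i _ (hf _ (Finset.mem_eraseNone.1 hi))
  have hs := h (Finset.eraseNone s) (f := fun i => f (some i))
    fun i hi => hf _ (Finset.mem_eraseNone.1 hi)
  by_cases hn : none ∈ s
  · have hset : ⋂ i ∈ s, f i = f none ∩ ⋂ i ∈ Finset.eraseNone s, f (some i) := by
      ext ω
      simp only [Set.mem_iInter, Set.mem_inter_iff, Finset.mem_eraseNone]
      exact ⟨fun hω => ⟨hω none hn, fun i hi => hω _ hi⟩, fun hω i hi => by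
        cases i with
        | none => exact hω.1
        | some i => exact hω.2 i hi⟩
    have hprod : ∏ i ∈ s, μ (f i) = μ (f none) * ∏ i ∈ Finset.eraseNone s, μ (f (some i)) := by
      rw [← Finset.prod_insertNone (fun i => μ (f i)), Finset.insertNone_eraseNone,
        Finset.insert_eq_of_mem hn]
    rw [hset, hprod, ← hs]
    exact (Indep_iff _ _ μ).1 h0 _ _ (hf _ hn) hmeas
  · have hset : ⋂ i ∈ s, f i = ⋂ i ∈ Finset.eraseNone s, f (some i) := by
      ext ω
      simp only [Set.mem_iInter, Finset.mem_eraseNone]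
      exact ⟨fun hω i hi => hω _ hi, fun hω i hi => by
        cases i with
        | none => exact absurd hi hn
        | some i => exact hω i hi⟩
    have hprod : ∏ i ∈ s, μ (f i) = ∏ i ∈ Finset.eraseNone s, μ (f (some i)) := by
      have : s = (Finset.eraseNone s).map Function.Embedding.some := by
        rw [Finset.map_some_eraseNone, Finset.erase_eq_of_notMem hn]
      conv_lhs => rw [this, Finset.prod_map]
      rfl
    rw [hset, hprod, hs]

/-- The joint law is a triple product measure, which can be bracketed in either way. -/
lemma indepFun_prod_assoc {α β γ : Type*} [MeasurableSpace α] [MeasurableSpace β]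
    [MeasurableSpace γ] [IsProbabilityMeasure μ] {f : Ω → α} {g : Ω → β} {k : Ω → γ}
    (hf : Measurable f) (hg : Measurable g) (hk : Measurable k) (hfg : IndepFun f g μ)
    (hfgk : IndepFun (fun ω => (f ω, g ω)) k μ) : IndepFun f (fun ω => (g ω, k ω)) μ := by
  have hgk : IndepFun g k μ := hfgk.comp measurable_snd measurable_id
  rw [indepFun_iff_map_prod_eq_prod_map_map hf.aemeasurable (hg.prodMk hk).aemeasurable,
    (indepFun_iff_map_prod_eq_prod_map_map hg.aemeasurable hk.aemeasurable).1 hgk]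
  have h1 := (indepFun_iff_map_prod_eq_prod_map_map (hf.prodMk hg).aemeasurable
    hk.aemeasurable).1 hfgk
  rw [(indepFun_iff_map_prod_eq_prod_map_map hf.aemeasurable hg.aemeasurable).1 hfg] at h1
  have : IsProbabilityMeasure (μ.map f) := Measure.isProbabilityMeasure_map hf.aemeasurable
  have : IsProbabilityMeasure (μ.map g) := Measure.isProbabilityMeasure_map hg.aemeasurable
  have : IsProbabilityMeasure (μ.map k) := Measure.isProbabilityMeasure_map hk.aemeasurable
  rw [← Measure.prodAssoc_prod, ← h1, Measure.map_map MeasurableEquiv.prodAssoc.measurable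
    ((hf.prodMk hg).prodMk hk)]
  rfl

/-- Integration of a function of two independent variables. -/
lemma lintegral_of_indepFun {α β : Type*} [MeasurableSpace α] [MeasurableSpace β]
    [IsProbabilityMeasure μ] {U : Ω → α} {V : Ω → β} (hU : Measurable U) (hV : Measurable V)
    (h : IndepFun U V μ) {F : α → β → ℝ≥0∞} (hF : Measurable (Function.uncurry F)) :
    ∫⁻ ω, F (U ω) (V ω) ∂μ = ∫⁻ ω, ∫⁻ ω', F (U ω) (V ω') ∂μ ∂μ := by
  have h1 := (indepFun_iff_map_prod_eq_prod_map_map hU.aemeasurable hV.aemeasurable).1 h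
  have : IsProbabilityMeasure (μ.map V) := Measure.isProbabilityMeasure_map hV.aemeasurable
  calc ∫⁻ ω, F (U ω) (V ω) ∂μ = ∫⁻ p, Function.uncurry F p ∂(μ.map fun ω => (U ω, V ω)) := by
        rw [lintegral_map hF (hU.prodMk hV)]; rfl
    _ = ∫⁻ u, ∫⁻ v, F u v ∂(μ.map V) ∂(μ.map U) := by
        rw [h1, lintegral_prod _ hF.aemeasurable]; rfl
    _ = ∫⁻ ω, ∫⁻ v, F (U ω) v ∂(μ.map V) ∂μ := by
        exact lintegral_map (Measurable.lintegral_prod_right' hF) hU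
    _ = _ := by
        refine lintegral_congr fun ω => ?_
        exact lintegral_map (hF.comp measurable_prodMk_left) hV

end general

namespace Network

variable {P : Params} {Ω : Type*} [mΩ : MeasurableSpace Ω] {μ : Measure Ω} (W : Network P μ)

/-- The independent sources of randomness: the BSs, the obstacles, and the attached variables. -/
noncomputable abbrev source : Option (Option Source) → MeasurableSpace Ω
  | none => MeasurableSpace.comap (fun ω i => W.b i ω) inferInstance
  | some none => MeasurableSpace.comap (fun ω i => W.o i ω) inferInstance
  | some (some s) => MeasurableSpace.comap (W.X s) inferInstance

lemma measurable_b : Measurable fun ω i => W.b i ω :=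
  measurable_pi_lambda _ W.b_ppp.measurable

lemma measurable_o : Measurable fun ω i => W.o i ω :=
  measurable_pi_lambda _ W.o_ppp.measurable

lemma measurable_X : Measurable fun ω s => W.X s ω := measurable_pi_lambda _ W.X_meas

lemma source_le (i : Option (Option Source)) : W.source i ≤ mΩ := by
  match i with
  | none => exact W.measurable_b.comap_le
  | some none => exact W.measurable_o.comap_le
  | some (some s) => exact (W.X_meas s).comap_le

/-- Combines the three independence assumptions of the network into the independence of one family,
so that no later argument has to go back to them separately. -/
lemma iIndep_source [IsProbabilityMeasure μ] : iIndep W.source μ := by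
  have hX : ⨆ s, W.source (some (some s)) = MeasurableSpace.comap (fun ω s => W.X s ω)
      MeasurableSpace.pi := by
    rw [MeasurableSpace.pi, MeasurableSpace.comap_iSup]
    refine iSup_congr fun s => ?_
    rw [MeasurableSpace.comap_comp]
    rfl
  have h1 : iIndep (fun i => W.source (some i)) μ := by
    refine iIndep_option W.X_indep ?_
    rw [hX]
    exact (W.boX_indep.comp (φ := Prod.snd) (ψ := id) measurable_snd measurable_id)
  refine iIndep_option h1 ?_
  have h2 := indepFun_prod_assoc W.measurable_b W.measurable_o W.measurable_X W.bo_indep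
    W.boX_indep
  rw [iSup_option, hX]
  have h3 : W.source (some none) ⊔ MeasurableSpace.comap (fun ω s => W.X s ω) MeasurableSpace.pi
      = MeasurableSpace.comap (fun ω => (fun i => W.o i ω, fun s => W.X s ω)) inferInstance :=
    (MeasurableSpace.comap_prodMk _ _).symm
  rw [h3]
  exact h2

/-- The information carried by a set of sources. -/
noncomputable abbrev sig (S : Set (Option (Option Source))) : MeasurableSpace Ω := ⨆ i ∈ S, W.source i

lemma sig_le (S : Set (Option (Option Source))) : W.sig S ≤ mΩ :=
  iSup₂_le fun i _ => W.source_le i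

lemma source_le_sig {S : Set (Option (Option Source))} {i : Option (Option Source)} (hi : i ∈ S) :
    W.source i ≤ W.sig S := le_iSup₂_of_le i hi le_rfl

lemma measurable_b_sig {S : Set (Option (Option Source))} (hS : none ∈ S) :
    Measurable[W.sig S] fun ω i => W.b i ω :=
  (comap_measurable _).mono (W.source_le_sig hS) le_rfl

lemma measurable_b_apply_sig {S : Set (Option (Option Source))} (hS : none ∈ S) (i : ℕ) :
    Measurable[W.sig S] (W.b i) :=
  (measurable_pi_apply i).comp (W.measurable_b_sig hS)

lemma measurable_o_sig {S : Set (Option (Option Source))} (hS : some none ∈ S) :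
    Measurable[W.sig S] fun ω i => W.o i ω :=
  (comap_measurable _).mono (W.source_le_sig hS) le_rfl

lemma measurable_X_sig {S : Set (Option (Option Source))} {s : Source} (hS : some (some s) ∈ S) :
    Measurable[W.sig S] (W.X s) :=
  (comap_measurable _).mono (W.source_le_sig hS) le_rfl

/-- The form in which independence is mostly used: it suffices to list the labels on which each
variable depends. -/
lemma indepFun_of_disjoint [IsProbabilityMeasure μ] {S T : Set (Option (Option Source))}
    (hST : Disjoint S T) {α β : Type*} [MeasurableSpace α] [MeasurableSpace β] {U : Ω → α}
    {V : Ω → β} (hU : Measurable[W.sig S] U) (hV : Measurable[W.sig T] V) : IndepFun U V μ := by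
  have h := indep_iSup_of_disjoint W.source_le W.iIndep_source hST
  rw [IndepFun_iff_Indep]
  exact indep_of_indep_of_le_right (indep_of_indep_of_le_left h hU.comap_le) hV.comap_le

end Network

end RISNet

namespace RISNet

open Filter Topology

/-! ### Laplace transform of the interference of one BS -/

namespace Params

variable (P : Params)

lemma zeta_pos : 0 < P.zeta := by
  have := P.lamF_pos
  have := Real.pi_pos
  unfold zeta; positivity

lemma beta_pos : 0 < P.beta := by
  have := P.lamO_pos
  have := P.Lo_pos
  have := Real.pi_pos
  unfold beta; positivity

lemma pVis_add (d : ℝ) : P.pVis Vis.L d + P.pVis Vis.N d = 1 := by simp [pVis]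

lemma pVisL_pos (d : ℝ) : 0 < P.pVis Vis.L d := Real.exp_pos _

lemma pVisL_le_one {d : ℝ} (hd : 0 ≤ d) : P.pVis Vis.L d ≤ 1 :=
  Real.exp_le_one_iff.2 (by have := mul_nonneg P.beta_pos.le hd; linarith)

lemma pVis_nonneg (v : Vis) {d : ℝ} (hd : 0 ≤ d) : 0 ≤ P.pVis v d := by
  cases v
  · exact (P.pVisL_pos d).le
  · have := P.pVisL_le_one hd
    have := P.pVis_add d
    linarith

lemma pVis_le_one (v : Vis) {d : ℝ} (hd : 0 ≤ d) : P.pVis v d ≤ 1 := by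
  cases v
  · exact P.pVisL_le_one hd
  · have := P.pVisL_pos d
    have := P.pVis_add d
    linarith

@[fun_prop]
lemma measurable_pVis (v : Vis) : Measurable (P.pVis v) := by
  cases v <;> · unfold pVis; fun_prop

lemma continuous_pVis (v : Vis) : Continuous (P.pVis v) := by
  cases v <;> · unfold pVis; fun_prop

lemma m_pos' (v : Vis) : (0 : ℝ) < P.m v := by exact_mod_cast P.m_pos v

lemma gain_le {n : ℕ} (hn : n ≤ P.Nb / 2) : P.gain n ≤ P.gain 0 := by
  rcases Nat.eq_zero_or_pos n with rfl | h
  · exact le_rfl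
  · exact (P.gain_strictAnti h hn).le

lemma kappa_le_one (v : Vis) {x : ℝ} (hx : 0 ≤ x) : P.kappa v x ≤ 1 := by
  refine le_trans ?_ P.sum_pGain.le
  refine Finset.sum_le_sum fun n hn => ?_
  have hn' : n ≤ P.Nb / 2 := by have := Finset.mem_range.1 hn; omega
  refine mul_le_of_le_one_right (P.pGain_nonneg hn') (inv_le_one_of_one_le₀ (one_le_pow₀ ?_))
  have := mul_nonneg hx (P.gain_nonneg n)
  have := P.m_pos' v
  have : 0 ≤ x * P.gain n / P.m v := by positivity
  linarith

/-- From `(1 + y / m) ^ m ≤ exp y` and `exp (-y) ≥ 1 - y`, with `G_n ≤ G_0` and weights of total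
mass one. This linear bound makes the exponents integrable at infinity and dominates them locally
uniformly in `s`. -/
lemma one_sub_kappa_le (v : Vis) {x : ℝ} (hx : 0 ≤ x) : 1 - P.kappa v x ≤ P.gain 0 * x := by
  have h : ∑ n ∈ Finset.range (P.Nb / 2 + 1), P.pGain n * (1 - P.gain 0 * x) ≤ P.kappa v x := by
    refine Finset.sum_le_sum fun n hn => ?_
    have hn' : n ≤ P.Nb / 2 := by have := Finset.mem_range.1 hn; omega
    refine mul_le_mul_of_nonneg_left ?_ (P.pGain_nonneg hn')
    have hm := P.m_pos' v
    have hy := mul_nonneg hx (P.gain_nonneg n)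
    set y := x * P.gain n with hydef
    have h1 : (1 + y / P.m v) ^ P.m v ≤ Real.exp y := by
      have h2 : 1 + y / P.m v ≤ Real.exp (y / P.m v) := by
        have := Real.add_one_le_exp (y / P.m v); linarith
      calc (1 + y / P.m v) ^ P.m v ≤ Real.exp (y / P.m v) ^ P.m v := by gcongr
        _ = Real.exp y := by rw [← Real.exp_nat_mul]; congr 1; field_simp
    have h3 : Real.exp (-y) ≤ ((1 + y / P.m v) ^ P.m v)⁻¹ := by
      rw [Real.exp_neg]
      exact inv_anti₀ (by positivity) h1
    have h4 := Real.add_one_le_exp (-y)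
    have h5 : y ≤ P.gain 0 * x := by
      rw [hydef, mul_comm]
      exact mul_le_mul_of_nonneg_right (P.gain_le hn') hx
    linarith
  rw [← Finset.sum_mul, P.sum_pGain, one_mul] at h
  linarith

/-- Putting all the mass on the largest gain gives a positive lower bound. Positivity is required
for taking the logarithm of `markLaplace`. -/
lemma kappa_pos (v : Vis) {x : ℝ} (hx : 0 ≤ x) : 0 < P.kappa v x := by
  have hm := P.m_pos' v
  have hg := P.gain_nonneg 0
  have h : ∑ n ∈ Finset.range (P.Nb / 2 + 1),
      P.pGain n * ((1 + x * P.gain 0 / P.m v) ^ (P.m v))⁻¹ ≤ P.kappa v x := by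
    refine Finset.sum_le_sum fun n hn => ?_
    have hn' : n ≤ P.Nb / 2 := by have := Finset.mem_range.1 hn; omega
    have hgn := P.gain_nonneg n
    refine mul_le_mul_of_nonneg_left ?_ (P.pGain_nonneg hn')
    refine inv_anti₀ (by positivity) ?_
    gcongr
    exact P.gain_le hn'
  rw [← Finset.sum_mul, P.sum_pGain, one_mul] at h
  refine lt_of_lt_of_le ?_ h
  positivity

@[fun_prop]
lemma measurable_kappa (v : Vis) : Measurable (P.kappa v) := by
  unfold kappa
  fun_prop

lemma continuousOn_kappa (v : Vis) : ContinuousOn (P.kappa v) (Set.Ici 0) := by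
  unfold kappa
  refine continuousOn_finsetSum _ fun n _ => continuousOn_const.mul (ContinuousOn.inv₀ ?_ ?_)
  · fun_prop
  · intro x hx
    have := mul_nonneg (show (0 : ℝ) ≤ x from hx) (P.gain_nonneg n)
    have := P.m_pos' v
    positivity

/-- Argument of `κ` in the Laplace transform of the interference. -/
noncomputable def pathGain (v : Vis) (d : ℝ) : ℝ := P.pb * P.zeta * d ^ (-P.alpha v)

lemma pathGain_nonneg (v : Vis) {d : ℝ} (hd : 0 ≤ d) : 0 ≤ P.pathGain v d := by
  have := P.pb_pos
  have := P.zeta_pos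
  unfold pathGain; positivity

@[fun_prop]
lemma measurable_pathGain (v : Vis) : Measurable (P.pathGain v) := by
  unfold pathGain; fun_prop

/-- Laplace transform of the power received from a BS at distance `d`. -/
noncomputable def markLaplace (s d : ℝ) : ℝ :=
  P.pVis Vis.L d * P.kappa Vis.L (s * P.pathGain Vis.L d)
    + P.pVis Vis.N d * P.kappa Vis.N (s * P.pathGain Vis.N d)

@[fun_prop]
lemma measurable_markLaplace (s : ℝ) : Measurable (P.markLaplace s) := by
  unfold markLaplace
  fun_prop

lemma markLaplace_pos {s d : ℝ} (hs : 0 ≤ s) (hd : 0 ≤ d) : 0 < P.markLaplace s d := by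
  have h1 := P.kappa_pos Vis.L (mul_nonneg hs (P.pathGain_nonneg Vis.L hd))
  have h2 := P.kappa_pos Vis.N (mul_nonneg hs (P.pathGain_nonneg Vis.N hd))
  exact add_pos_of_pos_of_nonneg (mul_pos (P.pVisL_pos d) h1)
    (mul_nonneg (P.pVis_nonneg Vis.N hd) h2.le)

lemma one_sub_markLaplace (s d : ℝ) : 1 - P.markLaplace s d
    = (1 - P.kappa Vis.L (s * P.pathGain Vis.L d)) * P.pVis Vis.L d
      + (1 - P.kappa Vis.N (s * P.pathGain Vis.N d)) * P.pVis Vis.N d := by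
  rw [markLaplace]
  linear_combination -P.pVis_add d

lemma markLaplace_le_one {s d : ℝ} (hs : 0 ≤ s) (hd : 0 ≤ d) : P.markLaplace s d ≤ 1 := by
  have h1 := P.kappa_le_one Vis.L (mul_nonneg hs (P.pathGain_nonneg Vis.L hd))
  have h2 := P.kappa_le_one Vis.N (mul_nonneg hs (P.pathGain_nonneg Vis.N hd))
  have h3 := P.one_sub_markLaplace s d
  have h4 := mul_nonneg (sub_nonneg.2 h1) (P.pVis_nonneg Vis.L hd)
  have h5 := mul_nonneg (sub_nonneg.2 h2) (P.pVis_nonneg Vis.N hd)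
  linarith

open Classical in
/-- Power received from a BS with label `i` at position `z`, from the values of the sources. -/
noncomputable def markPower (i : ℕ) (z : ℂ) (x : Source → ℝ) : ℝ :=
  P.pb * P.gainB (deviation (x (.bsAngle i), x (.bsBeam i))) * P.zeta *
    ‖z‖ ^ (-P.alpha (if x (.bsBlock i) < P.pVis Vis.L ‖z‖ then Vis.L else Vis.N))
    * x (.bsFading (if x (.bsBlock i) < P.pVis Vis.L ‖z‖ then Vis.L else Vis.N) i)

/-- Power received from a BS over a link of given type. -/
noncomputable def visPower (v : Vis) (i : ℕ) (z : ℂ) (x : Source → ℝ) : ℝ :=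
  P.pathGain v ‖z‖ * P.gainB (deviation (x (.bsAngle i), x (.bsBeam i))) * x (.bsFading v i)

lemma markPower_eq_L {i : ℕ} {z : ℂ} {x : Source → ℝ}
    (h : x (.bsBlock i) < P.pVis Vis.L ‖z‖) : P.markPower i z x = P.visPower Vis.L i z x := by
  rw [markPower, if_pos h, visPower, pathGain]; ring

lemma markPower_eq_N {i : ℕ} {z : ℂ} {x : Source → ℝ}
    (h : ¬ x (.bsBlock i) < P.pVis Vis.L ‖z‖) : P.markPower i z x = P.visPower Vis.N i z x := by
  rw [markPower, if_neg h, visPower, pathGain]; ring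

lemma measurable_visPower (v : Vis) (i : ℕ) :
    Measurable fun p : ℂ × (Source → ℝ) => P.visPower v i p.1 p.2 := by
  unfold visPower
  have := P.measurable_gainB
  fun_prop

lemma measurable_markPower (i : ℕ) :
    Measurable fun p : ℂ × (Source → ℝ) => P.markPower i p.1 p.2 := by
  have : (fun p : ℂ × (Source → ℝ) => P.markPower i p.1 p.2)
      = fun p => open Classical in if p.2 (.bsBlock i) < P.pVis Vis.L ‖p.1‖
        then P.visPower Vis.L i p.1 p.2 else P.visPower Vis.N i p.1 p.2 := by
    ext p
    split_ifs with h
    · exact P.markPower_eq_L h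
    · exact P.markPower_eq_N h
  rw [this]
  refine Measurable.ite (measurableSet_lt (by fun_prop) (by fun_prop))
    (P.measurable_visPower _ i) (P.measurable_visPower _ i)

end Params

namespace Network

variable {P : Params} {Ω : Type*} [mΩ : MeasurableSpace Ω] {μ : Measure Ω}
  [IsProbabilityMeasure μ] (W : Network P μ)

omit [IsProbabilityMeasure μ] in
lemma interf_eq (i : ℕ) (ω : Ω) : W.interf i ω = P.markPower i (W.b i ω) (fun s => W.X s ω) := by
  simp only [interf, vis, bsLoS, dev, Params.markPower, deviation]
  by_cases h : W.X (.bsBlock i) ω < P.pVis Vis.L ‖W.b i ω‖ <;> simp [h]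

/-- The sources attached to BS `i`. -/
def bsSet (i : ℕ) : Set (Option (Option Source)) :=
  {some (some (.bsBlock i)), some (some (.bsFading Vis.L i)), some (some (.bsFading Vis.N i)),
    some (some (.bsAngle i)), some (some (.bsBeam i))}

lemma bsSet_disjoint {i j : ℕ} (hij : i ≠ j) : Disjoint (bsSet i) (bsSet j) := by
  refine Set.disjoint_left.2 fun x hi hj => ?_
  simp only [bsSet, Set.mem_insert_iff, Set.mem_singleton_iff] at hi hj
  rcases hi with rfl | rfl | rfl | rfl | rfl <;> simp [hij] at hj

omit [IsProbabilityMeasure μ] in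
lemma measurable_visPower_sig (v : Vis) (i : ℕ) (z : ℂ) :
    Measurable[W.sig {some (some (.bsFading v i)), some (some (.bsAngle i)),
      some (some (.bsBeam i))}] fun ω => P.visPower v i z (fun s => W.X s ω) := by
  unfold Params.visPower
  have h1 := W.measurable_X_sig (S := {some (some (.bsFading v i)), some (some (.bsAngle i)),
      some (some (.bsBeam i))}) (s := .bsFading v i) (by simp)
  have h2 := W.measurable_X_sig (S := {some (some (.bsFading v i)), some (some (.bsAngle i)),
      some (some (.bsBeam i))}) (s := .bsAngle i) (by simp)
  have h3 := W.measurable_X_sig (S := {some (some (.bsFading v i)), some (some (.bsAngle i)),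
      some (some (.bsBeam i))}) (s := .bsBeam i) (by simp)
  exact ((P.measurable_gainB.comp (measurable_deviation.comp (h2.prodMk h3))).const_mul _).mul h1

omit [IsProbabilityMeasure μ] in
lemma sig_mono {S T : Set (Option (Option Source))} (h : S ⊆ T) : W.sig S ≤ W.sig T :=
  biSup_mono h

omit [IsProbabilityMeasure μ] in
lemma measurable_markPower_sig (i : ℕ) (z : ℂ) :
    Measurable[W.sig (bsSet i)] fun ω => P.markPower i z (fun s => W.X s ω) := by
  have : (fun ω => P.markPower i z (fun s => W.X s ω))
      = fun ω => open Classical in if W.X (.bsBlock i) ω < P.pVis Vis.L ‖z‖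
        then P.visPower Vis.L i z (fun s => W.X s ω)
        else P.visPower Vis.N i z (fun s => W.X s ω) := by
    ext ω
    split_ifs with h
    · exact P.markPower_eq_L h
    · exact P.markPower_eq_N h
  rw [this]
  refine Measurable.ite ?_ ?_ ?_
  · exact W.measurable_X_sig (S := bsSet i) (s := .bsBlock i) (by simp [bsSet]) measurableSet_Iio
  · exact (W.measurable_visPower_sig _ i z).mono (W.sig_mono (by
      intro x; simp only [bsSet, Set.mem_insert_iff, Set.mem_singleton_iff]; tauto)) le_rfl
  · exact (W.measurable_visPower_sig _ i z).mono (W.sig_mono (by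
      intro x; simp only [bsSet, Set.mem_insert_iff, Set.mem_singleton_iff]; tauto)) le_rfl

lemma map_deviation (i : ℕ) :
    μ.map (fun ω => deviation (W.X (.bsAngle i) ω, W.X (.bsBeam i) ω)) = deviationLaw := by
  have hind : IndepFun (W.X (.bsAngle i)) (W.X (.bsBeam i)) μ :=
    W.X_indep.indepFun (by simp)
  have h1 := (indepFun_iff_map_prod_eq_prod_map_map (W.X_meas (.bsAngle i)).aemeasurable
    (W.X_meas (.bsBeam i)).aemeasurable).1 hind
  rw [W.X_law, W.X_law] at h1
  change _ = (unif 0 (2 * Real.pi)).prod (unif 0 (2 * Real.pi)) at h1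
  rw [deviationLaw, ← h1, Measure.map_map measurable_deviation
    ((W.X_meas _).prodMk (W.X_meas _))]
  rfl

lemma measureReal_gainB_eq (i : ℕ) {n : ℕ} (hn : n ≤ P.Nb / 2) :
    μ.real {ω | P.gainB (W.dev i ω) = P.gain n} = P.pGain n := by
  have hm : Measurable fun ω => deviation (W.X (.bsAngle i) ω, W.X (.bsBeam i) ω) :=
    measurable_deviation.comp ((W.X_meas _).prodMk (W.X_meas _))
  have hs : MeasurableSet {y | P.gainB y = P.gain n} :=
    P.measurable_gainB (measurableSet_singleton _)
  rw [← P.deviationLaw_real_gain hn, ← W.map_deviation i, map_measureReal_apply hm hs]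
  rfl

omit [IsProbabilityMeasure μ] in
lemma ae_fading_nonneg (v : Vis) (i : ℕ) : ∀ᵐ ω ∂μ, 0 ≤ W.X (.bsFading v i) ω := by
  have h : μ (W.X (.bsFading v i) ⁻¹' Set.Iio 0) = 0 := by
    rw [← Measure.map_apply (W.X_meas _) measurableSet_Iio, W.X_law]
    exact nakagami_Iio _
  filter_upwards [measure_eq_zero_iff_ae_notMem.1 h] with ω hω
  simpa using hω

/-- The fading is averaged first, at fixed deviation, by the Gamma transform; the deviation then
enters only through the finitely many gain levels, whose probabilities are `pGain`. -/
lemma lintegral_expNeg_visPower (v : Vis) (i : ℕ) (z : ℂ) {s : ℝ} (hs : 0 ≤ s) :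
    ∫⁻ ω, expNeg (ENNReal.ofReal (s * P.visPower v i z (fun s => W.X s ω))) ∂μ
      = ENNReal.ofReal (P.kappa v (s * P.pathGain v ‖z‖)) := by
  set c := s * P.pathGain v ‖z‖ with hc
  have hc0 : 0 ≤ c := mul_nonneg hs (P.pathGain_nonneg v (norm_nonneg z))
  have hind : IndepFun (fun ω => deviation (W.X (.bsAngle i) ω, W.X (.bsBeam i) ω))
      (W.X (.bsFading v i)) μ :=
    W.indepFun_of_disjoint (S := {some (some (.bsAngle i)), some (some (.bsBeam i))})
      (T := {some (some (.bsFading v i))}) (by simp)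
      (measurable_deviation.comp ((W.measurable_X_sig (by simp)).prodMk
        (W.measurable_X_sig (by simp)))) (W.measurable_X_sig (by simp))
  have hdm : Measurable fun ω => deviation (W.X (.bsAngle i) ω, W.X (.bsBeam i) ω) :=
    measurable_deviation.comp ((W.X_meas _).prodMk (W.X_meas _))
  have h1 : ∫⁻ ω, expNeg (ENNReal.ofReal (s * P.visPower v i z (fun s => W.X s ω))) ∂μ
      = ∫⁻ ω, ENNReal.ofReal (Real.exp (-(c * P.gainB (deviation (W.X (.bsAngle i) ω,
          W.X (.bsBeam i) ω)) * W.X (.bsFading v i) ω))) ∂μ := by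
    refine lintegral_congr_ae ?_
    filter_upwards [W.ae_fading_nonneg v i] with ω hω
    have : s * P.visPower v i z (fun s => W.X s ω) = c * P.gainB (deviation (W.X (.bsAngle i) ω,
          W.X (.bsBeam i) ω)) * W.X (.bsFading v i) ω := by
      rw [Params.visPower, hc]; ring
    rw [this, expNeg_ofReal (mul_nonneg (mul_nonneg hc0 (P.gainB_nonneg _)) hω)]
  have hgm := P.measurable_gainB
  rw [h1, lintegral_of_indepFun hdm (W.X_meas _) hind (F := fun y h =>
    ENNReal.ofReal (Real.exp (-(c * P.gainB y * h)))) (by unfold Function.uncurry; fun_prop)]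
  have h2 : ∀ y, ∫⁻ ω', ENNReal.ofReal (Real.exp (-(c * P.gainB y * W.X (.bsFading v i) ω'))) ∂μ
      = ENNReal.ofReal (((1 + c * P.gainB y / P.m v) ^ P.m v)⁻¹) := fun y => by
    rw [← nakagami_laplace (P.m_pos v) (mul_nonneg hc0 (P.gainB_nonneg y))]
    have := W.X_law (.bsFading v i)
    change _ = nakagami (P.m v) at this
    rw [← this, lintegral_map (by fun_prop) (W.X_meas _)]
  simp_rw [h2]
  have h3 := P.lintegral_comp_gainB fun g => ENNReal.ofReal (((1 + c * g / P.m v) ^ P.m v)⁻¹)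
  rw [← W.map_deviation i, lintegral_map (by fun_prop) hdm] at h3
  rw [h3, Params.kappa, ENNReal.ofReal_sum_of_nonneg]
  · refine Finset.sum_congr rfl fun n hn => ?_
    rw [ENNReal.ofReal_mul (P.pGain_nonneg (by have := Finset.mem_range.1 hn; omega))]
  · intro n hn
    have h4 := P.pGain_nonneg (n := n) (by have := Finset.mem_range.1 hn; omega)
    have h5 := mul_nonneg hc0 (P.gain_nonneg n)
    have := P.m_pos' v
    positivity

lemma unif_Iio {p : ℝ} (h1 : p ≤ 1) : unif 0 1 (Set.Iio p) = ENNReal.ofReal p := by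
  rw [← lintegral_indicator_one measurableSet_Iio, lintegral_unif one_pos]
  have : Set.Iio p ∩ Set.Icc 0 1 = Set.Ico 0 p := by
    ext x; simp only [Set.mem_inter_iff, Set.mem_Iio, Set.mem_Icc, Set.mem_Ico]
    constructor
    · rintro ⟨h2, h3, h4⟩; exact ⟨h3, h2⟩
    · rintro ⟨h2, h3⟩; exact ⟨h3, h2, by linarith⟩
  rw [lintegral_indicator_one measurableSet_Iio, Measure.restrict_apply measurableSet_Iio, this]
  simp

omit [IsProbabilityMeasure μ] in
lemma measure_block_lt {s : Source} (hs : s.law P = unif 0 1) {p : ℝ}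
    (h1 : p ≤ 1) : μ {ω | W.X s ω < p} = ENNReal.ofReal p := by
  rw [← unif_Iio h1, ← hs, ← W.X_law, Measure.map_apply (W.X_meas _) measurableSet_Iio]
  rfl

/-- The blockage variable selects the propagation type and is independent of the power received over
either type of link, so the transform is the mixture of the two with the LoS and NLoS weights. -/
lemma lintegral_expNeg_markPower (i : ℕ) (z : ℂ) {s : ℝ} (hs : 0 ≤ s) :
    ∫⁻ ω, expNeg (ENNReal.ofReal (s * P.markPower i z (fun s => W.X s ω))) ∂μ
      = ENNReal.ofReal (P.markLaplace s ‖z‖) := by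
  set p := P.pVis Vis.L ‖z‖ with hp
  have hd := norm_nonneg z
  set E := {ω | W.X (.bsBlock i) ω < p} with hE
  have hEm : MeasurableSet E := measurableSet_lt (W.X_meas _) measurable_const
  have hμE : μ E = ENNReal.ofReal p :=
    W.measure_block_lt rfl (P.pVis_le_one _ hd)
  have hμEc : μ Eᶜ = ENNReal.ofReal (P.pVis Vis.N ‖z‖) := by
    rw [prob_compl_eq_one_sub hEm, hμE, ← ENNReal.ofReal_one,
      ← ENNReal.ofReal_sub _ (P.pVis_nonneg _ hd)]
    congr 1
  have hvm : ∀ v, Measurable fun ω =>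
      expNeg (ENNReal.ofReal (s * P.visPower v i z (fun s => W.X s ω))) := fun v => by
    have h1 : Measurable fun ω => P.visPower v i z (fun s => W.X s ω) :=
      (W.measurable_visPower_sig v i z).mono (W.sig_le _) le_rfl
    fun_prop
  -- Stated for a general set of blockage values, so that it covers both the LoS event and its
  -- complement.
  have key : ∀ (v : Vis) (B : Set ℝ), MeasurableSet B →
      ∫⁻ ω in (W.X (.bsBlock i)) ⁻¹' B,
        expNeg (ENNReal.ofReal (s * P.visPower v i z (fun s => W.X s ω))) ∂μ
      = μ ((W.X (.bsBlock i)) ⁻¹' B) * ENNReal.ofReal (P.kappa v (s * P.pathGain v ‖z‖)) := by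
    intro v B hB
    have hBm : MeasurableSet ((W.X (.bsBlock i)) ⁻¹' B) := W.X_meas _ hB
    have hind : IndepFun (W.X (.bsBlock i))
        (fun ω => P.visPower v i z (fun s => W.X s ω)) μ :=
      W.indepFun_of_disjoint (S := {some (some (.bsBlock i))}) (by simp)
        (W.measurable_X_sig (by simp)) (W.measurable_visPower_sig v i z)
    have hind2 : IndepFun ((B.indicator (fun _ => (1 : ℝ≥0∞))) ∘ (W.X (.bsBlock i)))
        ((fun y => expNeg (ENNReal.ofReal (s * y))) ∘
          (fun ω => P.visPower v i z (fun s => W.X s ω))) μ :=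
      hind.comp (measurable_const.indicator hB) (by fun_prop)
    have := lintegral_mul_eq_lintegral_mul_lintegral_of_indepFun
      ((measurable_const.indicator hB).comp (W.X_meas _)) (hvm v) hind2
    rw [← W.lintegral_expNeg_visPower v i z hs, ← lintegral_indicator hBm]
    refine Eq.trans ?_ (this.trans ?_)
    · refine lintegral_congr fun ω => ?_
      by_cases hω : W.X (.bsBlock i) ω ∈ B
      · simp [hω]
      · simp [hω]
    · congr 1
      rw [← lintegral_indicator_one hBm]
      rfl
  rw [← lintegral_add_compl _ hEm]
  have e1 : ∫⁻ ω in E, expNeg (ENNReal.ofReal (s * P.markPower i z (fun s => W.X s ω))) ∂μ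
      = ∫⁻ ω in E, expNeg (ENNReal.ofReal (s * P.visPower Vis.L i z (fun s => W.X s ω))) ∂μ :=
    setLIntegral_congr_fun hEm fun ω hω => by
      rw [P.markPower_eq_L (by exact hω)]
  have e2 : ∫⁻ ω in Eᶜ, expNeg (ENNReal.ofReal (s * P.markPower i z (fun s => W.X s ω))) ∂μ
      = ∫⁻ ω in Eᶜ, expNeg (ENNReal.ofReal (s * P.visPower Vis.N i z (fun s => W.X s ω))) ∂μ :=
    setLIntegral_congr_fun hEm.compl fun ω hω => by
      rw [P.markPower_eq_N (by exact hω)]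
  have e3 := key Vis.L (Set.Iio p) measurableSet_Iio
  have e4 := key Vis.N (Set.Iio p)ᶜ measurableSet_Iio.compl
  have hE' : W.X (.bsBlock i) ⁻¹' Set.Iio p = E := rfl
  rw [Set.preimage_compl] at e4
  rw [hE'] at e3 e4
  rw [e1, e2, e3, e4, hμE, hμEc, Params.markLaplace,
    ← ENNReal.ofReal_mul (P.pVis_nonneg _ hd), ← ENNReal.ofReal_mul (P.pVis_nonneg _ hd),
    ← ENNReal.ofReal_add]
  · exact mul_nonneg (P.pVis_nonneg _ hd)
      (P.kappa_pos _ (mul_nonneg hs (P.pathGain_nonneg _ hd))).le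
  · exact mul_nonneg (P.pVis_nonneg _ hd)
      (P.kappa_pos _ (mul_nonneg hs (P.pathGain_nonneg _ hd))).le

/-! ### Independent families of marks -/

lemma lintegral_prod_of_disjoint {S : ℕ → Set (Option (Option Source))}
    (hS : Pairwise (Function.onFun Disjoint S)) {e : ℕ → Ω → ℝ≥0∞}
    (he : ∀ i, Measurable[W.sig (S i)] (e i)) (n : ℕ) :
    ∫⁻ ω, ∏ i ∈ Finset.range n, e i ω ∂μ = ∏ i ∈ Finset.range n, ∫⁻ ω, e i ω ∂μ := by
  induction n with
  | zero => simp
  | succ n ih =>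
    simp_rw [Finset.prod_range_succ]
    rw [← ih]
    have hm : Measurable[W.sig (⋃ i ∈ Finset.range n, S i)]
        fun ω => ∏ i ∈ Finset.range n, e i ω := by
      refine Finset.measurable_prod _ fun i hi => ?_
      exact (he i).mono (W.sig_mono (Set.subset_biUnion_of_mem (u := S) hi)) le_rfl
    have hd : Disjoint (⋃ i ∈ Finset.range n, S i) (S n) := by
      rw [Set.disjoint_iUnion₂_left]
      exact fun i hi => hS (Finset.mem_range.1 hi).ne
    exact lintegral_mul_eq_lintegral_mul_lintegral_of_indepFun (hm.mono (W.sig_le _) le_rfl)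
      ((he n).mono (W.sig_le _) le_rfl) (W.indepFun_of_disjoint hd hm (he n))

/-- Finite products factor because the label sets are disjoint. Partial products are bounded by `1`,
so dominated convergence gives the infinite sum. Applied to the marks of the BSs and to those of the
obstacles. -/
lemma lintegral_expNeg_tsum {S : ℕ → Set (Option (Option Source))}
    (hS : Pairwise (Function.onFun Disjoint S)) {e : ℕ → Ω → ℝ≥0∞}
    (he : ∀ i, Measurable[W.sig (S i)] (e i)) {c : ℕ → ℝ≥0∞}
    (hc : ∀ i, ∫⁻ ω, expNeg (e i ω) ∂μ = expNeg (c i)) :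
    ∫⁻ ω, expNeg (∑' i, e i ω) ∂μ = expNeg (∑' i, c i) := by
  have h1 : ∀ n, ∫⁻ ω, ∏ i ∈ Finset.range n, expNeg (e i ω) ∂μ
      = ∏ i ∈ Finset.range n, expNeg (c i) := fun n => by
    refine (W.lintegral_prod_of_disjoint hS (fun i => expNeg_measurable.comp (he i)) n).trans ?_
    exact Finset.prod_congr rfl fun i _ => hc i
  have hL : Tendsto (fun n => ∫⁻ ω, ∏ i ∈ Finset.range n, expNeg (e i ω) ∂μ) atTop
      (𝓝 (∫⁻ ω, expNeg (∑' i, e i ω) ∂μ)) := by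
    refine tendsto_lintegral_of_dominated_convergence (fun _ => 1) (fun n => ?_) (fun n => ?_)
      (by simp) ?_
    · exact Finset.measurable_prod _ fun i _ =>
        expNeg_measurable.comp ((he i).mono (W.sig_le _) le_rfl)
    · exact Eventually.of_forall fun ω => Finset.prod_le_one' fun i _ => expNeg_le_one _
    · exact Eventually.of_forall fun ω => tendsto_prod_expNeg _
  simp_rw [h1] at hL
  exact tendsto_nhds_unique hL (tendsto_prod_expNeg c)

end Network

end RISNet

namespace RISNet

open Filter Topology

/-! ### Closed form of the Laplace transform of the interference -/

lemma lintegral_complex_polar {f : ℂ → ℝ≥0∞} (hf : Measurable f) :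
    ∫⁻ z, f z = ∫⁻ r in Set.Ioi (0 : ℝ), ∫⁻ θ in Set.Ioo (-Real.pi) Real.pi,
      ENNReal.ofReal r * f (r * Complex.exp (θ * Complex.I)) := by
  rw [← Complex.lintegral_comp_polarCoord_symm, polarCoord_target, Measure.volume_eq_prod,
    ← Measure.prod_restrict, lintegral_prod]
  · refine lintegral_congr fun r => lintegral_congr fun θ => ?_
    rw [Complex.polarCoord_symm_apply, smul_eq_mul, Complex.exp_mul_I]
    norm_cast
  · refine Measurable.aemeasurable ?_
    have h1 : Measurable fun p : ℝ × ℝ => Complex.polarCoord.symm p := by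
      simp_rw [Complex.polarCoord_symm_apply]
      fun_prop
    exact (measurable_fst.ennreal_ofReal).smul (hf.comp h1)

lemma lintegral_complex_radial {f : ℝ → ℝ≥0∞} (hf : Measurable f) :
    ∫⁻ z : ℂ, f ‖z‖ = ENNReal.ofReal (2 * Real.pi) * ∫⁻ r in Set.Ioi (0 : ℝ),
      ENNReal.ofReal r * f r := by
  rw [lintegral_complex_polar (f := fun z => f ‖z‖) (hf.comp measurable_norm),
    ← lintegral_const_mul' _ _ ENNReal.ofReal_ne_top]
  refine setLIntegral_congr_fun measurableSet_Ioi fun r hr => ?_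
  have h1 : ∀ θ : ℝ, ‖(r : ℂ) * Complex.exp (θ * Complex.I)‖ = r := fun θ => by
    rw [norm_mul, Complex.norm_exp_ofReal_mul_I, mul_one, Complex.norm_real, Real.norm_eq_abs,
      abs_of_pos hr]
  simp only [h1]
  rw [setLIntegral_const, Real.volume_Ioo, mul_comm]
  congr 2
  ring

namespace Params

variable (P : Params)

/-- The integrand of `laplaceVis`. -/
noncomputable def visIntegrand (v : Vis) (s d : ℝ) : ℝ :=
  (1 - P.kappa v (s * P.pathGain v d)) * d * P.pVis v d

lemma visIntegrand_nonneg (v : Vis) {s d : ℝ} (hs : 0 ≤ s) (hd : 0 ≤ d) :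
    0 ≤ P.visIntegrand v s d :=
  mul_nonneg (mul_nonneg (sub_nonneg.2 (P.kappa_le_one v
    (mul_nonneg hs (P.pathGain_nonneg v hd)))) hd) (P.pVis_nonneg v hd)

@[fun_prop]
lemma measurable_visIntegrand (v : Vis) (s : ℝ) : Measurable (P.visIntegrand v s) := by
  unfold visIntegrand; fun_prop

lemma visIntegrand_le (v : Vis) {s d : ℝ} (hs : 0 ≤ s) (hd : 0 ≤ d) :
    P.visIntegrand v s d ≤ s * (P.gain 0 * (P.pathGain v d * d * P.pVis v d)) := by
  have h := P.one_sub_kappa_le v (mul_nonneg hs (P.pathGain_nonneg v hd))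
  calc P.visIntegrand v s d ≤ (P.gain 0 * (s * P.pathGain v d)) * d * P.pVis v d := by
        unfold visIntegrand
        exact mul_le_mul_of_nonneg_right (mul_le_mul_of_nonneg_right h hd) (P.pVis_nonneg v hd)
    _ = _ := by ring

/-- For LoS the blockage factor `exp (-β d)` decays, and the path loss is bounded by its value at `t
> 0`, so any positive exponent works. For NLoS there is no such decay, and the exponent must exceed
`2`. -/
lemma integrableOn_pathGain (v : Vis) {t : ℝ} (ht : 0 < t) :
    IntegrableOn (fun d => P.gain 0 * (P.pathGain v d * d * P.pVis v d)) (Set.Ioi t) := by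
  refine Integrable.const_mul ?_ _
  have hpb := P.pb_pos
  have hz := P.zeta_pos
  have hm : Measurable fun d => P.pathGain v d * d * P.pVis v d := by fun_prop
  cases v with
  | L =>
    have h1 : IntegrableOn (fun d : ℝ => P.pb * P.zeta * t ^ (-P.alpha Vis.L)
        * (d ^ (1 : ℝ) * Real.exp (-P.beta * d ^ (1 : ℝ)))) (Set.Ioi t) :=
      ((integrableOn_rpow_mul_exp_neg_mul_rpow (by norm_num) one_pos P.beta_pos).mono_set
        (Set.Ioi_subset_Ioi ht.le)).const_mul _
    refine Integrable.mono' h1 hm.aestronglyMeasurable ?_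
    filter_upwards [ae_restrict_mem measurableSet_Ioi] with d hd
    have hd' : t < d := hd
    have hd0 : 0 < d := ht.trans hd'
    rw [Real.norm_of_nonneg (mul_nonneg (mul_nonneg (P.pathGain_nonneg _ hd0.le) hd0.le)
      (P.pVis_nonneg _ hd0.le)), pathGain, pVis, Real.rpow_one, mul_assoc]
    gcongr 1
    gcongr 1
    exact Real.rpow_le_rpow_of_nonpos ht hd'.le (by have := P.alphaL_pos; linarith)
  | N =>
    have h1 : IntegrableOn (fun d : ℝ => P.pb * P.zeta * d ^ (1 - P.alpha Vis.N)) (Set.Ioi t) :=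
      (integrableOn_Ioi_rpow_of_lt (by have := P.two_lt_alphaN; linarith) ht).const_mul _
    refine Integrable.mono' h1 hm.aestronglyMeasurable ?_
    filter_upwards [ae_restrict_mem measurableSet_Ioi] with d hd
    have hd0 : 0 < d := ht.trans hd
    have h2 := P.pathGain_nonneg Vis.N hd0.le
    rw [Real.norm_of_nonneg (mul_nonneg (mul_nonneg h2 hd0.le)
      (P.pVis_nonneg _ hd0.le))]
    calc P.pathGain Vis.N d * d * P.pVis Vis.N d ≤ P.pathGain Vis.N d * d * 1 := by
          gcongr; exact P.pVis_le_one _ hd0.le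
      _ = _ := by
          rw [pathGain, mul_one, mul_assoc, sub_eq_neg_add, Real.rpow_add hd0, Real.rpow_one]

lemma integrableOn_visIntegrand (v : Vis) {s t : ℝ} (hs : 0 ≤ s) (ht : 0 < t) :
    IntegrableOn (P.visIntegrand v s) (Set.Ioi t) := by
  refine Integrable.mono' ((P.integrableOn_pathGain v ht).const_mul s)
    (P.measurable_visIntegrand v s).aestronglyMeasurable ?_
  filter_upwards [ae_restrict_mem measurableSet_Ioi] with d hd
  have hd0 : 0 ≤ d := (ht.trans hd).le
  rw [Real.norm_of_nonneg (P.visIntegrand_nonneg v hs hd0)]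
  exact P.visIntegrand_le v hs hd0

lemma laplaceVis_eq (v : Vis) (t s : ℝ) : P.laplaceVis v t s
    = Real.exp (-2 * Real.pi * P.lamB * ∫ d in Set.Ioi t, P.visIntegrand v s d) := by
  unfold laplaceVis visIntegrand pathGain
  simp only [mul_assoc]

/-- Dominated convergence, with the linear bound on the integrand taken at `s₀ + 1`. The endpoint
`0` is included: it gives finiteness of the interference in the limit `s → 0`. -/
lemma continuousOn_laplaceVis (v : Vis) {t : ℝ} (ht : 0 < t) :
    ContinuousOn (P.laplaceVis v t) (Set.Ici 0) := by
  have h : ContinuousOn (fun s => ∫ d in Set.Ioi t, P.visIntegrand v s d) (Set.Ici 0) := by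
    intro s₀ hs₀
    refine continuousWithinAt_of_dominated
      (bound := fun d => (s₀ + 1) * (P.gain 0 * (P.pathGain v d * d * P.pVis v d))) ?_ ?_
      ((P.integrableOn_pathGain v ht).const_mul _) ?_
    · exact Eventually.of_forall fun s => (P.measurable_visIntegrand v s).aestronglyMeasurable
    · have h1 : ∀ᶠ s in 𝓝[Set.Ici 0] s₀, s < s₀ + 1 :=
        nhdsWithin_le_nhds (Iio_mem_nhds (by linarith))
      filter_upwards [h1, self_mem_nhdsWithin] with s hs hs0
      filter_upwards [ae_restrict_mem measurableSet_Ioi] with d hd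
      have hd0 : 0 ≤ d := (ht.trans hd).le
      rw [Real.norm_of_nonneg (P.visIntegrand_nonneg v hs0 hd0)]
      refine (P.visIntegrand_le v hs0 hd0).trans (mul_le_mul_of_nonneg_right hs.le ?_)
      exact mul_nonneg (P.gain_nonneg 0) (mul_nonneg (mul_nonneg (P.pathGain_nonneg v hd0) hd0)
        (P.pVis_nonneg v hd0))
    · filter_upwards [ae_restrict_mem measurableSet_Ioi] with d hd
      have hd0 : 0 ≤ d := (ht.trans hd).le
      have hg := P.pathGain_nonneg v hd0
      have h2 : ContinuousOn (fun s => P.kappa v (s * P.pathGain v d)) (Set.Ici 0) :=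
        (P.continuousOn_kappa v).comp (by fun_prop) fun s hs => mul_nonneg hs hg
      unfold visIntegrand
      exact (((continuousOn_const.sub h2).mul continuousOn_const).mul continuousOn_const) s₀ hs₀
  have h3 : P.laplaceVis v t = fun s =>
      Real.exp (-2 * Real.pi * P.lamB * ∫ d in Set.Ioi t, P.visIntegrand v s d) :=
    funext fun s => P.laplaceVis_eq v t s
  rw [h3]
  exact Real.continuous_exp.comp_continuousOn (continuousOn_const.mul h)

lemma continuousOn_laplace {t : ℝ} (ht : 0 < t) : ContinuousOn (P.laplace t) (Set.Ici 0) :=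
  (P.continuousOn_laplaceVis Vis.L ht).mul (P.continuousOn_laplaceVis Vis.N ht)

lemma laplaceVis_zero (v : Vis) (t : ℝ) : P.laplaceVis v t 0 = 1 := by
  have h : P.kappa v 0 = 1 := by simp [kappa, P.sum_pGain]
  simp [laplaceVis, h]

lemma laplace_zero (t : ℝ) : P.laplace t 0 = 1 := by simp [laplace, laplaceVis_zero]

lemma laplace_pos (t s : ℝ) : 0 < P.laplace t s := mul_pos (Real.exp_pos _) (Real.exp_pos _)

/-- The Laplace exponent of the interference. -/
noncomputable def interfExponent (s : ℝ) (z : ℂ) : ℝ≥0∞ := negLog (P.markLaplace s ‖z‖)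

lemma measurable_interfExponent (s : ℝ) : Measurable (P.interfExponent s) := by
  unfold interfExponent; fun_prop

lemma expNeg_interfExponent {s : ℝ} (hs : 0 ≤ s) (z : ℂ) :
    expNeg (P.interfExponent s z) = ENNReal.ofReal (P.markLaplace s ‖z‖) :=
  expNeg_negLog (P.markLaplace_pos hs (norm_nonneg z)) (P.markLaplace_le_one hs (norm_nonneg z))

/-- With cost `-log (markLaplace)`, the integrand of the Laplace functional is `1 - markLaplace`
outside the disc. It is radial, so polar coordinates give the factor `2 π`, and it splits into the
two propagation types. -/
lemma tailLaplace_interfExponent {s t : ℝ} (hs : 0 ≤ s) (ht : 0 < t) :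
    tailLaplace P.lamB (P.interfExponent s) t = ENNReal.ofReal (P.laplace t s) := by
  have h1 : ∀ z : ℂ, 1 - expNeg (tail t (P.interfExponent s) z)
      = (Set.Ioi t).indicator (fun d => ENNReal.ofReal (1 - P.markLaplace s d)) ‖z‖ := fun z => by
    rcases lt_or_ge t ‖z‖ with h | h
    · rw [tail_of_lt h, P.expNeg_interfExponent hs, Set.indicator_of_mem (by exact h),
        ENNReal.ofReal_sub _ (P.markLaplace_pos hs (norm_nonneg z)).le, ENNReal.ofReal_one]
    · rw [tail_of_le h, expNeg_zero, Set.indicator_of_notMem (by simpa using h), tsub_self]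
  have hm : Measurable fun d => ENNReal.ofReal (1 - P.markLaplace s d) := by fun_prop
  have h2 : ∫⁻ z : ℂ, 1 - expNeg (tail t (P.interfExponent s) z)
      = ENNReal.ofReal (2 * Real.pi * (∫ d in Set.Ioi t, P.visIntegrand Vis.L s d
        + P.visIntegrand Vis.N s d)) := by
    have hpi : (0 : ℝ) ≤ 2 * Real.pi := by have := Real.pi_pos; positivity
    rw [lintegral_congr h1, lintegral_complex_radial (hm.indicator measurableSet_Ioi),
      ENNReal.ofReal_mul (p := 2 * Real.pi) hpi, ofReal_integral_eq_lintegral_ofReal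
        (f := fun d => P.visIntegrand Vis.L s d + P.visIntegrand Vis.N s d)
        ((P.integrableOn_visIntegrand _ hs ht).add (P.integrableOn_visIntegrand _ hs ht))]
    · congr 1
      have h3 : ∀ r : ℝ, ENNReal.ofReal r
            * (Set.Ioi t).indicator (fun d => ENNReal.ofReal (1 - P.markLaplace s d)) r
          = (Set.Ioi t).indicator
            (fun d => ENNReal.ofReal d * ENNReal.ofReal (1 - P.markLaplace s d)) r := fun r => by
        by_cases hr : r ∈ Set.Ioi t <;> simp [hr]
      rw [lintegral_congr h3, lintegral_indicator measurableSet_Ioi,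
        Measure.restrict_restrict measurableSet_Ioi,
        Set.inter_eq_self_of_subset_left (Set.Ioi_subset_Ioi ht.le)]
      refine setLIntegral_congr_fun measurableSet_Ioi fun d hd => ?_
      have hd0 : 0 ≤ d := (ht.trans hd).le
      rw [← ENNReal.ofReal_mul hd0, P.one_sub_markLaplace]
      congr 1
      unfold visIntegrand
      ring
    · filter_upwards [ae_restrict_mem measurableSet_Ioi] with d hd
      have hd0 : 0 ≤ d := (ht.trans hd).le
      exact add_nonneg (P.visIntegrand_nonneg _ hs hd0) (P.visIntegrand_nonneg _ hs hd0)
  have hlam := P.lamB_pos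
  rw [tailLaplace, h2, ← ENNReal.ofReal_mul hlam.le, expNeg_ofReal, integral_add
    (P.integrableOn_visIntegrand _ hs ht) (P.integrableOn_visIntegrand _ hs ht), laplace,
    P.laplaceVis_eq, P.laplaceVis_eq, ← Real.exp_add]
  · congr 2; ring
  · have : 0 ≤ ∫ d in Set.Ioi t, P.visIntegrand Vis.L s d + P.visIntegrand Vis.N s d :=
      setIntegral_nonneg measurableSet_Ioi fun d hd => by
        have hd0 : 0 ≤ d := (ht.trans hd).le
        exact add_nonneg (P.visIntegrand_nonneg _ hs hd0) (P.visIntegrand_nonneg _ hs hd0)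
    have := Real.pi_pos
    positivity

lemma laplace_le_one {s t : ℝ} (hs : 0 ≤ s) (ht : 0 < t) : P.laplace t s ≤ 1 := by
  have h := tailLaplace_le_one P.lamB (P.interfExponent s) t
  rw [P.tailLaplace_interfExponent hs ht, ENNReal.ofReal_le_one] at h
  exact h

end Params

namespace Network

variable {P : Params} {Ω : Type*} [mΩ : MeasurableSpace Ω] {μ : Measure Ω} (W : Network P μ)

lemma measurable_tbu : Measurable W.tbu := measurable_norm.comp (W.b_ppp.measurable 0)

lemma measurable_interf (i : ℕ) : Measurable (W.interf i) := by
  have : W.interf i = fun ω => P.markPower i (W.b i ω) (fun s => W.X s ω) :=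
    funext fun ω => W.interf_eq i ω
  rw [this]
  have h := (P.measurable_markPower i).comp
    (g := fun p : ℂ × (Source → ℝ) => P.markPower i p.1 p.2)
    (f := fun ω => (W.b i ω, fun s => W.X s ω)) ((W.b_ppp.measurable i).prodMk W.measurable_X)
  simpa only [Function.comp_def] using h

/-- The aggregate interference as an extended nonnegative number. -/
noncomputable def interfSum (ω : Ω) : ℝ≥0∞ := ∑' i, ENNReal.ofReal (W.interf (i + 1) ω)

lemma ae_interf_nonneg : ∀ᵐ ω ∂μ, ∀ i, 0 ≤ W.interf i ω := by
  have h : ∀ᵐ ω ∂μ, ∀ i, 0 ≤ W.X (.bsFading Vis.L i) ω ∧ 0 ≤ W.X (.bsFading Vis.N i) ω :=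
    ae_all_iff.2 fun i => (W.ae_fading_nonneg Vis.L i).and (W.ae_fading_nonneg Vis.N i)
  filter_upwards [h] with ω hω i
  have h1 := P.gainB_nonneg (W.dev i ω)
  have h2 := P.pb_pos
  have h3 := P.zeta_pos
  have h4 : 0 ≤ W.X (.bsFading (W.vis i ω) i) ω := by
    cases W.vis i ω
    · exact (hω i).1
    · exact (hω i).2
  unfold interf
  positivity

variable [IsProbabilityMeasure μ]

lemma ae_tbu_pos : ∀ᵐ ω ∂μ, 0 < W.tbu ω := W.b_ppp.ae_norm_pos P.lamB_pos.le W.nearest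

/-- With the positions frozen, averaging the marks turns the interference into the sum of the costs
`interfExponent`. The positions are then averaged by `setLIntegral_expNeg_nearest`. -/
lemma setLIntegral_expNeg_interfSum {s : ℝ} (hs : 0 ≤ s) {A : Set ℝ} (hA : MeasurableSet A) :
    ∫⁻ ω in W.tbu ⁻¹' A, expNeg (ENNReal.ofReal s * W.interfSum ω) ∂μ
      = ∫⁻ ω in W.tbu ⁻¹' A, ENNReal.ofReal (P.laplace (W.tbu ω) s) ∂μ := by
  have hTm := W.measurable_tbu
  have h1 : ∀ ω, ENNReal.ofReal s * W.interfSum ω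
      = ∑' i, ENNReal.ofReal (s * P.markPower (i + 1) (W.b (i + 1) ω) (fun s => W.X s ω)) :=
    fun ω => by
      rw [interfSum, ← ENNReal.tsum_mul_left]
      refine tsum_congr fun i => ?_
      rw [ENNReal.ofReal_mul hs, W.interf_eq]
  -- The event on the BS–user distance is carried as a factor depending on the positions only, so it
  -- passes through the average over the marks.
  set F : (ℕ → ℂ) → (Source → ℝ) → ℝ≥0∞ := fun y x =>
    A.indicator (fun _ => 1) ‖y 0‖
      * expNeg (∑' i, ENNReal.ofReal (s * P.markPower (i + 1) (y (i + 1)) x)) with hF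
  have hFm : Measurable (Function.uncurry F) := by
    refine Measurable.mul ?_ (expNeg_measurable.comp (Measurable.tsum fun i => ?_))
    · exact (measurable_const.indicator hA).comp
        (measurable_norm.comp ((measurable_pi_apply 0).comp measurable_fst))
    · have h := (P.measurable_markPower (i + 1)).comp
        (g := fun p : ℂ × (Source → ℝ) => P.markPower (i + 1) p.1 p.2)
        (f := fun p : (ℕ → ℂ) × (Source → ℝ) => (p.1 (i + 1), p.2))
        (((measurable_pi_apply (i + 1)).comp measurable_fst).prodMk measurable_snd)
      simp only [Function.comp_def] at h
      exact (h.const_mul s).ennreal_ofReal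
  have hind : IndepFun (fun ω i => W.b i ω) (fun ω s => W.X s ω) μ :=
    W.boX_indep.comp measurable_fst measurable_id
  have h2 : ∀ y : ℕ → ℂ, ∫⁻ ω, F y (fun s => W.X s ω) ∂μ
      = A.indicator (fun _ => 1) ‖y 0‖ * expNeg (∑' i, P.interfExponent s (y (i + 1))) := by
    intro y
    rw [hF]
    simp only
    rw [lintegral_const_mul', W.lintegral_expNeg_tsum (S := fun i => bsSet (i + 1))
      (c := fun i => P.interfExponent s (y (i + 1)))
      (e := fun i ω => ENNReal.ofReal (s * P.markPower (i + 1) (y (i + 1)) (fun s => W.X s ω)))]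
    · exact fun i j hij => bsSet_disjoint (by simpa using hij)
    · exact fun i => ((W.measurable_markPower_sig (i + 1) (y (i + 1))).const_mul s).ennreal_ofReal
    · intro i
      rw [W.lintegral_expNeg_markPower _ _ hs, P.expNeg_interfExponent hs]
    · by_cases h : ‖y 0‖ ∈ A <;> simp [h]
  have hmain := W.b_ppp.setLIntegral_expNeg_nearest P.lamB_pos.le W.nearest
    (P.measurable_interfExponent s) hA
  have hpre : {ω | ‖W.b 0 ω‖ ∈ A} = W.tbu ⁻¹' A := rfl
  rw [hpre] at hmain
  have hind2 : ∀ G : Ω → ℝ≥0∞, ∫⁻ ω in W.tbu ⁻¹' A, G ω ∂μ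
      = ∫⁻ ω, A.indicator (fun _ => 1) (W.tbu ω) * G ω ∂μ := fun G => by
    rw [← lintegral_indicator (hTm hA)]
    refine lintegral_congr fun ω => ?_
    by_cases h : W.tbu ω ∈ A <;> simp [h]
  calc ∫⁻ ω in W.tbu ⁻¹' A, expNeg (ENNReal.ofReal s * W.interfSum ω) ∂μ
      = ∫⁻ ω, F (fun i => W.b i ω) (fun s => W.X s ω) ∂μ := by
        rw [hind2]
        refine lintegral_congr fun ω => ?_
        rw [h1]; rfl
    _ = ∫⁻ ω in W.tbu ⁻¹' A, expNeg (∑' i, P.interfExponent s (W.b (i + 1) ω)) ∂μ := by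
        rw [lintegral_of_indepFun W.measurable_b W.measurable_X hind hFm, hind2]
        exact lintegral_congr fun ω => h2 fun i => W.b i ω
    _ = ∫⁻ ω in W.tbu ⁻¹' A, ENNReal.ofReal (P.laplace (W.tbu ω) s) ∂μ := by
        rw [hmain]
        refine setLIntegral_congr_fun_ae (hTm hA) ?_
        filter_upwards [W.ae_tbu_pos] with ω hω _
        exact P.tailLaplace_interfExponent hs hω

omit [IsProbabilityMeasure μ] in
lemma measurable_interfSum : Measurable W.interfSum :=
  Measurable.tsum fun i => (W.measurable_interf (i + 1)).ennreal_ofReal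

/-- For `s > 0` the variable `exp (-s I)` is at most the indicator of `I < ∞`. Its expectation tends
to `1` as `s → 0`, since the closed form is continuous at `0` with value `1`. -/
lemma ae_interfSum_lt_top : ∀ᵐ ω ∂μ, W.interfSum ω < ∞ := by
  have hm : MeasurableSet {ω | W.interfSum ω < ∞} :=
    measurableSet_lt W.measurable_interfSum measurable_const
  set u : ℕ → ℝ := fun n => 1 / ((n : ℝ) + 1) with hu
  have hupos : ∀ n, 0 < u n := fun n => by rw [hu]; positivity
  have hulim : Tendsto u atTop (𝓝 0) := tendsto_one_div_add_atTop_nhds_zero_nat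
  have hle : ∀ n, ∫⁻ ω, ENNReal.ofReal (P.laplace (W.tbu ω) (u n)) ∂μ
      ≤ μ {ω | W.interfSum ω < ∞} := fun n => by
    have h := W.setLIntegral_expNeg_interfSum (hupos n).le MeasurableSet.univ
    simp only [Set.preimage_univ, Measure.restrict_univ] at h
    rw [← h, ← lintegral_indicator_one hm]
    refine lintegral_mono fun ω => ?_
    by_cases hω : W.interfSum ω < ∞
    · rw [Set.indicator_of_mem (by exact hω)]; exact expNeg_le_one _
    · rw [Set.indicator_of_notMem (by exact hω), not_lt_top_iff.1 hω, ENNReal.mul_top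
        (by simpa using hupos n), expNeg_top]
  have hlim : Tendsto (fun n => ∫⁻ ω, ENNReal.ofReal (P.laplace (W.tbu ω) (u n)) ∂μ) atTop
      (𝓝 (∫⁻ _, 1 ∂μ)) := by
    -- Measurability in the distance is taken from the monotone function `tailLaplace`, which agrees
    -- with the closed form at positive distances.
    have hmeas : ∀ n, AEMeasurable (fun ω => ENNReal.ofReal (P.laplace (W.tbu ω) (u n))) μ := by
      intro n
      refine ⟨fun ω => tailLaplace P.lamB (P.interfExponent (u n)) (W.tbu ω),
        (tailLaplace_measurable _ _).comp W.measurable_tbu, ?_⟩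
      filter_upwards [W.ae_tbu_pos] with ω hω
      exact (P.tailLaplace_interfExponent (hupos n).le hω).symm
    refine tendsto_lintegral_of_dominated_convergence' (fun _ => 1) hmeas (fun n => ?_)
      (by simp) ?_
    · filter_upwards [W.ae_tbu_pos] with ω hω
      exact ENNReal.ofReal_le_one.2 (P.laplace_le_one (hupos n).le hω)
    · filter_upwards [W.ae_tbu_pos] with ω hω
      rw [← ENNReal.ofReal_one, ← P.laplace_zero (W.tbu ω)]
      refine ENNReal.tendsto_ofReal ?_
      exact ((P.continuousOn_laplace hω) 0 (by simp)).tendsto.comp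
        (tendsto_nhdsWithin_iff.2 ⟨hulim, Eventually.of_forall fun n => (hupos n).le⟩)
  have h1 : (1 : ℝ≥0∞) ≤ μ {ω | W.interfSum ω < ∞} := by
    have := le_of_tendsto' hlim hle
    simpa using this
  exact (prob_compl_eq_zero_iff hm).2 (le_antisymm prob_le_one h1)

lemma ae_summable_interf : ∀ᵐ ω ∂μ, Summable fun i => W.interf (i + 1) ω := by
  filter_upwards [W.ae_interfSum_lt_top, W.ae_interf_nonneg] with ω h1 h2
  have h3 := ENNReal.summable_toReal (f := fun i => ENNReal.ofReal (W.interf (i + 1) ω)) h1.ne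
  refine h3.congr fun i => ?_
  rw [ENNReal.toReal_ofReal (h2 _)]

/-- `I` is a real `tsum`, which would be `0` for a divergent series; almost sure summability
excludes that case. -/
lemma ae_interfSum_eq : ∀ᵐ ω ∂μ, W.interfSum ω = ENNReal.ofReal (W.I ω) := by
  filter_upwards [W.ae_summable_interf, W.ae_interf_nonneg] with ω h1 h2
  rw [interfSum, I, ENNReal.ofReal_tsum_of_nonneg (fun i => h2 _) h1]

omit [IsProbabilityMeasure μ] in
lemma ae_I_nonneg : ∀ᵐ ω ∂μ, 0 ≤ W.I ω := by
  filter_upwards [W.ae_interf_nonneg] with ω h2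
  exact tsum_nonneg fun i => h2 _

omit [IsProbabilityMeasure μ] in
lemma measurable_I : Measurable W.I := Measurable.tsum fun i => W.measurable_interf (i + 1)

/-- The conditional Laplace transform of the interference, in integrated form. -/
theorem setLIntegral_exp_interf {s : ℝ} (hs : 0 ≤ s) {A : Set ℝ} (hA : MeasurableSet A) :
    ∫⁻ ω in W.tbu ⁻¹' A, ENNReal.ofReal (Real.exp (-s * W.I ω)) ∂μ
      = ∫⁻ ω in W.tbu ⁻¹' A, ENNReal.ofReal (P.laplace (W.tbu ω) s) ∂μ := by
  rw [← W.setLIntegral_expNeg_interfSum hs hA]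
  refine setLIntegral_congr_fun_ae (W.measurable_tbu hA) ?_
  filter_upwards [W.ae_interfSum_eq, W.ae_I_nonneg] with ω h1 h2 _
  rw [h1, ← ENNReal.ofReal_mul hs, expNeg_ofReal (mul_nonneg hs h2), neg_mul]

end Network

end RISNet

namespace RISNet

open Filter Topology

/-! ### The derivative formula for a mixture of Erlang tails -/

section mixture

variable {ν : Measure ℝ} [IsProbabilityMeasure ν]

lemma integrable_exp_neg_mul (hν : ∀ᵐ y ∂ν, 0 ≤ y) {s : ℝ} (hs : 0 ≤ s) :
    Integrable (fun y => Real.exp (-s * y)) ν := by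
  refine Integrable.mono' (integrable_const (1 : ℝ)) (by fun_prop) ?_
  filter_upwards [hν] with y hy
  rw [Real.norm_of_nonneg (Real.exp_pos _).le, Real.exp_le_one_iff]
  have := mul_nonneg hs hy
  linarith

lemma continuousOn_integral_exp_neg (hν : ∀ᵐ y ∂ν, 0 ≤ y) :
    ContinuousOn (fun s => ∫ y, Real.exp (-s * y) ∂ν) (Set.Ici 0) := by
  intro s₀ hs₀
  refine continuousWithinAt_of_dominated (bound := fun _ => 1) ?_ ?_ (integrable_const _) ?_
  · exact Eventually.of_forall fun s => by fun_prop
  · filter_upwards [self_mem_nhdsWithin] with s hs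
    filter_upwards [hν] with y hy
    rw [Real.norm_of_nonneg (Real.exp_pos _).le, Real.exp_le_one_iff]
    have := mul_nonneg (show (0 : ℝ) ≤ s from hs) hy
    linarith
  · exact Eventually.of_forall fun y => by fun_prop

/-- The derivatives of a Laplace transform give the average of an Erlang tail. -/
theorem sum_iteratedDeriv_eq_integral_erlangTail (hν : ∀ᵐ y ∂ν, 0 ≤ y) (c : ℝ)
    {l : ℝ → ℝ} (hl : ∀ s, 0 ≤ s → ∫ y, Real.exp (-s * y) ∂ν = l s) (m : ℕ) {s : ℝ} (hs : 0 < s) :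
    ∑ k ∈ Finset.range m, s ^ k / (k.factorial : ℝ) * (-1) ^ k *
        iteratedDeriv k (fun s => Real.exp (-s * c) * l s) s
      = ∫ y, erlangTail m (s * (c + y)) ∂ν := by
  have hexp : ∀ t : ℝ, 0 ≤ t → Integrable (fun y => Real.exp (t * (-(c + y)))) ν := fun t ht => by
    refine ((integrable_exp_neg_mul hν ht).const_mul (Real.exp (-t * c))).congr
      (Eventually.of_forall fun y => ?_)
    simp only
    rw [← Real.exp_add]; ring_nf
  -- The variable `-(c + y)` is almost surely bounded above, so all exponents `t > 0` are
  -- admissible, and differentiation under the integral is legitimate at `s > 0`.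
  have hint : s ∈ interior (integrableExpSet (fun y => -(c + y)) ν) := by
    refine mem_interior.2 ⟨Set.Ioi 0, fun t ht => hexp t (le_of_lt ht), isOpen_Ioi, hs⟩
  -- Nothing is known about `l` at negative arguments, but agreement near `s` determines the
  -- iterated derivatives there.
  have hmgf : (fun s => Real.exp (-s * c) * l s) =ᶠ[𝓝 s] mgf (fun y => -(c + y)) ν := by
    filter_upwards [Ioi_mem_nhds hs] with t ht
    rw [← hl t (le_of_lt ht), ← integral_const_mul, mgf]
    refine integral_congr_ae (Eventually.of_forall fun y => ?_)
    simp only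
    rw [← Real.exp_add]; ring_nf
  have hterm : ∀ k, s ^ k / (k.factorial : ℝ) * (-1) ^ k *
      iteratedDeriv k (fun s => Real.exp (-s * c) * l s) s
      = ∫ y, (s * (c + y)) ^ k / (k.factorial : ℝ) * Real.exp (-(s * (c + y))) ∂ν := fun k => by
    rw [hmgf.iteratedDeriv_eq, iteratedDeriv_mgf hint, ← integral_const_mul]
    refine integral_congr_ae (Eventually.of_forall fun y => ?_)
    simp only
    rw [neg_pow (c + y), mul_pow, mul_neg]
    have h1 : ((-1 : ℝ) ^ k) * (-1) ^ k = 1 := by rw [← mul_pow]; simp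
    linear_combination (s ^ k / (k.factorial : ℝ) * (c + y) ^ k * Real.exp (-(s * (c + y)))) * h1
  rw [Finset.sum_congr rfl fun k _ => hterm k, ← integral_finsetSum]
  · rfl
  · intro k _
    have h := (integrable_pow_mul_exp_of_mem_interior_integrableExpSet hint k).const_mul
      (s ^ k / (k.factorial : ℝ) * (-1) ^ k)
    refine h.congr (Eventually.of_forall fun y => ?_)
    simp only
    rw [neg_pow (c + y), mul_pow, mul_neg]
    have h1 : ((-1 : ℝ) ^ k) * (-1) ^ k = 1 := by rw [← mul_pow]; simp
    linear_combination (s ^ k / (k.factorial : ℝ) * (c + y) ^ k * Real.exp (-(s * (c + y)))) * h1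

/-- Binomial expansion of the integrand by `one_sub_one_sub_pow`; each power of the exponential
integrates to a value of the Laplace transform. -/
theorem sum_choose_eq_integral (hν : ∀ᵐ y ∂ν, 0 ≤ y) (c : ℝ)
    {l : ℝ → ℝ} (hl : ∀ s, 0 ≤ s → ∫ y, Real.exp (-s * y) ∂ν = l s) (m : ℕ) {β s : ℝ} (hβ : 0 ≤ β)
    (hs : 0 ≤ s) :
    ∑ k ∈ Finset.Icc 1 m, (m.choose k : ℝ) * (-1) ^ (k + 1) *
        Real.exp (-(k : ℝ) * β * s * c) * l (k * β * s)
      = ∫ y, (1 - (1 - Real.exp (-(β * (s * (c + y))))) ^ m) ∂ν := by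
  have h1 : ∀ k : ℕ, (m.choose k : ℝ) * (-1) ^ (k + 1) *
      Real.exp (-(k : ℝ) * β * s * c) * l (k * β * s)
      = ∫ y, (m.choose k : ℝ) * (-1) ^ (k + 1) * Real.exp (-(k : ℝ) * β * s * c)
        * Real.exp (-(k * β * s) * y) ∂ν := fun k => by
    rw [integral_const_mul, hl _ (by positivity)]
  rw [Finset.sum_congr rfl fun k _ => h1 k, ← integral_finsetSum]
  · refine integral_congr_ae (Eventually.of_forall fun y => ?_)
    simp only
    rw [one_sub_one_sub_pow]
    refine Finset.sum_congr rfl fun k _ => ?_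
    rw [mul_assoc _ (Real.exp _) (Real.exp _), ← Real.exp_add, ← Real.exp_nat_mul]
    ring_nf
  · exact fun k _ => (integrable_exp_neg_mul hν (by positivity)).const_mul _

lemma integrable_erlangTail (hν : ∀ᵐ y ∂ν, 0 ≤ y) {c : ℝ} (hc : 0 ≤ c) (m : ℕ) {s : ℝ}
    (hs : 0 ≤ s) : Integrable (fun y => erlangTail m (s * (c + y))) ν := by
  have hm : Continuous (erlangTail m) := continuous_erlangTail m
  refine Integrable.mono' (integrable_const (1 : ℝ)) (by fun_prop) ?_
  filter_upwards [hν] with y hy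
  have h : 0 ≤ s * (c + y) := by positivity
  rw [Real.norm_of_nonneg (erlangTail_nonneg m h)]
  exact erlangTail_le_one m h

theorem integral_erlangTail_le (hν : ∀ᵐ y ∂ν, 0 ≤ y) {c : ℝ} (hc : 0 ≤ c) {m : ℕ} (hm : 0 < m)
    {s : ℝ} (hs : 0 ≤ s) : ∫ y, erlangTail m (s * (c + y)) ∂ν
      ≤ ∫ y, (1 - (1 - Real.exp (-((m.factorial : ℝ) ^ (-1 / (m : ℝ)) * (s * (c + y))))) ^ m) ∂ν := by
  refine integral_mono_ae (integrable_erlangTail hν hc m hs) ?_ ?_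
  · refine Integrable.mono' (integrable_const (1 : ℝ)) (by fun_prop) ?_
    filter_upwards [hν] with y hy
    have h : 0 ≤ (m.factorial : ℝ) ^ (-1 / (m : ℝ)) * (s * (c + y)) := by positivity
    have h1 : Real.exp (-((m.factorial : ℝ) ^ (-1 / (m : ℝ)) * (s * (c + y)))) ≤ 1 := by
      rw [Real.exp_le_one_iff]; linarith
    have h2 := Real.exp_pos (-((m.factorial : ℝ) ^ (-1 / (m : ℝ)) * (s * (c + y))))
    have h3 := pow_nonneg (sub_nonneg.2 h1) m
    have h4 := pow_le_one₀ (n := m) (sub_nonneg.2 h1) (by linarith)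
    rw [Real.norm_of_nonneg (by linarith)]
    linarith
  · filter_upwards [hν] with y hy
    exact erlangTail_le hm (by positivity)

end mixture

namespace Params

variable (P : Params)

lemma mLink_pos (q : Link) : 0 < P.mLink q := by cases q <;> exact P.m_pos _

lemma betaLink_nonneg (q : Link) : 0 ≤ P.betaLink q := by unfold betaLink; positivity

/-- Each sum has a single term, `k = 0` on the left and `k = 1` on the right, and `betaLink` is `1`.
-/
lemma condCov_eq_condCovApprox {q : Link} (h : P.mLink q = 1) (γ t r θ : ℝ) :
    P.condCov q γ t r θ = P.condCovApprox q γ t r θ := by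
  simp [condCov, condCovApprox, betaLink, h]

@[fun_prop]
lemma measurable_tbr : Measurable fun p : ℝ × ℝ × ℝ => tbr p.1 p.2.1 p.2.2 := by
  unfold tbr; fun_prop

lemma measurable_meanPower (q : Link) :
    Measurable fun p : ℝ × ℝ × ℝ => P.meanPower q p.1 p.2.1 p.2.2 := by
  cases q <;> · unfold meanPower; fun_prop

lemma measurable_sArg (q : Link) (γ : ℝ) :
    Measurable fun p : ℝ × ℝ × ℝ => P.sArg q γ p.1 p.2.1 p.2.2 := by
  unfold sArg
  exact measurable_const.div (P.measurable_meanPower q)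

lemma Gb_pos : 0 < P.Gb := by
  have := P.two_le_Nb
  unfold Gb
  exact_mod_cast (by omega : 0 < P.Nb)

lemma meanPower_pos {q : Link} (hq : q ≠ Link.CL) {t : ℝ} (ht : 0 < t) (r θ : ℝ) :
    0 < P.meanPower q t r θ := by
  have := P.pb_pos
  have := P.zeta_pos
  have := P.Gb_pos
  cases q with
  | CL => exact absurd rfl hq
  | DL => unfold meanPower; positivity
  | DN => unfold meanPower; positivity

lemma meanPower_CL_pos {t r θ : ℝ} (hr : 0 < r) (h : 0 < tbr t r θ) :
    0 < P.meanPower Link.CL t r θ := by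
  have := P.pb_pos
  have := P.zeta_pos
  have := P.Gb_pos
  have : 0 < P.Gr := by have := P.Nr_pos; unfold Gr; positivity
  unfold meanPower; positivity

lemma sArg_pos {q : Link} {γ t r θ : ℝ} (hγ : 0 < γ) (h : 0 < P.meanPower q t r θ) :
    0 < P.sArg q γ t r θ := by
  have : (0 : ℝ) < P.mLink q := by exact_mod_cast P.mLink_pos q
  unfold sArg; positivity

end Params

/-! ### Conditional law of the interference and conditional coverage -/

namespace Network

variable {P : Params} {Ω : Type*} [mΩ : MeasurableSpace Ω] {μ : Measure Ω} (W : Network P μ)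
variable [IsProbabilityMeasure μ]

/-- Conditional law of the interference given the BS–user distance. -/
noncomputable def interfLaw : Kernel ℝ ℝ := condDistrib W.I W.tbu μ

instance : IsMarkovKernel W.interfLaw := by unfold interfLaw; infer_instance

/-- Disintegration of the joint law of distance and interference along the distance. -/
lemma lintegral_tbu_I {F : ℝ → ℝ → ℝ≥0∞} (hF : Measurable (Function.uncurry F)) :
    ∫⁻ ω, F (W.tbu ω) (W.I ω) ∂μ = ∫⁻ ω, ∫⁻ y, F (W.tbu ω) y ∂(W.interfLaw (W.tbu ω)) ∂μ := by
  have h := compProd_map_condDistrib (mβ := Real.measurableSpace) (μ := μ) (X := W.tbu) (Y := W.I)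
    W.measurable_I.aemeasurable
  calc ∫⁻ ω, F (W.tbu ω) (W.I ω) ∂μ
      = ∫⁻ p, Function.uncurry F p ∂(μ.map fun ω => (W.tbu ω, W.I ω)) :=
        (lintegral_map hF (W.measurable_tbu.prodMk W.measurable_I)).symm
    _ = ∫⁻ t, ∫⁻ y, F t y ∂(W.interfLaw t) ∂(μ.map W.tbu) := by
        rw [← h, Measure.lintegral_compProd hF]; rfl
    _ = _ := lintegral_map (Measurable.lintegral_kernel_prod_right hF) W.measurable_tbu

lemma ae_interfLaw_nonneg : ∀ᵐ t ∂(μ.map W.tbu), ∀ᵐ y ∂(W.interfLaw t), 0 ≤ y := by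
  have hm : Measurable (Function.uncurry fun _ y : ℝ =>
      (Set.Iio (0 : ℝ)).indicator (1 : ℝ → ℝ≥0∞) y) :=
    (measurable_one.indicator measurableSet_Iio).comp measurable_snd
  have h := W.lintegral_tbu_I (F := fun _ y => (Set.Iio (0 : ℝ)).indicator (1 : ℝ → ℝ≥0∞) y) hm
  have h0 : ∫⁻ ω, (Set.Iio (0 : ℝ)).indicator (1 : ℝ → ℝ≥0∞) (W.I ω) ∂μ = 0 := by
    refine (lintegral_congr_ae ?_).trans lintegral_zero
    filter_upwards [W.ae_I_nonneg] with ω hω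
    simpa using hω
  rw [h0] at h
  have hm2 : Measurable fun t => W.interfLaw t (Set.Iio 0) :=
    Kernel.measurable_coe _ measurableSet_Iio
  have h1 : ∀ᵐ ω ∂μ, W.interfLaw (W.tbu ω) (Set.Iio 0) = 0 := by
    have h2 := (lintegral_eq_zero_iff (hm2.comp W.measurable_tbu)).1 (by
      rw [h]
      exact lintegral_congr fun ω => (lintegral_indicator_one measurableSet_Iio).symm)
    exact h2
  rw [ae_map_iff W.measurable_tbu.aemeasurable (by
    have : {t | ∀ᵐ y ∂(W.interfLaw t), 0 ≤ y} = (fun t => W.interfLaw t (Set.Iio 0)) ⁻¹' {0} := by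
      ext t
      simp only [Set.mem_preimage, Set.mem_singleton_iff]
      rw [measure_eq_zero_iff_ae_notMem]
      simp
    rw [this]
    exact hm2 (measurableSet_singleton _))]
  filter_upwards [h1] with ω hω
  filter_upwards [measure_eq_zero_iff_ae_notMem.1 hω] with y hy
  simpa using hy

/-- Both functions of `t` have the same integral over every measurable set of distances, by
`setLIntegral_exp_interf`. The exceptional null set still depends on `s`. -/
lemma ae_lintegral_interfLaw {s : ℝ} (hs : 0 ≤ s) : ∀ᵐ t ∂(μ.map W.tbu),
    ∫⁻ y, ENNReal.ofReal (Real.exp (-s * y)) ∂(W.interfLaw t)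
      = tailLaplace P.lamB (P.interfExponent s) t := by
  have : IsProbabilityMeasure (μ.map W.tbu) :=
    Measure.isProbabilityMeasure_map W.measurable_tbu.aemeasurable
  have hm : Measurable fun t => ∫⁻ y, ENNReal.ofReal (Real.exp (-s * y)) ∂(W.interfLaw t) :=
    Measurable.lintegral_kernel_prod_right (f := fun _ y => ENNReal.ofReal (Real.exp (-s * y)))
      (by fun_prop)
  have hm2 := tailLaplace_measurable P.lamB (P.interfExponent s)
  refine ae_eq_of_forall_setLIntegral_eq_of_sigmaFinite hm hm2 fun A hA _ => ?_
  rw [setLIntegral_map hA hm W.measurable_tbu, setLIntegral_map hA hm2 W.measurable_tbu]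
  have h1 : ∫⁻ ω in W.tbu ⁻¹' A, tailLaplace P.lamB (P.interfExponent s) (W.tbu ω) ∂μ
      = ∫⁻ ω in W.tbu ⁻¹' A, ENNReal.ofReal (P.laplace (W.tbu ω) s) ∂μ := by
    refine setLIntegral_congr_fun_ae (W.measurable_tbu hA) ?_
    filter_upwards [W.ae_tbu_pos] with ω hω _
    exact P.tailLaplace_interfExponent hs hω
  rw [h1, ← W.setLIntegral_exp_interf hs hA, ← lintegral_indicator (W.measurable_tbu hA),
    ← lintegral_indicator (W.measurable_tbu hA)]
  have h2 := W.lintegral_tbu_I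
    (F := fun t y => A.indicator (fun _ => 1) t * ENNReal.ofReal (Real.exp (-s * y))) (by
      refine Measurable.mul ?_ (by fun_prop)
      exact (measurable_const.indicator hA).comp measurable_fst)
  calc _ = ∫⁻ ω, ∫⁻ y, A.indicator (fun _ => 1) (W.tbu ω) * ENNReal.ofReal (Real.exp (-s * y))
          ∂(W.interfLaw (W.tbu ω)) ∂μ := by
        refine lintegral_congr fun ω => ?_
        by_cases h : W.tbu ω ∈ A <;> simp [h]
    _ = _ := by
        rw [← h2]
        refine lintegral_congr fun ω => ?_
        by_cases h : W.tbu ω ∈ A <;> simp [h]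

lemma ae_map_tbu_pos : ∀ᵐ t ∂(μ.map W.tbu), 0 < t :=
  (ae_map_iff W.measurable_tbu.aemeasurable measurableSet_Ioi).2 W.ae_tbu_pos

/-- Almost surely the conditional law of the interference has the given Laplace transform. -/
theorem ae_integral_interfLaw : ∀ᵐ t ∂(μ.map W.tbu), ∀ s, 0 ≤ s →
    ∫ y, Real.exp (-s * y) ∂(W.interfLaw t) = P.laplace t s := by
  -- Countably many `s` share one null set of distances.
  have h1 : ∀ᵐ t ∂(μ.map W.tbu), ∀ s : ℚ, 0 ≤ s →
      ∫⁻ y, ENNReal.ofReal (Real.exp (-(s : ℝ) * y)) ∂(W.interfLaw t)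
        = tailLaplace P.lamB (P.interfExponent s) t :=
    ae_all_iff.2 fun s => by
      by_cases hs : 0 ≤ s
      · filter_upwards [W.ae_lintegral_interfLaw (s := s) (by exact_mod_cast hs)] with t ht _
        exact ht
      · exact Eventually.of_forall fun t h => absurd h hs
  filter_upwards [h1, W.ae_interfLaw_nonneg, W.ae_map_tbu_pos] with t h hν ht s hs
  have hq : ∀ s : ℚ, 0 ≤ s → ∫ y, Real.exp (-(s : ℝ) * y) ∂(W.interfLaw t) = P.laplace t s :=
    fun s hs => by
    have hs' : (0 : ℝ) ≤ s := by exact_mod_cast hs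
    rw [integral_eq_lintegral_of_nonneg_ae (Eventually.of_forall fun y => (Real.exp_pos _).le)
      (by fun_prop), h s hs, P.tailLaplace_interfExponent hs' ht,
      ENNReal.toReal_ofReal (P.laplace_pos t s).le]
  -- Approximation from above keeps the rationals in `[0, ∞)`, where both sides are continuous, also
  -- for `s = 0`.
  obtain ⟨u, -, hu, hlim⟩ := Real.exists_seq_rat_strictAnti_tendsto s
  have hu0 : ∀ n, (0 : ℝ) ≤ u n := fun n => hs.trans (hu n).le
  have hw : Tendsto (fun n => (u n : ℝ)) atTop (𝓝[Set.Ici 0] s) :=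
    tendsto_nhdsWithin_iff.2 ⟨hlim, Eventually.of_forall hu0⟩
  have h2 := ((continuousOn_integral_exp_neg hν) s hs).tendsto.comp hw
  have h3 := ((P.continuousOn_laplace ht) s hs).tendsto.comp hw
  refine tendsto_nhds_unique h2 (h3.congr fun n => ?_)
  exact (hq (u n) (by exact_mod_cast hu0 n)).symm

/-- Conditional coverage probability as an average of Erlang tails. -/
noncomputable def coverage (q : Link) (γ t r θ : ℝ) : ℝ≥0∞ :=
  ∫⁻ y, ENNReal.ofReal (erlangTail (P.mLink q) (P.sArg q γ t r θ * (P.sigma2 + y))) ∂(W.interfLaw t)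

/-- Integrals against a kernel are measurable in its parameter. Thus `coverage` is a measurable
substitute for `condCov`, whose iterated derivatives are never shown to be measurable. -/
lemma measurable_coverage (q : Link) (γ : ℝ) :
    Measurable fun p : ℝ × ℝ × ℝ => W.coverage q γ p.1 p.2.1 p.2.2 := by
  have h := P.measurable_sArg q γ
  have h2 : Measurable (erlangTail (P.mLink q)) := (continuous_erlangTail _).measurable
  have h3 : Measurable fun p : (ℝ × ℝ × ℝ) × ℝ => P.sArg q γ p.1.1 p.1.2.1 p.1.2.2 :=
    h.comp (measurable_fst (α := ℝ × ℝ × ℝ) (β := ℝ))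
  have h4 : Measurable fun p : (ℝ × ℝ × ℝ) × ℝ =>
      P.sArg q γ p.1.1 p.1.2.1 p.1.2.2 * (P.sigma2 + p.2) :=
    h3.mul (measurable_const.add measurable_snd)
  have h5 := Measurable.lintegral_kernel_prod_right'
    (κ := W.interfLaw.comap (Prod.fst : ℝ × ℝ × ℝ → ℝ) measurable_fst) (h2.comp h4).ennreal_ofReal
  simp only [Kernel.comap_apply, Function.comp_apply] at h5
  exact h5

/-- For a distance at which the conditional law is nonnegative and has the right Laplace transform
for all `s`, everything is deterministic, so one null set of distances serves all `q`, `γ`, `r`,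
`θ`. The bound by `1` supplies the finiteness of later integrals. -/
lemma ae_coverage : ∀ᵐ t ∂(μ.map W.tbu), ∀ q γ r θ, 0 < γ → 0 < P.meanPower q t r θ →
    W.coverage q γ t r θ = ENNReal.ofReal (P.condCov q γ t r θ) ∧ 0 ≤ P.condCov q γ t r θ ∧
      P.condCov q γ t r θ ≤ P.condCovApprox q γ t r θ ∧ P.condCovApprox q γ t r θ ≤ 1 := by
  filter_upwards [W.ae_integral_interfLaw, W.ae_interfLaw_nonneg] with t hl hν q γ r θ hγ hP
  have hs := P.sArg_pos hγ hP
  have hσ := P.sigma2_pos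
  have h1 : P.condCov q γ t r θ
      = ∫ y, erlangTail (P.mLink q) (P.sArg q γ t r θ * (P.sigma2 + y)) ∂(W.interfLaw t) :=
    sum_iteratedDeriv_eq_integral_erlangTail hν P.sigma2 hl _ hs
  have h2 : P.condCovApprox q γ t r θ = _ :=
    sum_choose_eq_integral hν P.sigma2 hl (P.mLink q) (P.betaLink_nonneg q) hs.le
  have hnn : ∀ᵐ y ∂(W.interfLaw t),
      0 ≤ erlangTail (P.mLink q) (P.sArg q γ t r θ * (P.sigma2 + y)) := by
    filter_upwards [hν] with y hy
    exact erlangTail_nonneg _ (by positivity)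
  refine ⟨?_, ?_, ?_, ?_⟩
  · rw [h1, coverage, ofReal_integral_eq_lintegral_ofReal
      (integrable_erlangTail hν hσ.le _ hs.le) hnn]
  · rw [h1]; exact integral_nonneg_of_ae hnn
  · rw [h1, h2]
    exact integral_erlangTail_le hν hσ.le (P.mLink_pos q) hs.le
  · rw [h2]
    refine (integral_mono_of_nonneg (g := fun _ => (1 : ℝ)) ?_ (integrable_const _) ?_).trans
      (by simp)
    · filter_upwards [hν] with y hy
      have h : 0 ≤ P.betaLink q * (P.sArg q γ t r θ * (P.sigma2 + y)) :=
        mul_nonneg (P.betaLink_nonneg q) (by positivity)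
      have h3 := Real.exp_pos (-(P.betaLink q * (P.sArg q γ t r θ * (P.sigma2 + y))))
      have h4 : Real.exp (-(P.betaLink q * (P.sArg q γ t r θ * (P.sigma2 + y)))) ≤ 1 := by
        rw [Real.exp_le_one_iff]; linarith
      exact sub_nonneg.2 (pow_le_one₀ (sub_nonneg.2 h4) (by linarith))
    · filter_upwards [hν] with y hy
      have h : 0 ≤ P.betaLink q * (P.sArg q γ t r θ * (P.sigma2 + y)) :=
        mul_nonneg (P.betaLink_nonneg q) (by positivity)
      have h4 : Real.exp (-(P.betaLink q * (P.sArg q γ t r θ * (P.sigma2 + y)))) ≤ 1 := by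
        rw [Real.exp_le_one_iff]; linarith
      exact sub_le_self _ (pow_nonneg (sub_nonneg.2 h4) _)

end Network

end RISNet

namespace RISNet

open Filter Topology

/-! ### The reflection probability -/

lemma inner_exp_mul_I (φ ρ α : ℝ) :
    inner ℝ (Complex.exp (φ * Complex.I)) ((ρ : ℂ) * Complex.exp (α * Complex.I))
      = ρ * Real.cos (φ - α) := by
  rw [Complex.inner, ← Complex.exp_conj, map_mul, Complex.conj_ofReal, Complex.conj_I]
  have h : (ρ : ℂ) * Complex.exp (α * Complex.I) * Complex.exp (φ * -Complex.I)
      = (ρ : ℂ) * Complex.exp (((α - φ : ℝ) : ℂ) * Complex.I) := by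
    rw [mul_assoc, ← Complex.exp_add]
    push_cast
    ring_nf
  rw [h, Complex.re_ofReal_mul, Complex.exp_ofReal_mul_I_re, ← Real.cos_neg, neg_sub]

lemma cos_pos_iff_of_abs_lt {x : ℝ} (h1 : -(3 * Real.pi / 2) < x) (h2 : x < 3 * Real.pi / 2) :
    0 < Real.cos x ↔ -(Real.pi / 2) < x ∧ x < Real.pi / 2 := by
  constructor
  · intro h
    by_contra hc
    have : -(Real.pi / 2) < x → Real.pi / 2 ≤ x := fun h3 => by
      by_contra h4; exact hc ⟨h3, not_le.1 h4⟩
    have hle : Real.cos x ≤ 0 := by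
      by_cases h3 : -(Real.pi / 2) < x
      · exact Real.cos_nonpos_of_pi_div_two_le_of_le (this h3) (by linarith)
      · rw [← Real.cos_neg]
        exact Real.cos_nonpos_of_pi_div_two_le_of_le (by linarith) (by linarith)
    linarith
  · rintro ⟨h3, h4⟩
    exact Real.cos_pos_of_mem_Ioo ⟨h3, h4⟩

/-- Two open half-circles centred at the angles `0` and `c` intersect in a single arc; within the
window `(-π, π]` no wrap-around occurs, since `cos ψ > 0` already confines `ψ` to `(-π / 2, π / 2)`.
-/
lemma volume_cos_pos {c : ℝ} (h1 : -Real.pi < c) (h2 : c ≤ Real.pi) :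
    volume.real (Set.Ioc (-Real.pi) Real.pi ∩ {ψ | 0 < Real.cos ψ ∧ 0 < Real.cos (ψ - c)})
      = Real.pi - |c| := by
  have hpi := Real.pi_pos
  have hset : Set.Ioc (-Real.pi) Real.pi ∩ {ψ | 0 < Real.cos ψ ∧ 0 < Real.cos (ψ - c)}
      = Set.Ioo (max (-(Real.pi / 2)) (c - Real.pi / 2)) (min (Real.pi / 2) (c + Real.pi / 2)) := by
    ext ψ
    simp only [Set.mem_inter_iff, Set.mem_Ioc, Set.mem_ofPred_eq, Set.mem_Ioo, max_lt_iff,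
      lt_min_iff]
    constructor
    · rintro ⟨⟨h3, h4⟩, h5, h6⟩
      obtain ⟨h7, h8⟩ := (cos_pos_iff_of_abs_lt (by linarith) (by linarith)).1 h5
      obtain ⟨h9, h10⟩ := (cos_pos_iff_of_abs_lt (by linarith) (by linarith)).1 h6
      exact ⟨⟨h7, by linarith⟩, h8, by linarith⟩
    · rintro ⟨⟨h3, h4⟩, h5, h6⟩
      exact ⟨⟨by linarith, by linarith⟩, Real.cos_pos_of_mem_Ioo ⟨h3, h5⟩,
        Real.cos_pos_of_mem_Ioo ⟨by linarith, by linarith⟩⟩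
  rw [hset, measureReal_def, Real.volume_Ioo]
  rcases le_total 0 c with hc | hc
  · rw [abs_of_nonneg hc, max_eq_right (by linarith), min_eq_left (by linarith),
      ENNReal.toReal_ofReal (by linarith)]
    ring
  · rw [abs_of_nonpos hc, max_eq_left (by linarith), min_eq_right (by linarith),
      ENNReal.toReal_ofReal (by linarith)]
    ring

/-- Probability that two directions are both in a half-plane with uniformly random normal. -/
theorem unif_inner_pos {u v : ℂ} (hu : u ≠ 0) (hv : v ≠ 0) :
    unif 0 (2 * Real.pi) {φ : ℝ | 0 < inner ℝ (Complex.exp (φ * Complex.I)) u ∧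
      0 < inner ℝ (Complex.exp (φ * Complex.I)) v}
      = ENNReal.ofReal (1 / 2 - 1 / (2 * Real.pi) * InnerProductGeometry.angle u v) := by
  have hpi := Real.pi_pos
  set a := u.arg with ha
  set c := (v / u).arg with hc
  set S : Set ℝ := {φ | 0 < Real.cos (φ - a) ∧ 0 < Real.cos (φ - a - c)} with hS
  have hu' : u = (‖u‖ : ℂ) * Complex.exp (a * Complex.I) := (Complex.norm_mul_exp_arg_mul_I u).symm
  have hv' : v = ((‖u‖ * ‖v / u‖ : ℝ) : ℂ) * Complex.exp (((a + c : ℝ) : ℂ) * Complex.I) := by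
    have h1 := Complex.norm_mul_exp_arg_mul_I (v / u)
    rw [← hc] at h1
    have h2 : v = u * (v / u) := by field_simp
    calc v = u * (v / u) := h2
      _ = (‖u‖ : ℂ) * Complex.exp (a * Complex.I)
          * ((‖v / u‖ : ℂ) * Complex.exp (c * Complex.I)) := by rw [h1, ← hu']
      _ = _ := by
        rw [Complex.ofReal_mul, Complex.ofReal_add, add_mul, Complex.exp_add]
        ring
  have hset : {φ : ℝ | 0 < inner ℝ (Complex.exp (φ * Complex.I)) u ∧
      0 < inner ℝ (Complex.exp (φ * Complex.I)) v} = S := by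
    ext φ
    have h1 : 0 < ‖u‖ := norm_pos_iff.2 hu
    have h2 : 0 < ‖u‖ * ‖v / u‖ := mul_pos h1 (norm_pos_iff.2 (div_ne_zero hv hu))
    have h3 : inner ℝ (Complex.exp (φ * Complex.I)) u = ‖u‖ * Real.cos (φ - a) := by
      conv_lhs => rw [hu']
      exact inner_exp_mul_I _ _ _
    have h4 : inner ℝ (Complex.exp (φ * Complex.I)) v
        = ‖u‖ * ‖v / u‖ * Real.cos (φ - a - c) := by
      conv_lhs => rw [hv']
      rw [inner_exp_mul_I, sub_sub]
    rw [hS, Set.mem_ofPred_eq, Set.mem_ofPred_eq, h3, h4, mul_pos_iff_of_pos_left h1,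
      mul_pos_iff_of_pos_left h2]
  have hm : ∀ d : ℝ, MeasurableSet {φ : ℝ | 0 < Real.cos (φ - d)} := fun d =>
    measurableSet_lt measurable_const (by fun_prop)
  have hSm : MeasurableSet S := by
    simp only [hS, sub_sub]
    exact (hm a).inter (hm (a + c))
  have hvol : volume.real (Set.Ioc 0 (2 * Real.pi) ∩ S) = Real.pi - |c| := by
    -- Periodicity allows the window `[0, 2 π]` to be shifted so that the direction of `u` is at
    -- angle `0`, the situation of `volume_cos_pos`.
    have hper : Function.Periodic (S.indicator (1 : ℝ → ℝ)) (2 * Real.pi) := fun φ => by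
      have h1 : (φ + 2 * Real.pi ∈ S) = (φ ∈ S) := by
        have h5 : φ + 2 * Real.pi - a = (φ - a) + 2 * Real.pi := by ring
        have h6 : φ + 2 * Real.pi - a - c = (φ - a - c) + 2 * Real.pi := by ring
        rw [hS, Set.mem_ofPred_eq, Set.mem_ofPred_eq, h6, h5, Real.cos_add_two_pi,
          Real.cos_add_two_pi]
      by_cases h : φ ∈ S
      · rw [Set.indicator_of_mem h, Set.indicator_of_mem (h1 ▸ h)]; rfl
      · rw [Set.indicator_of_notMem h, Set.indicator_of_notMem (h1 ▸ h)]
    have h1 := hper.intervalIntegral_add_eq 0 (-Real.pi + a)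
    have h2 : ∫ φ in (-Real.pi + a)..(-Real.pi + a + 2 * Real.pi), S.indicator (1 : ℝ → ℝ) φ
        = ∫ ψ in (-Real.pi)..Real.pi, S.indicator (1 : ℝ → ℝ) (ψ + a) := by
      rw [intervalIntegral.integral_comp_add_right]
      congr 1; ring
    rw [zero_add, h2, intervalIntegral.integral_of_le (by linarith),
      intervalIntegral.integral_of_le (by linarith), integral_indicator_one hSm] at h1
    have h3 : (fun ψ : ℝ => S.indicator (1 : ℝ → ℝ) (ψ + a))
        = {ψ | 0 < Real.cos ψ ∧ 0 < Real.cos (ψ - c)}.indicator (1 : ℝ → ℝ) := by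
      ext ψ
      simp only [Set.indicator, hS, Set.mem_ofPred_eq, add_sub_cancel_right, Pi.one_apply]
    have h4 : MeasurableSet {ψ : ℝ | 0 < Real.cos ψ ∧ 0 < Real.cos (ψ - c)} := by
      have h5 := hm 0
      simp only [sub_zero] at h5
      exact h5.inter (hm c)
    rw [h3, integral_indicator_one h4, measureReal_restrict_apply hSm,
      measureReal_restrict_apply h4, Set.inter_comm, Set.inter_comm _ (Set.Ioc _ _),
      volume_cos_pos (Complex.neg_pi_lt_arg _) (Complex.arg_le_pi _)] at h1
    exact h1
  have hfin : volume (Set.Ioc 0 (2 * Real.pi) ∩ S) ≠ ∞ :=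
    measure_ne_top_of_subset Set.inter_subset_left measure_Ioc_lt_top.ne
  rw [hset, ← lintegral_indicator_one hSm, lintegral_unif (by positivity), sub_zero,
    setLIntegral_congr (Ioc_ae_eq_Icc (a := 0) (b := 2 * Real.pi)).symm,
    lintegral_indicator_one hSm, Measure.restrict_apply hSm, Set.inter_comm,
    ← ENNReal.ofReal_toReal hfin, ← measureReal_def, hvol,
    ← ENNReal.ofReal_mul (by positivity)]
  have hang : InnerProductGeometry.angle u v = |c| := by
    rw [InnerProductGeometry.angle_comm, Complex.angle_eq_abs_arg hv hu]
  rw [hang]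
  congr 1
  field_simp

/-- Probability that the user and a BS at `z` are both on the front side of an obstacle at `x`. -/
noncomputable def front (z x : ℂ) : ℝ≥0∞ :=
  unif 0 (2 * Real.pi) {φ : ℝ | 0 < inner ℝ (Complex.exp (φ * Complex.I)) (0 - x) ∧
    0 < inner ℝ (Complex.exp (φ * Complex.I)) (z - x)}

lemma measurableSet_front : MeasurableSet {p : (ℂ × ℂ) × ℝ |
    0 < inner ℝ (Complex.exp (p.2 * Complex.I)) (0 - p.1.2) ∧
    0 < inner ℝ (Complex.exp (p.2 * Complex.I)) (p.1.1 - p.1.2)} := by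
  have h1 : Measurable fun p : (ℂ × ℂ) × ℝ =>
      inner ℝ (Complex.exp (p.2 * Complex.I)) (0 - p.1.2) := by fun_prop
  have h2 : Measurable fun p : (ℂ × ℂ) × ℝ =>
      inner ℝ (Complex.exp (p.2 * Complex.I)) (p.1.1 - p.1.2) := by fun_prop
  exact (measurableSet_lt measurable_const h1).inter (measurableSet_lt measurable_const h2)

lemma measurable_front : Measurable fun p : ℂ × ℂ => front p.1 p.2 :=
  measurable_measure_prodMk_left measurableSet_front

lemma front_le_one (z x : ℂ) : front z x ≤ 1 := prob_le_one

lemma tbr_sq (t r θ : ℝ) : t ^ 2 + r ^ 2 - 2 * t * r * Real.cos θ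
    = (r - t * Real.cos θ) ^ 2 + (t * Real.sin θ) ^ 2 := by
  have := Real.sin_sq_add_cos_sq θ
  linear_combination -t ^ 2 * this

namespace Params

/-- The relevant angle is the one at the obstacle between the user and the BS. Its cosine is
computed from inner products, and a common factor `r` cancels. Only the angle relative to the BS
enters. -/
lemma front_eq {t r : ℝ} (ht : 0 < t) (hr : 0 < r) (a α : ℝ)
    (h : (t : ℂ) * Complex.exp (a * Complex.I) ≠ r * Complex.exp (α * Complex.I)) :
    front (t * Complex.exp (a * Complex.I)) (r * Complex.exp (α * Complex.I))
      = ENNReal.ofReal (pRefl t r (α - a)) := by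
  set z := (t : ℂ) * Complex.exp (a * Complex.I) with hz
  set x := (r : ℂ) * Complex.exp (α * Complex.I) with hx
  have hxn : ‖x‖ = r := by
    rw [hx, norm_mul, Complex.norm_exp_ofReal_mul_I, mul_one, Complex.norm_real, Real.norm_eq_abs,
      abs_of_pos hr]
  have hzn : ‖z‖ = t := by
    rw [hz, norm_mul, Complex.norm_exp_ofReal_mul_I, mul_one, Complex.norm_real, Real.norm_eq_abs,
      abs_of_pos ht]
  have hx0 : 0 - x ≠ 0 := by
    rw [zero_sub, neg_ne_zero, ← norm_pos_iff, hxn]; exact hr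
  have hin : inner ℝ x z = r * (t * Real.cos (α - a)) := by
    have h1 := inner_exp_mul_I α t a
    have h2 : x = r • Complex.exp (α * Complex.I) := by rw [hx, Complex.real_smul]
    rw [h2, real_inner_smul_left, hz, h1]
  have hnorm : ‖z - x‖ = tbr t r (α - a) := by
    rw [tbr, eq_comm, Real.sqrt_eq_iff_mul_self_eq_of_pos (norm_pos_iff.2 (sub_ne_zero.2 h)),
      ← sq, norm_sub_sq_real, hzn, hxn, real_inner_comm, hin]
    ring
  rw [front, unif_inner_pos hx0 (sub_ne_zero.2 h), pRefl, InnerProductGeometry.angle]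
  congr 4
  rw [hnorm, zero_sub, norm_neg, hxn, inner_neg_left, inner_sub_right, hin, real_inner_self_eq_norm_sq,
    hxn]
  rw [show -(r * (t * Real.cos (α - a)) - r ^ 2) = r * (r - t * Real.cos (α - a)) by ring,
    mul_div_mul_left _ _ hr.ne']

lemma pRefl_nonneg (t r θ : ℝ) : 0 ≤ pRefl t r θ := by
  have hpi := Real.pi_pos
  have h := Real.arccos_le_pi ((r - t * Real.cos θ) / tbr t r θ)
  have h2 : 1 / (2 * Real.pi) * Real.arccos ((r - t * Real.cos θ) / tbr t r θ)
      ≤ 1 / (2 * Real.pi) * Real.pi := by gcongr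
  have h3 : 1 / (2 * Real.pi) * Real.pi = 1 / 2 := by field_simp
  unfold pRefl
  linarith

lemma pRefl_le (t r θ : ℝ) : pRefl t r θ ≤ 1 := by
  have hpi := Real.pi_pos
  have h := Real.arccos_nonneg ((r - t * Real.cos θ) / tbr t r θ)
  have h2 : 0 ≤ 1 / (2 * Real.pi) * Real.arccos ((r - t * Real.cos θ) / tbr t r θ) := by positivity
  unfold pRefl
  linarith

lemma measurable_pRefl : Measurable fun p : ℝ × ℝ × ℝ => pRefl p.1 p.2.1 p.2.2 := by
  have h : Measurable fun p : ℝ × ℝ × ℝ => tbr p.1 p.2.1 p.2.2 := measurable_tbr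
  unfold pRefl
  exact measurable_const.sub (measurable_const.mul (Real.continuous_arccos.measurable.comp
    (((measurable_fst.comp measurable_snd).sub (measurable_fst.mul
      (Real.continuous_cos.measurable.comp (measurable_snd.comp measurable_snd)))).div h)))

lemma tbr_pos {t θ : ℝ} (ht : 0 < t) (h : Real.sin θ ≠ 0) (r : ℝ) : 0 < tbr t r θ := by
  rw [tbr, tbr_sq]
  have : 0 < (t * Real.sin θ) ^ 2 := by positivity
  positivity

/-- The quotient can be singular only where obstacle and BS coincide, which requires `sin θ = 0`. -/
lemma continuous_pRefl {t θ : ℝ} (ht : 0 < t) (h : Real.sin θ ≠ 0) :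
    Continuous fun r => pRefl t r θ := by
  unfold pRefl
  refine continuous_const.sub (continuous_const.mul (Real.continuous_arccos.comp ?_))
  refine Continuous.div (by fun_prop) ?_ fun r => (tbr_pos ht h r).ne'
  unfold tbr
  fun_prop

lemma sin_ne_zero_of_mem {θ : ℝ} (h : θ ∈ Set.Ioo (-Real.pi) Real.pi) (h0 : θ ≠ 0) :
    Real.sin θ ≠ 0 := by
  rcases lt_or_gt_of_ne h0 with h1 | h1
  · exact (Real.sin_neg_of_neg_of_neg_pi_lt h1 h.1).ne
  · exact (Real.sin_pos_of_pos_of_lt_pi h1 h.2).ne'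

lemma ae_sin_ne_zero : ∀ᵐ θ ∂(volume.restrict (Set.Ioc (-Real.pi) Real.pi)), Real.sin θ ≠ 0 := by
  rw [← restrict_Ioo_eq_restrict_Ioc]
  have h0 : ∀ᵐ θ : ℝ, θ ≠ 0 := by simp [ae_iff]
  filter_upwards [ae_restrict_mem measurableSet_Ioo, ae_restrict_of_ae h0] with θ h1 h2
  exact sin_ne_zero_of_mem h1 h2

variable (P : Params)

lemma aRIS_nonneg (t r θ : ℝ) : 0 ≤ P.aRIS t r θ :=
  mul_nonneg (P.pVisL_pos r).le (pRefl_nonneg t r θ)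

lemma aRIS_le (t r θ : ℝ) : P.aRIS t r θ ≤ P.pVis Vis.L r :=
  mul_le_of_le_one_right (P.pVisL_pos r).le (pRefl_le t r θ)

lemma measurable_aRIS : Measurable fun p : ℝ × ℝ × ℝ => P.aRIS p.1 p.2.1 p.2.2 := by
  unfold aRIS
  exact ((P.measurable_pVis Vis.L).comp (measurable_fst.comp measurable_snd)).mul measurable_pRefl

lemma aBar_eq (t r : ℝ) : P.aBar t r = ∫ θ in Set.Ioc (-Real.pi) Real.pi, P.aRIS t r θ := by
  rw [aBar, intervalIntegral.integral_of_le (by linarith [Real.pi_pos])]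

lemma aBar_nonneg (t r : ℝ) : 0 ≤ P.aBar t r := by
  rw [aBar_eq]
  exact integral_nonneg fun θ => P.aRIS_nonneg t r θ

lemma integrableOn_aRIS (t r : ℝ) : IntegrableOn (P.aRIS t r) (Set.Ioc (-Real.pi) Real.pi) := by
  have h : Measurable (P.aRIS t r) :=
    P.measurable_aRIS.comp (measurable_prodMk_left.comp measurable_prodMk_left)
  refine Integrable.mono' (g := fun _ => P.pVis Vis.L r) (integrable_const _)
    h.aestronglyMeasurable (Eventually.of_forall fun θ => ?_)
  rw [Real.norm_of_nonneg (P.aRIS_nonneg t r θ)]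
  exact P.aRIS_le t r θ

lemma aBar_le (t r : ℝ) : P.aBar t r ≤ 2 * Real.pi * P.pVis Vis.L r := by
  rw [aBar_eq]
  refine (integral_mono (P.integrableOn_aRIS t r) (integrable_const _)
    fun θ => P.aRIS_le t r θ).trans (le_of_eq ?_)
  have hpi := Real.pi_pos
  rw [integral_const, measureReal_restrict_apply_univ, measureReal_def, Real.volume_Ioc,
    ENNReal.toReal_ofReal (by linarith), smul_eq_mul]
  ring

lemma measurable_aBar : Measurable fun p : ℝ × ℝ => P.aBar p.1 p.2 := by
  have h1 : Measurable fun q : (ℝ × ℝ) × ℝ => P.aRIS q.1.1 q.1.2 q.2 := by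
    have h2 : Measurable fun q : (ℝ × ℝ) × ℝ => (q.1.1, q.1.2, q.2) := by fun_prop
    exact P.measurable_aRIS.comp h2
  have h3 := h1.stronglyMeasurable.integral_prod_right'
    (ν := volume.restrict (Set.Ioc (-Real.pi) Real.pi))
  have h4 : (fun p : ℝ × ℝ => P.aBar p.1 p.2)
      = fun p => ∫ θ in Set.Ioc (-Real.pi) Real.pi, P.aRIS p.1 p.2 θ :=
    funext fun p => P.aBar_eq p.1 p.2
  rw [h4]
  exact h3.measurable

/-- Dominated convergence: the integrand is continuous in `r` except for a null set of angles.
Continuity makes `risMass` differentiable at every point. -/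
lemma continuous_aBar {t : ℝ} (ht : 0 < t) : Continuous (P.aBar t) := by
  have h4 : P.aBar t = fun r => ∫ θ in Set.Ioc (-Real.pi) Real.pi, P.aRIS t r θ :=
    funext fun r => P.aBar_eq t r
  rw [h4, continuous_iff_continuousAt]
  intro r₀
  have hp := P.continuous_pVis Vis.L
  refine continuousAt_of_dominated (bound := fun _ => P.pVis Vis.L r₀ + 1) ?_ ?_
    (integrable_const _) ?_
  · exact Eventually.of_forall fun r => (P.integrableOn_aRIS t r).aestronglyMeasurable
  · filter_upwards [hp.continuousAt.eventually_lt continuousAt_const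
      (show P.pVis Vis.L r₀ < P.pVis Vis.L r₀ + 1 by linarith)] with r hr
    refine Eventually.of_forall fun θ => ?_
    rw [Real.norm_of_nonneg (P.aRIS_nonneg t r θ)]
    exact (P.aRIS_le t r θ).trans hr.le
  · filter_upwards [ae_sin_ne_zero] with θ hθ
    exact (hp.mul (continuous_pRefl ht hθ)).continuousAt

end Params

end RISNet

namespace RISNet

open Filter Topology

namespace Params

variable (P : Params)

/-! ### Intensity of the obstacles that offer a cascaded link -/

lemma lamR_nonneg : 0 ≤ P.lamR := mul_nonneg P.mu_nonneg P.lamO_pos.le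

lemma aBar_mul_nonneg (t : ℝ) {r : ℝ} (hr : 0 ≤ r) : 0 ≤ P.aBar t r * r :=
  mul_nonneg (P.aBar_nonneg t r) hr

lemma measurable_aBar_mul (t : ℝ) : Measurable fun r => P.aBar t r * r :=
  (P.measurable_aBar.comp measurable_prodMk_left).mul measurable_id

/-- The exponential decay of the LoS probability makes the total intensity of suitable obstacles
finite. -/
lemma integrableOn_aBar_mul (t : ℝ) : IntegrableOn (fun r => P.aBar t r * r) (Set.Ioi 0) := by
  have h1 : IntegrableOn (fun d : ℝ => 2 * Real.pi
      * (d ^ (1 : ℝ) * Real.exp (-P.beta * d ^ (1 : ℝ)))) (Set.Ioi 0) :=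
    (integrableOn_rpow_mul_exp_neg_mul_rpow (by norm_num) one_pos P.beta_pos).const_mul _
  refine Integrable.mono' h1 (P.measurable_aBar_mul t).aestronglyMeasurable ?_
  filter_upwards [ae_restrict_mem measurableSet_Ioi] with r hr
  have hr0 : 0 ≤ r := le_of_lt hr
  rw [Real.norm_of_nonneg (P.aBar_mul_nonneg t hr0), Real.rpow_one]
  calc P.aBar t r * r ≤ 2 * Real.pi * P.pVis Vis.L r * r := by gcongr; exact P.aBar_le t r
    _ = _ := by rw [pVis]; ring

/-- Integral of the angular intensity up to distance `r`. -/
noncomputable def risMass (t r : ℝ) : ℝ := ∫ x in (0 : ℝ)..r, P.aBar t x * x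

/-- Density of the distance of the nearest suitable obstacle, of total mass `pCL`. -/
noncomputable def risDensity (t r : ℝ) : ℝ :=
  P.lamR * r * P.aBar t r * Real.exp (-P.lamR * P.risMass t r)

lemma fTru_eq (t r : ℝ) : P.fTru t r = P.risDensity t r / P.pCL t := rfl

lemma risDensity_nonneg (t : ℝ) {r : ℝ} (hr : 0 ≤ r) : 0 ≤ P.risDensity t r := by
  have := P.lamR_nonneg
  have := P.aBar_nonneg t r
  unfold risDensity
  positivity

/-- Replacing `r` by `max r 0` removes the orientation sign of the interval integral, which then is
an integral of an indicator and jointly measurable. On `(0, ∞)` nothing changes. -/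
lemma measurable_risMass : Measurable fun p : ℝ × ℝ => P.risMass p.1 (max p.2 0) := by
  have h1 : Measurable fun q : (ℝ × ℝ) × ℝ =>
      (Set.Ioc 0 (max q.1.2 0)).indicator (fun x => P.aBar q.1.1 x * x) q.2 := by
    have h2 : MeasurableSet {q : (ℝ × ℝ) × ℝ | 0 < q.2 ∧ q.2 ≤ max q.1.2 0} :=
      (measurableSet_lt measurable_const measurable_snd).inter
        (measurableSet_le measurable_snd ((measurable_snd.comp measurable_fst).max measurable_const))
    have h3 : Measurable fun q : (ℝ × ℝ) × ℝ => P.aBar q.1.1 q.2 * q.2 :=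
      (P.measurable_aBar.comp ((measurable_fst.comp measurable_fst).prodMk measurable_snd)).mul
        measurable_snd
    exact h3.indicator h2
  have h4 := h1.stronglyMeasurable.integral_prod_right' (ν := volume)
  have h5 : (fun p : ℝ × ℝ => P.risMass p.1 (max p.2 0))
      = fun p => ∫ x, (Set.Ioc 0 (max p.2 0)).indicator (fun x => P.aBar p.1 x * x) x := by
    ext p
    rw [risMass, intervalIntegral.integral_of_le (le_max_right _ _),
      integral_indicator measurableSet_Ioc]
  rw [h5]
  exact h4.measurable

lemma measurable_risDensity :
    Measurable fun p : ℝ × ℝ => P.risDensity p.1 (max p.2 0) := by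
  have h1 : Measurable fun p : ℝ × ℝ => P.aBar p.1 (max p.2 0) :=
    P.measurable_aBar.comp (measurable_fst.prodMk (measurable_snd.max measurable_const))
  have h2 := P.measurable_risMass
  unfold risDensity
  exact ((measurable_const.mul (measurable_snd.max measurable_const)).mul h1).mul
    (Real.continuous_exp.measurable.comp (measurable_const.mul h2))

lemma hasDerivAt_risMass {t : ℝ} (ht : 0 < t) (r : ℝ) :
    HasDerivAt (P.risMass t) (P.aBar t r * r) r := by
  have hc : Continuous fun x => P.aBar t x * x := (P.continuous_aBar ht).mul continuous_id
  exact intervalIntegral.integral_hasDerivAt_right (hc.intervalIntegrable _ _)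
    (hc.stronglyMeasurableAtFilter _ _) hc.continuousAt

lemma continuous_risDensity {t : ℝ} (ht : 0 < t) : Continuous (P.risDensity t) := by
  have hm : Continuous (P.risMass t) :=
    continuous_iff_continuousAt.2 fun x => (P.hasDerivAt_risMass ht x).continuousAt
  have ha := P.continuous_aBar ht
  unfold risDensity
  fun_prop

/-- `risDensity` is the derivative of minus the void probability `exp (-λ_r risMass)`. -/
lemma integral_risDensity {t : ℝ} (ht : 0 < t) (r : ℝ) :
    ∫ x in (0 : ℝ)..r, P.risDensity t x = 1 - Real.exp (-P.lamR * P.risMass t r) := by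
  have hw := P.continuous_risDensity ht
  have hd2 : ∀ x, HasDerivAt (fun x => -Real.exp (-P.lamR * P.risMass t x)) (P.risDensity t x) x :=
    fun x => by
      refine (((P.hasDerivAt_risMass ht x).const_mul (-P.lamR)).exp.neg).congr_deriv ?_
      rw [risDensity]; ring
  rw [intervalIntegral.integral_eq_sub_of_hasDerivAt (fun x _ => hd2 x)
    (hw.intervalIntegrable _ _)]
  have h0 : P.risMass t 0 = 0 := by simp [risMass]
  rw [h0]
  simp only [mul_zero, Real.exp_zero]
  ring

lemma lintegral_risDensity {t : ℝ} (ht : 0 < t) {r : ℝ} (hr : 0 ≤ r) :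
    ∫⁻ x in Set.Ioo 0 r, ENNReal.ofReal (P.risDensity t x)
      = ENNReal.ofReal (1 - Real.exp (-P.lamR * P.risMass t r)) := by
  have hw := P.continuous_risDensity ht
  rw [← P.integral_risDensity ht, intervalIntegral.integral_of_le hr,
    setLIntegral_congr Ioo_ae_eq_Ioc, ofReal_integral_eq_lintegral_ofReal
      (hw.integrableOn_Ioc)]
  filter_upwards [ae_restrict_mem measurableSet_Ioc] with x hx
  exact P.risDensity_nonneg t hx.1.le

lemma pCL_nonneg (t : ℝ) : 0 ≤ P.pCL t := by
  have h : 0 ≤ ∫ r in Set.Ioi (0 : ℝ), P.aBar t r * r :=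
    setIntegral_nonneg measurableSet_Ioi fun r hr => P.aBar_mul_nonneg t (le_of_lt hr)
  rw [pCL, sub_nonneg, Real.exp_le_one_iff]
  have := mul_nonneg P.lamR_nonneg h
  linarith

lemma pCL_le_one (t : ℝ) : P.pCL t ≤ 1 := by
  rw [pCL]
  have := Real.exp_pos (-P.lamR * ∫ r in Set.Ioi (0 : ℝ), P.aBar t r * r)
  linarith

/-- If `pCL` vanishes, `fTru` is a division by zero; then `λ_r` or the total intensity is `0`, and
`risDensity` vanishes almost everywhere too. This covers the network without RISs. -/
lemma pCL_mul_fTru (t : ℝ) : ∀ᵐ r ∂(volume.restrict (Set.Ioi (0 : ℝ))),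
    P.pCL t * P.fTru t r = P.risDensity t r := by
  by_cases h : P.pCL t = 0
  · have h1 : P.lamR * ∫ r in Set.Ioi (0 : ℝ), P.aBar t r * r = 0 := by
      rw [pCL, sub_eq_zero, eq_comm, Real.exp_eq_one_iff] at h
      linarith
    rcases mul_eq_zero.1 h1 with h2 | h2
    · exact Eventually.of_forall fun r => by rw [h, risDensity, h2]; simp
    · have h3 := (setIntegral_eq_zero_iff_of_nonneg_ae (by
        filter_upwards [ae_restrict_mem measurableSet_Ioi] with r hr
        exact P.aBar_mul_nonneg t (le_of_lt hr)) (P.integrableOn_aBar_mul t)).1 h2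
      filter_upwards [h3] with r hr
      have hr' : P.aBar t r * r = 0 := hr
      rw [h, zero_mul, risDensity, mul_assoc P.lamR, mul_comm r, hr']
      simp
  · exact Eventually.of_forall fun r => by rw [fTru_eq, mul_div_cancel₀ _ h]

lemma periodic_aRIS (t r : ℝ) : Function.Periodic (P.aRIS t r) (2 * Real.pi) := fun θ => by
  simp [aRIS, pRefl, tbr, Real.cos_add_two_pi]

/-- Rotation invariance: the direction of the BS drops out of the angular average by periodicity. -/
lemma integral_aRIS_sub (t r a : ℝ) :
    ∫ θ in (-Real.pi)..Real.pi, P.aRIS t r (θ - a) = P.aBar t r := by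
  rw [intervalIntegral.integral_comp_sub_right (P.aRIS t r), aBar]
  have h := (P.periodic_aRIS t r).intervalIntegral_add_eq (-Real.pi - a) (-Real.pi)
  rw [show -Real.pi - a + 2 * Real.pi = Real.pi - a by ring,
    show -Real.pi + 2 * Real.pi = Real.pi by ring] at h
  exact h

lemma lintegral_aRIS_sub (t r a : ℝ) :
    ∫⁻ θ in Set.Ioo (-Real.pi) Real.pi, ENNReal.ofReal (P.aRIS t r (θ - a))
      = ENNReal.ofReal (P.aBar t r) := by
  have hm : Measurable fun θ => P.aRIS t r (θ - a) :=
    P.measurable_aRIS.comp (measurable_const.prodMk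
      (measurable_const.prodMk (measurable_id.sub measurable_const)))
  have hi : IntegrableOn (fun θ => P.aRIS t r (θ - a)) (Set.Ioc (-Real.pi) Real.pi) := by
    refine Integrable.mono' (g := fun _ => P.pVis Vis.L r) (integrable_const _)
      hm.aestronglyMeasurable (Eventually.of_forall fun θ => ?_)
    rw [Real.norm_of_nonneg (P.aRIS_nonneg t r _)]
    exact P.aRIS_le t r _
  rw [setLIntegral_congr Ioo_ae_eq_Ioc, ← P.integral_aRIS_sub t r a,
    intervalIntegral.integral_of_le (by linarith [Real.pi_pos]),
    ofReal_integral_eq_lintegral_ofReal hi (Eventually.of_forall fun θ => P.aRIS_nonneg t r _)]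

/-- In polar coordinates about the user, `front_eq` turns the integrand into `aRIS` at the angle
relative to the BS, and the angular integral is `aBar`. -/
lemma lintegral_front {z : ℂ} (hz : z ≠ 0) {B : Set ℝ} (hB : MeasurableSet B) :
    ∫⁻ x : ℂ, B.indicator 1 ‖x‖ * (ENNReal.ofReal (P.pVis Vis.L ‖x‖) * front z x)
      = ∫⁻ r in B ∩ Set.Ioi 0, ENNReal.ofReal (P.aBar ‖z‖ r * r) := by
  have hfm : Measurable (front z) := Measurable.of_uncurry_left (f := front) measurable_front
  have hBm : Measurable (B.indicator (1 : ℝ → ℝ≥0∞)) := measurable_one.indicator hB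
  have hpm := P.measurable_pVis Vis.L
  have ht : 0 < ‖z‖ := norm_pos_iff.2 hz
  have hz' : (‖z‖ : ℂ) * Complex.exp (z.arg * Complex.I) = z := Complex.norm_mul_exp_arg_mul_I z
  rw [lintegral_complex_polar (f := fun x => B.indicator 1 ‖x‖
      * (ENNReal.ofReal (P.pVis Vis.L ‖x‖) * front z x))
      ((hBm.comp measurable_norm).mul ((hpm.comp measurable_norm).ennreal_ofReal.mul hfm)),
    ← Measure.restrict_restrict hB, ← lintegral_indicator hB]
  refine setLIntegral_congr_fun measurableSet_Ioi fun r hr => ?_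
  have hr0 : 0 < r := hr
  have h1 : ∀ θ : ℝ, ‖(r : ℂ) * Complex.exp (θ * Complex.I)‖ = r := fun θ => by
    rw [norm_mul, Complex.norm_exp_ofReal_mul_I, mul_one, Complex.norm_real, Real.norm_eq_abs,
      abs_of_pos hr0]
  have h2 : ∀ᵐ θ : ℝ ∂(volume.restrict (Set.Ioo (-Real.pi) Real.pi)),
      ENNReal.ofReal r * (B.indicator 1 ‖(r : ℂ) * Complex.exp (θ * Complex.I)‖
        * (ENNReal.ofReal (P.pVis Vis.L ‖(r : ℂ) * Complex.exp (θ * Complex.I)‖)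
          * front z (r * Complex.exp (θ * Complex.I))))
      = (ENNReal.ofReal r * B.indicator 1 r) * ENNReal.ofReal (P.aRIS ‖z‖ r (θ - z.arg)) := by
    -- Away from this single angle the obstacle cannot coincide with the BS, as `front_eq` requires.
    have h0 : ∀ᵐ θ : ℝ, θ ≠ z.arg := by simp [ae_iff]
    filter_upwards [ae_restrict_mem measurableSet_Ioo, ae_restrict_of_ae h0] with θ hθ hne
    have h3 : (‖z‖ : ℂ) * Complex.exp (z.arg * Complex.I) ≠ r * Complex.exp (θ * Complex.I) := by
      intro h
      rw [hz'] at h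
      refine hne ?_
      rw [h, Complex.exp_mul_I]
      exact (Complex.arg_mul_cos_add_sin_mul_I hr0 ⟨hθ.1, hθ.2.le⟩).symm
    have h4 := front_eq ht hr0 z.arg θ h3
    rw [hz'] at h4
    rw [h1, h4, aRIS, ENNReal.ofReal_mul (P.pVisL_pos r).le, mul_assoc]
  rw [lintegral_congr_ae h2, lintegral_const_mul' _ _ (by
    by_cases h : r ∈ B <;> simp [h]), P.lintegral_aRIS_sub]
  by_cases h : r ∈ B
  · rw [Set.indicator_of_mem h, Set.indicator_of_mem h, Pi.one_apply, mul_one,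
      ← ENNReal.ofReal_mul hr0.le, mul_comm]
  · simp [h]

/-- Probability that no suitable obstacle has its distance in `B`, given the nearest BS. -/
noncomputable def voidProb (B : Set ℝ) (z : ℂ) : ℝ≥0∞ :=
  expNeg (ENNReal.ofReal P.lamO * ∫⁻ x : ℂ,
    B.indicator 1 ‖x‖ * (ENNReal.ofReal P.mu * (ENNReal.ofReal (P.pVis Vis.L ‖x‖) * front z x)))

/-- The equipment probability merges with the obstacle density into `λ_r = μ λ_o`. -/
lemma voidProb_eq {z : ℂ} (hz : z ≠ 0) {B : Set ℝ} (hB : MeasurableSet B) :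
    P.voidProb B z = expNeg (ENNReal.ofReal P.lamR
      * ∫⁻ r in B ∩ Set.Ioi 0, ENNReal.ofReal (P.aBar ‖z‖ r * r)) := by
  have h : ∀ x : ℂ, B.indicator 1 ‖x‖ * (ENNReal.ofReal P.mu *
      (ENNReal.ofReal (P.pVis Vis.L ‖x‖) * front z x))
      = ENNReal.ofReal P.mu * (B.indicator 1 ‖x‖ *
        (ENNReal.ofReal (P.pVis Vis.L ‖x‖) * front z x)) := fun x => by ring
  rw [voidProb, lintegral_congr h, lintegral_const_mul' _ _ ENNReal.ofReal_ne_top,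
    P.lintegral_front hz hB, ← mul_assoc, ← ENNReal.ofReal_mul P.lamO_pos.le, lamR,
    mul_comm P.lamO]

lemma voidProb_Iio {z : ℂ} (hz : z ≠ 0) {r : ℝ} (hr : 0 ≤ r) :
    P.voidProb (Set.Iio r) z = ENNReal.ofReal (Real.exp (-P.lamR * P.risMass ‖z‖ r)) := by
  have h1 : Set.Iio r ∩ Set.Ioi 0 = Set.Ioo 0 r := by
    ext x; simp [and_comm]
  have h2 : 0 ≤ ∫ x in Set.Ioc 0 r, P.aBar ‖z‖ x * x :=
    setIntegral_nonneg measurableSet_Ioc fun x hx => P.aBar_mul_nonneg _ hx.1.le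
  rw [P.voidProb_eq hz measurableSet_Iio, h1, setLIntegral_congr Ioo_ae_eq_Ioc,
    ← ofReal_integral_eq_lintegral_ofReal ((P.integrableOn_aBar_mul _).mono_set
      Set.Ioc_subset_Ioi_self), ← ENNReal.ofReal_mul P.lamR_nonneg,
    expNeg_ofReal (mul_nonneg P.lamR_nonneg h2), risMass, intervalIntegral.integral_of_le hr,
    neg_mul]
  filter_upwards [ae_restrict_mem measurableSet_Ioc] with x hx
  exact P.aBar_mul_nonneg _ hx.1.le

lemma voidProb_univ {z : ℂ} (hz : z ≠ 0) :
    P.voidProb Set.univ z = ENNReal.ofReal (1 - P.pCL ‖z‖) := by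
  have h2 : 0 ≤ ∫ x in Set.Ioi 0, P.aBar ‖z‖ x * x :=
    setIntegral_nonneg measurableSet_Ioi fun x hx => P.aBar_mul_nonneg _ (le_of_lt hx)
  rw [P.voidProb_eq hz MeasurableSet.univ, Set.univ_inter,
    ← ofReal_integral_eq_lintegral_ofReal (P.integrableOn_aBar_mul _),
    ← ENNReal.ofReal_mul P.lamR_nonneg, expNeg_ofReal (mul_nonneg P.lamR_nonneg h2), pCL,
    sub_sub_cancel, neg_mul]
  filter_upwards [ae_restrict_mem measurableSet_Ioi] with x hx
  exact P.aBar_mul_nonneg _ (le_of_lt hx)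

end Params

end RISNet

namespace RISNet

open Filter Topology

/-- The inverse of `expNeg` on `[0, 1]`. -/
noncomputable def negLogE (a : ℝ≥0∞) : ℝ≥0∞ := if a = 0 then ∞ else negLog a.toReal

@[fun_prop]
lemma measurable_negLogE : Measurable negLogE :=
  Measurable.ite (measurableSet_singleton 0) measurable_const
    (negLog_measurable.comp ENNReal.measurable_toReal)

lemma expNeg_negLogE {a : ℝ≥0∞} (h : a ≤ 1) : expNeg (negLogE a) = a := by
  have ha : a ≠ ∞ := (h.trans_lt ENNReal.one_lt_top).ne
  by_cases h0 : a = 0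
  · simp [negLogE, h0, expNeg_top]
  · rw [negLogE, if_neg h0, expNeg_negLog (ENNReal.toReal_pos h0 ha)
      (ENNReal.toReal_le_of_le_ofReal zero_le_one (by simpa using h)), ENNReal.ofReal_toReal ha]

/-! ### The nearest suitable obstacle -/

namespace Params

variable (P : Params)

/-- Locations of the nearest BS and of an obstacle, and marks of that obstacle, such that the
obstacle offers a cascaded link. -/
def suitSet : Set ((ℂ × ℂ) × (ℝ × ℝ × ℝ)) :=
  {p | p.2.1 < P.mu ∧ p.2.2.1 < P.pVis Vis.L ‖p.1.2‖ ∧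
    0 < inner ℝ (Complex.exp (p.2.2.2 * Complex.I)) (0 - p.1.2) ∧
    0 < inner ℝ (Complex.exp (p.2.2.2 * Complex.I)) (p.1.1 - p.1.2)}

lemma measurableSet_suitSet : MeasurableSet P.suitSet := by
  have hp := P.measurable_pVis Vis.L
  have h0 : Measurable fun p : (ℂ × ℂ) × (ℝ × ℝ × ℝ) => P.pVis Vis.L ‖p.1.2‖ :=
    hp.comp (by fun_prop : Measurable fun p : (ℂ × ℂ) × (ℝ × ℝ × ℝ) => ‖p.1.2‖)
  have h1 : Measurable fun p : (ℂ × ℂ) × (ℝ × ℝ × ℝ) =>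
      inner ℝ (Complex.exp (p.2.2.2 * Complex.I)) (0 - p.1.2) := by fun_prop
  have h2 : Measurable fun p : (ℂ × ℂ) × (ℝ × ℝ × ℝ) =>
      inner ℝ (Complex.exp (p.2.2.2 * Complex.I)) (p.1.1 - p.1.2) := by fun_prop
  have h3 : Measurable fun p : (ℂ × ℂ) × (ℝ × ℝ × ℝ) => p.2.1 := by fun_prop
  have h4 : Measurable fun p : (ℂ × ℂ) × (ℝ × ℝ × ℝ) => p.2.2.1 := by fun_prop
  exact (measurableSet_lt h3 measurable_const).inter ((measurableSet_lt h4 h0).inter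
    ((measurableSet_lt measurable_const h1).inter (measurableSet_lt measurable_const h2)))

/-- Suitable obstacles with distance in `B`. -/
def suitSetIn (B : Set ℝ) : Set ((ℂ × ℂ) × (ℝ × ℝ × ℝ)) := P.suitSet ∩ {p | ‖p.1.2‖ ∈ B}

lemma measurableSet_suitSetIn {B : Set ℝ} (hB : MeasurableSet B) :
    MeasurableSet (P.suitSetIn B) := by
  refine P.measurableSet_suitSet.inter ?_
  have : Measurable fun p : (ℂ × ℂ) × (ℝ × ℝ × ℝ) => ‖p.1.2‖ := by fun_prop
  exact this hB

/-- Configurations with a suitable obstacle with distance in `B`. -/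
def foundSet (B : Set ℝ) : Set (ℂ × (ℕ → ℂ) × (ℕ → ℝ × ℝ × ℝ)) :=
  {q | ∃ i, ((q.1, q.2.1 i), q.2.2 i) ∈ P.suitSetIn B}

lemma measurableSet_foundSet {B : Set ℝ} (hB : MeasurableSet B) :
    MeasurableSet (P.foundSet B) := by
  have h : P.foundSet B = ⋃ i : ℕ, (fun q : ℂ × (ℕ → ℂ) × (ℕ → ℝ × ℝ × ℝ) =>
      ((q.1, q.2.1 i), q.2.2 i)) ⁻¹' P.suitSetIn B := by
    ext q; simp [foundSet]
  rw [h]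
  refine MeasurableSet.iUnion fun i => ?_
  have : Measurable fun q : ℂ × (ℕ → ℂ) × (ℕ → ℝ × ℝ × ℝ) => ((q.1, q.2.1 i), q.2.2 i) := by
    fun_prop
  exact this (P.measurableSet_suitSetIn hB)

/-- Infinite cost of a suitable obstacle with distance in `B`. -/
noncomputable def risCost (B : Set ℝ) (z x : ℂ) (k : ℝ × ℝ × ℝ) : ℝ≥0∞ :=
  (P.suitSetIn B).indicator (fun _ => ∞) ((z, x), k)

lemma measurable_risCost {B : Set ℝ} (hB : MeasurableSet B) :
    Measurable ((P.suitSetIn B).indicator (fun _ => (∞ : ℝ≥0∞))) :=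
  measurable_const.indicator (P.measurableSet_suitSetIn hB)

/-- One suitable obstacle makes the total cost infinite, and without any the cost is `0`. So the
exponential is a void indicator, accessible to the Laplace functional. -/
lemma expNeg_tsum_risCost (B : Set ℝ) (z : ℂ) (x : ℕ → ℂ) (k : ℕ → ℝ × ℝ × ℝ) :
    expNeg (∑' i, P.risCost B z (x i) (k i)) = (P.foundSet B)ᶜ.indicator 1 (z, x, k) := by
  by_cases h : (z, x, k) ∈ P.foundSet B
  · obtain ⟨i, hi⟩ := h
    have h1 : ∑' i, P.risCost B z (x i) (k i) = ∞ := by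
      refine ENNReal.tsum_eq_top_of_eq_top ⟨i, ?_⟩
      exact Set.indicator_of_mem (by exact hi) _
    have h2 : (z, x, k) ∉ (P.foundSet B)ᶜ := fun hc => hc ⟨i, hi⟩
    rw [h1, expNeg_top, Set.indicator_of_notMem h2]
  · have h1 : ∑' i, P.risCost B z (x i) (k i) = 0 := by
      refine ENNReal.tsum_eq_zero.2 fun i => ?_
      exact Set.indicator_of_notMem (fun hi => h ⟨i, hi⟩) _
    rw [h1, expNeg_zero, Set.indicator_of_mem (by exact h)]
    rfl

end Params

namespace Network

variable {P : Params} {Ω : Type*} [mΩ : MeasurableSpace Ω] {μ : Measure Ω} (W : Network P μ)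

/-- The sources attached to obstacle `i`. -/
def risSet (i : ℕ) : Set (Option (Option Source)) :=
  {some (some (.risEquip i)), some (some (.risBlock i)), some (some (.risNormal i))}

/-- The sources of the obstacles. -/
def risAll : Set (Option (Option Source)) := {some none} ∪ ⋃ i, risSet i

lemma risSet_disjoint {i j : ℕ} (hij : i ≠ j) : Disjoint (risSet i) (risSet j) := by
  refine Set.disjoint_left.2 fun x hi hj => ?_
  simp only [risSet, Set.mem_insert_iff, Set.mem_singleton_iff] at hi hj
  rcases hi with rfl | rfl | rfl <;> simp [hij] at hj

/-- The marks of obstacle `i`. -/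
def risMark (i : ℕ) (ω : Ω) : ℝ × ℝ × ℝ :=
  (W.X (.risEquip i) ω, W.X (.risBlock i) ω, W.X (.risNormal i) ω)

/-- What determines the nearest suitable obstacle. -/
def risConfig (ω : Ω) : ℂ × (ℕ → ℂ) × (ℕ → ℝ × ℝ × ℝ) :=
  (W.b 0 ω, fun i => W.o i ω, fun i => W.risMark i ω)

lemma measurable_risMark_sig {S : Set (Option (Option Source))} {i : ℕ} (h : risSet i ⊆ S) :
    Measurable[W.sig S] (W.risMark i) := by
  have h1 : Measurable[W.sig S] (W.X (.risEquip i)) := W.measurable_X_sig (h (by simp [risSet]))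
  have h2 : Measurable[W.sig S] (W.X (.risBlock i)) := W.measurable_X_sig (h (by simp [risSet]))
  have h3 : Measurable[W.sig S] (W.X (.risNormal i)) := W.measurable_X_sig (h (by simp [risSet]))
  exact h1.prodMk (h2.prodMk h3)

lemma measurable_risMarks_sig {S : Set (Option (Option Source))} (h : ∀ i, risSet i ⊆ S) :
    Measurable[W.sig S] fun ω i => W.risMark i ω :=
  @measurable_pi_lambda _ _ _ (W.sig S) _ _ fun i => W.measurable_risMark_sig (h i)

lemma measurable_risConfig_sig {S : Set (Option (Option Source))} (h0 : none ∈ S)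
    (h : risAll ⊆ S) : Measurable[W.sig S] W.risConfig := by
  have h1 := W.measurable_b_apply_sig h0 0
  have h2 := W.measurable_o_sig (S := S) (h (Or.inl rfl))
  have h3 := W.measurable_risMarks_sig (S := S) fun i x hx =>
    h (Or.inr (Set.mem_iUnion.2 ⟨i, hx⟩))
  exact h1.prodMk (h2.prodMk h3)

lemma measurable_risConfig : Measurable W.risConfig :=
  (W.measurable_risConfig_sig (S := Set.univ) trivial (Set.subset_univ _)).mono (W.sig_le _) le_rfl

lemma existsCL_eq : W.existsCL = W.risConfig ⁻¹' P.foundSet Set.univ := by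
  ext ω
  simp [existsCL, suitable, normal, risConfig, Params.foundSet, Params.suitSetIn, Params.suitSet,
    risMark]

lemma tru_nonneg (ω : Ω) : 0 ≤ W.tru ω := by
  refine Real.sInf_nonneg ?_
  rintro d ⟨i, -, rfl⟩
  exact norm_nonneg _

/-- The infimum lies below `r` exactly when some suitable obstacle does. The intersection with
`existsCL` is needed because the infimum of the empty set is `0`. -/
lemma existsCL_inter_tru_lt (r : ℝ) :
    W.existsCL ∩ {ω | W.tru ω < r} = W.risConfig ⁻¹' P.foundSet (Set.Iio r) := by
  ext ω
  have hb : BddBelow {d | ∃ i, W.suitable i ω ∧ d = ‖W.o i ω‖} :=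
    ⟨0, by rintro d ⟨i, -, rfl⟩; exact norm_nonneg _⟩
  have h1 : ω ∈ W.risConfig ⁻¹' P.foundSet (Set.Iio r)
      ↔ ∃ i, W.suitable i ω ∧ ‖W.o i ω‖ < r := by
    simp [suitable, normal, risConfig, Params.foundSet, Params.suitSetIn, Params.suitSet, risMark]
  rw [h1]
  constructor
  · rintro ⟨⟨i, hi⟩, h⟩
    obtain ⟨d, ⟨j, hj, rfl⟩, hd⟩ := (csInf_lt_iff hb ⟨_, i, hi, rfl⟩).1 h
    exact ⟨j, hj, hd⟩
  · rintro ⟨i, hi, h⟩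
    exact ⟨⟨i, hi⟩, (csInf_lt_iff hb ⟨_, i, hi, rfl⟩).2 ⟨_, ⟨i, hi, rfl⟩, h⟩⟩

lemma measurableSet_existsCL_sig {S : Set (Option (Option Source))} (h0 : none ∈ S)
    (h : risAll ⊆ S) : MeasurableSet[W.sig S] W.existsCL := by
  rw [W.existsCL_eq]
  exact W.measurable_risConfig_sig h0 h (P.measurableSet_foundSet MeasurableSet.univ)

lemma measurable_tru_sig {S : Set (Option (Option Source))} (h0 : none ∈ S)
    (h : risAll ⊆ S) : Measurable[W.sig S] W.tru := by
  refine @measurable_of_Iio _ _ _ _ _ (W.sig S) _ _ _ _ fun r => ?_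
  by_cases hr : 0 < r
  · have h1 : W.tru ⁻¹' Set.Iio r = (W.existsCL ∩ {ω | W.tru ω < r}) ∪ W.existsCLᶜ := by
      ext ω
      constructor
      · intro hω
        by_cases hc : ω ∈ W.existsCL
        · exact Or.inl ⟨hc, hω⟩
        · exact Or.inr hc
      · rintro (hω | hω)
        · exact hω.2
        · have h2 : {d | ∃ i, W.suitable i ω ∧ d = ‖W.o i ω‖} = ∅ := by
            ext d
            simp only [Set.mem_ofPred_eq, Set.mem_empty_iff_false, iff_false]
            rintro ⟨i, hi, -⟩
            exact hω ⟨i, hi⟩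
          rw [Set.mem_preimage, tru, h2, Real.sInf_empty]
          exact hr
    rw [h1, W.existsCL_inter_tru_lt]
    exact (W.measurable_risConfig_sig h0 h (P.measurableSet_foundSet measurableSet_Iio)).union
      (W.measurableSet_existsCL_sig h0 h).compl
  · have h1 : W.tru ⁻¹' Set.Iio r = ∅ := by
      ext ω
      simp only [Set.mem_preimage, Set.mem_Iio, Set.mem_empty_iff_false, iff_false, not_lt]
      exact (not_lt.1 hr).trans (W.tru_nonneg ω)
    rw [h1]
    exact @MeasurableSet.empty _ (W.sig S)

lemma measurableSet_existsCL : MeasurableSet W.existsCL :=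
  W.sig_le _ _ (W.measurableSet_existsCL_sig (S := Set.univ) trivial (Set.subset_univ _))

lemma measurable_tru : Measurable W.tru :=
  (W.measurable_tru_sig (S := Set.univ) trivial (Set.subset_univ _)).mono (W.sig_le _) le_rfl

variable [IsProbabilityMeasure μ]

lemma measure_risMark_suitSet (z x : ℂ) (i : ℕ) :
    μ {ω | ((z, x), W.risMark i ω) ∈ P.suitSet}
      = ENNReal.ofReal P.mu * (ENNReal.ofReal (P.pVis Vis.L ‖x‖) * front z x) := by
  set A : Set Ω := W.X (.risEquip i) ⁻¹' Set.Iio P.mu with hA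
  set B : Set Ω := W.X (.risBlock i) ⁻¹' Set.Iio (P.pVis Vis.L ‖x‖) with hB
  set N : Set ℝ := {φ : ℝ | 0 < inner ℝ (Complex.exp (φ * Complex.I)) (0 - x) ∧
    0 < inner ℝ (Complex.exp (φ * Complex.I)) (z - x)} with hN
  have hNm : MeasurableSet N := measurable_prodMk_left (x := (z, x)) measurableSet_front
  have hset : {ω | ((z, x), W.risMark i ω) ∈ P.suitSet}
      = A ∩ (fun ω => (W.X (.risBlock i) ω, W.X (.risNormal i) ω)) ⁻¹'
        (Set.Iio (P.pVis Vis.L ‖x‖) ×ˢ N) := by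
    ext ω
    simp [hA, hN, Params.suitSet, risMark]
  have h1 : IndepFun (W.X (.risEquip i))
      (fun ω => (W.X (.risBlock i) ω, W.X (.risNormal i) ω)) μ := by
    refine W.indepFun_of_disjoint (S := {some (some (.risEquip i))})
      (T := {some (some (.risBlock i)), some (some (.risNormal i))}) (by simp)
      (W.measurable_X_sig (by simp)) ?_
    have h2 : Measurable[W.sig {some (some (.risBlock i)), some (some (.risNormal i))}]
      (W.X (.risBlock i)) := W.measurable_X_sig (by simp)
    have h3 : Measurable[W.sig {some (some (.risBlock i)), some (some (.risNormal i))}]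
      (W.X (.risNormal i)) := W.measurable_X_sig (by simp)
    exact h2.prodMk h3
  have h2 : IndepFun (W.X (.risBlock i)) (W.X (.risNormal i)) μ := W.X_indep.indepFun (by simp)
  have h3 : (fun ω => (W.X (.risBlock i) ω, W.X (.risNormal i) ω)) ⁻¹'
        (Set.Iio (P.pVis Vis.L ‖x‖) ×ˢ N)
      = W.X (.risBlock i) ⁻¹' Set.Iio (P.pVis Vis.L ‖x‖) ∩ W.X (.risNormal i) ⁻¹' N := rfl
  rw [hset, h1.measure_inter_preimage_eq_mul _ _ measurableSet_Iio (measurableSet_Iio.prod hNm), h3,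
    h2.measure_inter_preimage_eq_mul _ _ measurableSet_Iio hNm]
  congr 2
  · exact W.measure_block_lt (s := .risEquip i) rfl P.mu_le_one
  · exact W.measure_block_lt (s := .risBlock i) rfl (P.pVisL_le_one (norm_nonneg x))
  · rw [← Measure.map_apply (W.X_meas _) hNm, W.X_law]
    rfl

lemma lintegral_expNeg_risCost (B : Set ℝ) (z x : ℂ) (i : ℕ) :
    ∫⁻ ω, expNeg (P.risCost B z x (W.risMark i ω)) ∂μ = 1 - B.indicator 1 ‖x‖ *
      (ENNReal.ofReal P.mu * (ENNReal.ofReal (P.pVis Vis.L ‖x‖) * front z x)) := by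
  have hmm : Measurable (W.risMark i) :=
    (W.measurable_risMark_sig (S := Set.univ) (Set.subset_univ _)).mono (W.sig_le _) le_rfl
  by_cases hx : ‖x‖ ∈ B
  · have hE : MeasurableSet {ω | ((z, x), W.risMark i ω) ∈ P.suitSet} :=
      (measurable_const.prodMk hmm) P.measurableSet_suitSet
    have h1 : ∀ ω, expNeg (P.risCost B z x (W.risMark i ω))
        = {ω | ((z, x), W.risMark i ω) ∈ P.suitSet}ᶜ.indicator 1 ω := fun ω => by
      by_cases hω : ((z, x), W.risMark i ω) ∈ P.suitSet
      · have h2 : ω ∉ {ω | ((z, x), W.risMark i ω) ∈ P.suitSet}ᶜ := fun hc => hc hω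
        rw [Set.indicator_of_notMem h2, Params.risCost, Set.indicator_of_mem (by exact ⟨hω, hx⟩),
          expNeg_top]
      · rw [Set.indicator_of_mem (by exact hω), Params.risCost,
          Set.indicator_of_notMem (fun h => hω h.1), expNeg_zero]
        rfl
    rw [lintegral_congr h1, lintegral_indicator_one hE.compl, prob_compl_eq_one_sub hE,
      W.measure_risMark_suitSet, Set.indicator_of_mem hx, Pi.one_apply, one_mul]
  · have h1 : ∀ ω, P.risCost B z x (W.risMark i ω) = 0 := fun ω =>
      Set.indicator_of_notMem (fun h => hx h.2) _
    simp [h1, hx, expNeg_zero]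

/-- Independent thinning: at fixed positions the marks are averaged, each obstacle surviving with
one minus its retention probability. Minus the logarithm of this is a cost for the Laplace
functional of the obstacles, where `1 - expNeg` gives back the retention probability. -/
lemma lintegral_risConfig_compl {B : Set ℝ} (hB : MeasurableSet B) (z : ℂ) :
    ∫⁻ ω, (P.foundSet B)ᶜ.indicator 1 (z, (fun i => W.o i ω), fun i => W.risMark i ω) ∂μ
      = P.voidProb B z := by
  -- `negLogE` also accepts the value `0`, so no positive lower bound on this probability is needed.
  set c : ℂ → ℝ≥0∞ := fun x => negLogE (1 - B.indicator 1 ‖x‖ *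
      (ENNReal.ofReal P.mu * (ENNReal.ofReal (P.pVis Vis.L ‖x‖) * front z x))) with hc
  have hfm : Measurable (front z) := Measurable.of_uncurry_left (f := front) measurable_front
  have hBm : Measurable (B.indicator (1 : ℝ → ℝ≥0∞)) := measurable_one.indicator hB
  have hpm := P.measurable_pVis Vis.L
  have hcm : Measurable c := measurable_negLogE.comp (measurable_const.sub
    ((hBm.comp measurable_norm).mul (((hpm.comp measurable_norm).ennreal_ofReal.mul hfm).const_mul _)))
  have hce : ∀ x, expNeg (c x) = 1 - B.indicator 1 ‖x‖ *
      (ENNReal.ofReal P.mu * (ENNReal.ofReal (P.pVis Vis.L ‖x‖) * front z x)) := fun x =>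
    expNeg_negLogE tsub_le_self
  have hle : ∀ x : ℂ, B.indicator 1 ‖x‖ *
      (ENNReal.ofReal P.mu * (ENNReal.ofReal (P.pVis Vis.L ‖x‖) * front z x)) ≤ 1 := fun x => by
    refine mul_le_one' ?_ (mul_le_one' ?_ (mul_le_one' ?_ (front_le_one z x)))
    · exact Set.indicator_le (fun _ _ => le_rfl) _
    · exact ENNReal.ofReal_le_one.2 P.mu_le_one
    · exact ENNReal.ofReal_le_one.2 (P.pVisL_le_one (norm_nonneg x))
  have hind : IndepFun (fun ω i => W.o i ω) (fun ω i => W.risMark i ω) μ := by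
    refine W.indepFun_of_disjoint (S := {some none}) (T := ⋃ i, risSet i) ?_
      (W.measurable_o_sig (by simp))
      (W.measurable_risMarks_sig fun i => Set.subset_iUnion risSet i)
    rw [Set.disjoint_singleton_left, Set.mem_iUnion]
    rintro ⟨i, hi⟩
    simp [risSet] at hi
  have hmm : Measurable fun ω i => W.risMark i ω :=
    (W.measurable_risMarks_sig (S := Set.univ) fun i => Set.subset_univ _).mono (W.sig_le _) le_rfl
  have hFm : Measurable (Function.uncurry fun (y : ℕ → ℂ) (k : ℕ → ℝ × ℝ × ℝ) =>
      expNeg (∑' i, P.risCost B z (y i) (k i))) := by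
    refine expNeg_measurable.comp (Measurable.tsum fun i => ?_)
    have : Measurable fun p : (ℕ → ℂ) × (ℕ → ℝ × ℝ × ℝ) => ((z, p.1 i), p.2 i) := by fun_prop
    exact (P.measurable_risCost hB).comp this
  calc _ = ∫⁻ ω, expNeg (∑' i, P.risCost B z (W.o i ω) (W.risMark i ω)) ∂μ :=
        lintegral_congr fun ω => (P.expNeg_tsum_risCost B z _ _).symm
    _ = ∫⁻ ω, ∫⁻ ω', expNeg (∑' i, P.risCost B z (W.o i ω) (W.risMark i ω')) ∂μ ∂μ :=
        lintegral_of_indepFun W.measurable_o hmm hind hFm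
    _ = ∫⁻ ω, expNeg (∑' i, c (W.o i ω)) ∂μ := by
        refine lintegral_congr fun ω => ?_
        refine W.lintegral_expNeg_tsum (S := risSet)
          (e := fun i ω' => P.risCost B z (W.o i ω) (W.risMark i ω'))
          (c := fun i => c (W.o i ω)) (fun i j hij => risSet_disjoint hij) (fun i => ?_) fun i => ?_
        · have h1 := W.measurable_risMark_sig (S := risSet i) (i := i) le_rfl
          have h2 : Measurable fun k : ℝ × ℝ × ℝ => ((z, W.o i ω), k) := by fun_prop
          exact ((P.measurable_risCost hB).comp h2).comp h1
        · rw [W.lintegral_expNeg_risCost B, hce]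
    _ = _ := by
        rw [W.o_ppp.laplace_functional P.lamO_pos.le hcm, Params.voidProb]
        congr 2
        refine lintegral_congr fun x => ?_
        rw [hce, ENNReal.sub_sub_cancel ENNReal.one_ne_top (hle x)]

/-- Averages over the configurations without a suitable obstacle with distance in `B`. -/
theorem setLIntegral_not_found {S : Set (Option (Option Source))} (h0 : none ∈ S)
    (hS : Disjoint S risAll) {β : Type*} [MeasurableSpace β] {V : Ω → β}
    (hV : Measurable[W.sig S] V) {F : β → ℝ≥0∞} (hF : Measurable F) {B : Set ℝ}
    (hB : MeasurableSet B) :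
    ∫⁻ ω in (W.risConfig ⁻¹' P.foundSet B)ᶜ, F (V ω) ∂μ
      = ∫⁻ ω, F (V ω) * P.voidProb B (W.b 0 ω) ∂μ := by
  have hb : Measurable[W.sig S] (W.b 0) := W.measurable_b_apply_sig h0 0
  have hU : Measurable[W.sig S] fun ω => (W.b 0 ω, V ω) := hb.prodMk hV
  have hR : Measurable[W.sig risAll] fun ω => (fun i => W.o i ω, fun i => W.risMark i ω) :=
    (W.measurable_o_sig (S := risAll) (Or.inl rfl)).prodMk
      (W.measurable_risMarks_sig (S := risAll) fun i x hx => Or.inr (Set.mem_iUnion.2 ⟨i, hx⟩))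
  have hind := W.indepFun_of_disjoint hS hU hR
  have hm : Measurable ((P.foundSet B)ᶜ.indicator
      (1 : ℂ × (ℕ → ℂ) × (ℕ → ℝ × ℝ × ℝ) → ℝ≥0∞)) :=
    measurable_one.indicator (P.measurableSet_foundSet hB).compl
  have hG : Measurable (Function.uncurry fun (u : ℂ × β) (v : (ℕ → ℂ) × (ℕ → ℝ × ℝ × ℝ)) =>
      F u.2 * (P.foundSet B)ᶜ.indicator 1 (u.1, v)) := by
    have h1 : Measurable fun p : (ℂ × β) × ((ℕ → ℂ) × (ℕ → ℝ × ℝ × ℝ)) => F p.1.2 :=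
      hF.comp (measurable_snd.comp measurable_fst)
    have h2 : Measurable fun p : (ℂ × β) × ((ℕ → ℂ) × (ℕ → ℝ × ℝ × ℝ)) => (p.1.1, p.2) :=
      (measurable_fst.comp measurable_fst).prodMk measurable_snd
    exact h1.mul (hm.comp h2)
  have hset : MeasurableSet (W.risConfig ⁻¹' P.foundSet B)ᶜ :=
    (W.measurable_risConfig (P.measurableSet_foundSet hB)).compl
  calc _ = ∫⁻ ω, F (V ω) * (P.foundSet B)ᶜ.indicator 1 (W.b 0 ω, fun i => W.o i ω,
          fun i => W.risMark i ω) ∂μ := by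
        rw [← lintegral_indicator hset]
        refine lintegral_congr fun ω => ?_
        by_cases h : W.risConfig ω ∈ P.foundSet B
        · have h1 : ω ∉ (W.risConfig ⁻¹' P.foundSet B)ᶜ := fun hc => hc h
          have h2 : (W.b 0 ω, (fun i => W.o i ω), fun i => W.risMark i ω) ∉ (P.foundSet B)ᶜ :=
            fun hc => hc h
          rw [Set.indicator_of_notMem h1, Set.indicator_of_notMem h2, mul_zero]
        · rw [Set.indicator_of_mem (by exact h), Set.indicator_of_mem (by exact h), Pi.one_apply,
            mul_one]
    _ = ∫⁻ ω, ∫⁻ ω', F (V ω) * (P.foundSet B)ᶜ.indicator 1 (W.b 0 ω, fun i => W.o i ω',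
          fun i => W.risMark i ω') ∂μ ∂μ :=
        lintegral_of_indepFun (hU.mono (W.sig_le _) le_rfl) (hR.mono (W.sig_le _) le_rfl) hind hG
    _ = _ := by
        refine lintegral_congr fun ω => ?_
        rw [lintegral_const_mul, W.lintegral_risConfig_compl hB]
        have h2 : Measurable fun ω' => (W.b 0 ω, (fun i => W.o i ω'), fun i => W.risMark i ω') :=
          measurable_const.prodMk (hR.mono (W.sig_le _) le_rfl)
        exact hm.comp h2

end Network

end RISNet

/-! ### Law of the distance of the nearest suitable obstacle -/

namespace RISNet

open Filter Topology

lemma measure_ext_Iio {μ ν : Measure ℝ} [IsFiniteMeasure μ]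
    (h : ∀ r, μ (Set.Iio r) = ν (Set.Iio r)) : μ = ν := by
  refine Measure.ext_of_generateFrom_of_iUnion (Set.range Set.Iio) (fun n : ℕ => Set.Iio (n : ℝ))
    ?_ isPiSystem_Iio ?_ (fun n => ⟨_, rfl⟩) (fun n => measure_ne_top _ _) ?_
  · rw [← borel_eq_generateFrom_Iio]; exact Real.borelSpace.measurable_eq
  · refine Set.eq_univ_of_forall fun x => Set.mem_iUnion.2 ?_
    obtain ⟨n, hn⟩ := exists_nat_gt x
    exact ⟨n, hn⟩
  · rintro s ⟨r, rfl⟩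
    exact h r

/-- Finite measures on `β × ℝ` that agree on the sets `A × (-∞, r)` are equal. -/
lemma measure_ext_prod_Iio {β : Type*} [MeasurableSpace β] {M N : Measure (β × ℝ)}
    [IsFiniteMeasure M]
    (h : ∀ A, MeasurableSet A → ∀ r, M (A ×ˢ Set.Iio r) = N (A ×ˢ Set.Iio r)) : M = N := by
  refine Measure.ext_prod fun {A C} hA hC => ?_
  have hpre : ∀ (R : Measure (β × ℝ)) (D : Set ℝ), MeasurableSet D →
      ((R.restrict (A ×ˢ Set.univ)).map Prod.snd) D = R (A ×ˢ D) := fun R D hD => by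
    rw [Measure.map_apply measurable_snd hD, Measure.restrict_apply (measurable_snd hD)]
    congr 1
    ext p
    simp [and_comm]
  have h1 : (M.restrict (A ×ˢ Set.univ)).map Prod.snd
      = (N.restrict (A ×ˢ Set.univ)).map Prod.snd := by
    refine measure_ext_Iio fun r => ?_
    rw [hpre _ _ measurableSet_Iio, hpre _ _ measurableSet_Iio, h A hA]
  rw [← hpre M C hC, ← hpre N C hC, h1]

namespace Network

variable {P : Params} {Ω : Type*} [mΩ : MeasurableSpace Ω] {μ : Measure Ω} (W : Network P μ)
variable [IsProbabilityMeasure μ]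

/-- Averages when no cascaded link exists. -/
theorem setLIntegral_existsCL_compl {S : Set (Option (Option Source))} (h0 : none ∈ S)
    (hS : Disjoint S risAll) {β : Type*} [MeasurableSpace β] {V : Ω → β}
    (hV : Measurable[W.sig S] V) {F : β → ℝ≥0∞} (hF : Measurable F) :
    ∫⁻ ω in W.existsCLᶜ, F (V ω) ∂μ
      = ∫⁻ ω, F (V ω) * ENNReal.ofReal (1 - P.pCL (W.tbu ω)) ∂μ := by
  rw [W.existsCL_eq, W.setLIntegral_not_found h0 hS hV hF MeasurableSet.univ]
  refine lintegral_congr_ae ?_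
  filter_upwards [W.ae_tbu_pos] with ω hω
  rw [P.voidProb_univ (norm_pos_iff.1 hω)]
  rfl

/-- Averages when a cascaded link exists: the distance of the nearest suitable obstacle has
density `risDensity`. -/
theorem setLIntegral_existsCL {S : Set (Option (Option Source))} (h0 : none ∈ S)
    (hS : Disjoint S risAll) {β : Type*} [MeasurableSpace β] {V : Ω → β}
    (hV : Measurable[W.sig S] V) {F : β → ℝ → ℝ≥0∞} (hF : Measurable (Function.uncurry F)) :
    ∫⁻ ω in W.existsCL, F (V ω) (W.tru ω) ∂μ
      = ∫⁻ ω, (∫⁻ r in Set.Ioi 0, ENNReal.ofReal (P.risDensity (W.tbu ω) r) * F (V ω) r) ∂μ := by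
  have hVm : Measurable V := hV.mono (W.sig_le _) le_rfl
  have hT := W.measurable_tbu
  have hdm : Measurable fun p : Ω × ℝ => ENNReal.ofReal (P.risDensity (W.tbu p.1) (max p.2 0)) :=
    (P.measurable_risDensity.comp ((hT.comp measurable_fst).prodMk measurable_snd)).ennreal_ofReal
  have hVp : Measurable fun p : Ω × ℝ => (V p.1, p.2) :=
    (hVm.comp measurable_fst).prodMk measurable_snd
  -- Both sides are integrals of `F` against measures on `β × ℝ`, which are compared on the sets `A
  -- × (-∞, r)`. The density is written at `max p.2 0`, the form that is jointly measurable.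
  set M : Measure (β × ℝ) := (μ.restrict W.existsCL).map fun ω => (V ω, W.tru ω) with hM
  set N : Measure (β × ℝ) := ((μ.prod (volume.restrict (Set.Ioi (0 : ℝ)))).withDensity
    fun p => ENNReal.ofReal (P.risDensity (W.tbu p.1) (max p.2 0))).map fun p => (V p.1, p.2) with hN
  have hNint : ∀ G : β × ℝ → ℝ≥0∞, Measurable G → ∫⁻ p, G p ∂N
      = ∫⁻ ω, (∫⁻ r in Set.Ioi 0, ENNReal.ofReal (P.risDensity (W.tbu ω) r) * G (V ω, r)) ∂μ :=
    fun G hG => by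
    have hGV : Measurable fun p : Ω × ℝ => G (V p.1, p.2) := hG.comp hVp
    rw [hN, lintegral_map hG hVp, lintegral_withDensity_eq_lintegral_mul _ hdm hGV,
      lintegral_prod _ (hdm.mul hGV).aemeasurable]
    refine lintegral_congr fun ω => setLIntegral_congr_fun measurableSet_Ioi fun r hr => ?_
    simp only [Pi.mul_apply]
    rw [max_eq_left (le_of_lt hr)]
  have hMN : M = N := by
    refine measure_ext_prod_Iio fun A hA r => ?_
    have hAV : MeasurableSet (V ⁻¹' A) := hVm hA
    have hset : MeasurableSet (A ×ˢ Set.Iio r) := hA.prod measurableSet_Iio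
    have hfound := W.measurable_risConfig (P.measurableSet_foundSet (measurableSet_Iio (a := r)))
    have hM1 : M (A ×ˢ Set.Iio r) = μ (V ⁻¹' A ∩ W.risConfig ⁻¹' P.foundSet (Set.Iio r)) := by
      rw [hM, Measure.map_apply (hVm.prodMk W.measurable_tru) hset, Measure.restrict_apply
        (hVm.prodMk W.measurable_tru hset), ← W.existsCL_inter_tru_lt]
      congr 1
      ext ω
      simp only [Set.mem_inter_iff, Set.mem_preimage, Set.mem_prod, Set.mem_Iio, Set.mem_ofPred_eq]
      tauto
    have hN1 : N (A ×ˢ Set.Iio r) = ∫⁻ ω, A.indicator 1 (V ω)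
        * (∫⁻ x in Set.Ioi 0 ∩ Set.Iio r, ENNReal.ofReal (P.risDensity (W.tbu ω) x)) ∂μ := by
      rw [← lintegral_indicator_one hset, hNint _ (measurable_one.indicator hset)]
      refine lintegral_congr fun ω => ?_
      have h1 : ∀ x, ENNReal.ofReal (P.risDensity (W.tbu ω) x)
            * (A ×ˢ Set.Iio r).indicator 1 (V ω, x)
          = A.indicator 1 (V ω) * (Set.Iio r).indicator
            (fun x => ENNReal.ofReal (P.risDensity (W.tbu ω) x)) x := fun x => by
        by_cases ha : V ω ∈ A <;> by_cases hx : x < r <;> simp [ha, hx]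
      rw [lintegral_congr h1, lintegral_const_mul' _ _ (by
        by_cases ha : V ω ∈ A <;> simp [ha]), lintegral_indicator measurableSet_Iio,
        Measure.restrict_restrict measurableSet_Iio, Set.inter_comm]
    rcases le_or_gt r 0 with hr | hr
    · have h1 : Set.Ioi 0 ∩ Set.Iio r = (∅ : Set ℝ) := by
        ext x; simp only [Set.mem_inter_iff, Set.mem_Ioi, Set.mem_Iio, Set.mem_empty_iff_false,
          iff_false, not_and, not_lt]
        intro h; linarith
      rw [hM1, hN1, h1, ← W.existsCL_inter_tru_lt]
      have h2 : {ω | W.tru ω < r} = ∅ := by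
        ext ω
        simp only [Set.mem_ofPred_eq, Set.mem_empty_iff_false, iff_false, not_lt]
        exact hr.trans (W.tru_nonneg ω)
      simp [h2]
    · have h1 : Set.Ioi 0 ∩ Set.Iio r = Set.Ioo 0 r := rfl
      have h2 := W.setLIntegral_not_found h0 hS hV (F := A.indicator 1)
        (measurable_one.indicator hA) (measurableSet_Iio (a := r))
      have h3 : μ (V ⁻¹' A ∩ (W.risConfig ⁻¹' P.foundSet (Set.Iio r))ᶜ)
          = ∫⁻ ω, A.indicator 1 (V ω) * P.voidProb (Set.Iio r) (W.b 0 ω) ∂μ := by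
        rw [← h2, ← Measure.restrict_apply hAV, ← lintegral_indicator_one hAV]
        rfl
      -- The mass of the density below `r` and the void probability of the disc add up to one.
      -- Removing the finite void term from the two decompositions of the event `V ∈ A` gives the
      -- equality on this set.
      have h4 : μ (V ⁻¹' A) = N (A ×ˢ Set.Iio r)
          + ∫⁻ ω, A.indicator 1 (V ω) * P.voidProb (Set.Iio r) (W.b 0 ω) ∂μ := by
        have hmA : Measurable fun ω => A.indicator (1 : β → ℝ≥0∞) (V ω) :=
          (measurable_one.indicator hA).comp hVm
        have h5 : ∀ᵐ ω ∂μ, A.indicator (1 : β → ℝ≥0∞) (V ω)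
            = A.indicator 1 (V ω)
              * (∫⁻ x in Set.Ioo 0 r, ENNReal.ofReal (P.risDensity (W.tbu ω) x))
              + A.indicator 1 (V ω) * P.voidProb (Set.Iio r) (W.b 0 ω) := by
          filter_upwards [W.ae_tbu_pos] with ω hω
          have h6 : 0 ≤ 1 - Real.exp (-P.lamR * P.risMass ‖W.b 0 ω‖ r) := by
            rw [sub_nonneg, Real.exp_le_one_iff]
            have h7 : 0 ≤ P.risMass ‖W.b 0 ω‖ r :=
              intervalIntegral.integral_nonneg hr.le fun x hx => P.aBar_mul_nonneg _ hx.1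
            have := mul_nonneg P.lamR_nonneg h7
            linarith
          rw [P.lintegral_risDensity hω hr.le, P.voidProb_Iio (norm_pos_iff.1 hω) hr.le, ← mul_add,
            tbu, ← ENNReal.ofReal_add h6 (Real.exp_pos _).le, sub_add_cancel, ENNReal.ofReal_one,
            mul_one]
        have hvm : Measurable fun ω => A.indicator (1 : β → ℝ≥0∞) (V ω)
            * ∫⁻ x in Set.Ioo 0 r, ENNReal.ofReal (P.risDensity (W.tbu ω) x) := by
          have h8 : ∀ ω, ∫⁻ x in Set.Ioo 0 r, ENNReal.ofReal (P.risDensity (W.tbu ω) x)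
              = ∫⁻ x in Set.Ioo 0 r, ENNReal.ofReal (P.risDensity (W.tbu ω) (max x 0)) :=
            fun ω => setLIntegral_congr_fun measurableSet_Ioo fun x hx => by
              simp only [max_eq_left hx.1.le]
          simp_rw [h8]
          exact hmA.mul hdm.lintegral_prod_right'
        calc μ (V ⁻¹' A) = ∫⁻ ω, A.indicator 1 (V ω) ∂μ := by
              rw [← lintegral_indicator_one hAV]; rfl
          _ = _ := by rw [lintegral_congr_ae h5, lintegral_add_left hvm, hN1, h1]
      have h6 : ∫⁻ ω, A.indicator 1 (V ω) * P.voidProb (Set.Iio r) (W.b 0 ω) ∂μ ≠ ∞ := by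
        rw [← h3]; exact measure_ne_top _ _
      have h7 := measure_inter_add_sdiff (μ := μ) (V ⁻¹' A) hfound
      rw [← hM1, Set.sdiff_eq, h3, h4] at h7
      exact (ENNReal.add_left_inj h6).1 h7
  calc ∫⁻ ω in W.existsCL, F (V ω) (W.tru ω) ∂μ = ∫⁻ p, Function.uncurry F p ∂M := by
        rw [hM, lintegral_map hF (hVm.prodMk W.measurable_tru)]; rfl
    _ = _ := by rw [hMN, hNint _ hF]; rfl

end Network

end RISNet

/-! ### Total mass of the distance density, label sets, and the average over the serving fading -/

namespace RISNet

open Filter Topology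

/-- Exhaustion of the half-line by `(0, n)`: the void probabilities converge to that of the whole
plane. -/
lemma lintegral_risDensity_Ioi (P : Params) {t : ℝ} (ht : 0 < t) :
    ∫⁻ r in Set.Ioi 0, ENNReal.ofReal (P.risDensity t r) = ENNReal.ofReal (P.pCL t) := by
  have h1 : Set.Ioi (0 : ℝ) = ⋃ n : ℕ, Set.Ioo 0 (n : ℝ) := by
    ext x
    simp only [Set.mem_Ioi, Set.mem_iUnion, Set.mem_Ioo]
    constructor
    · intro hx
      obtain ⟨n, hn⟩ := exists_nat_gt x
      exact ⟨n, hx, hn⟩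
    · rintro ⟨n, hx, -⟩
      exact hx
  have hmono : Monotone fun n : ℕ => Set.Ioo (0 : ℝ) n := fun m n hmn =>
    Set.Ioo_subset_Ioo_right (by exact_mod_cast hmn)
  have h2 : Tendsto (fun n : ℕ => P.risMass t n) atTop
      (𝓝 (∫ r in Set.Ioi (0 : ℝ), P.aBar t r * r)) :=
    intervalIntegral_tendsto_integral_Ioi 0 (P.integrableOn_aBar_mul t)
      tendsto_natCast_atTop_atTop
  have h3 : Tendsto (fun n : ℕ => ∫⁻ r in Set.Ioo (0 : ℝ) n, ENNReal.ofReal (P.risDensity t r)) atTop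
      (𝓝 (ENNReal.ofReal (P.pCL t))) := by
    have h4 := ENNReal.tendsto_ofReal (tendsto_const_nhds (x := (1 : ℝ)).sub
      ((Real.continuous_exp.tendsto _).comp (h2.const_mul (-P.lamR))))
    exact h4.congr fun n => (P.lintegral_risDensity ht (Nat.cast_nonneg n)).symm
  have h5 := tendsto_atTop_iSup (f := fun n : ℕ =>
    ∫⁻ r in Set.Ioo (0 : ℝ) n, ENNReal.ofReal (P.risDensity t r))
    fun m n hmn => lintegral_mono_set (hmono hmn)
  conv_lhs => rw [h1]
  rw [setLIntegral_iUnion_of_directed _ hmono.directed_le]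
  exact tendsto_nhds_unique h5 h3

namespace Params

variable (P : Params)

lemma meanPower_congr {q : Link} (hq : q ≠ Link.CL) (t r θ : ℝ) :
    P.meanPower q t r θ = P.meanPower q t 0 0 := by
  cases q with
  | CL => exact absurd rfl hq
  | DL => rfl
  | DN => rfl

lemma measurable_pCL : Measurable P.pCL := by
  have h1 : Measurable fun q : ℝ × ℝ => P.aBar q.1 q.2 * q.2 := P.measurable_aBar.mul measurable_snd
  have h2 := h1.stronglyMeasurable.integral_prod_right' (ν := volume.restrict (Set.Ioi (0 : ℝ)))
  exact measurable_const.sub (Real.continuous_exp.measurable.comp (measurable_const.mul h2.measurable))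

end Params

namespace Network

variable {P : Params} {Ω : Type*} [mΩ : MeasurableSpace Ω] {μ : Measure Ω} (W : Network P μ)

/-- The sources of the BSs and of their interference. -/
def bsAll : Set (Option (Option Source)) := {none} ∪ ⋃ i, bsSet (i + 1)

/-- The sources of the blockage of the serving link and of the angle. -/
def auxSet : Set (Option (Option Source)) := {some (some (.bsBlock 0)), some (some .theta)}

/-- All sources but the fading of the serving link. -/
def noFading : Set (Option (Option Source)) := {x | ∀ q, x ≠ some (some (.servFading q))}

lemma mem_bsAll {x : Option (Option Source)} : x ∈ bsAll ↔ x = none ∨ ∃ i, x ∈ bsSet (i + 1) := by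
  simp [bsAll]

lemma mem_risAll {x : Option (Option Source)} : x ∈ risAll ↔ x = some none ∨ ∃ i, x ∈ risSet i := by
  simp [risAll]

lemma disjoint_bsAll_auxSet : Disjoint bsAll auxSet := by
  refine Set.disjoint_left.2 fun x h1 h2 => ?_
  rcases mem_bsAll.1 h1 with rfl | ⟨i, hi⟩
  · simp [auxSet] at h2
  · simp only [bsSet, Set.mem_insert_iff, Set.mem_singleton_iff] at hi
    rcases hi with rfl | rfl | rfl | rfl | rfl <;> simp [auxSet] at h2

lemma disjoint_risAll : Disjoint (bsAll ∪ auxSet) risAll := by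
  refine Set.disjoint_left.2 fun x h1 h2 => ?_
  rcases mem_risAll.1 h2 with rfl | ⟨j, hj⟩
  · rcases h1 with h1 | h1
    · rcases mem_bsAll.1 h1 with h | ⟨i, hi⟩
      · simp at h
      · simp [bsSet] at hi
    · simp [auxSet] at h1
  · rcases h1 with h1 | h1
    · rcases mem_bsAll.1 h1 with rfl | ⟨i, hi⟩
      · simp [risSet] at hj
      · simp only [bsSet, Set.mem_insert_iff, Set.mem_singleton_iff] at hi
        rcases hi with rfl | rfl | rfl | rfl | rfl <;> simp [risSet] at hj
    · simp only [auxSet, Set.mem_insert_iff, Set.mem_singleton_iff] at h1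
      rcases h1 with rfl | rfl <;> simp [risSet] at hj

lemma subset_noFading : bsAll ∪ auxSet ⊆ noFading := by
  rintro x h1 q rfl
  rcases h1 with h1 | h1
  · rcases mem_bsAll.1 h1 with h | ⟨i, hi⟩
    · simp at h
    · simp [bsSet] at hi
  · simp [auxSet] at h1

lemma risAll_subset_noFading : risAll ⊆ noFading := by
  rintro x h1 q rfl
  rcases mem_risAll.1 h1 with h | ⟨i, hi⟩
  · simp at h
  · simp [risSet] at hi

lemma measurable_tbu_sig {S : Set (Option (Option Source))} (h : none ∈ S) :
    Measurable[W.sig S] W.tbu := measurable_norm.comp (W.measurable_b_apply_sig h 0)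

/-- Interferers have labels at least `1`, so their marks avoid the blockage of the tagged BS.
Together with the positions they avoid all obstacle sources and the angle. -/
lemma measurable_interf_sig (i : ℕ) : Measurable[W.sig bsAll] (W.interf (i + 1)) := by
  have hb : Measurable[W.sig bsAll] (W.b (i + 1)) :=
    W.measurable_b_apply_sig (Or.inl rfl) (i + 1)
  have hX : ∀ {s : Source}, some (some s) ∈ bsSet (i + 1) → Measurable[W.sig bsAll] (W.X s) :=
    fun h => W.measurable_X_sig (mem_bsAll.2 (Or.inr ⟨i, h⟩))
  have hV : ∀ v, Measurable[W.sig bsAll] fun ω =>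
      P.visPower v (i + 1) (W.b (i + 1) ω) (fun s => W.X s ω) := fun v => by
    have h1 : Measurable[W.sig bsAll] (W.X (.bsFading v (i + 1))) :=
      hX (by cases v <;> simp [bsSet])
    have h2 : Measurable[W.sig bsAll] fun ω =>
        deviation (W.X (.bsAngle (i + 1)) ω, W.X (.bsBeam (i + 1)) ω) :=
      measurable_deviation.comp ((hX (by simp [bsSet])).prodMk (hX (by simp [bsSet])))
    unfold Params.visPower
    exact (((P.measurable_pathGain v).comp (measurable_norm.comp hb)).mul
      (P.measurable_gainB.comp h2)).mul h1
  have hblock : Measurable[W.sig bsAll] (W.X (.bsBlock (i + 1))) := hX (by simp [bsSet])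
  have hp : Measurable[W.sig bsAll] fun ω => P.pVis Vis.L ‖W.b (i + 1) ω‖ :=
    (P.measurable_pVis Vis.L).comp (measurable_norm.comp hb)
  have : W.interf (i + 1) = fun ω => open Classical in
      if W.X (.bsBlock (i + 1)) ω < P.pVis Vis.L ‖W.b (i + 1) ω‖
        then P.visPower Vis.L (i + 1) (W.b (i + 1) ω) (fun s => W.X s ω)
        else P.visPower Vis.N (i + 1) (W.b (i + 1) ω) (fun s => W.X s ω) := by
    ext ω
    rw [W.interf_eq]
    split_ifs with h
    · exact P.markPower_eq_L h
    · exact P.markPower_eq_N h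
  rw [this]
  refine Measurable.ite ?_ ?_ ?_
  · exact (hblock.prodMk hp) measurableSet_lt'
  · exact hV Vis.L
  · exact hV Vis.N

lemma measurable_I_sig : Measurable[W.sig bsAll] W.I :=
  @Measurable.tsum Ω ℝ ℕ (W.sig bsAll) _ _ _ _ _ _ _ _ (SummationFilter.unconditional ℕ) _ _ _
    fun i => W.measurable_interf_sig i

lemma measurable_theta : Measurable W.theta := W.X_meas _

variable [IsProbabilityMeasure μ]

/-- Averaging over the fading of the serving link. -/
lemma setLIntegral_lt_fading (q : Link) {ψ : Ω → ℝ≥0∞} {x : Ω → ℝ}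
    (hψ : Measurable[W.sig noFading] ψ) (hx : Measurable[W.sig noFading] x)
    (h0 : ∀ᵐ ω ∂μ, ψ ω ≠ 0 → 0 ≤ x ω) :
    ∫⁻ ω in {ω | x ω < W.X (.servFading q) ω}, ψ ω ∂μ
      = ∫⁻ ω, ψ ω * ENNReal.ofReal (erlangTail (P.mLink q) (P.mLink q * x ω)) ∂μ := by
  have hind : IndepFun (fun ω => (ψ ω, x ω)) (W.X (.servFading q)) μ := by
    refine W.indepFun_of_disjoint (S := noFading) (T := {some (some (.servFading q))}) ?_
      (hψ.prodMk hx) (W.measurable_X_sig (by simp))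
    rw [Set.disjoint_singleton_right]
    intro h
    exact h q rfl
  have hψm : Measurable ψ := hψ.mono (W.sig_le _) le_rfl
  have hxm : Measurable x := hx.mono (W.sig_le _) le_rfl
  have hset : MeasurableSet {ω | x ω < W.X (.servFading q) ω} := measurableSet_lt hxm (W.X_meas _)
  have hF : Measurable (Function.uncurry fun (p : ℝ≥0∞ × ℝ) (h : ℝ) =>
      p.1 * (Set.Ioi p.2).indicator 1 h) := by
    have h1 : MeasurableSet {r : (ℝ≥0∞ × ℝ) × ℝ | r.1.2 < r.2} :=
      measurableSet_lt (measurable_snd.comp measurable_fst) measurable_snd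
    have h2 : Measurable fun r : (ℝ≥0∞ × ℝ) × ℝ => r.1.1 := measurable_fst.comp measurable_fst
    exact h2.mul (measurable_one.indicator h1)
  calc _ = ∫⁻ ω, ψ ω * (Set.Ioi (x ω)).indicator 1 (W.X (.servFading q) ω) ∂μ := by
        rw [← lintegral_indicator hset]
        refine lintegral_congr fun ω => ?_
        by_cases h : x ω < W.X (.servFading q) ω <;> simp [h]
    _ = ∫⁻ ω, ∫⁻ ω', ψ ω * (Set.Ioi (x ω)).indicator 1 (W.X (.servFading q) ω') ∂μ ∂μ :=
        lintegral_of_indepFun (hψm.prodMk hxm) (W.X_meas _) hind hF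
    _ = _ := by
        refine lintegral_congr_ae ?_
        filter_upwards [h0] with ω hω
        by_cases hz : ψ ω = 0
        · simp [hz]
        · rw [lintegral_const_mul (f := fun ω' => (Set.Ioi (x ω)).indicator 1 (W.X (.servFading q) ω')) _
              ((measurable_one.indicator measurableSet_Ioi).comp (W.X_meas _)),
            ← nakagami_Ioi (P.mLink_pos q) (hω hz)]
          congr 1
          rw [← lintegral_map (f := (Set.Ioi (x ω)).indicator 1)
            (measurable_one.indicator measurableSet_Ioi) (W.X_meas _), W.X_law,
            lintegral_indicator_one measurableSet_Ioi]
          rfl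

omit [IsProbabilityMeasure μ] in
lemma measurable_meanPower_sig (q : Link) :
    Measurable[W.sig noFading] fun ω => P.meanPower q (W.tbu ω) (W.tru ω) (W.theta ω) := by
  have h1 : Measurable[W.sig noFading] W.tbu := W.measurable_tbu_sig (fun q => by simp)
  have h2 : Measurable[W.sig noFading] W.tru :=
    W.measurable_tru_sig (fun q => by simp) risAll_subset_noFading
  have h3 : Measurable[W.sig noFading] W.theta := W.measurable_X_sig (fun q => by simp)
  exact (P.measurable_meanPower q).comp (h1.prodMk (h2.prodMk h3))

omit [IsProbabilityMeasure μ] in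
lemma measurable_I_noFading : Measurable[W.sig noFading] W.I :=
  W.measurable_I_sig.mono (W.sig_mono (Set.subset_union_left.trans subset_noFading)) le_rfl

/-- The event that the SINR exceeds a threshold, averaged over the serving fading. -/
theorem setLIntegral_sinrOf {q : Link} {γ : ℝ} (hγ : 0 < γ) {ψ : Ω → ℝ≥0∞}
    (hψ : Measurable[W.sig noFading] ψ)
    (h0 : ∀ᵐ ω ∂μ, ψ ω ≠ 0 → 0 < P.meanPower q (W.tbu ω) (W.tru ω) (W.theta ω)) :
    ∫⁻ ω in {ω | γ < W.sinrOf q ω}, ψ ω ∂μ = ∫⁻ ω, ψ ω * ENNReal.ofReal (erlangTail (P.mLink q)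
        (P.sArg q γ (W.tbu ω) (W.tru ω) (W.theta ω) * (P.sigma2 + W.I ω))) ∂μ := by
  have hPm := W.measurable_meanPower_sig q
  have hIm := W.measurable_I_noFading
  -- Where the mean power is positive, the SINR exceeds `γ` exactly when the fading exceeds `x`.
  -- Elsewhere `ψ` vanishes almost surely.
  set x : Ω → ℝ := fun ω => γ * (P.sigma2 + W.I ω)
    / P.meanPower q (W.tbu ω) (W.tru ω) (W.theta ω) with hx
  have hxm : Measurable[W.sig noFading] x :=
    (measurable_const.mul (measurable_const.add hIm)).div hPm
  have hσ := P.sigma2_pos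
  have hx0 : ∀ᵐ ω ∂μ, ψ ω ≠ 0 → 0 ≤ x ω := by
    filter_upwards [h0, W.ae_I_nonneg] with ω h1 h2 h3
    have := h1 h3
    rw [hx]
    positivity
  have hψm : Measurable ψ := hψ.mono (W.sig_le _) le_rfl
  have hsm : Measurable fun ω => W.sinrOf q ω := by
    unfold sinrOf power
    exact ((hPm.mono (W.sig_le _) le_rfl).mul (W.X_meas _)).div
      (measurable_const.add W.measurable_I)
  have hs1 : MeasurableSet {ω | γ < W.sinrOf q ω} := measurableSet_lt measurable_const hsm
  have hs2 : MeasurableSet {ω | x ω < W.X (.servFading q) ω} :=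
    measurableSet_lt (hxm.mono (W.sig_le _) le_rfl) (W.X_meas _)
  have h4 : ∀ ω, P.mLink q * x ω
      = P.sArg q γ (W.tbu ω) (W.tru ω) (W.theta ω) * (P.sigma2 + W.I ω) := fun ω => by
    rw [hx, Params.sArg]; ring
  simp_rw [← h4]
  rw [← W.setLIntegral_lt_fading q hψ hxm hx0, ← lintegral_indicator hs1, ← lintegral_indicator hs2]
  refine lintegral_congr_ae ?_
  filter_upwards [h0, W.ae_I_nonneg] with ω h1 h2
  by_cases hz : ψ ω = 0
  · simp [Set.indicator, hz]
  · have hp := h1 hz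
    have hI : 0 < P.sigma2 + W.I ω := by linarith
    have h5 : (γ < W.sinrOf q ω) = (x ω < W.X (.servFading q) ω) := by
      rw [sinrOf, power, hx, lt_div_iff₀ hI]
      simp only
      rw [div_lt_iff₀ hp, mul_comm (W.X _ ω)]
    simp only [Set.indicator, Set.mem_ofPred_eq, h5]

end Network

end RISNet

/-! ### Replacing the interference by its conditional law -/

namespace RISNet

open Filter Topology

namespace Network

variable {P : Params} {Ω : Type*} [mΩ : MeasurableSpace Ω] {μ : Measure Ω} (W : Network P μ)

/-- The blockage variable of the tagged BS and the angle. -/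
def aux (ω : Ω) : ℝ × ℝ := (W.X (.bsBlock 0) ω, W.theta ω)

lemma measurable_aux_sig : Measurable[W.sig auxSet] W.aux := by
  have h1 : Measurable[W.sig auxSet] (W.X (.bsBlock 0)) := W.measurable_X_sig (by simp [auxSet])
  have h2 : Measurable[W.sig auxSet] (W.X .theta) := W.measurable_X_sig (by simp [auxSet])
  exact h1.prodMk h2

lemma measurable_aux : Measurable W.aux := W.measurable_aux_sig.mono (W.sig_le _) le_rfl

lemma measurable_tbu_I_sig : Measurable[W.sig bsAll] fun ω => (W.tbu ω, W.I ω) :=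
  (W.measurable_tbu_sig (S := bsAll) (Or.inl rfl)).prodMk W.measurable_I_sig

lemma measurable_tbu_aux_I_sig :
    Measurable[W.sig (bsAll ∪ auxSet)] fun ω => (W.tbu ω, W.aux ω, W.I ω) := by
  have h1 : Measurable[W.sig (bsAll ∪ auxSet)] W.tbu := W.measurable_tbu_sig (Or.inl (Or.inl rfl))
  have h2 := W.measurable_aux_sig.mono (W.sig_mono (Set.subset_union_right (s := bsAll))) le_rfl
  have h3 := W.measurable_I_sig.mono (W.sig_mono (Set.subset_union_left (t := auxSet))) le_rfl
  exact h1.prodMk (h2.prodMk h3)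

lemma measurable_tbu_aux_sig :
    Measurable[W.sig (bsAll ∪ auxSet)] fun ω => (W.tbu ω, W.aux ω) := by
  have h1 : Measurable[W.sig (bsAll ∪ auxSet)] W.tbu := W.measurable_tbu_sig (Or.inl (Or.inl rfl))
  have h2 := W.measurable_aux_sig.mono (W.sig_mono (Set.subset_union_right (s := bsAll))) le_rfl
  exact h1.prodMk h2

variable [IsProbabilityMeasure μ]

/-- The interference, given the BS–user distance, is independent of the auxiliary variables. -/
lemma lintegral_tbu_aux_I {Φ : ℝ × (ℝ × ℝ) × ℝ → ℝ≥0∞} (hΦ : Measurable Φ) :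
    ∫⁻ ω, Φ (W.tbu ω, W.aux ω, W.I ω) ∂μ
      = ∫⁻ ω, ∫⁻ y, Φ (W.tbu ω, W.aux ω, y) ∂(W.interfLaw (W.tbu ω)) ∂μ := by
  have hind : IndepFun (fun ω => (W.tbu ω, W.I ω)) W.aux μ :=
    W.indepFun_of_disjoint disjoint_bsAll_auxSet W.measurable_tbu_I_sig W.measurable_aux_sig
  have hTI : Measurable fun ω => (W.tbu ω, W.I ω) := W.measurable_tbu.prodMk W.measurable_I
  have hind2 : IndepFun W.tbu W.aux μ := hind.comp measurable_fst measurable_id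
  have hF1 : Measurable (Function.uncurry fun (u : ℝ × ℝ) (v : ℝ × ℝ) => Φ (u.1, v, u.2)) := by
    have : Measurable fun p : (ℝ × ℝ) × (ℝ × ℝ) => (p.1.1, p.2, p.1.2) := by fun_prop
    exact hΦ.comp this
  set K : ℝ × (ℝ × ℝ) → ℝ≥0∞ := fun p => ∫⁻ y, Φ (p.1, p.2, y) ∂(W.interfLaw p.1) with hK
  have hKm : Measurable K := by
    have h1 : Measurable fun p : (ℝ × (ℝ × ℝ)) × ℝ => Φ (p.1.1, p.1.2, p.2) := by
      have : Measurable fun p : (ℝ × (ℝ × ℝ)) × ℝ => (p.1.1, p.1.2, p.2) := by fun_prop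
      exact hΦ.comp this
    have h2 := Measurable.lintegral_kernel_prod_right'
      (κ := W.interfLaw.comap (Prod.fst : ℝ × (ℝ × ℝ) → ℝ) measurable_fst) h1
    simp only [Kernel.comap_apply] at h2
    exact h2
  -- The auxiliary variables are independent of distance and interference jointly, so they are
  -- integrated out over a separate `ω'`. The interference is then disintegrated, and the auxiliary
  -- variables are put back by their independence of the distance.
  set G : ℝ → ℝ → ℝ≥0∞ := fun t y => ∫⁻ ω', Φ (t, W.aux ω', y) ∂μ with hG
  have hGm0 : Measurable fun p : (ℝ × ℝ) × Ω => Φ (p.1.1, W.aux p.2, p.1.2) := by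
    have : Measurable fun p : (ℝ × ℝ) × Ω => (p.1.1, W.aux p.2, p.1.2) :=
      (measurable_fst.comp measurable_fst).prodMk
        ((W.measurable_aux.comp measurable_snd).prodMk (measurable_snd.comp measurable_fst))
    exact hΦ.comp this
  have hGm : Measurable (Function.uncurry G) := hGm0.lintegral_prod_right'
  calc ∫⁻ ω, Φ (W.tbu ω, W.aux ω, W.I ω) ∂μ
      = ∫⁻ ω, G (W.tbu ω) (W.I ω) ∂μ := lintegral_of_indepFun hTI W.measurable_aux hind hF1
    _ = ∫⁻ ω, ∫⁻ y, G (W.tbu ω) y ∂(W.interfLaw (W.tbu ω)) ∂μ := W.lintegral_tbu_I hGm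
    _ = ∫⁻ ω, ∫⁻ ω', K (W.tbu ω, W.aux ω') ∂μ ∂μ := by
        refine lintegral_congr fun ω => ?_
        refine lintegral_lintegral_swap (f := fun y ω' => Φ (W.tbu ω, W.aux ω', y)) ?_
        have : Measurable fun p : ℝ × Ω => (W.tbu ω, W.aux p.2, p.1) :=
          measurable_const.prodMk ((W.measurable_aux.comp measurable_snd).prodMk measurable_fst)
        exact (hΦ.comp this).aemeasurable
    _ = ∫⁻ ω, K (W.tbu ω, W.aux ω) ∂μ :=
        (lintegral_of_indepFun (F := fun t v => K (t, v)) W.measurable_tbu W.measurable_aux hind2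
          hKm).symm

lemma setLIntegral_existsCL_aux {Ψ : ℝ × (ℝ × ℝ) × ℝ → ℝ≥0∞} (hΨ : Measurable Ψ) :
    ∫⁻ ω in W.existsCL, Ψ (W.tbu ω, W.aux ω, W.tru ω) ∂μ
      = ∫⁻ ω, (∫⁻ r in Set.Ioi 0, ENNReal.ofReal (P.risDensity (W.tbu ω) r)
          * Ψ (W.tbu ω, W.aux ω, r)) ∂μ := by
  have hF : Measurable (Function.uncurry fun (v : ℝ × (ℝ × ℝ)) (r : ℝ) => Ψ (v.1, v.2, r)) := by
    have : Measurable fun p : (ℝ × (ℝ × ℝ)) × ℝ => (p.1.1, p.1.2, p.2) := by fun_prop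
    exact hΨ.comp this
  exact W.setLIntegral_existsCL (Or.inl (Or.inl rfl)) disjoint_risAll W.measurable_tbu_aux_sig hF

/-- On the event that a cascaded link exists, the interference has its conditional law given the
BS–user distance. -/
lemma setLIntegral_existsCL_I {Ψ : ℝ × (ℝ × ℝ) × ℝ × ℝ → ℝ≥0∞} (hΨ : Measurable Ψ) :
    ∫⁻ ω in W.existsCL, Ψ (W.tbu ω, W.aux ω, W.tru ω, W.I ω) ∂μ
      = ∫⁻ ω in W.existsCL, ∫⁻ y, Ψ (W.tbu ω, W.aux ω, W.tru ω, y)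
          ∂(W.interfLaw (W.tbu ω)) ∂μ := by
  have hF : Measurable (Function.uncurry fun (v : ℝ × (ℝ × ℝ) × ℝ) (r : ℝ) =>
      Ψ (v.1, v.2.1, r, v.2.2)) := by
    have : Measurable fun p : (ℝ × (ℝ × ℝ) × ℝ) × ℝ => (p.1.1, p.1.2.1, p.2, p.1.2.2) := by
      fun_prop
    exact hΨ.comp this
  have hd : Measurable fun p : ℝ × ℝ => ENNReal.ofReal (P.risDensity p.1 (max p.2 0)) :=
    P.measurable_risDensity.ennreal_ofReal
  set Φ : ℝ × (ℝ × ℝ) × ℝ → ℝ≥0∞ := fun p => ∫⁻ r in Set.Ioi 0,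
    ENNReal.ofReal (P.risDensity p.1 (max r 0)) * Ψ (p.1, p.2.1, r, p.2.2) with hΦ
  have hΦm : Measurable Φ := by
    have h1 : Measurable fun q : (ℝ × (ℝ × ℝ) × ℝ) × ℝ =>
        ENNReal.ofReal (P.risDensity q.1.1 (max q.2 0)) * Ψ (q.1.1, q.1.2.1, q.2, q.1.2.2) := by
      have h2 : Measurable fun q : (ℝ × (ℝ × ℝ) × ℝ) × ℝ => (q.1.1, q.2) := by fun_prop
      have h3 : Measurable fun q : (ℝ × (ℝ × ℝ) × ℝ) × ℝ => (q.1.1, q.1.2.1, q.2, q.1.2.2) := by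
        fun_prop
      exact (hd.comp h2).mul (hΨ.comp h3)
    exact h1.lintegral_prod_right'
  set Ψ' : ℝ × (ℝ × ℝ) × ℝ → ℝ≥0∞ := fun p =>
    ∫⁻ y, Ψ (p.1, p.2.1, p.2.2, y) ∂(W.interfLaw p.1) with hΨ'
  have hΨm : Measurable Ψ' := by
    have h1 : Measurable fun p : (ℝ × (ℝ × ℝ) × ℝ) × ℝ => Ψ (p.1.1, p.1.2.1, p.1.2.2, p.2) := by
      have : Measurable fun p : (ℝ × (ℝ × ℝ) × ℝ) × ℝ => (p.1.1, p.1.2.1, p.1.2.2, p.2) := by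
        fun_prop
      exact hΨ.comp this
    have h2 := Measurable.lintegral_kernel_prod_right'
      (κ := W.interfLaw.comap (Prod.fst : ℝ × (ℝ × ℝ) × ℝ → ℝ) measurable_fst) h1
    simp only [Kernel.comap_apply] at h2
    exact h2
  have hmax : ∀ (t : ℝ) (H : ℝ → ℝ≥0∞),
      ∫⁻ r in Set.Ioi 0, ENNReal.ofReal (P.risDensity t r) * H r
        = ∫⁻ r in Set.Ioi 0, ENNReal.ofReal (P.risDensity t (max r 0)) * H r := fun t H =>
    setLIntegral_congr_fun measurableSet_Ioi fun r hr => by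
      rw [max_eq_left (le_of_lt (show (0 : ℝ) < r from hr))]
  -- The obstacles are integrated out, which trades `tru` for `risDensity`; the formula without
  -- obstacles replaces `I` by its conditional law; then the obstacles are restored.
  calc ∫⁻ ω in W.existsCL, Ψ (W.tbu ω, W.aux ω, W.tru ω, W.I ω) ∂μ
      = ∫⁻ ω, Φ (W.tbu ω, W.aux ω, W.I ω) ∂μ := by
        have h1 := W.setLIntegral_existsCL (Or.inl (Or.inl rfl)) disjoint_risAll
          W.measurable_tbu_aux_I_sig hF
        refine h1.trans (lintegral_congr fun ω => ?_)
        exact hmax _ _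
    _ = ∫⁻ ω, ∫⁻ y, Φ (W.tbu ω, W.aux ω, y) ∂(W.interfLaw (W.tbu ω)) ∂μ :=
        W.lintegral_tbu_aux_I hΦm
    _ = ∫⁻ ω, (∫⁻ r in Set.Ioi 0, ENNReal.ofReal (P.risDensity (W.tbu ω) r)
          * Ψ' (W.tbu ω, W.aux ω, r)) ∂μ := by
        refine lintegral_congr fun ω => ?_
        rw [hmax]
        have hm1 : Measurable fun p : ℝ × ℝ => ENNReal.ofReal (P.risDensity (W.tbu ω) (max p.2 0))
            * Ψ (W.tbu ω, W.aux ω, p.2, p.1) := by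
          have h2 : Measurable fun p : ℝ × ℝ => (W.tbu ω, p.2) := by fun_prop
          have h3 : Measurable fun p : ℝ × ℝ => (W.tbu ω, W.aux ω, p.2, p.1) := by fun_prop
          exact (hd.comp h2).mul (hΨ.comp h3)
        refine (lintegral_lintegral_swap (f := fun y r =>
          ENNReal.ofReal (P.risDensity (W.tbu ω) (max r 0)) * Ψ (W.tbu ω, W.aux ω, r, y))
          hm1.aemeasurable).trans ?_
        refine lintegral_congr fun r => ?_
        exact lintegral_const_mul' _ _ ENNReal.ofReal_ne_top
    _ = _ := (W.setLIntegral_existsCL_aux hΨm).symm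

lemma setLIntegral_existsCL_compl_aux {Φ : ℝ × (ℝ × ℝ) → ℝ≥0∞} (hΦ : Measurable Φ) :
    ∫⁻ ω in W.existsCLᶜ, Φ (W.tbu ω, W.aux ω) ∂μ
      = ∫⁻ ω, Φ (W.tbu ω, W.aux ω) * ENNReal.ofReal (1 - P.pCL (W.tbu ω)) ∂μ :=
  W.setLIntegral_existsCL_compl (Or.inl (Or.inl rfl)) disjoint_risAll W.measurable_tbu_aux_sig hΦ

lemma lintegral_interfLaw_comp {Φ : ℝ × (ℝ × ℝ) × ℝ → ℝ≥0∞} (hΦ : Measurable Φ) :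
    Measurable fun p : ℝ × (ℝ × ℝ) => ∫⁻ y, Φ (p.1, p.2, y) ∂(W.interfLaw p.1) := by
  have h1 : Measurable fun p : (ℝ × (ℝ × ℝ)) × ℝ => Φ (p.1.1, p.1.2, p.2) := by
    have : Measurable fun p : (ℝ × (ℝ × ℝ)) × ℝ => (p.1.1, p.1.2, p.2) := by fun_prop
    exact hΦ.comp this
  have h2 := Measurable.lintegral_kernel_prod_right'
    (κ := W.interfLaw.comap (Prod.fst : ℝ × (ℝ × ℝ) → ℝ) measurable_fst) h1
  simp only [Kernel.comap_apply] at h2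
  exact h2

lemma setLIntegral_existsCL_compl_I {Φ : ℝ × (ℝ × ℝ) × ℝ → ℝ≥0∞} (hΦ : Measurable Φ) :
    ∫⁻ ω in W.existsCLᶜ, Φ (W.tbu ω, W.aux ω, W.I ω) ∂μ
      = ∫⁻ ω in W.existsCLᶜ, ∫⁻ y, Φ (W.tbu ω, W.aux ω, y) ∂(W.interfLaw (W.tbu ω)) ∂μ := by
  have hp : Measurable fun t => ENNReal.ofReal (1 - P.pCL t) :=
    (measurable_const.sub P.measurable_pCL).ennreal_ofReal
  calc ∫⁻ ω in W.existsCLᶜ, Φ (W.tbu ω, W.aux ω, W.I ω) ∂μ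
      = ∫⁻ ω, Φ (W.tbu ω, W.aux ω, W.I ω) * ENNReal.ofReal (1 - P.pCL (W.tbu ω)) ∂μ :=
        W.setLIntegral_existsCL_compl (Or.inl (Or.inl rfl)) disjoint_risAll
          W.measurable_tbu_aux_I_sig hΦ
    _ = ∫⁻ ω, ∫⁻ y, Φ (W.tbu ω, W.aux ω, y) * ENNReal.ofReal (1 - P.pCL (W.tbu ω))
          ∂(W.interfLaw (W.tbu ω)) ∂μ :=
        W.lintegral_tbu_aux_I (Φ := fun p => Φ p * ENNReal.ofReal (1 - P.pCL p.1))
          (hΦ.mul (hp.comp measurable_fst))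
    _ = ∫⁻ ω, (∫⁻ y, Φ (W.tbu ω, W.aux ω, y) ∂(W.interfLaw (W.tbu ω)))
          * ENNReal.ofReal (1 - P.pCL (W.tbu ω)) ∂μ :=
        lintegral_congr fun ω => lintegral_mul_const' _ _ ENNReal.ofReal_ne_top
    _ = _ := (W.setLIntegral_existsCL_compl_aux (W.lintegral_interfLaw_comp hΦ)).symm

/-! ### Coverage events -/

-- Ensures that the modelled distance `tbr` between BS and RIS is positive almost surely.
omit [IsProbabilityMeasure μ] in
lemma ae_sin_theta_ne_zero : ∀ᵐ ω ∂μ, Real.sin (W.theta ω) ≠ 0 := by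
  have hs : MeasurableSet {θ : ℝ | Real.sin θ = 0} :=
    Real.continuous_sin.measurable (measurableSet_singleton 0)
  have hpi := Real.pi_pos
  have h1 : μ (W.theta ⁻¹' {θ | Real.sin θ = 0}) = 0 := by
    rw [← Measure.map_apply W.measurable_theta hs]
    have h2 : μ.map W.theta = unif (-Real.pi) Real.pi := W.X_law .theta
    have h3 : ∫⁻ θ in Set.Ioc (-Real.pi) Real.pi,
        {θ : ℝ | Real.sin θ = 0}.indicator (1 : ℝ → ℝ≥0∞) θ = 0 := by
      refine (lintegral_congr_ae ?_).trans lintegral_zero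
      filter_upwards [Params.ae_sin_ne_zero] with θ hθ
      have hθ' : θ ∉ {θ : ℝ | Real.sin θ = 0} := hθ
      exact Set.indicator_of_notMem hθ' _
    rw [h2, ← lintegral_indicator_one hs, lintegral_unif (by linarith),
      setLIntegral_congr Ioc_ae_eq_Icc.symm, h3, mul_zero]
  filter_upwards [measure_eq_zero_iff_ae_notMem.1 h1] with ω hω
  exact hω

/-- On `existsCL` the law of `tru` has a density carried by `(0, ∞)`. -/
lemma ae_tru_pos : ∀ᵐ ω ∂μ, ω ∈ W.existsCL → 0 < W.tru ω := by
  have hm : Measurable fun p : ℝ × (ℝ × ℝ) × ℝ => (Set.Iic (0 : ℝ)).indicator (1 : ℝ → ℝ≥0∞) p.2.2 :=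
    (measurable_one.indicator measurableSet_Iic).comp (measurable_snd.comp measurable_snd)
  have h1 := W.setLIntegral_existsCL_aux hm
  have h2 : ∫⁻ ω, (∫⁻ r in Set.Ioi 0, ENNReal.ofReal (P.risDensity (W.tbu ω) r)
      * (Set.Iic (0 : ℝ)).indicator (1 : ℝ → ℝ≥0∞) r) ∂μ = 0 := by
    refine (lintegral_congr fun ω => ?_).trans lintegral_zero
    refine (setLIntegral_congr_fun measurableSet_Ioi fun r hr => ?_).trans lintegral_zero
    have hr' : r ∉ Set.Iic (0 : ℝ) := fun h => absurd (show r ≤ 0 from h) (not_le.2 hr)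
    rw [Set.indicator_of_notMem hr', mul_zero]
  have hs : MeasurableSet (W.tru ⁻¹' Set.Iic 0) := W.measurable_tru measurableSet_Iic
  have h3 : μ (W.tru ⁻¹' Set.Iic 0 ∩ W.existsCL) = 0 := by
    rw [← Measure.restrict_apply hs, ← lintegral_indicator_one hs]
    exact h1.trans h2
  filter_upwards [measure_eq_zero_iff_ae_notMem.1 h3] with ω hω hc
  by_contra h
  exact hω ⟨not_lt.1 h, hc⟩

lemma ae_meanPower_CL_pos : ∀ᵐ ω ∂μ, ω ∈ W.existsCL →
    0 < P.meanPower Link.CL (W.tbu ω) (W.tru ω) (W.theta ω) := by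
  filter_upwards [W.ae_tru_pos, W.ae_sin_theta_ne_zero, W.ae_tbu_pos] with ω h1 h2 h3 hc
  exact P.meanPower_CL_pos (h1 hc) (Params.tbr_pos h3 h2 _)

omit [IsProbabilityMeasure μ] in
lemma measurable_sinrOf (q : Link) : Measurable (W.sinrOf q) := by
  have h := (W.measurable_meanPower_sig q).mono (W.sig_le _) le_rfl
  unfold sinrOf power
  exact (h.mul (W.X_meas _)).div (measurable_const.add W.measurable_I)

lemma measurable_erlangTail_sArg (q : Link) (γ : ℝ) : Measurable fun p : (ℝ × ℝ × ℝ) × ℝ =>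
    ENNReal.ofReal (erlangTail (P.mLink q) (P.sArg q γ p.1.1 p.1.2.1 p.1.2.2 * (P.sigma2 + p.2))) := by
  have h2 : Measurable (erlangTail (P.mLink q)) := (continuous_erlangTail _).measurable
  have h3 : Measurable fun p : (ℝ × ℝ × ℝ) × ℝ => P.sArg q γ p.1.1 p.1.2.1 p.1.2.2 :=
    (P.measurable_sArg q γ).comp (measurable_fst (α := ℝ × ℝ × ℝ) (β := ℝ))
  have h4 : Measurable fun p : (ℝ × ℝ × ℝ) × ℝ =>
      P.sArg q γ p.1.1 p.1.2.1 p.1.2.2 * (P.sigma2 + p.2) :=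
    h3.mul (measurable_const.add measurable_snd)
  exact (h2.comp h4).ennreal_ofReal

lemma measurable_erlangTail_right (P : Params) (q : Link) (s : ℝ) : Measurable fun y : ℝ =>
    ENNReal.ofReal (erlangTail (P.mLink q) (s * (P.sigma2 + y))) := by
  have h2 : Measurable (erlangTail (P.mLink q)) := (continuous_erlangTail _).measurable
  fun_prop

/-- Coverage through a cascaded link. -/
theorem setLIntegral_sinrOf_CL {γ : ℝ} (hγ : 0 < γ) {φ : ℝ × (ℝ × ℝ) × ℝ → ℝ≥0∞}
    (hφ : Measurable φ) :
    ∫⁻ ω in {ω | γ < W.sinrOf Link.CL ω} ∩ W.existsCL, φ (W.tbu ω, W.aux ω, W.tru ω) ∂μ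
      = ∫⁻ ω in W.existsCL, φ (W.tbu ω, W.aux ω, W.tru ω)
          * W.coverage Link.CL γ (W.tbu ω) (W.tru ω) (W.theta ω) ∂μ := by
  have hE := W.measurableSet_existsCL
  have hs : MeasurableSet {ω | γ < W.sinrOf Link.CL ω} :=
    measurableSet_lt measurable_const (W.measurable_sinrOf _)
  have hEs := W.measurableSet_existsCL_sig (S := noFading) (fun q => by simp)
    risAll_subset_noFading
  have hT : Measurable[W.sig noFading] W.tbu := W.measurable_tbu_sig (fun q => by simp)
  have hA : Measurable[W.sig noFading] W.aux :=
    W.measurable_aux_sig.mono (W.sig_mono (Set.subset_union_right.trans subset_noFading)) le_rfl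
  have hR : Measurable[W.sig noFading] W.tru :=
    W.measurable_tru_sig (fun q => by simp) risAll_subset_noFading
  have hφm : Measurable[W.sig noFading] fun ω => φ (W.tbu ω, W.aux ω, W.tru ω) :=
    hφ.comp (hT.prodMk (hA.prodMk hR))
  have hψ : Measurable[W.sig noFading]
      (W.existsCL.indicator fun ω => φ (W.tbu ω, W.aux ω, W.tru ω)) := hφm.indicator hEs
  -- The indicator of `existsCL` is part of the weight, because only there is the mean power of the
  -- cascaded link known to be positive.
  have h1 := W.setLIntegral_sinrOf (q := Link.CL) hγ hψ (by
    filter_upwards [W.ae_meanPower_CL_pos] with ω hω hz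
    refine hω ?_
    by_contra hc
    exact hz (Set.indicator_of_notMem hc _))
  have h2 : Measurable fun p : ℝ × (ℝ × ℝ) × ℝ × ℝ => φ (p.1, p.2.1, p.2.2.1)
      * ENNReal.ofReal (erlangTail (P.mLink Link.CL)
        (P.sArg Link.CL γ p.1 p.2.2.1 p.2.1.2 * (P.sigma2 + p.2.2.2))) := by
    have h3 : Measurable fun p : ℝ × (ℝ × ℝ) × ℝ × ℝ => (p.1, p.2.1, p.2.2.1) := by fun_prop
    have h4 : Measurable fun p : ℝ × (ℝ × ℝ) × ℝ × ℝ => ((p.1, p.2.2.1, p.2.1.2), p.2.2.2) := by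
      fun_prop
    have h6 := (measurable_erlangTail_sArg (P := P) Link.CL γ).comp h4
    simp only [Function.comp_def] at h6
    exact (hφ.comp h3).mul h6
  have hE5 := W.setLIntegral_existsCL_I h2
  set E : Ω → ℝ → ℝ≥0∞ := fun ω y => ENNReal.ofReal (erlangTail (P.mLink Link.CL)
    (P.sArg Link.CL γ (W.tbu ω) (W.tru ω) (W.theta ω) * (P.sigma2 + y))) with hEdef
  calc _ = ∫⁻ ω in {ω | γ < W.sinrOf Link.CL ω},
          W.existsCL.indicator (fun ω => φ (W.tbu ω, W.aux ω, W.tru ω)) ω ∂μ := by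
        rw [setLIntegral_indicator hE, Set.inter_comm]
    _ = ∫⁻ ω, W.existsCL.indicator (fun ω => φ (W.tbu ω, W.aux ω, W.tru ω)) ω
          * E ω (W.I ω) ∂μ := h1
    _ = ∫⁻ ω in W.existsCL, φ (W.tbu ω, W.aux ω, W.tru ω) * E ω (W.I ω) ∂μ := by
        rw [← lintegral_indicator hE]
        refine lintegral_congr fun ω => ?_
        by_cases h : ω ∈ W.existsCL
        · rw [Set.indicator_of_mem h, Set.indicator_of_mem h]
        · rw [Set.indicator_of_notMem h, Set.indicator_of_notMem h, zero_mul]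
    _ = ∫⁻ ω in W.existsCL, ∫⁻ y, φ (W.tbu ω, W.aux ω, W.tru ω) * E ω y
          ∂(W.interfLaw (W.tbu ω)) ∂μ := hE5
    _ = _ := by
        refine lintegral_congr fun ω => ?_
        rw [coverage, ← lintegral_const_mul]
        exact measurable_erlangTail_right P Link.CL _

lemma measurable_direct (q : Link) (γ : ℝ) {φ : ℝ × (ℝ × ℝ) → ℝ≥0∞} (hφ : Measurable φ) :
    Measurable fun p : ℝ × (ℝ × ℝ) × ℝ => φ (p.1, p.2.1) * ENNReal.ofReal
      (erlangTail (P.mLink q) (P.sArg q γ p.1 0 0 * (P.sigma2 + p.2.2))) := by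
  have h3 : Measurable fun p : ℝ × (ℝ × ℝ) × ℝ => (p.1, p.2.1) := by fun_prop
  have h4 : Measurable fun p : ℝ × (ℝ × ℝ) × ℝ => ((p.1, (0 : ℝ), (0 : ℝ)), p.2.2) := by
    fun_prop
  have h6 := (measurable_erlangTail_sArg (P := P) q γ).comp h4
  simp only [Function.comp_def] at h6
  exact (hφ.comp h3).mul h6

/-- Coverage through a direct link. -/
theorem setLIntegral_sinrOf_direct {q : Link} (hq : q ≠ Link.CL) {γ : ℝ} (hγ : 0 < γ)
    {φ : ℝ × (ℝ × ℝ) → ℝ≥0∞} (hφ : Measurable φ) :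
    ∫⁻ ω in {ω | γ < W.sinrOf q ω}, φ (W.tbu ω, W.aux ω) ∂μ
      = ∫⁻ ω, φ (W.tbu ω, W.aux ω) * W.coverage q γ (W.tbu ω) 0 0 ∂μ := by
  have hφm : Measurable[W.sig noFading] fun ω => φ (W.tbu ω, W.aux ω) :=
    hφ.comp (W.measurable_tbu_aux_sig.mono (W.sig_mono subset_noFading) le_rfl)
  have h1 := W.setLIntegral_sinrOf (q := q) hγ hφm (by
    filter_upwards [W.ae_tbu_pos] with ω hω _
    exact P.meanPower_pos hq hω _ _)
  have hs : ∀ ω, P.sArg q γ (W.tbu ω) (W.tru ω) (W.theta ω) = P.sArg q γ (W.tbu ω) 0 0 :=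
    fun ω => by rw [Params.sArg, Params.sArg, P.meanPower_congr hq]
  simp_rw [hs] at h1
  refine (h1.trans (W.lintegral_tbu_aux_I (measurable_direct q γ hφ))).trans ?_
  refine lintegral_congr fun ω => ?_
  rw [coverage, ← lintegral_const_mul]
  exact measurable_erlangTail_right P q _

/-- Coverage through a direct link, without cascaded link. -/
theorem setLIntegral_sinrOf_direct_compl {q : Link} (hq : q ≠ Link.CL) {γ : ℝ} (hγ : 0 < γ)
    {φ : ℝ × (ℝ × ℝ) → ℝ≥0∞} (hφ : Measurable φ) :
    ∫⁻ ω in {ω | γ < W.sinrOf q ω} ∩ W.existsCLᶜ, φ (W.tbu ω, W.aux ω) ∂μ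
      = ∫⁻ ω, φ (W.tbu ω, W.aux ω) * W.coverage q γ (W.tbu ω) 0 0
          * ENNReal.ofReal (1 - P.pCL (W.tbu ω)) ∂μ := by
  have hE := W.measurableSet_existsCL.compl
  have hEs := (W.measurableSet_existsCL_sig (S := noFading) (fun q => by simp)
    risAll_subset_noFading).compl
  have hφm : Measurable[W.sig noFading] fun ω => φ (W.tbu ω, W.aux ω) :=
    hφ.comp (W.measurable_tbu_aux_sig.mono (W.sig_mono subset_noFading) le_rfl)
  have h1 := W.setLIntegral_sinrOf (q := q) hγ (hφm.indicator hEs) (by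
    filter_upwards [W.ae_tbu_pos] with ω hω _
    exact P.meanPower_pos hq hω _ _)
  have hs : ∀ ω, P.sArg q γ (W.tbu ω) (W.tru ω) (W.theta ω) = P.sArg q γ (W.tbu ω) 0 0 :=
    fun ω => by rw [Params.sArg, Params.sArg, P.meanPower_congr hq]
  simp_rw [hs] at h1
  have h2 := W.setLIntegral_existsCL_compl_I (measurable_direct (P := P) q γ hφ)
  have h3 := W.lintegral_interfLaw_comp (measurable_direct (P := P) q γ hφ)
  set E : Ω → ℝ → ℝ≥0∞ := fun ω y => ENNReal.ofReal (erlangTail (P.mLink q)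
    (P.sArg q γ (W.tbu ω) 0 0 * (P.sigma2 + y))) with hEdef
  calc _ = ∫⁻ ω in {ω | γ < W.sinrOf q ω},
          W.existsCLᶜ.indicator (fun ω => φ (W.tbu ω, W.aux ω)) ω ∂μ := by
        rw [setLIntegral_indicator hE, Set.inter_comm]
    _ = ∫⁻ ω, W.existsCLᶜ.indicator (fun ω => φ (W.tbu ω, W.aux ω)) ω * E ω (W.I ω) ∂μ := h1
    _ = ∫⁻ ω in W.existsCLᶜ, φ (W.tbu ω, W.aux ω) * E ω (W.I ω) ∂μ := by
        rw [← lintegral_indicator hE]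
        refine lintegral_congr fun ω => ?_
        by_cases h : ω ∈ W.existsCLᶜ
        · rw [Set.indicator_of_mem h, Set.indicator_of_mem h]
        · rw [Set.indicator_of_notMem h, Set.indicator_of_notMem h, zero_mul]
    _ = ∫⁻ ω in W.existsCLᶜ, ∫⁻ y, φ (W.tbu ω, W.aux ω) * E ω y
          ∂(W.interfLaw (W.tbu ω)) ∂μ := h2
    _ = ∫⁻ ω, (∫⁻ y, φ (W.tbu ω, W.aux ω) * E ω y ∂(W.interfLaw (W.tbu ω)))
          * ENNReal.ofReal (1 - P.pCL (W.tbu ω)) ∂μ := W.setLIntegral_existsCL_compl_aux h3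
    _ = _ := by
        refine lintegral_congr fun ω => ?_
        rw [coverage, ← lintegral_const_mul]
        exact measurable_erlangTail_right P q _

end Network

end RISNet

/-! ### From integral identities to conditional expectations; blockage and angle -/

namespace RISNet

open Filter Topology

/-- Conditional expectations given a random variable, from integrals over its events. -/
lemma condExp_comap_ae_eq {Ω β : Type*} [mΩ : MeasurableSpace Ω] [mβ : MeasurableSpace β]
    {ρ : Measure Ω} [IsFiniteMeasure ρ] {X : Ω → β} (hX : Measurable X) {f g : Ω → ℝ}
    (hf : Integrable f ρ) (hf0 : 0 ≤ᵐ[ρ] f) {G : β → ℝ≥0∞} (hG : Measurable G)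
    (hg : ∀ᵐ ω ∂ρ, g ω = (G (X ω)).toReal)
    (h : ∀ A, MeasurableSet A → ∫⁻ ω in X ⁻¹' A, ENNReal.ofReal (f ω) ∂ρ
      = ∫⁻ ω in X ⁻¹' A, G (X ω) ∂ρ) :
    ρ[f | MeasurableSpace.comap X mβ] =ᵐ[ρ] g := by
  have hGX : Measurable fun ω => G (X ω) := hG.comp hX
  have htot : ∫⁻ ω, G (X ω) ∂ρ ≠ ∞ := by
    have h1 := h Set.univ MeasurableSet.univ
    simp only [Set.preimage_univ, Measure.restrict_univ] at h1
    rw [← h1, ← ofReal_integral_eq_lintegral_ofReal hf hf0]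
    exact ENNReal.ofReal_ne_top
  have hfin : ∀ᵐ ω ∂ρ, G (X ω) < ∞ := ae_lt_top hGX htot
  have hint : Integrable (fun ω => (G (X ω)).toReal) ρ :=
    integrable_toReal_of_lintegral_ne_top hGX.aemeasurable htot
  have hmain : (fun ω => (G (X ω)).toReal) =ᵐ[ρ] ρ[f | MeasurableSpace.comap X mβ] := by
    refine ae_eq_condExp_of_forall_setIntegral_eq hX.comap_le hf (fun s _ _ => hint.integrableOn)
      ?_ ?_
    · rintro s ⟨A, hA, rfl⟩ -
      rw [integral_toReal hGX.aemeasurable (ae_restrict_of_ae hfin), ← h A hA,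
        integral_eq_lintegral_of_nonneg_ae (ae_restrict_of_ae hf0) hf.aestronglyMeasurable.restrict]
    · have h1 : Measurable[MeasurableSpace.comap X mβ] fun ω => (G (X ω)).toReal :=
        ENNReal.measurable_toReal.comp (hG.comp (comap_measurable X))
      exact h1.aestronglyMeasurable
  filter_upwards [hmain, hg] with ω h1 h2
  rw [← h1, h2]

/-- The case of conditional probabilities. -/
lemma condProb_comap_ae_eq {Ω β : Type*} [mΩ : MeasurableSpace Ω] [mβ : MeasurableSpace β]
    {ρ : Measure Ω} [IsFiniteMeasure ρ] {X : Ω → β} (hX : Measurable X) {s : Set Ω}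
    (hs : MeasurableSet s) {g : Ω → ℝ} {G : β → ℝ≥0∞} (hG : Measurable G)
    (hg : ∀ᵐ ω ∂ρ, g ω = (G (X ω)).toReal)
    (h : ∀ A, MeasurableSet A → ρ (X ⁻¹' A ∩ s) = ∫⁻ ω in X ⁻¹' A, G (X ω) ∂ρ) :
    ρ⟦s | MeasurableSpace.comap X mβ⟧ =ᵐ[ρ] g := by
  refine condExp_comap_ae_eq hX ((integrable_const (1 : ℝ)).indicator hs)
    (Eventually.of_forall fun ω => Set.indicator_nonneg (fun _ _ => zero_le_one) _) hG hg
    fun A hA => ?_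
  rw [← h A hA]
  have h1 : ∀ ω, ENNReal.ofReal (s.indicator (fun _ => (1 : ℝ)) ω) = s.indicator 1 ω := fun ω => by
    by_cases hω : ω ∈ s <;> simp [hω]
  rw [lintegral_congr h1, lintegral_indicator_one hs, Measure.restrict_apply hs, Set.inter_comm]

namespace Network

variable {P : Params} {Ω : Type*} [mΩ : MeasurableSpace Ω] {μ : Measure Ω} (W : Network P μ)

lemma tbu_nonneg (ω : Ω) : 0 ≤ W.tbu ω := norm_nonneg _

lemma measurableSet_bsLoS : MeasurableSet {ω | W.bsLoS 0 ω} :=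
  measurableSet_lt (W.X_meas _) ((P.measurable_pVis Vis.L).comp W.measurable_tbu)

/-- The tagged BS is line of sight, in terms of its distance and the auxiliary variables. -/
def losSet (P : Params) : Set (ℝ × (ℝ × ℝ)) := {p | p.2.1 < P.pVis Vis.L p.1}

lemma measurableSet_losSet : MeasurableSet (losSet P) :=
  measurableSet_lt (by fun_prop) ((P.measurable_pVis Vis.L).comp measurable_fst)

lemma link_eq_DL : {ω | W.link ω = Link.DL} = {ω | W.bsLoS 0 ω} := by
  ext ω
  simp only [Set.mem_ofPred_eq, link]
  split_ifs with h1 h2 <;> simp [h1]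

lemma link_eq_CL : {ω | W.link ω = Link.CL} = {ω | W.bsLoS 0 ω}ᶜ ∩ W.existsCL := by
  ext ω
  simp only [Set.mem_ofPred_eq, link, Set.mem_inter_iff, Set.mem_compl_iff]
  by_cases h1 : W.bsLoS 0 ω <;> by_cases h2 : ω ∈ W.existsCL <;> simp [h1, h2]

lemma link_eq_DN : {ω | W.link ω = Link.DN} = {ω | W.bsLoS 0 ω}ᶜ ∩ W.existsCLᶜ := by
  ext ω
  simp only [Set.mem_ofPred_eq, link, Set.mem_inter_iff, Set.mem_compl_iff]
  by_cases h1 : W.bsLoS 0 ω <;> by_cases h2 : ω ∈ W.existsCL <;> simp [h1, h2]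

lemma measurableSet_link (q : Link) : MeasurableSet {ω | W.link ω = q} := by
  cases q with
  | DL => rw [W.link_eq_DL]; exact W.measurableSet_bsLoS
  | CL => rw [W.link_eq_CL]; exact W.measurableSet_bsLoS.compl.inter W.measurableSet_existsCL
  | DN => rw [W.link_eq_DN]; exact W.measurableSet_bsLoS.compl.inter W.measurableSet_existsCL.compl

lemma measurable_tbu_theta_sig : Measurable[W.sig (bsAll ∪ {some (some .theta)})]
    fun ω => (W.tbu ω, W.theta ω) := by
  have h1 : Measurable[W.sig (bsAll ∪ {some (some .theta)})] W.tbu :=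
    W.measurable_tbu_sig (Or.inl (Or.inl rfl))
  have h2 : Measurable[W.sig (bsAll ∪ {some (some .theta)})] (W.X .theta) :=
    W.measurable_X_sig (Or.inr rfl)
  exact h1.prodMk h2

variable [IsProbabilityMeasure μ]

/-- `bsAll` contains the marks of the BSs from label `1` on, so the blockage variable of label `0`
is separate. -/
lemma indepFun_block : IndepFun (fun ω => (W.tbu ω, W.theta ω)) (W.X (.bsBlock 0)) μ := by
  refine W.indepFun_of_disjoint (T := {some (some (.bsBlock 0))}) ?_ W.measurable_tbu_theta_sig
    (W.measurable_X_sig (by simp))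
  rw [Set.disjoint_singleton_right]
  rintro (h | h)
  · rcases mem_bsAll.1 h with h | ⟨i, hi⟩
    · simp at h
    · simp [bsSet] at hi
  · simp at h

/-- Averaging over the blockage of the tagged BS. -/
lemma lintegral_losSet {F : ℝ × ℝ → ℝ≥0∞} (hF : Measurable F) :
    ∫⁻ ω, F (W.tbu ω, W.theta ω) * (losSet P).indicator 1 (W.tbu ω, W.aux ω) ∂μ
      = ∫⁻ ω, F (W.tbu ω, W.theta ω) * ENNReal.ofReal (P.pVis Vis.L (W.tbu ω)) ∂μ := by
  have hm : Measurable (Function.uncurry fun (p : ℝ × ℝ) (u : ℝ) =>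
      F p * (Set.Iio (P.pVis Vis.L p.1)).indicator 1 u) := by
    have h1 : MeasurableSet {q : (ℝ × ℝ) × ℝ | q.2 < P.pVis Vis.L q.1.1} :=
      measurableSet_lt measurable_snd ((P.measurable_pVis Vis.L).comp
        (measurable_fst.comp measurable_fst))
    exact (hF.comp measurable_fst).mul (measurable_one.indicator h1)
  refine (lintegral_of_indepFun (W.measurable_tbu.prodMk W.measurable_theta) (W.X_meas _)
    W.indepFun_block hm).trans (lintegral_congr fun ω => ?_)
  have hI : Measurable fun ω' =>
      (Set.Iio (P.pVis Vis.L (W.tbu ω))).indicator (1 : ℝ → ℝ≥0∞) (W.X (.bsBlock 0) ω') :=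
    (measurable_one.indicator measurableSet_Iio).comp (W.X_meas _)
  rw [lintegral_const_mul _ hI, ← W.measure_block_lt (s := .bsBlock 0) rfl
    (P.pVisL_le_one (W.tbu_nonneg ω)), ← lintegral_indicator_one
    (measurableSet_lt (W.X_meas _) measurable_const)]
  rfl

lemma lintegral_losSet_compl {F : ℝ × ℝ → ℝ≥0∞} (hF : Measurable F) :
    ∫⁻ ω, F (W.tbu ω, W.theta ω) * (losSet P)ᶜ.indicator 1 (W.tbu ω, W.aux ω) ∂μ
      = ∫⁻ ω, F (W.tbu ω, W.theta ω) * ENNReal.ofReal (P.pVis Vis.N (W.tbu ω)) ∂μ := by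
  have hm : Measurable (Function.uncurry fun (p : ℝ × ℝ) (u : ℝ) =>
      F p * (Set.Iio (P.pVis Vis.L p.1))ᶜ.indicator 1 u) := by
    have h1 : MeasurableSet {q : (ℝ × ℝ) × ℝ | q.2 < P.pVis Vis.L q.1.1} :=
      measurableSet_lt measurable_snd ((P.measurable_pVis Vis.L).comp
        (measurable_fst.comp measurable_fst))
    exact (hF.comp measurable_fst).mul (measurable_one.indicator h1.compl)
  refine (lintegral_of_indepFun (W.measurable_tbu.prodMk W.measurable_theta) (W.X_meas _)
    W.indepFun_block hm).trans (lintegral_congr fun ω => ?_)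
  have hI : Measurable fun ω' =>
      (Set.Iio (P.pVis Vis.L (W.tbu ω)))ᶜ.indicator (1 : ℝ → ℝ≥0∞) (W.X (.bsBlock 0) ω') :=
    (measurable_one.indicator measurableSet_Iio.compl).comp (W.X_meas _)
  have hs : MeasurableSet {ω' | W.X (.bsBlock 0) ω' < P.pVis Vis.L (W.tbu ω)} :=
    measurableSet_lt (W.X_meas _) measurable_const
  have h2 : ENNReal.ofReal (P.pVis Vis.N (W.tbu ω))
      = μ {ω' | W.X (.bsBlock 0) ω' < P.pVis Vis.L (W.tbu ω)}ᶜ := by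
    rw [prob_compl_eq_one_sub hs, W.measure_block_lt (s := .bsBlock 0) rfl
      (P.pVisL_le_one (W.tbu_nonneg ω)), ← ENNReal.ofReal_one, ← ENNReal.ofReal_sub _
      (P.pVisL_pos _).le, ← P.pVis_add (W.tbu ω), add_sub_cancel_left]
  rw [lintegral_const_mul _ hI, h2, ← lintegral_indicator_one hs.compl]
  rfl

/-- Averaging over the angle. -/
lemma lintegral_theta {F : ℝ → ℝ → ℝ≥0∞} (hF : Measurable (Function.uncurry F)) :
    ∫⁻ ω, F (W.tbu ω) (W.theta ω) ∂μ = ∫⁻ ω, ENNReal.ofReal (1 / (2 * Real.pi))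
      * (∫⁻ θ in Set.Ioc (-Real.pi) Real.pi, F (W.tbu ω) θ) ∂μ := by
  have hind : IndepFun W.tbu W.theta μ := by
    refine W.indepFun_of_disjoint (S := {none}) (T := {some (some .theta)}) (by simp)
      (W.measurable_tbu_sig (by simp)) ?_
    exact W.measurable_X_sig (s := .theta) (by simp)
  have hpi := Real.pi_pos
  rw [lintegral_of_indepFun W.measurable_tbu W.measurable_theta hind hF]
  refine lintegral_congr fun ω => ?_
  have h2 : μ.map W.theta = unif (-Real.pi) Real.pi := W.X_law .theta
  have h3 : Measurable (F (W.tbu ω)) := Measurable.of_uncurry_left hF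
  rw [← lintegral_map h3 W.measurable_theta, h2, lintegral_unif (by linarith),
    setLIntegral_congr Ioc_ae_eq_Icc]
  congr 2
  rw [one_div]
  congr 1
  ring

/-! ### Association -/

omit [IsProbabilityMeasure μ] in
lemma setLIntegral_bsLoS_compl (E : Set Ω) (hE : MeasurableSet E) (G : Ω → ℝ≥0∞) :
    ∫⁻ ω in {ω | W.bsLoS 0 ω}ᶜ ∩ E, G ω ∂μ
      = ∫⁻ ω in E, (losSet P)ᶜ.indicator 1 (W.tbu ω, W.aux ω) * G ω ∂μ := by
  rw [← setLIntegral_indicator W.measurableSet_bsLoS.compl]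
  refine setLIntegral_congr_fun hE fun ω _ => ?_
  by_cases h : W.bsLoS 0 ω
  · have h1 : ω ∉ {ω | W.bsLoS 0 ω}ᶜ := fun hc => hc h
    have h2 : (W.tbu ω, W.aux ω) ∉ (losSet P)ᶜ := fun hc => hc h
    rw [Set.indicator_of_notMem h1, Set.indicator_of_notMem h2, zero_mul]
  · rw [Set.indicator_of_mem (by exact h), Set.indicator_of_mem (by exact h), Pi.one_apply, one_mul]

/-- Association probabilities, in integrated form. -/
theorem measure_link (q : Link) {A : Set ℝ} (hA : MeasurableSet A) :
    μ (W.tbu ⁻¹' A ∩ {ω | W.link ω = q})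
      = ∫⁻ ω in W.tbu ⁻¹' A, ENNReal.ofReal (P.assoc q (W.tbu ω)) ∂μ := by
  have hAm : Measurable (A.indicator (1 : ℝ → ℝ≥0∞)) := measurable_one.indicator hA
  have hTA := W.measurable_tbu hA
  have hc := (measurableSet_losSet (P := P)).compl
  have hp : Measurable fun t => ENNReal.ofReal (P.pCL t) := P.measurable_pCL.ennreal_ofReal
  have hp' : Measurable fun t => ENNReal.ofReal (1 - P.pCL t) :=
    (measurable_const.sub P.measurable_pCL).ennreal_ofReal
  have hφ : Measurable fun p : ℝ × (ℝ × ℝ) => A.indicator (1 : ℝ → ℝ≥0∞) p.1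
      * (losSet P)ᶜ.indicator 1 p :=
    (hAm.comp measurable_fst).mul (measurable_one.indicator hc)
  have hind : ∀ G : Ω → ℝ≥0∞, ∫⁻ ω in W.tbu ⁻¹' A, G ω ∂μ
      = ∫⁻ ω, A.indicator 1 (W.tbu ω) * G ω ∂μ := fun G => by
    rw [← lintegral_indicator hTA]
    refine lintegral_congr fun ω => ?_
    by_cases h : W.tbu ω ∈ A <;> simp [h]
  have hmeas : ∀ E : Set Ω, MeasurableSet E → μ (W.tbu ⁻¹' A ∩ E)
      = ∫⁻ ω in E, A.indicator 1 (W.tbu ω) ∂μ := fun E hE => by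
    rw [← Measure.restrict_apply hTA, ← lintegral_indicator_one hTA]
    rfl
  rw [hmeas _ (W.measurableSet_link q), hind]
  cases q with
  | DL =>
    rw [W.link_eq_DL, ← lintegral_indicator W.measurableSet_bsLoS]
    refine Eq.trans ?_ (W.lintegral_losSet (F := fun p => A.indicator 1 p.1)
      (hAm.comp measurable_fst))
    refine lintegral_congr fun ω => ?_
    by_cases h : W.bsLoS 0 ω
    · have h2 : (W.tbu ω, W.aux ω) ∈ losSet P := h
      rw [Set.indicator_of_mem (by exact h), Set.indicator_of_mem h2, Pi.one_apply, mul_one]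
    · have h2 : (W.tbu ω, W.aux ω) ∉ losSet P := h
      rw [Set.indicator_of_notMem (by exact h), Set.indicator_of_notMem h2, mul_zero]
  | CL =>
    rw [W.link_eq_CL, W.setLIntegral_bsLoS_compl _ W.measurableSet_existsCL]
    have h1 := W.setLIntegral_existsCL_aux (Ψ := fun p => A.indicator 1 p.1
      * (losSet P)ᶜ.indicator 1 (p.1, p.2.1)) (hφ.comp (by fun_prop :
        Measurable fun p : ℝ × (ℝ × ℝ) × ℝ => (p.1, p.2.1)))
    have h2 := W.lintegral_losSet_compl (F := fun p => A.indicator 1 p.1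
      * ENNReal.ofReal (P.pCL p.1)) ((hAm.mul hp).comp measurable_fst)
    calc _ = ∫⁻ ω in W.existsCL, A.indicator 1 (W.tbu ω)
          * (losSet P)ᶜ.indicator 1 (W.tbu ω, W.aux ω) ∂μ :=
          lintegral_congr fun ω => mul_comm _ _
      _ = ∫⁻ ω, A.indicator 1 (W.tbu ω) * ENNReal.ofReal (P.pCL (W.tbu ω))
          * (losSet P)ᶜ.indicator 1 (W.tbu ω, W.aux ω) ∂μ := by
          rw [h1]
          refine lintegral_congr_ae ?_
          filter_upwards [W.ae_tbu_pos] with ω hω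
          rw [lintegral_mul_const' _ _ (by
            by_cases ha : W.tbu ω ∈ A <;> by_cases hb : (W.tbu ω, W.aux ω) ∈ losSet P <;>
              simp [ha, hb]), lintegral_risDensity_Ioi P hω]
          ring
      _ = _ := by
          rw [h2]
          refine lintegral_congr fun ω => ?_
          rw [Params.assoc, ENNReal.ofReal_mul (P.pVis_nonneg _ (W.tbu_nonneg ω))]
          ring
  | DN =>
    rw [W.link_eq_DN, W.setLIntegral_bsLoS_compl _ W.measurableSet_existsCL.compl]
    have h1 := W.setLIntegral_existsCL_compl_aux hφ
    have h2 := W.lintegral_losSet_compl (F := fun p => A.indicator 1 p.1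
      * ENNReal.ofReal (1 - P.pCL p.1)) ((hAm.mul hp').comp measurable_fst)
    calc _ = ∫⁻ ω in W.existsCLᶜ, A.indicator 1 (W.tbu ω)
          * (losSet P)ᶜ.indicator 1 (W.tbu ω, W.aux ω) ∂μ :=
          lintegral_congr fun ω => mul_comm _ _
      _ = ∫⁻ ω, A.indicator 1 (W.tbu ω) * ENNReal.ofReal (1 - P.pCL (W.tbu ω))
          * (losSet P)ᶜ.indicator 1 (W.tbu ω, W.aux ω) ∂μ := by
          rw [h1]
          exact lintegral_congr fun ω => by ring
      _ = _ := by
          rw [h2]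
          refine lintegral_congr fun ω => ?_
          rw [Params.assoc, ENNReal.ofReal_mul (P.pVis_nonneg _ (W.tbu_nonneg ω))]
          ring

lemma assoc_nonneg (P : Params) (q : Link) {t : ℝ} (ht : 0 ≤ t) : 0 ≤ P.assoc q t := by
  have h1 := P.pVis_nonneg Vis.N ht
  have h2 := P.pVisL_pos t
  have h3 := P.pCL_nonneg t
  have h4 := P.pCL_le_one t
  cases q with
  | DL => exact h2.le
  | CL => exact mul_nonneg h1 h3
  | DN => exact mul_nonneg h1 (by linarith)

lemma measurable_assoc (P : Params) (q : Link) : Measurable (P.assoc q) := by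
  have h1 := P.measurable_pVis Vis.N
  have h2 := P.measurable_pVis Vis.L
  have h3 := P.measurable_pCL
  cases q with
  | DL => exact h2
  | CL => exact h1.mul h3
  | DN => exact h1.mul (measurable_const.sub h3)

theorem condProb_link (q : Link) :
    μ⟦{ω | W.link ω = q} | W.sigmaTbu⟧ =ᵐ[μ] fun ω => P.assoc q (W.tbu ω) := by
  refine condProb_comap_ae_eq W.measurable_tbu (W.measurableSet_link q)
    (measurable_assoc P q).ennreal_ofReal (Eventually.of_forall fun ω => ?_)
    fun A hA => W.measure_link q hA
  rw [ENNReal.toReal_ofReal (assoc_nonneg P q (W.tbu_nonneg ω))]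

/-- `tailLaplace` provides the measurable function of the distance, equal to the closed form
wherever the distance is positive. -/
theorem condExp_exp_interf {s : ℝ} (hs : 0 ≤ s) :
    μ[fun ω => Real.exp (-s * W.I ω) | W.sigmaTbu] =ᵐ[μ] fun ω => P.laplace (W.tbu ω) s := by
  have hm : Measurable fun ω => Real.exp (-s * W.I ω) :=
    Real.continuous_exp.measurable.comp (measurable_const.mul W.measurable_I)
  refine condExp_comap_ae_eq W.measurable_tbu ?_
    (Eventually.of_forall fun ω => (Real.exp_pos _).le)
    (tailLaplace_measurable P.lamB (P.interfExponent s)) ?_ fun A hA => ?_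
  · refine Integrable.mono' (integrable_const (1 : ℝ)) hm.aestronglyMeasurable ?_
    filter_upwards [W.ae_I_nonneg] with ω hω
    rw [Real.norm_of_nonneg (Real.exp_pos _).le, Real.exp_le_one_iff]
    have := mul_nonneg hs hω
    linarith
  · filter_upwards [W.ae_tbu_pos] with ω hω
    rw [P.tailLaplace_interfExponent hs hω, ENNReal.toReal_ofReal (P.laplace_pos _ _).le]
  · rw [W.setLIntegral_exp_interf hs hA]
    refine setLIntegral_congr_fun_ae (W.measurable_tbu hA) ?_
    filter_upwards [W.ae_tbu_pos] with ω hω _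
    exact (P.tailLaplace_interfExponent hs hω).symm

/-- Distribution of the distance of the nearest suitable obstacle. -/
theorem condProb_tru {A : Set ℝ} (hA : MeasurableSet A) :
    μ⟦W.existsCL ∩ W.tru ⁻¹' A | W.sigmaTbu⟧ =ᵐ[μ]
      fun ω => P.pCL (W.tbu ω) * ∫ r in A ∩ Set.Ioi 0, P.fTru (W.tbu ω) r := by
  have hAm : Measurable (A.indicator (1 : ℝ → ℝ≥0∞)) := measurable_one.indicator hA
  have hd : Measurable fun p : ℝ × ℝ => ENNReal.ofReal (P.risDensity p.1 (max p.2 0))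
      * A.indicator 1 p.2 := P.measurable_risDensity.ennreal_ofReal.mul (hAm.comp measurable_snd)
  set G : ℝ → ℝ≥0∞ := fun t => ∫⁻ r in Set.Ioi 0,
    ENNReal.ofReal (P.risDensity t (max r 0)) * A.indicator 1 r with hG
  have hGm : Measurable G := hd.lintegral_prod_right'
  have hG2 : ∀ t, G t = ∫⁻ r in Set.Ioi 0, ENNReal.ofReal (P.risDensity t r) * A.indicator 1 r :=
    fun t => setLIntegral_congr_fun measurableSet_Ioi fun r hr => by
      simp only [max_eq_left (le_of_lt (show (0 : ℝ) < r from hr))]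
  refine condProb_comap_ae_eq W.measurable_tbu
    (W.measurableSet_existsCL.inter (W.measurable_tru hA)) hGm ?_ fun C hC => ?_
  · filter_upwards [W.ae_tbu_pos] with ω hω
    -- The product with `pCL` is rewritten as `risDensity`, which is harmless also where `pCL` is
    -- `0`.
    have h1 : ∀ᵐ r ∂(volume.restrict (A ∩ Set.Ioi 0)),
        P.pCL (W.tbu ω) * P.fTru (W.tbu ω) r = P.risDensity (W.tbu ω) r :=
      ae_mono (Measure.restrict_mono Set.inter_subset_right le_rfl) (P.pCL_mul_fTru (W.tbu ω))
    rw [← integral_const_mul, integral_congr_ae h1, integral_eq_lintegral_of_nonneg_ae, hG2]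
    · congr 1
      rw [← setLIntegral_indicator hA]
      refine lintegral_congr fun r => ?_
      by_cases hr : r ∈ A <;> simp [hr]
    · filter_upwards [ae_restrict_mem (hA.inter measurableSet_Ioi)] with r hr
      exact P.risDensity_nonneg _ (le_of_lt hr.2)
    · exact (P.continuous_risDensity hω).aestronglyMeasurable
  · have hCm : Measurable (C.indicator (1 : ℝ → ℝ≥0∞)) := measurable_one.indicator hC
    have hs := W.measurable_tbu hC
    have hsA := W.measurable_tru hA
    have h1 := W.setLIntegral_existsCL_aux (Ψ := fun p => C.indicator 1 p.1 * A.indicator 1 p.2.2)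
      ((hCm.comp measurable_fst).mul (hAm.comp (measurable_snd.comp measurable_snd)))
    calc μ (W.tbu ⁻¹' C ∩ (W.existsCL ∩ W.tru ⁻¹' A))
        = ∫⁻ ω in W.existsCL, C.indicator 1 (W.tbu ω) * A.indicator 1 (W.tru ω) ∂μ := by
          have h2 : W.tbu ⁻¹' C ∩ (W.existsCL ∩ W.tru ⁻¹' A)
              = (W.tbu ⁻¹' C ∩ W.tru ⁻¹' A) ∩ W.existsCL := by
            ext ω; simp only [Set.mem_inter_iff]; tauto
          rw [h2, ← Measure.restrict_apply (hs.inter hsA), ← lintegral_indicator_one (hs.inter hsA)]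
          refine lintegral_congr fun ω => ?_
          by_cases h3 : W.tbu ω ∈ C <;> by_cases h4 : W.tru ω ∈ A <;> simp [h3, h4]
      _ = ∫⁻ ω, C.indicator 1 (W.tbu ω) * G (W.tbu ω) ∂μ := by
          rw [h1]
          refine lintegral_congr fun ω => ?_
          rw [hG2, ← lintegral_const_mul' _ _ (by
            by_cases h3 : W.tbu ω ∈ C <;> simp [h3])]
          refine lintegral_congr fun r => by ring
      _ = _ := by
          rw [← lintegral_indicator hs]
          refine lintegral_congr fun ω => ?_
          by_cases h3 : W.tbu ω ∈ C <;> simp [h3]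

end Network

end RISNet

/-! ### The coverage probability as an average over distances and angle -/

namespace RISNet

open Filter Topology

namespace Params

variable (P : Params)

lemma measurable_laplaceVis (v : Vis) : Measurable fun p : ℝ × ℝ => P.laplaceVis v p.1 p.2 := by
  have h1 : Measurable fun q : (ℝ × ℝ) × ℝ =>
      (Set.Ioi q.1.1).indicator (P.visIntegrand v q.1.2) q.2 := by
    have h2 : MeasurableSet {q : (ℝ × ℝ) × ℝ | q.1.1 < q.2} :=
      measurableSet_lt (by fun_prop) measurable_snd
    have h3 : Measurable fun q : (ℝ × ℝ) × ℝ => P.visIntegrand v q.1.2 q.2 := by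
      have h4 := P.measurable_kappa v
      have h5 := P.measurable_pathGain v
      have h6 := P.measurable_pVis v
      unfold visIntegrand
      fun_prop
    exact h3.indicator h2
  have h4 := h1.stronglyMeasurable.integral_prod_right' (ν := volume)
  have h5 : (fun p : ℝ × ℝ => P.laplaceVis v p.1 p.2) = fun p => Real.exp (-2 * Real.pi * P.lamB
      * ∫ d, (Set.Ioi p.1).indicator (P.visIntegrand v p.2) d) := by
    ext p
    rw [P.laplaceVis_eq, integral_indicator measurableSet_Ioi]
  rw [h5]
  exact Real.continuous_exp.measurable.comp (measurable_const.mul h4.measurable)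

lemma measurable_laplace : Measurable fun p : ℝ × ℝ => P.laplace p.1 p.2 :=
  (P.measurable_laplaceVis Vis.L).mul (P.measurable_laplaceVis Vis.N)

lemma measurable_condCovApprox (q : Link) (γ : ℝ) :
    Measurable fun p : ℝ × ℝ × ℝ => P.condCovApprox q γ p.1 p.2.1 p.2.2 := by
  have hs := P.measurable_sArg q γ
  unfold condCovApprox
  refine Finset.measurable_sum _ fun k _ => Measurable.mul ?_ ?_
  · exact measurable_const.mul (Real.continuous_exp.measurable.comp
      ((measurable_const.mul hs).mul measurable_const))
  · exact P.measurable_laplace.comp (measurable_fst.prodMk (measurable_const.mul hs))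

lemma fTbu_pos {t : ℝ} (ht : 0 < t) : 0 < P.fTbu t := by
  have := P.lamB_pos
  have := Real.pi_pos
  unfold fTbu
  positivity

lemma measurable_fTbu : Measurable P.fTbu := by unfold fTbu; fun_prop

/-- The cascaded part of the average, before averaging over the BS–user distance. -/
noncomputable def cascaded (F : ℝ × ℝ × ℝ → ℝ≥0∞) (t : ℝ) : ℝ≥0∞ :=
  ∫⁻ r in Set.Ioi 0, ∫⁻ θ in Set.Ioc (-Real.pi) Real.pi, ENNReal.ofReal (P.pVis Vis.N t)
    * (ENNReal.ofReal (1 / (2 * Real.pi)) * (ENNReal.ofReal (P.risDensity t (max r 0))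
      * F (t, r, θ)))

/-- The integrand of the average. -/
noncomputable def mixture (F : Link → ℝ × ℝ × ℝ → ℝ≥0∞) (t : ℝ) : ℝ≥0∞ :=
  ENNReal.ofReal (P.assoc Link.DL t) * F Link.DL (t, 0, 0) + P.cascaded (F Link.CL) t
    + ENNReal.ofReal (P.assoc Link.DN t) * F Link.DN (t, 0, 0)

lemma measurable_cascaded_integrand {F : ℝ × ℝ × ℝ → ℝ≥0∞} (hF : Measurable F) :
    Measurable fun q : (ℝ × ℝ) × ℝ => ENNReal.ofReal (P.pVis Vis.N q.1.1)
      * (ENNReal.ofReal (1 / (2 * Real.pi)) * (ENNReal.ofReal (P.risDensity q.1.1 (max q.1.2 0))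
        * F (q.1.1, q.1.2, q.2))) := by
  have h1 : Measurable fun q : (ℝ × ℝ) × ℝ => ENNReal.ofReal (P.pVis Vis.N q.1.1) :=
    ((P.measurable_pVis Vis.N).comp (measurable_fst.comp measurable_fst)).ennreal_ofReal
  have h2 : Measurable fun q : (ℝ × ℝ) × ℝ =>
      ENNReal.ofReal (P.risDensity q.1.1 (max q.1.2 0)) :=
    (P.measurable_risDensity.comp measurable_fst).ennreal_ofReal
  have h3 : Measurable fun q : (ℝ × ℝ) × ℝ => (q.1.1, q.1.2, q.2) := by fun_prop
  exact h1.mul (measurable_const.mul (h2.mul (hF.comp h3)))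

lemma measurable_cascaded {F : ℝ × ℝ × ℝ → ℝ≥0∞} (hF : Measurable F) :
    Measurable (P.cascaded F) := by
  have h1 := (P.measurable_cascaded_integrand hF).lintegral_prod_right'
    (ν := volume.restrict (Set.Ioc (-Real.pi) Real.pi))
  exact h1.lintegral_prod_right'

lemma measurable_mixture {F : Link → ℝ × ℝ × ℝ → ℝ≥0∞} (hF : ∀ q, Measurable (F q)) :
    Measurable (P.mixture F) := by
  have h1 : Measurable fun t : ℝ => (t, (0 : ℝ), (0 : ℝ)) := by fun_prop
  exact (((Network.measurable_assoc P _).ennreal_ofReal.mul ((hF _).comp h1)).add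
    (P.measurable_cascaded (hF _))).add
    ((Network.measurable_assoc P _).ennreal_ofReal.mul ((hF _).comp h1))

/-- The cascaded part is monotone in the conditional coverage of the possible positions. -/
lemma cascaded_mono {F G : ℝ × ℝ × ℝ → ℝ≥0∞} {t : ℝ} (ht : 0 < t)
    (h : ∀ r θ, 0 < P.meanPower Link.CL t r θ → F (t, r, θ) ≤ G (t, r, θ)) :
    P.cascaded F t ≤ P.cascaded G t := by
  refine lintegral_mono_ae ?_
  filter_upwards [ae_restrict_mem measurableSet_Ioi] with r hr
  refine lintegral_mono_ae ?_
  filter_upwards [ae_sin_ne_zero] with θ hθ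
  gcongr
  exact h r θ (P.meanPower_CL_pos hr (tbr_pos ht hθ r))

/-- The NLoS weight is at most `1` and the uniform angular weight has total mass one. The bound on
`F` is needed only at positive mean power, hence for almost every angle. -/
lemma cascaded_inner_le {F : ℝ × ℝ × ℝ → ℝ≥0∞} {t : ℝ} (ht : 0 < t)
    (h : ∀ r θ, 0 < P.meanPower Link.CL t r θ → F (t, r, θ) ≤ 1) {r : ℝ} (hr : 0 < r) :
    ∫⁻ θ in Set.Ioc (-Real.pi) Real.pi, ENNReal.ofReal (P.pVis Vis.N t)
      * (ENNReal.ofReal (1 / (2 * Real.pi)) * (ENNReal.ofReal (P.risDensity t (max r 0))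
        * F (t, r, θ))) ≤ ENNReal.ofReal (P.risDensity t r) := by
  have hpi := Real.pi_pos
  calc _ ≤ ∫⁻ θ in Set.Ioc (-Real.pi) Real.pi,
          (ENNReal.ofReal (1 / (2 * Real.pi)) * ENNReal.ofReal (P.risDensity t r)) := by
        refine lintegral_mono_ae ?_
        filter_upwards [ae_sin_ne_zero] with θ hθ
        have h1 := h r θ (P.meanPower_CL_pos hr (tbr_pos ht hθ r))
        have h2 : ENNReal.ofReal (P.pVis Vis.N t) ≤ 1 :=
          ENNReal.ofReal_le_one.2 (P.pVis_le_one _ ht.le)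
        rw [max_eq_left hr.le]
        calc _ ≤ 1 * (ENNReal.ofReal (1 / (2 * Real.pi))
              * (ENNReal.ofReal (P.risDensity t r) * 1)) := by gcongr
          _ = _ := by rw [one_mul, mul_one]
    _ = _ := by
        rw [setLIntegral_const, Real.volume_Ioc, mul_right_comm, ← ENNReal.ofReal_mul (by positivity),
          show 1 / (2 * Real.pi) * (Real.pi - -Real.pi) = 1 by field_simp; ring, ENNReal.ofReal_one,
          one_mul]

lemma cascaded_le_one {F : ℝ × ℝ × ℝ → ℝ≥0∞} {t : ℝ} (ht : 0 < t)
    (h : ∀ r θ, 0 < P.meanPower Link.CL t r θ → F (t, r, θ) ≤ 1) : P.cascaded F t ≤ 1 := by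
  calc P.cascaded F t ≤ ∫⁻ r in Set.Ioi 0, ENNReal.ofReal (P.risDensity t r) :=
        setLIntegral_mono' measurableSet_Ioi fun r hr => P.cascaded_inner_le ht h hr
    _ = ENNReal.ofReal (P.pCL t) := lintegral_risDensity_Ioi P ht
    _ ≤ 1 := ENNReal.ofReal_le_one.2 (P.pCL_le_one t)

lemma assoc_le_one (q : Link) {t : ℝ} (ht : 0 ≤ t) : P.assoc q t ≤ 1 := by
  have h1 := P.pVis_nonneg Vis.N ht
  have h2 := P.pVis_le_one Vis.N ht
  have h3 := P.pCL_nonneg t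
  have h4 := P.pCL_le_one t
  cases q with
  | DL => exact P.pVisL_le_one ht
  | CL => exact mul_le_one₀ h2 h3 h4
  | DN => exact mul_le_one₀ h2 (by linarith) (by linarith)

/-- A crude bound, one for each link type; only its finiteness matters. -/
lemma mixture_le {F : Link → ℝ × ℝ × ℝ → ℝ≥0∞} {t : ℝ} (ht : 0 < t)
    (h : ∀ q r θ, 0 < P.meanPower q t r θ → F q (t, r, θ) ≤ 1) : P.mixture F t ≤ 3 := by
  have h1 : ∀ q, q ≠ Link.CL → ENNReal.ofReal (P.assoc q t) * F q (t, 0, 0) ≤ 1 := fun q hq =>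
    mul_le_one' (ENNReal.ofReal_le_one.2 (P.assoc_le_one q ht.le))
      (h q 0 0 (P.meanPower_pos hq ht 0 0))
  calc P.mixture F t ≤ 1 + 1 + 1 :=
        add_le_add (add_le_add (h1 _ (by simp)) (P.cascaded_le_one ht (h Link.CL))) (h1 _ (by simp))
    _ = 3 := by norm_num

lemma mixture_mono {F G : Link → ℝ × ℝ × ℝ → ℝ≥0∞} {t : ℝ} (ht : 0 < t)
    (h : ∀ q r θ, 0 < P.meanPower q t r θ → F q (t, r, θ) ≤ G q (t, r, θ)) :
    P.mixture F t ≤ P.mixture G t := by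
  unfold mixture
  gcongr
  · exact h _ 0 0 (P.meanPower_pos (by simp) ht 0 0)
  · exact P.cascaded_mono ht (h _)
  · exact h _ 0 0 (P.meanPower_pos (by simp) ht 0 0)

/-- The integrand of the average as a real number. -/
lemma toReal_mixture {F : Link → ℝ → ℝ → ℝ → ℝ} {G : Link → ℝ × ℝ × ℝ → ℝ≥0∞}
    (hG : ∀ q, Measurable (G q)) {t : ℝ} (ht : 0 < t)
    (h : ∀ q r θ, 0 < P.meanPower q t r θ →
      G q (t, r, θ) = ENNReal.ofReal (F q t r θ) ∧ 0 ≤ F q t r θ ∧ F q t r θ ≤ 1) :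
    P.assoc Link.DL t * F Link.DL t 0 0
      + (∫ r in Set.Ioi (0 : ℝ), ∫ θ in (-Real.pi)..Real.pi,
          P.assoc Link.CL t * F Link.CL t r θ * (1 / (2 * Real.pi) * P.fTru t r))
      + P.assoc Link.DN t * F Link.DN t 0 0 = (P.mixture G t).toReal := by
  have hpi := Real.pi_pos
  have hle : ∀ q r θ, 0 < P.meanPower q t r θ → G q (t, r, θ) ≤ 1 := fun q r θ hp => by
    rw [(h q r θ hp).1]
    exact ENNReal.ofReal_le_one.2 (h q r θ hp).2.2
  have hdir : ∀ q, q ≠ Link.CL → (ENNReal.ofReal (P.assoc q t) * G q (t, 0, 0)).toReal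
      = P.assoc q t * F q t 0 0 := fun q hq => by
    have h1 := h q 0 0 (P.meanPower_pos hq ht 0 0)
    rw [h1.1, ENNReal.toReal_mul, ENNReal.toReal_ofReal (Network.assoc_nonneg P q ht.le),
      ENNReal.toReal_ofReal h1.2.1]
  have hdirf : ∀ q, q ≠ Link.CL → ENNReal.ofReal (P.assoc q t) * G q (t, 0, 0) ≠ ∞ := fun q hq =>
    ENNReal.mul_ne_top ENNReal.ofReal_ne_top
      (ne_top_of_le_ne_top ENNReal.one_ne_top (hle q 0 0 (P.meanPower_pos hq ht 0 0)))
  have hcf : P.cascaded (G Link.CL) t ≠ ∞ :=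
    ne_top_of_le_ne_top ENNReal.one_ne_top (P.cascaded_le_one ht (hle Link.CL))
  rw [mixture, ENNReal.toReal_add (ENNReal.add_ne_top.2 ⟨hdirf _ (by simp), hcf⟩)
    (hdirf _ (by simp)), ENNReal.toReal_add (hdirf _ (by simp)) hcf, hdir _ (by simp),
    hdir _ (by simp)]
  congr 2
  have hm : Measurable fun q : ℝ × ℝ => ENNReal.ofReal (P.pVis Vis.N t)
      * (ENNReal.ofReal (1 / (2 * Real.pi)) * (ENNReal.ofReal (P.risDensity t (max q.1 0))
        * G Link.CL (t, q.1, q.2))) := by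
    have h1 : Measurable fun q : ℝ × ℝ => ((t, q.1), q.2) := by fun_prop
    have h2 := (P.measurable_cascaded_integrand (hG Link.CL)).comp h1
    simpa only [Function.comp_def] using h2
  have hm2 : Measurable fun r : ℝ => ∫⁻ θ in Set.Ioc (-Real.pi) Real.pi,
      ENNReal.ofReal (P.pVis Vis.N t)
      * (ENNReal.ofReal (1 / (2 * Real.pi)) * (ENNReal.ofReal (P.risDensity t (max r 0))
        * G Link.CL (t, r, θ))) := hm.lintegral_prod_right'
  rw [cascaded, ← integral_toReal hm2.aemeasurable]
  · refine integral_congr_ae ?_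
    filter_upwards [ae_restrict_mem measurableSet_Ioi, P.pCL_mul_fTru t] with r hr hw
    have hr0 : 0 < r := hr
    rw [intervalIntegral.integral_of_le (by linarith), ← integral_toReal]
    · refine integral_congr_ae ?_
      filter_upwards [ae_sin_ne_zero] with θ hθ
      obtain ⟨h1, h2, -⟩ := h Link.CL r θ (P.meanPower_CL_pos hr0 (tbr_pos ht hθ r))
      rw [h1, max_eq_left hr0.le, ENNReal.toReal_mul, ENNReal.toReal_mul, ENNReal.toReal_mul,
        ENNReal.toReal_ofReal (P.pVis_nonneg _ ht.le), ENNReal.toReal_ofReal (by positivity),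
        ENNReal.toReal_ofReal (P.risDensity_nonneg t hr0.le), ENNReal.toReal_ofReal h2, ← hw, assoc]
      ring
    · exact (hm.comp measurable_prodMk_left).aemeasurable
    · filter_upwards [ae_sin_ne_zero] with θ hθ
      have h1 := hle Link.CL r θ (P.meanPower_CL_pos hr0 (tbr_pos ht hθ r))
      exact ENNReal.mul_lt_top ENNReal.ofReal_lt_top (ENNReal.mul_lt_top ENNReal.ofReal_lt_top
        (ENNReal.mul_lt_top ENNReal.ofReal_lt_top (h1.trans_lt ENNReal.one_lt_top)))
  · filter_upwards [ae_restrict_mem measurableSet_Ioi] with r hr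
    exact (P.cascaded_inner_le ht (hle Link.CL) hr).trans_lt ENNReal.ofReal_lt_top

end Params

namespace Network

variable {P : Params} {Ω : Type*} [mΩ : MeasurableSpace Ω] {μ : Measure Ω} (W : Network P μ)
variable [IsProbabilityMeasure μ]

/-- The density `fTbu` is positive on `(0, ∞)`, so null sets of the law of the distance are Lebesgue
null there. This transfers almost sure statements to the integral in `average`. -/
lemma ae_of_ae_map_tbu {p : ℝ → Prop} (h : ∀ᵐ t ∂(μ.map W.tbu), p t) :
    ∀ᵐ t ∂(volume.restrict (Set.Ioi (0 : ℝ))), p t := by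
  rw [W.map_tbu, ae_withDensity_iff P.measurable_fTbu.ennreal_ofReal] at h
  filter_upwards [h, ae_restrict_mem measurableSet_Ioi] with t h1 h2
  exact h1 (ENNReal.ofReal_pos.2 (P.fTbu_pos h2)).ne'

/-- The average is an expectation over the BS–user distance. -/
theorem average_eq {F : Link → ℝ → ℝ → ℝ → ℝ} {G : Link → ℝ × ℝ × ℝ → ℝ≥0∞}
    (hG : ∀ q, Measurable (G q))
    (h : ∀ᵐ t ∂(μ.map W.tbu), ∀ q r θ, 0 < P.meanPower q t r θ →
      G q (t, r, θ) = ENNReal.ofReal (F q t r θ) ∧ 0 ≤ F q t r θ ∧ F q t r θ ≤ 1) :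
    P.average F = (∫⁻ ω, P.mixture G (W.tbu ω) ∂μ).toReal := by
  have hm := P.measurable_mixture hG
  have hd := P.measurable_fTbu.ennreal_ofReal
  have h1 : ∀ᵐ t ∂(volume.restrict (Set.Ioi (0 : ℝ))), ∀ q r θ, 0 < P.meanPower q t r θ →
      G q (t, r, θ) = ENNReal.ofReal (F q t r θ) ∧ 0 ≤ F q t r θ ∧ F q t r θ ≤ 1 :=
    W.ae_of_ae_map_tbu h
  rw [← lintegral_map hm W.measurable_tbu, W.map_tbu, lintegral_withDensity_eq_lintegral_mul _ hd hm,
    ← integral_toReal (hd.mul hm).aemeasurable]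
  · refine integral_congr_ae ?_
    filter_upwards [h1, ae_restrict_mem measurableSet_Ioi] with t h2 ht
    rw [P.toReal_mixture hG ht h2, Pi.mul_apply, ENNReal.toReal_mul,
      ENNReal.toReal_ofReal (P.fTbu_pos ht).le, mul_comm]
  · filter_upwards [h1, ae_restrict_mem measurableSet_Ioi] with t h2 ht
    refine ENNReal.mul_lt_top ENNReal.ofReal_lt_top ((P.mixture_le ht fun q r θ hp => ?_).trans_lt
      (by norm_num))
    rw [(h2 q r θ hp).1]
    exact ENNReal.ofReal_le_one.2 (h2 q r θ hp).2.2

/-- The coverage probability as an expectation over the BS–user distance. -/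
theorem measure_sinr_gt {γ : ℝ} (hγ : 0 < γ) : μ {ω | γ < W.sinr ω}
    = ∫⁻ ω, P.mixture (fun q p => W.coverage q γ p.1 p.2.1 p.2.2) (W.tbu ω) ∂μ := by
  have hB := W.measurableSet_bsLoS
  have hE := W.measurableSet_existsCL
  have hL := measurableSet_losSet (P := P)
  have hs : ∀ q, MeasurableSet {ω | γ < W.sinrOf q ω} := fun q =>
    measurableSet_lt measurable_const (W.measurable_sinrOf q)
  have hcov := fun q => W.measurable_coverage q γ
  have hp : Measurable fun t => ENNReal.ofReal (P.pVis Vis.N t) :=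
    (P.measurable_pVis Vis.N).ennreal_ofReal
  have hdec : {ω | γ < W.sinr ω} = ({ω | γ < W.sinrOf Link.DL ω} ∩ {ω | W.bsLoS 0 ω})
      ∪ ({ω | γ < W.sinrOf Link.CL ω} ∩ ({ω | W.bsLoS 0 ω}ᶜ ∩ W.existsCL))
      ∪ ({ω | γ < W.sinrOf Link.DN ω} ∩ ({ω | W.bsLoS 0 ω}ᶜ ∩ W.existsCLᶜ)) := by
    ext ω
    simp only [Set.mem_ofPred_eq, sinr, link, Set.mem_union, Set.mem_inter_iff, Set.mem_compl_iff]
    by_cases h1 : W.bsLoS 0 ω <;> by_cases h2 : ω ∈ W.existsCL <;> simp [h1, h2]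
  have hd1 : Disjoint ({ω | γ < W.sinrOf Link.DL ω} ∩ {ω | W.bsLoS 0 ω})
      ({ω | γ < W.sinrOf Link.CL ω} ∩ ({ω | W.bsLoS 0 ω}ᶜ ∩ W.existsCL)) :=
    Set.disjoint_left.2 fun ω h1 h2 => h2.2.1 h1.2
  have hd2 : Disjoint (({ω | γ < W.sinrOf Link.DL ω} ∩ {ω | W.bsLoS 0 ω})
      ∪ ({ω | γ < W.sinrOf Link.CL ω} ∩ ({ω | W.bsLoS 0 ω}ᶜ ∩ W.existsCL)))
      ({ω | γ < W.sinrOf Link.DN ω} ∩ ({ω | W.bsLoS 0 ω}ᶜ ∩ W.existsCLᶜ)) := by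
    refine Set.disjoint_left.2 fun ω h1 h2 => ?_
    rcases h1 with h1 | h1
    · exact h2.2.1 h1.2
    · exact h2.2.2 h1.2.2
  have hz : Measurable fun p : ℝ × ℝ => (p.1, (0 : ℝ), (0 : ℝ)) := by fun_prop
  have hDL : μ ({ω | γ < W.sinrOf Link.DL ω} ∩ {ω | W.bsLoS 0 ω})
      = ∫⁻ ω, ENNReal.ofReal (P.assoc Link.DL (W.tbu ω))
        * W.coverage Link.DL γ (W.tbu ω) 0 0 ∂μ := by
    have h1 := W.setLIntegral_sinrOf_direct (q := Link.DL) (by simp) hγ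
      (φ := (losSet P).indicator 1) (measurable_one.indicator hL)
    have h2 := W.lintegral_losSet (F := fun p => W.coverage Link.DL γ p.1 0 0)
      ((hcov Link.DL).comp hz)
    calc _ = ∫⁻ ω in {ω | γ < W.sinrOf Link.DL ω},
            (losSet P).indicator 1 (W.tbu ω, W.aux ω) ∂μ := by
          rw [Set.inter_comm, ← Measure.restrict_apply hB, ← lintegral_indicator_one hB]
          rfl
      _ = _ := by
          rw [h1]
          refine (lintegral_congr fun ω => mul_comm _ _).trans (h2.trans ?_)
          exact lintegral_congr fun ω => mul_comm _ _
  have hDN : μ ({ω | γ < W.sinrOf Link.DN ω} ∩ ({ω | W.bsLoS 0 ω}ᶜ ∩ W.existsCLᶜ))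
      = ∫⁻ ω, ENNReal.ofReal (P.assoc Link.DN (W.tbu ω))
        * W.coverage Link.DN γ (W.tbu ω) 0 0 ∂μ := by
    have h1 := W.setLIntegral_sinrOf_direct_compl (q := Link.DN) (by simp) hγ
      (φ := (losSet P)ᶜ.indicator 1) (measurable_one.indicator hL.compl)
    have h2 := W.lintegral_losSet_compl (F := fun p => W.coverage Link.DN γ p.1 0 0
      * ENNReal.ofReal (1 - P.pCL p.1)) (((hcov Link.DN).comp hz).mul
        ((measurable_const.sub P.measurable_pCL).ennreal_ofReal.comp measurable_fst))
    calc _ = ∫⁻ ω in {ω | γ < W.sinrOf Link.DN ω} ∩ W.existsCLᶜ,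
            (losSet P)ᶜ.indicator 1 (W.tbu ω, W.aux ω) ∂μ := by
          have h3 : {ω | γ < W.sinrOf Link.DN ω} ∩ ({ω | W.bsLoS 0 ω}ᶜ ∩ W.existsCLᶜ)
              = {ω | W.bsLoS 0 ω}ᶜ ∩ ({ω | γ < W.sinrOf Link.DN ω} ∩ W.existsCLᶜ) := by
            ext ω; simp only [Set.mem_inter_iff]; tauto
          rw [h3, ← Measure.restrict_apply hB.compl, ← lintegral_indicator_one hB.compl]
          rfl
      _ = ∫⁻ ω, W.coverage Link.DN γ (W.tbu ω) 0 0 * ENNReal.ofReal (1 - P.pCL (W.tbu ω))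
            * (losSet P)ᶜ.indicator 1 (W.tbu ω, W.aux ω) ∂μ := by
          rw [h1]
          exact lintegral_congr fun ω => by ring
      _ = _ := by
          rw [h2]
          refine lintegral_congr fun ω => ?_
          rw [Params.assoc, ENNReal.ofReal_mul (P.pVis_nonneg _ (W.tbu_nonneg ω))]
          ring
  have hCL : μ ({ω | γ < W.sinrOf Link.CL ω} ∩ ({ω | W.bsLoS 0 ω}ᶜ ∩ W.existsCL))
      = ∫⁻ ω, P.cascaded (fun p => W.coverage Link.CL γ p.1 p.2.1 p.2.2) (W.tbu ω) ∂μ := by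
    have hpr : Measurable fun p : ℝ × (ℝ × ℝ) × ℝ => (p.1, p.2.1) := by fun_prop
    have hpr2 : Measurable fun p : ℝ × (ℝ × ℝ) × ℝ => (p.1, p.2.2, p.2.1.2) := by fun_prop
    have hLm := (measurable_one (α := ℝ≥0∞)).indicator hL.compl
    have h1 := W.setLIntegral_sinrOf_CL hγ (φ := fun p => (losSet P)ᶜ.indicator 1 (p.1, p.2.1))
      (hLm.comp hpr)
    have h2 := W.setLIntegral_existsCL_aux (Ψ := fun p => (losSet P)ᶜ.indicator 1 (p.1, p.2.1)
      * W.coverage Link.CL γ p.1 p.2.2 p.2.1.2) ((hLm.comp hpr).mul ((hcov Link.CL).comp hpr2))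
    -- The radial average at fixed distance and angle. Blockage and then the angle are averaged
    -- next, and a final exchange of integrals restores the order used in `cascaded`.
    set K : ℝ × ℝ → ℝ≥0∞ := fun p => ∫⁻ r in Set.Ioi 0,
      ENNReal.ofReal (P.risDensity p.1 (max r 0)) * W.coverage Link.CL γ p.1 r p.2 with hK
    have hKi : Measurable fun q : (ℝ × ℝ) × ℝ =>
        ENNReal.ofReal (P.risDensity q.1.1 (max q.2 0)) * W.coverage Link.CL γ q.1.1 q.2 q.1.2 := by
      have h3 : Measurable fun q : (ℝ × ℝ) × ℝ => (q.1.1, q.2) := by fun_prop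
      have h4 : Measurable fun q : (ℝ × ℝ) × ℝ => (q.1.1, q.2, q.1.2) := by fun_prop
      exact (P.measurable_risDensity.comp h3).ennreal_ofReal.mul ((hcov Link.CL).comp h4)
    have hKm : Measurable K := hKi.lintegral_prod_right'
    have h3 := W.lintegral_losSet_compl hKm
    have h4 := W.lintegral_theta (F := fun t θ => K (t, θ) * ENNReal.ofReal (P.pVis Vis.N t))
      (hKm.mul (hp.comp measurable_fst))
    calc _ = ∫⁻ ω in {ω | γ < W.sinrOf Link.CL ω} ∩ W.existsCL,
            (losSet P)ᶜ.indicator 1 (W.tbu ω, W.aux ω) ∂μ := by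
          have h3 : {ω | γ < W.sinrOf Link.CL ω} ∩ ({ω | W.bsLoS 0 ω}ᶜ ∩ W.existsCL)
              = {ω | W.bsLoS 0 ω}ᶜ ∩ ({ω | γ < W.sinrOf Link.CL ω} ∩ W.existsCL) := by
            ext ω; simp only [Set.mem_inter_iff]; tauto
          rw [h3, ← Measure.restrict_apply hB.compl, ← lintegral_indicator_one hB.compl]
          rfl
      _ = ∫⁻ ω, (∫⁻ r in Set.Ioi 0, ENNReal.ofReal (P.risDensity (W.tbu ω) r)
            * ((losSet P)ᶜ.indicator 1 (W.tbu ω, W.aux ω)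
              * W.coverage Link.CL γ (W.tbu ω) r (W.theta ω))) ∂μ := h1.trans h2
      _ = ∫⁻ ω, K (W.tbu ω, W.theta ω) * (losSet P)ᶜ.indicator 1 (W.tbu ω, W.aux ω) ∂μ := by
          refine lintegral_congr fun ω => ?_
          rw [hK, ← lintegral_mul_const' _ _ (by
            by_cases h : (W.tbu ω, W.aux ω) ∈ losSet P <;> simp [h])]
          refine setLIntegral_congr_fun measurableSet_Ioi fun r hr => ?_
          simp only [max_eq_left (le_of_lt (show (0 : ℝ) < r from hr))]
          ring
      _ = ∫⁻ ω, ENNReal.ofReal (1 / (2 * Real.pi)) * (∫⁻ θ in Set.Ioc (-Real.pi) Real.pi,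
            K (W.tbu ω, θ) * ENNReal.ofReal (P.pVis Vis.N (W.tbu ω))) ∂μ := h3.trans h4
      _ = _ := by
          refine lintegral_congr fun ω => ?_
          rw [← lintegral_const_mul' _ _ ENNReal.ofReal_ne_top]
          have h5 : ∀ θ, ENNReal.ofReal (1 / (2 * Real.pi))
              * (K (W.tbu ω, θ) * ENNReal.ofReal (P.pVis Vis.N (W.tbu ω)))
              = ∫⁻ r in Set.Ioi 0, ENNReal.ofReal (P.pVis Vis.N (W.tbu ω))
                * (ENNReal.ofReal (1 / (2 * Real.pi))
                  * (ENNReal.ofReal (P.risDensity (W.tbu ω) (max r 0))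
                    * W.coverage Link.CL γ (W.tbu ω) r θ)) := fun θ => by
            rw [lintegral_const_mul' _ _ ENNReal.ofReal_ne_top,
              lintegral_const_mul' _ _ ENNReal.ofReal_ne_top]
            ring
          rw [lintegral_congr h5]
          have h6 : Measurable fun q : ℝ × ℝ => ENNReal.ofReal (P.pVis Vis.N (W.tbu ω))
                * (ENNReal.ofReal (1 / (2 * Real.pi))
                  * (ENNReal.ofReal (P.risDensity (W.tbu ω) (max q.2 0))
                    * W.coverage Link.CL γ (W.tbu ω) q.2 q.1)) := by
            have h7 : Measurable fun q : ℝ × ℝ => ((W.tbu ω, q.1), q.2) := by fun_prop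
            have h8 := hKi.comp h7
            simp only [Function.comp_def] at h8
            exact (h8.const_mul _).const_mul _
          exact lintegral_lintegral_swap (f := fun θ r => ENNReal.ofReal (P.pVis Vis.N (W.tbu ω))
                * (ENNReal.ofReal (1 / (2 * Real.pi))
                  * (ENNReal.ofReal (P.risDensity (W.tbu ω) (max r 0))
                    * W.coverage Link.CL γ (W.tbu ω) r θ))) h6.aemeasurable
  have hmz : Measurable fun t : ℝ => (t, (0 : ℝ), (0 : ℝ)) := by fun_prop
  have hm1 : Measurable fun ω => ENNReal.ofReal (P.assoc Link.DL (W.tbu ω))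
      * W.coverage Link.DL γ (W.tbu ω) 0 0 :=
    (((measurable_assoc P _).comp W.measurable_tbu).ennreal_ofReal).mul
      ((hcov Link.DL).comp (hmz.comp W.measurable_tbu))
  have hm2 : Measurable fun ω =>
      P.cascaded (fun p => W.coverage Link.CL γ p.1 p.2.1 p.2.2) (W.tbu ω) :=
    (P.measurable_cascaded (hcov Link.CL)).comp W.measurable_tbu
  have hm3 : Measurable fun ω => ENNReal.ofReal (P.assoc Link.DL (W.tbu ω))
      * W.coverage Link.DL γ (W.tbu ω) 0 0
      + P.cascaded (fun p => W.coverage Link.CL γ p.1 p.2.1 p.2.2) (W.tbu ω) := hm1.add hm2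
  rw [hdec, measure_union hd2 ((hs _).inter (hB.compl.inter hE.compl)),
    measure_union hd1 ((hs _).inter (hB.compl.inter hE)), hDL, hCL, hDN,
    ← lintegral_add_left hm1, ← lintegral_add_left hm3]
  rfl

theorem ae_coverage_tbu : ∀ᵐ ω ∂μ, ∀ q γ r θ, 0 < γ → 0 < P.meanPower q (W.tbu ω) r θ →
    W.coverage q γ (W.tbu ω) r θ = ENNReal.ofReal (P.condCov q γ (W.tbu ω) r θ)
      ∧ 0 ≤ P.condCov q γ (W.tbu ω) r θ
      ∧ P.condCov q γ (W.tbu ω) r θ ≤ P.condCovApprox q γ (W.tbu ω) r θ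
      ∧ P.condCovApprox q γ (W.tbu ω) r θ ≤ 1 :=
  ae_of_ae_map W.measurable_tbu.aemeasurable W.ae_coverage

/-- Conditional coverage of the direct links. -/
theorem condProb_sinrOf {q : Link} (hq : q ≠ Link.CL) {γ : ℝ} (hγ : 0 < γ) :
    μ⟦{ω | γ < W.sinrOf q ω} | W.sigmaTbu⟧ =ᵐ[μ] fun ω => P.condCov q γ (W.tbu ω) 0 0 := by
  have hs : MeasurableSet {ω | γ < W.sinrOf q ω} :=
    measurableSet_lt measurable_const (W.measurable_sinrOf q)
  have hz : Measurable fun t : ℝ => (t, (0 : ℝ), (0 : ℝ)) := by fun_prop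
  refine condProb_comap_ae_eq W.measurable_tbu hs (G := fun t => W.coverage q γ t 0 0)
    ((W.measurable_coverage q γ).comp hz) ?_ fun A hA => ?_
  · filter_upwards [W.ae_coverage_tbu, W.ae_tbu_pos] with ω h1 h2
    obtain ⟨h3, h4, -⟩ := h1 q γ 0 0 hγ (P.meanPower_pos hq h2 0 0)
    rw [h3, ENNReal.toReal_ofReal h4]
  · have hT := W.measurable_tbu hA
    have hAm : Measurable fun p : ℝ × (ℝ × ℝ) => A.indicator (1 : ℝ → ℝ≥0∞) p.1 :=
      (measurable_one.indicator hA).comp measurable_fst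
    have h1 := W.setLIntegral_sinrOf_direct hq hγ hAm
    rw [← Measure.restrict_apply hT, ← lintegral_indicator_one hT, ← lintegral_indicator hT]
    refine h1.trans (lintegral_congr fun ω => ?_)
    by_cases h : W.tbu ω ∈ A <;> simp [h]

omit [IsProbabilityMeasure μ] in
lemma ae_cond_of_ae {p : Ω → Prop} {E : Set Ω} (hE : MeasurableSet E)
    (h : ∀ᵐ ω ∂μ, ω ∈ E → p ω) : ∀ᵐ ω ∂(ProbabilityTheory.cond μ E), p ω :=
  Measure.ae_smul_measure ((ae_restrict_iff' hE).2 h) _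

/-- Conditional coverage of the cascaded link. -/
theorem condProb_sinrOf_CL {γ : ℝ} (hγ : 0 < γ) :
    (ProbabilityTheory.cond μ W.existsCL)⟦{ω | γ < W.sinrOf Link.CL ω} | W.sigmaCL⟧
      =ᵐ[ProbabilityTheory.cond μ W.existsCL]
        (fun ω => P.condCov Link.CL γ (W.tbu ω) (W.tru ω) (W.theta ω)) := by
  have hE := W.measurableSet_existsCL
  have hs : MeasurableSet {ω | γ < W.sinrOf Link.CL ω} :=
    measurableSet_lt measurable_const (W.measurable_sinrOf Link.CL)
  have hX : Measurable fun ω => (W.tbu ω, W.tru ω, W.theta ω) :=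
    W.measurable_tbu.prodMk (W.measurable_tru.prodMk W.measurable_theta)
  refine condProb_comap_ae_eq hX hs
    (G := fun p => W.coverage Link.CL γ p.1 p.2.1 p.2.2) (W.measurable_coverage Link.CL γ) ?_
    fun A hA => ?_
  · refine ae_cond_of_ae hE ?_
    filter_upwards [W.ae_coverage_tbu, W.ae_meanPower_CL_pos] with ω h1 h2 hc
    obtain ⟨h3, h4, -⟩ := h1 Link.CL γ _ _ hγ (h2 hc)
    rw [h3, ENNReal.toReal_ofReal h4]
  · have hpr : Measurable fun p : ℝ × (ℝ × ℝ) × ℝ => (p.1, p.2.2, p.2.1.2) := by fun_prop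
    have hAX := hX hA
    have hAm : Measurable fun p : ℝ × (ℝ × ℝ) × ℝ =>
        A.indicator (1 : ℝ × ℝ × ℝ → ℝ≥0∞) (p.1, p.2.2, p.2.1.2) :=
      (measurable_one.indicator hA).comp hpr
    have h1 := W.setLIntegral_sinrOf_CL hγ hAm
    -- The normalising factor occurs on both sides, so the claim reduces to the restricted measure,
    -- also when `existsCL` is null.
    rw [ProbabilityTheory.cond, Measure.smul_apply, Measure.restrict_smul, lintegral_smul_measure]
    congr 1
    have h2 : (μ.restrict W.existsCL)
        ((fun ω => (W.tbu ω, W.tru ω, W.theta ω)) ⁻¹' A ∩ {ω | γ < W.sinrOf Link.CL ω})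
        = ∫⁻ ω in {ω | γ < W.sinrOf Link.CL ω} ∩ W.existsCL,
          A.indicator (1 : ℝ × ℝ × ℝ → ℝ≥0∞) (W.tbu ω, W.tru ω, W.theta ω) ∂μ := by
      rw [Measure.restrict_apply (hAX.inter hs), Set.inter_assoc, ← Measure.restrict_apply hAX,
        ← lintegral_indicator_one hAX]
      rfl
    rw [h2, ← lintegral_indicator hAX]
    refine h1.trans (lintegral_congr fun ω => ?_)
    by_cases h : (W.tbu ω, W.tru ω, W.theta ω) ∈ A
    · have h3 : ω ∈ (fun ω => (W.tbu ω, W.tru ω, W.theta ω)) ⁻¹' A := h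
      rw [Set.indicator_of_mem h3]
      have h4 : A.indicator (1 : ℝ × ℝ × ℝ → ℝ≥0∞) (W.tbu ω, W.tru ω, (W.aux ω).2) = 1 :=
        Set.indicator_of_mem (by exact h) _
      simp only [h4, one_mul]
    · have h3 : ω ∉ (fun ω => (W.tbu ω, W.tru ω, W.theta ω)) ⁻¹' A := h
      rw [Set.indicator_of_notMem h3]
      have h4 : A.indicator (1 : ℝ × ℝ × ℝ → ℝ≥0∞) (W.tbu ω, W.tru ω, (W.aux ω).2) = 0 :=
        Set.indicator_of_notMem (by exact h) _
      simp only [h4, zero_mul]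

/-- The coverage probability is the average of the derivative formula. -/
theorem measureReal_sinr_gt {γ : ℝ} (hγ : 0 < γ) :
    μ.real {ω | γ < W.sinr ω} = P.average (fun q t r θ => P.condCov q γ t r θ) := by
  rw [measureReal_def, W.measure_sinr_gt hγ]
  refine (W.average_eq (fun q => W.measurable_coverage q γ) ?_).symm
  filter_upwards [W.ae_coverage] with t h q r θ hp
  obtain ⟨h1, h2, h3, h4⟩ := h q γ r θ hγ hp
  exact ⟨h1, h2, h3.trans h4⟩

/-- The coverage probability is at most the average of the derivative-free formula. -/
theorem measureReal_sinr_gt_le {γ : ℝ} (hγ : 0 < γ) :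
    μ.real {ω | γ < W.sinr ω} ≤ P.average (fun q t r θ => P.condCovApprox q γ t r θ) := by
  have hG := fun q => (P.measurable_condCovApprox q γ).ennreal_ofReal
  rw [W.average_eq (F := fun q t r θ => P.condCovApprox q γ t r θ)
    (G := fun q p => ENNReal.ofReal (P.condCovApprox q γ p.1 p.2.1 p.2.2)) hG (by
      filter_upwards [W.ae_coverage] with t h q r θ hp
      obtain ⟨h1, h2, h3, h4⟩ := h q γ r θ hγ hp
      exact ⟨rfl, h2.trans h3, h4⟩), measureReal_def, W.measure_sinr_gt hγ]
  refine ENNReal.toReal_mono ?_ (lintegral_mono_ae ?_)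
  -- Passing the inequality through `toReal` requires a finite right-hand side.
  · refine ne_top_of_le_ne_top (b := 3) (by norm_num) ?_
    calc _ ≤ ∫⁻ _, 3 ∂μ := by
          refine lintegral_mono_ae ?_
          filter_upwards [W.ae_coverage_tbu, W.ae_tbu_pos] with ω h ht
          exact P.mixture_le ht fun q r θ hp => ENNReal.ofReal_le_one.2 (h q γ r θ hγ hp).2.2.2
      _ = 3 := by simp
  · filter_upwards [W.ae_coverage_tbu, W.ae_tbu_pos] with ω h ht
    refine P.mixture_mono ht fun q r θ hp => ?_
    obtain ⟨h1, -, h3, -⟩ := h q γ r θ hγ hp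
    simp only [h1]
    exact ENNReal.ofReal_le_ofReal h3

end Network

end RISNet

/-! ### Downlink coverage probability -/

theorem theorem1 (P : RISNet.Params) {Ω : Type*} [MeasurableSpace Ω] (μ : Measure Ω)
    [IsProbabilityMeasure μ] (W : RISNet.Network P μ) (γ : ℝ) (hγ : 0 < γ) :
    -- the coverage probability as the average over distances and angle
    μ.real {ω | γ < W.sinr ω} = P.average (fun q t r θ => P.condCov q γ t r θ) ∧
    -- distance distributions and association probabilities used in the average
    μ.map W.tbu = (volume.restrict (Set.Ioi 0)).withDensity (fun t => ENNReal.ofReal (P.fTbu t)) ∧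
    (∀ A : Set ℝ, MeasurableSet A →
      μ⟦W.existsCL ∩ W.tru ⁻¹' A | W.sigmaTbu⟧ =ᵐ[μ]
        fun ω => P.pCL (W.tbu ω) * ∫ r in A ∩ Set.Ioi 0, P.fTru (W.tbu ω) r) ∧
    (∀ q, μ⟦{ω | W.link ω = q} | W.sigmaTbu⟧ =ᵐ[μ] fun ω => P.assoc q (W.tbu ω)) ∧
    -- conditional coverage: the derivative formula
    (∀ q, q ≠ RISNet.Link.CL →
      μ⟦{ω | γ < W.sinrOf q ω} | W.sigmaTbu⟧ =ᵐ[μ] fun ω => P.condCov q γ (W.tbu ω) 0 0) ∧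
    (ProbabilityTheory.cond μ W.existsCL)⟦{ω | γ < W.sinrOf RISNet.Link.CL ω} | W.sigmaCL⟧
      =ᵐ[ProbabilityTheory.cond μ W.existsCL]
        (fun ω => P.condCov RISNet.Link.CL γ (W.tbu ω) (W.tru ω) (W.theta ω)) ∧
    -- the interference is finite, with the stated conditional Laplace transform
    (∀ᵐ ω ∂μ, Summable (fun i => W.interf (i + 1) ω)) ∧
    (∀ s, 0 ≤ s → μ[fun ω => Real.exp (-s * W.I ω) | W.sigmaTbu] =ᵐ[μ]
      fun ω => P.laplace (W.tbu ω) s) ∧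
    (∀ i n, n ≤ P.Nb / 2 → μ.real {ω | P.gainB (W.dev i ω) = P.gain n} = P.pGain n) ∧
    -- the derivative-free approximation bounds the coverage from above, and is exact for
    -- Nakagami parameter one
    (∀ q, q ≠ RISNet.Link.CL → ∀ᵐ ω ∂μ,
      P.condCov q γ (W.tbu ω) 0 0 ≤ P.condCovApprox q γ (W.tbu ω) 0 0) ∧
    (∀ᵐ ω ∂(ProbabilityTheory.cond μ W.existsCL),
      P.condCov RISNet.Link.CL γ (W.tbu ω) (W.tru ω) (W.theta ω) ≤
        P.condCovApprox RISNet.Link.CL γ (W.tbu ω) (W.tru ω) (W.theta ω)) ∧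
    (∀ q t r θ, P.mLink q = 1 → P.condCov q γ t r θ = P.condCovApprox q γ t r θ) ∧
    μ.real {ω | γ < W.sinr ω} ≤ P.average (fun q t r θ => P.condCovApprox q γ t r θ) := by
  refine ⟨W.measureReal_sinr_gt hγ, W.map_tbu, fun A hA => W.condProb_tru hA,
    fun q => W.condProb_link q, fun q hq => W.condProb_sinrOf hq hγ, W.condProb_sinrOf_CL hγ,
    W.ae_summable_interf, fun s hs => W.condExp_exp_interf hs,
    fun i n hn => W.measureReal_gainB_eq i hn, fun q hq => ?_, ?_,
    fun q t r θ h => P.condCov_eq_condCovApprox h γ t r θ, W.measureReal_sinr_gt_le hγ⟩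
  · filter_upwards [W.ae_coverage_tbu, W.ae_tbu_pos] with ω h1 h2
    exact (h1 q γ 0 0 hγ (P.meanPower_pos hq h2 0 0)).2.2.1
  · refine RISNet.Network.ae_cond_of_ae W.measurableSet_existsCL ?_
    filter_upwards [W.ae_coverage_tbu, W.ae_meanPower_CL_pos] with ω h1 h2 hc
    exact (h1 _ γ _ _ hγ (h2 hc)).2.2.1
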